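/- **Notation.** Write $e(z)=e^{2\pi i z}$, $\zeta_N=e(1/N)$, $q=e(\tau)$, $\mathbb H$ for the upper half-plane, $M_r=\begin{pmatrix}1&0\\ r&1\end{pmatrix}$, $T_b=\begin{pmatrix}1&b\\0&1\end{pmatrix}$; all roots are principal. Let $$\vartheta(v;\tau)=\sum_{n\in\mathbb Z}e\big((n+\tfrac12)(v+\tfrac12)\big)q^{\frac12(n+\frac12)^2},\qquad \mu(u,v;\tau)=\frac{e^{\pi iu}}{\vartheta(v;\tau)}\sum_{n\in\mathbb Z}\frac{(-1)^ne(nv)q^{n(n+1)/2}}{1-e(u)q^n}.$$ A pair $(m,n)$ with $1\le m\le 6$, $1\le n\le 8$ is *admissible* if it is none of $(1,6),(2,5),(3,8),(5,4),(6,7)$. Let $v_n=\tau/2,\ \tau/2-\tfrac12,\ \tau/3,\ \tau/3-\tfrac12,\ \tau/4,\ \tau/4-\tfrac12,\ \tau/6,\ \tau/6-\tfrac12$ for $n=1,\dots,8$. For $\tau\in\mathbb H$ put $$V_{mn}(\tau)=\sum_{(w,\alpha,\beta)}w\,q^{-\alpha^2/2}\mu(u_n,v_n;\tau),\qquad u_n=v_n+\alpha\tau+\beta,$$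 where $(w,\alpha,\beta)$ is $(-1,-\frac14,\frac12)$, $(i,-\frac14,0)$, $(-1,-\frac16,\frac12)$, $(-1,-\frac13,\frac12)$, $(i,-\frac16,0)$ for $m=1,2,3,5,6$, and the sum is over the two triples $(i,-\frac5{12},0)$, $(i,-\frac1{12},0)$ for $m=4$. *Values at rationals.* Let $(a;q)_n=\prod_{j=0}^{n-1}(1-aq^j)$, $g_2(z;q)=\sum_{n\ge0}\frac{(-q;q)_nq^{n(n+1)/2}}{(z;q)_{n+1}(z^{-1}q;q)_{n+1}}$ and $\theta_j(z)=(1-e(z)q^j)(1-e(-z)q^{j+1})$. At $x\in\mathbb Q$ the value $V_{mn}(x)$ is the value at $\tau=x$ (with $q^s=e(sx)$) of $$\sum_{(w,\alpha,\beta)}iwq^{\frac18-\frac{\alpha^2}2}\Big[g_2\big(e(\tfrac{u_1}2);q^{\frac12}\big)-\prod_{j\ge0}\frac{(1-q^{j+1})(1+q^{\frac{j+1}2})^2}{\theta_j(u_1)}-e(\tfrac{u_1}2)\prod_{j\ge0}\frac{(1-q^{j+1})\,\theta_j(\frac\tau2+u_n)\,\theta_j(u_n-u_1)}{\theta_j(u_1)\theta_j(\frac\tau2)\theta_j(u_n)\theta_j(v_n)}\Big];$$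 it *exists* if no denominator here vanishes and the series and products converge (a product with a zero factor and no zero denominator has value $0$). *Eta-theta functions.* $E_m(\tau)=\sum_{n\ge1}\chi_m(n)\,n\,q^{n^2}$, where, in Kronecker symbols, $\chi_1=(\frac{-4}n)$, $\chi_2=(\frac{-2}n)$, $\chi_3=(\frac n3)$, $\chi_4=(\frac{-6}n)$, $\chi_5=(\frac n{12})$, $\chi_6=2(\frac n{12})-(\frac n3)$. *Constants.* For $m=1,\dots,6$: $\ell_m=2,1,2,1,2,1$; $a_m=8,8,3,24,12,3$; $b_m=4,4,6,12,6,6$; $c_m=8,8,6,24,12,6$. Let $\ell_{mn}=\ell_m$ if $n=1$ and $\ell_{mn}=2$ otherwise. Let $\kappa_{mn}=3$ for $m\in\{1,2\}$, $n\in\{3,4,7,8\}$; $\kappa_{mn}=2$ for $m\in\{3,5,6\}$, $n\in\{5,6\}$; and $\kappa_{mn}=1$ for all other admissible pairs. *Sets and groups.* Let $S$ be the set of rationals $h/k$ (lowest terms, $k>0$) with $h$ odd, and let $S',S_{ev},S_{od}\subset S$ be given by $h\equiv\pm1\ (6)$, $k$ even, $k$ odd respectively. Then $S_{11},S_{17},S_{21},S_{27},S_{41},S_{45},S_{47}=S$;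 $S_{12},S_{18},S_{22},S_{28},S_{42},S_{52}=S_{ev}$; $S_{13},S_{23},S_{31},S_{34},S_{35},S_{36},S_{43},S_{61},S_{63},S_{64},S_{65},S_{66}=S'$; $S_{14},S_{15},S_{24},S_{26}=S_{od}$; $S_{32},S_{33},S_{62}=S'\cap S_{ev}$; $S_{37},S_{53},S_{68}=S'\cap S_{od}$; $S_{44}=S'\cup S_{od}$; $S_{46},S_{48},S_{51},S_{55},S_{56},S_{57},S_{58}=S'\cup S_{ev}$. Let $G_{mn}=\langle M_{\ell_{mn}},T_{B}\rangle\subset\mathrm{SL}_2(\mathbb Z)$, where $B=4$ for $(m,n)\in\{(1,1),(1,2),(1,5),(2,1),(2,2),(2,6)\}$; $B=12$ for $m=4$, for $m\in\{1,2\}$, $n\in\{3,4,7,8\}$, and for $m\in\{3,5,6\}$, $n\in\{5,6\}$; and $B=6$ otherwise. **Theorem.** Let $(m,n)$ be admissible. Then $V_{mn}$ is a quantum modular form of weight $\frac12$ on $S_{mn}\setminus\{-1/\ell_{mn}\}$ for $G_{mn}$. That is: for all $x\in S_{mn}\setminus\{-1/\ell_{mn}\}$ and $\gamma=\begin{pmatrix}a&b\\c&d\end{pmatrix}\in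 G_{mn}$, the values $V_{mn}(x)$ and (if $cx+d\ne0$) $V_{mn}(\gamma x)$ exist; and for each $\gamma\in G_{mn}$ there is $\epsilon(\gamma)\in\mathbb C$ with $|\epsilon(\gamma)|=1$ such that the function $$x\mapsto V_{mn}(x)-\epsilon(\gamma)(cx+d)^{-\frac12}V_{mn}(\gamma x)\qquad(x\in S_{mn}\setminus\{-1/\ell_{mn}\},\ cx+d\neq0)$$ extends to a function that is real analytic at every $y\in\mathbb R$ with $cy+d\ne0$; here $(cx+d)^{-1/2}$ is the boundary value of the principal branch on $\mathbb H$. Moreover: (i) For all $x\in\mathbb H\cup S_{mn}$ with $x\neq-\frac12$, $$V_{mn}(x)+\zeta_4^{\ell_m}(2x+1)^{-\frac12}V_{mn}(M_2x)=-\frac i{c_m}\int_{1/2}^{i\infty}\frac{E_m(2u/c_m^2)}{\sqrt{-i(u+x)}}\,du,$$ the integral, along the vertical line, being absolutely convergent. (ii) If $n=1$ and $m\in\{2,4,6\}$, then for all $x\in\mathbb H\cup S_{m1}$ with $x\ne-1$, $$V_{m1}(x)-\zeta_8^{-1}(x+1)^{-\frac12}V_{m1}(M_1x)=-\frac i{c_m}\int_{1}^{i\infty}\frac{E_m(2u/c_m^2)}{\sqrt{-i(u+x)}}\,du,$$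 again with absolute convergence. (iii) For all $x\in\mathbb H\cup S_{mn}$, $V_{mn}(x)-\zeta_{a_m}^{\kappa_{mn}}V_{mn}(x+\kappa_{mn}b_m)=0$. Finally, for $n=1$ the values at rationals continue $V_{m1}$ from $\mathbb H$: $V_{m1}(x)=\lim_{t\to0^+}V_{m1}(x+it)$ for all $x\in S_{m1}$. -/

import Mathlib

noncomputable section

namespace EtaTheta

/-- `e(z) = exp(2πiz)`; thus `q ^ t` is written `e (t * τ)`, where `q = e(τ)`. -/
def e (z : ℂ) : ℂ := Complex.exp (2 * Real.pi * Complex.I * z)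

/-- `ζ_N = e(1/N)`. -/
def zeta (N : ℕ) : ℂ := e (1 / (N : ℂ))

/-! ### The odd eta-theta functions and their Eichler integrals -/

/-- Coefficients of the six odd eta-theta functions. All symbols are Kronecker symbols; the Jacobi
symbol of Mathlib agrees with them here (it vanishes if both entries are even, and
`(n/12) = (n/2)²(n/3)`). -/
def oddChar (m n : ℕ) : ℤ :=
  match m with
  | 1 => jacobiSym (-4) n
  | 2 => jacobiSym (-2) n
  | 3 => jacobiSym n 3
  | 4 => jacobiSym (-6) n
  | 5 => jacobiSym n 12
  | 6 => 2 * jacobiSym n 12 - jacobiSym n 3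
  | _ => 0

/-- The odd eta-theta function `E_m(τ) = ∑_{n ≥ 1} χ_m(n) n q^{n²}` (the term `n = 0` is zero). -/
def oddE (m : ℕ) (τ : ℂ) : ℂ := ∑' n : ℕ, (oddChar m n : ℂ) * n * e ((n : ℂ) ^ 2 * τ)

def ellConst (m : ℕ) : ℕ := if m = 1 ∨ m = 3 ∨ m = 5 then 2 else 1

def aConst (m : ℕ) : ℕ :=
  match m with
  | 1 => 8
  | 2 => 8
  | 3 => 3
  | 4 => 24
  | 5 => 12
  | 6 => 3
  | _ => 1

def bConst (m : ℕ) : ℕ := if m = 3 ∨ m = 6 then 2 * aConst m else aConst m / 2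

def cConst (m : ℕ) : ℕ := if m = 3 ∨ m = 6 then 2 * aConst m else aConst m

def kappa (m n : ℕ) : ℕ :=
  match m, n with
  | 1, 3 | 1, 4 | 1, 7 | 1, 8 => 3
  | 2, 3 | 2, 4 | 2, 7 | 2, 8 => 3
  | 3, 5 | 3, 6 => 2
  | 5, 5 | 5, 6 => 2
  | 6, 5 | 6, 6 => 2
  | _, _ => 1

/-- `ℓ_{mn}`: equal to `ℓ_m` if `n = 1` and to `2` otherwise. -/
def ellPair (m n : ℕ) : ℕ := if n = 1 then ellConst m else 2

/-- The integrand of `∫_r^{i∞} E_m(2u/c_m²) / √(-i(u+x)) du` along `u = r + it`, `t > 0`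
(principal square root; the real part of `-i(u+x)` is positive). -/
def eichlerIntegrand (m : ℕ) (r : ℝ) (x : ℂ) (t : ℝ) : ℂ :=
  oddE m (2 * ((r : ℂ) + t * Complex.I) / (cConst m : ℂ) ^ 2) /
    (-Complex.I * ((r : ℂ) + t * Complex.I + x)) ^ (1 / 2 : ℂ) * Complex.I

/-- `∫_r^{i∞} E_m(2u/c_m²) / √(-i(u+x)) du`. -/
def eichlerIntegral (m : ℕ) (r : ℝ) (x : ℂ) : ℂ :=
  ∫ t in Set.Ioi (0 : ℝ), eichlerIntegrand m r x t

/-! ### The functions `V_{mn}` on the upper half-plane -/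

/-- The 43 pairs `(m,n)`, `m ∈ {1,…,6}`, for which `V_{mn}` is defined (the five omitted pairs lead
to `u = 0`, a pole of `μ`). -/
def Admissible (m n : ℕ) : Prop :=
  1 ≤ m ∧ m ≤ 6 ∧ 1 ≤ n ∧ n ≤ 8 ∧
    (m, n) ∉ ({(1, 6), (2, 5), (3, 8), (5, 4), (6, 7)} : Set (ℕ × ℕ))

/-- `ϑ(v;τ)`. -/
def theta (v τ : ℂ) : ℂ :=
  ∑' n : ℤ, e (((n : ℂ) + 1 / 2) * (v + 1 / 2)) * e (((n : ℂ) + 1 / 2) ^ 2 / 2 * τ)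

/-- Zwegers' function `μ(u,v;τ)`. -/
def mu (u v τ : ℂ) : ℂ :=
  e (u / 2) / theta v τ *
    ∑' n : ℤ, (-1 : ℂ) ^ n * e (n * v) * e ((n : ℂ) * (n + 1) / 2 * τ) / (1 - e u * e (n * τ))

/-- The data of a function `w q^t μ(u,v;τ)` with `u - v = α τ + β` and `t = -α²/2`. -/
structure Piece where
  w : ℂ
  α : ℚ
  β : ℚ

/-- The pieces of `V_{mn}`: one for `m ≠ 4`, and two, to be added, for `m = 4`. -/
def pieces (m : ℕ) : List Piece :=
  match m with
  | 1 => [⟨-1, -1 / 4, 1 / 2⟩]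
  | 2 => [⟨Complex.I, -1 / 4, 0⟩]
  | 3 => [⟨-1, -1 / 6, 1 / 2⟩]
  | 4 => [⟨Complex.I, -5 / 12, 0⟩, ⟨Complex.I, -1 / 12, 0⟩]
  | 5 => [⟨-1, -1 / 3, 1 / 2⟩]
  | 6 => [⟨Complex.I, -1 / 6, 0⟩]
  | _ => []

/-- The exponent `t = -α²/2`. -/
def Piece.t (p : Piece) : ℂ := -(p.α : ℂ) ^ 2 / 2

/-- The second argument `v_τ` of `μ`, which depends only on `n` and `τ`. -/
def vArg (n : ℕ) (τ : ℂ) : ℂ :=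
  match n with
  | 1 => τ / 2
  | 2 => τ / 2 - 1 / 2
  | 3 => τ / 3
  | 4 => τ / 3 - 1 / 2
  | 5 => τ / 4
  | 6 => τ / 4 - 1 / 2
  | 7 => τ / 6
  | 8 => τ / 6 - 1 / 2
  | _ => 0

/-- The first argument `u_τ` of `μ`. -/
def Piece.uArg (p : Piece) (n : ℕ) (τ : ℂ) : ℂ := vArg n τ + (p.α : ℂ) * τ + (p.β : ℂ)

/-- `V_{mn}(τ) = ∑ w q^t μ(u_τ, v_τ; τ)` for `τ` in the upper half-plane. -/
def VUpper (m n : ℕ) (τ : ℂ) : ℂ :=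
  ((pieces m).map fun p => p.w * e (p.t * τ) * mu (p.uArg n τ) (vArg n τ) τ).sum

/-! ### The functions `V_{mn}` at rational numbers

On the upper half-plane each piece of `V_{mn}` is the sum of three `q`-expressions: the piece of
`V_{m1}` is a `g₂`-series plus an eta-theta quotient, and the piece of `V_{mn} - V_{m1}` is
`i w q^t η³ ϑ(τ/2+u_n) ϑ(u_n-u_1) / (ϑ(u_1) ϑ(τ/2) ϑ(u_n) ϑ(v_n))`. The value at a rational number
is the value of these `q`-expressions at the corresponding roots of unity. -/

/-- The `q`-Pochhammer symbol `(a;q)_n`. -/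
def qPoch (a q : ℂ) (n : ℕ) : ℂ := ∏ j ∈ Finset.range n, (1 - a * q ^ j)

/-- The `n`-th term of the universal mock theta function `g₂(z;q)`. -/
def g2Term (z q : ℂ) (n : ℕ) : ℂ :=
  qPoch (-q) q n * q ^ (n * (n + 1) / 2) / (qPoch z q (n + 1) * qPoch (z⁻¹ * q) q (n + 1))

/-- `g₂(z;q)`. -/
def g2 (z q : ℂ) : ℂ := ∑' n : ℕ, g2Term z q n

/-- The `j`-th factor of `(e(z);q)_∞ (e(-z)q;q)_∞`, where `q = e(x)`. -/
def jacobiFactor (z x : ℂ) (j : ℕ) : ℂ := (1 - e z * e x ^ j) * (1 - e (-z) * e x ^ (j + 1))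

/-- The `j`-th factor of `(q;q)_∞ (-q^{1/2};q^{1/2})_∞² / ((e(u_1);q)_∞ (e(-u_1)q;q)_∞)`, where
`q = e(x)`; this product is `-i e(-u_1/2) η(x)⁴ / (η(x/2)² ϑ(u_1;x))`. -/
def etaFactor (p : Piece) (x : ℂ) (j : ℕ) : ℂ :=
  (1 - e x ^ (j + 1)) * (1 + e (x / 2) ^ (j + 1)) ^ 2 / jacobiFactor (p.uArg 1 x) x j

/-- The denominator of the `j`-th factor of the product for `V_{mn} - V_{m1}`. -/
def diffDen (p : Piece) (n : ℕ) (x : ℂ) (j : ℕ) : ℂ :=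
  jacobiFactor (p.uArg 1 x) x j * jacobiFactor (x / 2) x j *
    jacobiFactor (p.uArg n x) x j * jacobiFactor (vArg n x) x j

/-- The `j`-th factor of the product for `V_{mn} - V_{m1}`, obtained from the triple product
expansions of `η³ ϑ(x/2+u_n) ϑ(u_n-u_1) / (ϑ(u_1) ϑ(x/2) ϑ(u_n) ϑ(v_n))`. -/
def diffFactor (p : Piece) (n : ℕ) (x : ℂ) (j : ℕ) : ℂ :=
  (1 - e x ^ (j + 1)) * jacobiFactor (x / 2 + p.uArg n x) x j *
    jacobiFactor (p.uArg n x - p.uArg 1 x) x j / diffDen p n x j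

/-- The value of `V_{mn}` at a rational number `x`: the sum over the pieces of
`i w q^{t+1/8} (g₂(e(u_1/2); q^{1/2}) - ∏ etaFactor) - i w q^{t+1/8} e(u_1/2) ∏ diffFactor`, the
last term being the piece of `V_{mn} - V_{m1}`. -/
def VRat (m n : ℕ) (x : ℂ) : ℂ :=
  ((pieces m).map fun p =>
    Complex.I * p.w * e ((p.t + 1 / 8) * x) *
        (g2 (e (p.uArg 1 x / 2)) (e (x / 2)) - ∏' j : ℕ, etaFactor p x j) -
      Complex.I * p.w * e ((p.t + 1 / 8) * x) * e (p.uArg 1 x / 2) *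
        ∏' j : ℕ, diffFactor p n x j).sum

/-- `V_{mn}` exists (is non-singular) at the rational number `x`: no denominator in the series and
products that define its value vanishes, and these series and products converge. -/
def NonsingularAt (m n : ℕ) (x : ℚ) : Prop :=
  ∀ p ∈ pieces m,
    (∀ j : ℕ, qPoch (e (p.uArg 1 x / 2)) (e ((x : ℂ) / 2)) j ≠ 0 ∧
      qPoch ((e (p.uArg 1 x / 2))⁻¹ * e ((x : ℂ) / 2)) (e ((x : ℂ) / 2)) j ≠ 0) ∧
    Summable (g2Term (e (p.uArg 1 x / 2)) (e ((x : ℂ) / 2))) ∧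
    (∀ j : ℕ, jacobiFactor (p.uArg 1 x) x j ≠ 0) ∧
    Multipliable (etaFactor p x) ∧
    (∀ j : ℕ, diffDen p n x j ≠ 0) ∧
    Multipliable (diffFactor p n x)

/-- `V_{mn}` on the union of the upper half-plane and the rational numbers. -/
def V (m n : ℕ) (x : ℂ) : ℂ :=
  open Classical in if 0 < x.im then VUpper m n x else VRat m n x

/-! ### Quantum sets and groups -/

/-- Rationals `h/k` in lowest terms with `h` odd. -/
def SAll : Set ℚ := {x | Odd x.num}

/-- Rationals `h/k` in lowest terms with `h ≡ ±1 (mod 6)`. -/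
def SPrime : Set ℚ := {x | x.num % 6 = 1 ∨ x.num % 6 = 5}

/-- Rationals `h/k` in lowest terms with `h` odd and `k` even. -/
def SEv : Set ℚ := {x | Odd x.num ∧ Even x.den}

/-- Rationals `h/k` in lowest terms with `h` odd and `k` odd. -/
def SOd : Set ℚ := {x | Odd x.num ∧ Odd x.den}

/-- The quantum sets `S_{mn}`. -/
def quantumSet (m n : ℕ) : Set ℚ :=
  match m, n with
  | 1, 1 | 1, 7 | 2, 1 | 2, 7 | 4, 1 | 4, 5 | 4, 7 => SAll
  | 1, 2 | 1, 8 | 2, 2 | 2, 8 | 4, 2 | 5, 2 => SEv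
  | 1, 3 | 2, 3 | 3, 1 | 3, 4 | 3, 5 | 3, 6 | 4, 3 => SPrime
  | 6, 1 | 6, 3 | 6, 4 | 6, 5 | 6, 6 => SPrime
  | 1, 4 | 1, 5 | 2, 4 | 2, 6 => SOd
  | 3, 2 | 3, 3 | 6, 2 => SPrime ∩ SEv
  | 3, 7 | 5, 3 | 6, 8 => SPrime ∩ SOd
  | 4, 4 => SPrime ∪ SOd
  | 4, 6 | 4, 8 | 5, 1 | 5, 5 | 5, 6 | 5, 7 | 5, 8 => SPrime ∪ SEv
  | _, _ => ∅

/-- The set `ℍ ∪ S_{mn}`, as a set of complex numbers. -/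
def upperOrQuantum (m n : ℕ) : Set ℂ :=
  {z | 0 < z.im} ∪ (fun x : ℚ => (x : ℂ)) '' quantumSet m n

/-- `M_r`, with rows `(1, 0)` and `(r, 1)`. -/
def lowerMat (r : ℤ) : Matrix.SpecialLinearGroup (Fin 2) ℤ :=
  ⟨!![1, 0; r, 1], by simp [Matrix.det_fin_two]⟩

/-- The translation matrix with rows `(1, b)` and `(0, 1)`. -/
def upperMat (b : ℤ) : Matrix.SpecialLinearGroup (Fin 2) ℤ :=
  ⟨!![1, b; 0, 1], by simp [Matrix.det_fin_two]⟩

/-- The width of the translation that generates `G_{mn}` together with `M_{ℓ_{mn}}`. -/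
def groupShift (m n : ℕ) : ℤ :=
  match m, n with
  | 1, 1 | 1, 2 | 1, 5 | 2, 1 | 2, 2 | 2, 6 => 4
  | 1, 3 | 1, 4 | 1, 7 | 1, 8 | 2, 3 | 2, 4 | 2, 7 | 2, 8 => 12
  | 3, 5 | 3, 6 | 5, 5 | 5, 6 | 6, 5 | 6, 6 => 12
  | 4, _ => 12
  | _, _ => 6

/-- The groups `G_{mn}`. -/
def quantumGroup (m n : ℕ) : Subgroup (Matrix.SpecialLinearGroup (Fin 2) ℤ) :=
  Subgroup.closure {lowerMat (ellPair m n), upperMat (groupShift m n)}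

/-! ### Quantum modular forms -/

/-- The denominator `cx + d` of the action of `γ` on `x`. -/
def moebiusDen (γ : Matrix.SpecialLinearGroup (Fin 2) ℤ) (x : ℚ) : ℚ := γ.1 1 0 * x + γ.1 1 1

/-- `γx = (ax + b)/(cx + d)`; meaningful if `cx + d ≠ 0`. -/
def moebius (γ : Matrix.SpecialLinearGroup (Fin 2) ℤ) (x : ℚ) : ℚ :=
  (γ.1 0 0 * x + γ.1 0 1) / moebiusDen γ x

/-- `(cx + d)^{-k}` for a rational number `x`, as the boundary value of the principal branch of
`(cτ + d)^{-k}` on the upper half-plane: at negative values of `cx + d` the argument is `π` if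
`c ≥ 0` and `-π` if `c < 0`. -/
def autFactor (k : ℝ) (γ : Matrix.SpecialLinearGroup (Fin 2) ℤ) (x : ℚ) : ℂ :=
  if 0 ≤ γ.1 1 0 then (moebiusDen γ x : ℂ) ^ (-(k : ℂ))
  else (starRingEnd ℂ) ((moebiusDen γ x : ℂ) ^ (-(k : ℂ)))

/-- `f`, which exists at the rational numbers in `D`, is a quantum modular form of weight `k` on `S`
for the group `G`: the set `S` is a quantum set for `f` and `G`, that is, `f(x)` and `f(γx)` exist
for `x ∈ S` and `γ ∈ G` (with `x ≠ -d/c`), and for each `γ ∈ G` there is a number `ε(γ)` of absolute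
value one such that `f(x) - ε(γ) (cx+d)^{-k} f(γx)`, `x ∈ S`, `x ≠ -d/c`, is the restriction of a
function that is real analytic on the real line without `-d/c`. -/
def IsQuantumModularForm (k : ℝ) (f : ℂ → ℂ) (D S : Set ℚ)
    (G : Subgroup (Matrix.SpecialLinearGroup (Fin 2) ℤ)) : Prop :=
  (∀ x ∈ S, x ∈ D ∧ ∀ γ ∈ G, moebiusDen γ x ≠ 0 → moebius γ x ∈ D) ∧
  ∀ γ ∈ G, ∃ ε : ℂ, ‖ε‖ = 1 ∧ ∃ h : ℝ → ℂ,
    AnalyticOnNhd ℝ h {y : ℝ | (γ.1 1 0 : ℝ) * y + γ.1 1 1 ≠ 0} ∧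
    ∀ x ∈ S, moebiusDen γ x ≠ 0 →
      f (x : ℂ) - ε * autFactor k γ x * f ((moebius γ x : ℚ) : ℂ) = h x

end EtaTheta

end

open Complex Filter Topology
namespace EtaTheta

/-! ### The exponential `e` -/

lemma e_add (a b : ℂ) : e (a + b) = e a * e b := by
  simp only [e, mul_add, Complex.exp_add]

lemma e_neg (a : ℂ) : e (-a) = (e a)⁻¹ := by
  simp only [e, mul_neg, Complex.exp_neg]

lemma e_sub (a b : ℂ) : e (a - b) = e a / e b := by
  rw [sub_eq_add_neg, e_add, e_neg, div_eq_mul_inv]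

lemma e_ne_zero (a : ℂ) : e a ≠ 0 := Complex.exp_ne_zero _

@[simp] lemma e_zero : e 0 = 1 := by simp [e]

lemma e_int (n : ℤ) : e n = 1 := by
  rw [e, mul_comm]; exact Complex.exp_int_mul_two_pi_mul_I n

lemma e_nat (n : ℕ) : e n = 1 := by exact_mod_cast e_int n

@[simp] lemma e_half : e (1 / 2) = -1 := by
  rw [e, show 2 * (Real.pi : ℂ) * I * (1 / 2) = Real.pi * I by ring, Complex.exp_pi_mul_I]

lemma e_eq_one_iff (a : ℂ) : e a = 1 ↔ ∃ n : ℤ, a = n := by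
  rw [e, Complex.exp_eq_one_iff]
  refine exists_congr fun n => ?_
  rw [mul_comm (n : ℂ)]
  constructor
  · exact fun h => mul_left_cancel₀ Complex.two_pi_I_ne_zero h
  · rintro rfl; rfl

/-- `e` is periodic modulo the integers. -/
lemma e_congr {a b : ℂ} (n : ℤ) (h : a = b + n) : e a = e b := by
  rw [h, e_add, e_int, mul_one]

/-- `e` changes sign under shifts by half-integers. -/
lemma e_congr_neg {a b : ℂ} (n : ℤ) (h : a = b + n + 1 / 2) : e a = -e b := by
  rw [h, e_add, e_add, e_int, mul_one, e_half]; ring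

lemma e_add_int (a : ℂ) (n : ℤ) : e (a + n) = e a := e_congr n rfl

lemma e_add_one (a : ℂ) : e (a + 1) = e a := e_congr 1 (by simp)

lemma e_pow (a : ℂ) (n : ℕ) : e a ^ n = e (n * a) := by
  rw [e, e, ← Complex.exp_nat_mul]; congr 1; ring

lemma e_zpow (a : ℂ) (n : ℤ) : e a ^ n = e (n * a) := by
  rw [e, e, ← Complex.exp_int_mul]; congr 1; ring

lemma neg_one_zpow_eq (n : ℤ) : (-1 : ℂ) ^ n = e (n / 2) := by
  rw [← e_half, e_zpow]; congr 1; ring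

lemma norm_e (z : ℂ) : ‖e z‖ = Real.exp (-2 * Real.pi * z.im) := by
  rw [e, Complex.norm_exp]; congr 1
  simp

lemma norm_e_ofReal (x : ℝ) : ‖e x‖ = 1 := by
  rw [norm_e]; simp

lemma norm_e_ratCast (x : ℚ) : ‖e (x : ℂ)‖ = 1 := by
  have := norm_e_ofReal (x : ℝ); simpa using this

lemma differentiable_e : Differentiable ℂ e := by
  unfold e; fun_prop

lemma continuous_e : Continuous e := differentiable_e.continuous

@[fun_prop] lemma Differentiable.e' {f : ℂ → ℂ} (hf : Differentiable ℂ f) :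
    Differentiable ℂ fun z => e (f z) := differentiable_e.comp hf

@[fun_prop] lemma DifferentiableAt.e' {f : ℂ → ℂ} {z : ℂ} (hf : DifferentiableAt ℂ f z) :
    DifferentiableAt ℂ (fun z => e (f z)) z := (differentiable_e _).comp z hf

@[fun_prop] lemma Continuous.e' {X : Type*} [TopologicalSpace X] {f : X → ℂ} (hf : Continuous f) :
    Continuous fun z => e (f z) := continuous_e.comp hf

@[fun_prop] lemma ContinuousAt.e' {X : Type*} [TopologicalSpace X] {f : X → ℂ} {x : X}
    (hf : ContinuousAt f x) : ContinuousAt (fun z => e (f z)) x :=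
  continuous_e.continuousAt.comp hf

lemma hasDerivAt_e (z : ℂ) : HasDerivAt e (2 * Real.pi * I * e z) z := by
  unfold e
  have := ((hasDerivAt_id z).const_mul (2 * (Real.pi : ℂ) * I)).cexp
  simpa [mul_comm] using this

/-! ### The theta function -/

lemma theta_eq (v τ : ℂ) :
    theta v τ = e ((v + 1 / 2) / 2 + τ / 8) * jacobiTheta₂ (v + 1 / 2 + τ / 2) τ := by
  rw [theta, jacobiTheta₂, ← tsum_mul_left]
  refine tsum_congr fun n => ?_
  rw [jacobiTheta₂_term, ← e_add, show 2 * (Real.pi : ℂ) * I * n * (v + 1 / 2 + τ / 2)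
    + Real.pi * I * n ^ 2 * τ = 2 * Real.pi * I * (n * (v + 1 / 2 + τ / 2) + n ^ 2 * τ / 2) by ring]
  change _ = _ * e _
  rw [← e_add]; congr 1; ring

lemma differentiable_theta {τ : ℂ} (hτ : 0 < τ.im) : Differentiable ℂ fun v => theta v τ := by
  simp only [theta_eq]
  refine Differentiable.mul (by fun_prop) ?_
  intro v
  exact (differentiableAt_jacobiTheta₂_fst (v + 1 / 2 + τ / 2) hτ).comp v
    (f := fun v => v + 1 / 2 + τ / 2) (by fun_prop)

lemma theta_add_one (v τ : ℂ) : theta (v + 1) τ = -theta v τ := by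
  rw [theta_eq, theta_eq, show v + 1 + 1 / 2 + τ / 2 = v + 1 / 2 + τ / 2 + 1 by ring,
    jacobiTheta₂_add_left, ← neg_mul]
  congr 1
  exact e_congr_neg 0 (by push_cast; ring)

lemma theta_add_tau (v τ : ℂ) : theta (v + τ) τ = -e (-τ / 2 - v) * theta v τ := by
  rw [theta_eq, theta_eq, show v + τ + 1 / 2 + τ / 2 = v + 1 / 2 + τ / 2 + τ by ring,
    jacobiTheta₂_add_left', show -(Real.pi : ℂ) * I * (τ + 2 * (v + 1 / 2 + τ / 2)) =
      2 * Real.pi * I * (-(τ + 2 * (v + 1 / 2 + τ / 2)) / 2) by ring]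
  change _ * (e _ * _) = _
  rw [← mul_assoc, ← mul_assoc, ← e_add, neg_mul, ← e_add]
  congr 1
  exact e_congr_neg (-1) (by push_cast; ring)

lemma theta_neg (v τ : ℂ) : theta (-v) τ = -theta v τ := by
  rw [theta_eq, theta_eq, show -v + 1 / 2 + τ / 2 = -(v + 1 / 2 + τ / 2) + τ + 1 by ring,
    jacobiTheta₂_add_left, jacobiTheta₂_add_left', jacobiTheta₂_neg_left,
    show -(Real.pi : ℂ) * I * (τ + 2 * -(v + 1 / 2 + τ / 2)) =
      2 * Real.pi * I * (-(τ + 2 * -(v + 1 / 2 + τ / 2)) / 2) by ring]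
  change _ * (e _ * _) = _
  rw [← mul_assoc, ← neg_mul, ← e_add]
  congr 1
  exact e_congr_neg 0 (by push_cast; ring)

lemma theta_zero (τ : ℂ) : theta 0 τ = 0 := by
  have := theta_neg 0 τ
  rw [neg_zero] at this
  exact self_eq_neg.mp this

lemma theta_tau_add_one (v τ : ℂ) : theta v (τ + 1) = e (1 / 8) * theta v τ := by
  rw [theta, theta, ← tsum_mul_left]
  refine tsum_congr fun n => ?_
  rw [← e_add, ← mul_assoc, ← e_add, ← e_add]
  obtain ⟨k, hk⟩ := Int.even_mul_succ_self n
  have hk' : (n : ℂ) * (n + 1) = k + k := by exact_mod_cast hk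
  refine e_congr k ?_
  linear_combination (1 / 2) * hk'

lemma neg_inv_im_pos {τ : ℂ} (hτ : 0 < τ.im) : 0 < (-1 / τ).im := by
  have : 0 < normSq τ := normSq_pos.mpr (by rintro rfl; simp at hτ)
  rw [neg_div, neg_im, one_div, inv_im, neg_div, neg_neg]; positivity

lemma ne_zero_of_im_pos {τ : ℂ} (hτ : 0 < τ.im) : τ ≠ 0 := by rintro rfl; simp at hτ

lemma sqrt_ne_zero {τ : ℂ} (hτ : 0 < τ.im) : (-I * τ) ^ (1 / 2 : ℂ) ≠ 0 := by
  rw [Ne, cpow_eq_zero_iff, not_and_or]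
  left; simpa using ne_zero_of_im_pos hτ

lemma theta_S {τ : ℂ} (hτ : 0 < τ.im) (v : ℂ) :
    theta (v / τ) (-1 / τ) = -I * (-I * τ) ^ (1 / 2 : ℂ) * e (v ^ 2 / (2 * τ)) * theta v τ := by
  have h0 := ne_zero_of_im_pos hτ
  have h1 := sqrt_ne_zero hτ
  have h2 : theta (v / τ) (-1 / τ) = e ((v / τ + 1 / 2) / 2 - 1 / (8 * τ)) *
      jacobiTheta₂ ((v - 1 / 2 + τ / 2) / τ) (-1 / τ) := by
    rw [theta_eq]; congr 2 <;> field_simp <;> ring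
  have h3 := jacobiTheta₂_functional_equation (v - 1 / 2 + τ / 2) τ
  rw [h2, theta_eq, show v + 1 / 2 + τ / 2 = v - 1 / 2 + τ / 2 + 1 by ring, jacobiTheta₂_add_left, h3,
    show -(Real.pi : ℂ) * I * (v - 1 / 2 + τ / 2) ^ 2 / τ =
      2 * Real.pi * I * (-(v - 1 / 2 + τ / 2) ^ 2 / (2 * τ)) by field_simp]
  change _ = _ * (_ * (_ * e _ * _))
  have hI : -I = e (-1 / 4) := by
    rw [e, show 2 * (Real.pi : ℂ) * I * (-1 / 4) = -(Real.pi / 2 * I) by ring, Complex.exp_neg,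
      Complex.exp_pi_div_two_mul_I, Complex.inv_I]
  have key : e ((v / τ + 1 / 2) / 2 - 1 / (8 * τ)) = e (-1 / 4) * e (v ^ 2 / (2 * τ)) *
      e ((v + 1 / 2) / 2 + τ / 8) * e (-(v - 1 / 2 + τ / 2) ^ 2 / (2 * τ)) := by
    rw [← e_add, ← e_add, ← e_add]
    refine e_congr 0 ?_
    push_cast; field_simp; ring
  rw [key]
  nth_rw 1 [← hI]
  field_simp

end EtaTheta

open Complex Filter Topology
namespace EtaTheta

/-! ### Finite `q`-series identities -/

/-- `1/(q;q)_n` with `q = e(τ)`, extended by zero to negative `n`. -/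
noncomputable def recipPoch (τ : ℂ) (n : ℤ) : ℂ :=
  if n < 0 then 0 else (qPoch (e τ) (e τ) n.toNat)⁻¹

lemma norm_e_lt_one {τ : ℂ} (hτ : 0 < τ.im) : ‖e τ‖ < 1 := by
  rw [norm_e, Real.exp_lt_one_iff]; nlinarith [Real.pi_pos]

lemma one_sub_e_ne_zero {τ : ℂ} (hτ : 0 < τ.im) {x : ℝ} (hx : x ≠ 0) :
    1 - e (x * τ) ≠ 0 := by
  intro h
  have h1 : ‖e (x * τ)‖ = 1 := by rw [← sub_eq_zero.mp h]; simp
  rw [norm_e, Real.exp_eq_one_iff] at h1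
  simp [Real.pi_ne_zero, hx, hτ.ne'] at h1

lemma qPoch_succ (a q : ℂ) (n : ℕ) : qPoch a q (n + 1) = qPoch a q n * (1 - a * q ^ n) := by
  rw [qPoch, qPoch, Finset.prod_range_succ]

lemma qPoch_zero (a q : ℂ) : qPoch a q 0 = 1 := by simp [qPoch]

lemma qPoch_self_ne_zero {τ : ℂ} (hτ : 0 < τ.im) (n : ℕ) : qPoch (e τ) (e τ) n ≠ 0 := by
  refine Finset.prod_ne_zero_iff.mpr fun j _ => ?_
  have := one_sub_e_ne_zero hτ (x := j + 1) (by positivity)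
  rwa [e_pow, ← e_add, show τ + j * τ = ((j + 1 : ℝ) : ℂ) * τ by push_cast; ring]

lemma recipPoch_of_nat (τ : ℂ) (n : ℕ) : recipPoch τ n = (qPoch (e τ) (e τ) n)⁻¹ := by
  simp [recipPoch]

lemma recipPoch_of_neg (τ : ℂ) {n : ℤ} (h : n < 0) : recipPoch τ n = 0 := by
  simp [recipPoch, h]

lemma recipPoch_zero (τ : ℂ) : recipPoch τ 0 = 1 := by
  simpa [qPoch_zero] using recipPoch_of_nat τ 0

lemma recipPoch_rec {τ : ℂ} (hτ : 0 < τ.im) (n : ℤ) :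
    recipPoch τ n = (1 - e ((n + 1) * τ)) * recipPoch τ (n + 1) := by
  rcases lt_trichotomy n (-1) with h | rfl | h
  · rw [recipPoch_of_neg _ (by omega), recipPoch_of_neg _ (by omega), mul_zero]
  · simp [recipPoch_of_neg]
  · obtain ⟨k, rfl⟩ := Int.eq_ofNat_of_zero_le (show 0 ≤ n by omega)
    have h2 := recipPoch_of_nat τ (k + 1)
    push_cast at h2
    have h3 := qPoch_self_ne_zero hτ (k + 1)
    rw [recipPoch_of_nat, h2]
    rw [qPoch_succ, e_pow, ← e_add, show τ + k * τ = (k + 1) * τ by ring] at h3 ⊢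
    have := left_ne_zero_of_mul h3
    have := right_ne_zero_of_mul h3
    push_cast
    field_simp

lemma recipPoch_rec' {τ : ℂ} (hτ : 0 < τ.im) {m n : ℤ} (h : m = n + 1) :
    recipPoch τ n = (1 - e (m * τ)) * recipPoch τ m := by
  subst h; rw [recipPoch_rec hτ]; push_cast; rfl

lemma finite_support_of_bdd {f : ℤ → ℂ} (N : ℤ) (h : ∀ r, f r ≠ 0 → -N ≤ r ∧ r ≤ N) :
    f.support.Finite :=
  (Set.finite_Icc (-N) N).subset fun r hr => h r hr

/-- The `r`-th term of the finite Jacobi triple product. -/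
noncomputable def tripleTerm (τ v : ℂ) (N : ℕ) (r : ℤ) : ℂ :=
  e (r / 2) * e (r * v) * e (r * (r - 1) / 2 * τ) * (recipPoch τ (N + r) * recipPoch τ (N - r))

lemma summable_tripleTerm (τ v : ℂ) (N : ℕ) : Summable (tripleTerm τ v N) := by
  refine summable_of_hasFiniteSupport (finite_support_of_bdd N fun r hr => ?_)
  by_contra! hc
  apply hr
  rcases lt_or_ge r (-N) with h | h
  · rw [tripleTerm, recipPoch_of_neg _ (show (N : ℤ) + r < 0 by omega)]; ring
  · rw [tripleTerm, recipPoch_of_neg _ (show (N : ℤ) - r < 0 by have := hc h; omega)]; ring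

lemma tsum_shift (f : ℤ → ℂ) (k : ℤ) : ∑' r, f (r + k) = ∑' r, f r :=
  (Equiv.addRight k).tsum_eq f

lemma summable_shift {f : ℤ → ℂ} (hf : Summable f) (k : ℤ) : Summable fun r => f (r + k) :=
  (Equiv.addRight k).summable_iff.mpr hf

/-- The finite form of the Jacobi triple product. -/
lemma tsum_tripleTerm {τ : ℂ} (hτ : 0 < τ.im) (v : ℂ) (N : ℕ) :
    ∑' r, tripleTerm τ v N r =
      qPoch (e v) (e τ) N * qPoch (e (τ - v)) (e τ) N * recipPoch τ (2 * N) := by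
  induction N with
  | zero =>
    rw [tsum_eq_single 0]
    · simp [tripleTerm, qPoch_zero, recipPoch_zero]
    · intro r hr
      rcases lt_or_gt_of_ne hr with h | h
      · rw [tripleTerm, recipPoch_of_neg _ (show ((0 : ℕ) : ℤ) + r < 0 by simpa)]; ring
      · rw [tripleTerm, recipPoch_of_neg _ (show ((0 : ℕ) : ℤ) - r < 0 by simpa)]; ring
  | succ N ih =>
    have hs := summable_tripleTerm τ v N
    have key : ∀ r : ℤ, (1 - e ((2 * N + 1) * τ)) * (1 - e ((2 * N + 2) * τ)) *
        tripleTerm τ v (N + 1) r = (1 + e ((2 * N + 1) * τ)) * tripleTerm τ v N r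
          - e (v + N * τ) * tripleTerm τ v N (r + -1)
          - e ((N + 1) * τ - v) * tripleTerm τ v N (r + 1) := by
      intro r
      have r1 := recipPoch_rec' hτ (show ((N + 1 : ℕ) : ℤ) + r = N + r + 1 by push_cast; ring)
      have r2 := recipPoch_rec' hτ (show ((N + 1 : ℕ) : ℤ) - r = N - r + 1 by push_cast; ring)
      have r3 := recipPoch_rec' hτ (show (N : ℤ) + r = N + (r + -1) + 1 by ring)
      have r4 := recipPoch_rec' hτ (show (N : ℤ) - r = N - (r + 1) + 1 by ring)
      simp only [tripleTerm]
      rw [r3, r4, show (N : ℤ) - (r + -1) = (N + 1 : ℕ) - r by push_cast; ring,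
        show (N : ℤ) + (r + 1) = (N + 1 : ℕ) + r by push_cast; ring, r1, r2]
      have a1 : e ((2 * N + 1) * τ) = e ((N + r) * τ) * e ((N + 1 - r) * τ) := by
        rw [← e_add]; congr 1; ring
      have a2 : e ((2 * N + 2) * τ) = e ((N + r) * τ) * e τ * e ((N + 1 - r) * τ) := by
        rw [← e_add, ← e_add]; congr 1; ring
      have a3 : e ((N + 1 + r) * τ) = e ((N + r) * τ) * e τ := by
        rw [← e_add]; congr 1; ring
      have a4 : e ((N + 1 - r) * τ) = e ((N - r) * τ) * e τ := by
        rw [← e_add]; congr 1; ring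
      have b1 : e (v + N * τ) * (e (((r + -1 : ℤ) : ℂ) / 2) * e (((r + -1 : ℤ) : ℂ) * v) *
          e (((r + -1 : ℤ) : ℂ) * (((r + -1 : ℤ) : ℂ) - 1) / 2 * τ)) =
          -(e ((N + 1 - r) * τ) * (e (r / 2) * e (r * v) * e (r * (r - 1) / 2 * τ))) := by
        simp only [← e_add]
        exact e_congr_neg (-1) (by push_cast; ring)
      have b2 : e ((N + 1) * τ - v) * (e (((r + 1 : ℤ) : ℂ) / 2) * e (((r + 1 : ℤ) : ℂ) * v) *
          e (((r + 1 : ℤ) : ℂ) * (((r + 1 : ℤ) : ℂ) - 1) / 2 * τ)) =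
          -(e ((N + r) * τ) * e τ * (e (r / 2) * e (r * v) * e (r * (r - 1) / 2 * τ))) := by
        simp only [← e_add]
        exact e_congr_neg 0 (by push_cast; ring)
      push_cast at b1 b2 ⊢
      rw [show ∀ A B C D : ℂ, e (v + N * τ) * (A * B * C * D) = e (v + N * τ) * (A * B * C) * D by
        intros; ring, b1, show ∀ A B C D : ℂ, e ((N + 1) * τ - v) * (A * B * C * D) =
          e ((N + 1) * τ - v) * (A * B * C) * D by intros; ring, b2, a1, a2, a3, a4]
      ring
    have hsum : (1 - e ((2 * N + 1) * τ)) * (1 - e ((2 * N + 2) * τ)) *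
        ∑' r, tripleTerm τ v (N + 1) r =
        (1 - e (v + N * τ)) * (1 - e ((N + 1) * τ - v)) * ∑' r, tripleTerm τ v N r := by
      rw [← tsum_mul_left, tsum_congr key, Summable.tsum_sub, Summable.tsum_sub, tsum_mul_left,
        tsum_mul_left, tsum_mul_left, tsum_shift, tsum_shift]
      · have : e ((2 * N + 1) * τ) = e (v + N * τ) * e ((N + 1) * τ - v) := by
          rw [← e_add]; congr 1; ring
        rw [this]; ring
      · exact hs.mul_left _
      · exact (summable_shift hs _).mul_left _
      · exact (hs.mul_left _).sub ((summable_shift hs _).mul_left _)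
      · exact (summable_shift hs _).mul_left _
    have h1 := one_sub_e_ne_zero hτ (x := 2 * N + 1) (by positivity)
    have h2 := one_sub_e_ne_zero hτ (x := 2 * N + 2) (by positivity)
    push_cast at h1 h2
    have r1 := recipPoch_rec hτ (2 * N)
    have r2 := recipPoch_rec hτ (2 * N + 1)
    rw [show (2 * (N : ℤ) + 1 + 1) = 2 * ((N + 1 : ℕ) : ℤ) by push_cast; ring] at r2
    rw [r2] at r1
    push_cast at r1
    rw [show (2 * (N : ℂ) + 1 + 1) = 2 * N + 2 by ring] at r1
    rw [ih, r1] at hsum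
    rw [qPoch_succ, qPoch_succ, e_pow, ← e_add, ← e_add,
      show τ - v + N * τ = (N + 1) * τ - v by ring]
    have := mul_left_cancel₀ (mul_ne_zero h1 h2) (hsum.trans (b := _) (c := _)
      (show _ = (1 - e ((2 * N + 1) * τ)) * (1 - e ((2 * N + 2) * τ)) *
        (qPoch (e v) (e τ) N * (1 - e (v + N * τ)) * (qPoch (e (τ - v)) (e τ) N *
          (1 - e ((N + 1) * τ - v))) * recipPoch τ (2 * ((N + 1 : ℕ) : ℤ))) by push_cast; ring))
    push_cast at this ⊢
    exact this

/-- The `r`-th coefficient of the partial fraction expansion of `1/((z;q)_{n+1} (q/z;q)_{n+1})`. -/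
noncomputable def pfCoeff (τ : ℂ) (n : ℕ) (r : ℤ) : ℂ :=
  e (r / 2) * e (r * (r + 1) / 2 * τ) * (recipPoch τ (n - r) * recipPoch τ (n + r + 1))

lemma pfCoeff_support (τ : ℂ) (n : ℕ) (r : ℤ) (h : pfCoeff τ n r ≠ 0) :
    -(n + 1 : ℤ) ≤ r ∧ r ≤ n + 1 := by
  by_contra! hc
  apply h
  rcases lt_or_ge r (-(n + 1)) with h | h
  · rw [pfCoeff, recipPoch_of_neg _ (show (n : ℤ) + r + 1 < 0 by omega)]; ring
  · rw [pfCoeff, recipPoch_of_neg _ (show (n : ℤ) - r < 0 by have := hc h; omega)]; ring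

lemma summable_pfCoeff_mul (τ : ℂ) (n : ℕ) (g : ℤ → ℂ) : Summable fun r => pfCoeff τ n r * g r :=
  summable_of_hasFiniteSupport (finite_support_of_bdd (n + 1) fun r hr =>
    pfCoeff_support τ n r (left_ne_zero_of_mul hr))

lemma tsum_pfCoeff (τ : ℂ) (n : ℕ) : ∑' r, pfCoeff τ n r = 0 := by
  have h : ∑' r, pfCoeff τ n r = -∑' r, pfCoeff τ n r := by
    rw [← tsum_neg]
    refine (((Equiv.neg ℤ).trans (Equiv.subRight (1 : ℤ))).tsum_eq _).symm.trans
      (tsum_congr fun r => ?_)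
    simp only [Equiv.trans_apply, Equiv.neg_apply, Equiv.subRight_apply]
    rw [pfCoeff, pfCoeff, show (n : ℤ) - (-r - 1) = n + r + 1 by ring,
      show (n : ℤ) + (-r - 1) + 1 = n - r by ring, ← e_add, ← e_add, ← neg_mul,
      mul_comm (recipPoch τ (n - r))]
    congr 1
    exact e_congr_neg (-r - 1) (by push_cast; ring)
  exact self_eq_neg.mp h

lemma tsum_pfCoeff_mul {τ : ℂ} (hτ : 0 < τ.im) {n : ℕ} (hn : 1 ≤ n) :
    ∑' r, pfCoeff τ n r * e (-r * τ) = 0 := by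
  have key : ∀ r : ℤ, pfCoeff τ n r * e (-r * τ) =
      tripleTerm τ 0 (n + 1) r - e ((n + 1) * τ) * tripleTerm τ (-τ) (n + 1) r := by
    intro r
    simp only [pfCoeff, tripleTerm]
    rw [recipPoch_rec' hτ (show ((n + 1 : ℕ) : ℤ) - r = n - r + 1 by push_cast; ring),
      show (n : ℤ) + r + 1 = (n + 1 : ℕ) + r by push_cast; ring]
    have c1 : e (r * (r + 1) / 2 * τ) * e (-r * τ) = e (r * (r - 1) / 2 * τ) := by
      rw [← e_add]; congr 1; ring
    have c2 : e (((((n + 1 : ℕ) : ℤ) - r : ℤ) : ℂ) * τ) = e ((n + 1) * τ) * e (r * -τ) := by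
      rw [← e_add]; congr 1; push_cast; ring
    rw [c2, ← c1]; simp only [mul_zero, e_zero]; ring
  have z1 : qPoch (e 0) (e τ) (n + 1) = 0 :=
    Finset.prod_eq_zero (Finset.mem_range.mpr (Nat.succ_pos n)) (by simp)
  have z2 : qPoch (e (-τ)) (e τ) (n + 1) = 0 :=
    Finset.prod_eq_zero (Finset.mem_range.mpr (show 1 < n + 1 by omega))
      (by rw [pow_one, ← e_add]; simp)
  rw [tsum_congr key, Summable.tsum_sub (summable_tripleTerm _ _ _)
    ((summable_tripleTerm _ _ _).mul_left _), tsum_mul_left, tsum_tripleTerm hτ, tsum_tripleTerm hτ,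
    z1, z2]
  ring

lemma qPoch_ne_zero_of_forall {a q : ℂ} (h : ∀ j : ℕ, 1 - a * q ^ j ≠ 0) (n : ℕ) :
    qPoch a q n ≠ 0 :=
  Finset.prod_ne_zero_iff.mpr fun j _ => h j

/-- Partial fractions of `1/((z;q)_{n+1} (q/z;q)_{n+1})`, where `z = e(u)`. -/
lemma tsum_partialFraction {τ : ℂ} (hτ : 0 < τ.im) {u : ℂ}
    (hu : ∀ r : ℤ, 1 - e (u + r * τ) ≠ 0) (n : ℕ) :
    ∑' r : ℤ, pfCoeff τ n r * (1 - e (u + r * τ))⁻¹ =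
      (qPoch (e u) (e τ) (n + 1) * qPoch (e (τ - u)) (e τ) (n + 1))⁻¹ := by
  have hu1 : ∀ j : ℕ, 1 - e u * e τ ^ j ≠ 0 := fun j => by
    rw [e_pow, ← e_add]; exact_mod_cast hu j
  have hu2 : ∀ j : ℕ, 1 - e (τ - u) * e τ ^ j ≠ 0 := fun j h => by
    rw [e_pow, ← e_add, sub_eq_zero] at h
    apply hu (-(j + 1))
    rw [show u + ((-(j + 1) : ℤ) : ℂ) * τ = -(τ - u + j * τ) by push_cast; ring, e_neg, ← h]; simp
  induction n with
  | zero =>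
    have hz : ∀ r ∉ ({0, -1} : Finset ℤ), pfCoeff τ 0 r * (1 - e (u + r * τ))⁻¹ = 0 := by
      intro r hr
      simp only [Finset.mem_insert, Finset.mem_singleton, not_or] at hr
      rw [pfCoeff]
      rcases lt_or_gt_of_ne hr.1 with h | h
      · rw [recipPoch_of_neg _ (show ((0 : ℕ) : ℤ) + r + 1 < 0 by omega)]; ring
      · rw [recipPoch_of_neg _ (show ((0 : ℕ) : ℤ) - r < 0 by omega)]; ring
    rw [tsum_eq_sum hz, Finset.sum_pair (by norm_num)]
    have h0 := hu 0
    have h1 := hu (-1)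
    have h2 := hu2 0
    have hq := one_sub_e_ne_zero hτ (x := 1) one_ne_zero
    simp only [pfCoeff, qPoch_succ, qPoch_zero, recipPoch_zero, Int.cast_zero, Int.cast_neg,
      Int.cast_one, Nat.cast_zero, zero_sub, zero_add, neg_neg, zero_mul, zero_div, e_zero,
      add_zero, pow_zero, mul_one, one_mul, neg_add_cancel, mul_zero, ofReal_one] at *
    have hr : recipPoch τ 1 = (1 - e τ)⁻¹ := by
      have := recipPoch_of_nat τ 1
      simpa [qPoch] using this
    have e1 : e (-1 / 2) = -1 := e_congr_neg (-1) (b := 0) (by push_cast; ring) |>.trans (by simp)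
    have e2 : e (u + -τ) = (e (τ - u))⁻¹ := by rw [← e_neg]; congr 1; ring
    have e3 : e τ = e u * e (τ - u) := by rw [← e_add]; congr 1; ring
    rw [neg_zero, recipPoch_zero, hr, e1]
    have e4 : u + -1 * τ = u + -τ := by ring
    rw [e4, e2] at h1
    rw [e4, e2]
    rw [e3] at hq
    rw [e3]
    have h4 := e_ne_zero (τ - u)
    have h5 : e (τ - u) - 1 ≠ 0 := by intro h; apply h2; linear_combination -h
    field_simp
    ring
  | succ n ih =>
    have key : ∀ r : ℤ, (1 - e (u + (n + 1) * τ)) * (1 - e ((n + 2) * τ - u)) *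
        (pfCoeff τ (n + 1) r * (1 - e (u + r * τ))⁻¹) = pfCoeff τ n r * (1 - e (u + r * τ))⁻¹
        + (e ((n + 1) * τ) * (pfCoeff τ (n + 1) r * e (-r * τ))
          - e ((n + 2) * τ - u) * pfCoeff τ (n + 1) r) := by
      intro r
      have hr := hu r
      have c : pfCoeff τ n r = (1 - e ((n + 1 - r) * τ)) * (1 - e ((n + 2 + r) * τ)) *
          pfCoeff τ (n + 1) r := by
        have r1 := recipPoch_rec' hτ (show ((n + 1 : ℕ) : ℤ) - r = n - r + 1 by push_cast; ring)
        have r2 := recipPoch_rec' hτ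
          (show ((n + 1 : ℕ) : ℤ) + r + 1 = n + r + 1 + 1 by push_cast; ring)
        rw [pfCoeff, pfCoeff, r1, r2]
        push_cast
        rw [show (n : ℂ) + 1 + r + 1 = n + 2 + r by ring]
        ring
      have d1 : e (u + (n + 1) * τ) = e (u + r * τ) * e (-r * τ) * e ((n + 1) * τ) := by
        simp only [← e_add]; congr 1; ring
      have d2 : e ((n + 1 - r) * τ) = e (-r * τ) * e ((n + 1) * τ) := by
        simp only [← e_add]; congr 1; ring
      have d3 : e ((n + 2 + r) * τ) = e (u + r * τ) * e ((n + 2) * τ - u) := by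
        simp only [← e_add]; congr 1; ring
      rw [c, d1, d2, d3]
      generalize e (u + r * τ) = X at hr ⊢
      generalize e (-r * τ) = Y
      generalize e ((n + 1) * τ) = A
      generalize e ((n + 2) * τ - u) = B
      field_simp
      ring
    have hsum : (1 - e (u + (n + 1) * τ)) * (1 - e ((n + 2) * τ - u)) *
        ∑' r : ℤ, pfCoeff τ (n + 1) r * (1 - e (u + r * τ))⁻¹ =
          ∑' r : ℤ, pfCoeff τ n r * (1 - e (u + r * τ))⁻¹ := by
      have s1 := summable_pfCoeff_mul τ (n + 1) (fun r => e (-r * τ))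
      have s2 : Summable (pfCoeff τ (n + 1)) := by
        simpa using summable_pfCoeff_mul τ (n + 1) (fun _ => 1)
      rw [← tsum_mul_left, tsum_congr key, Summable.tsum_add (summable_pfCoeff_mul _ _ _)
        ((s1.mul_left _).sub (s2.mul_left _)), Summable.tsum_sub (s1.mul_left _) (s2.mul_left _),
        tsum_mul_left, tsum_mul_left, tsum_pfCoeff_mul hτ (by omega), tsum_pfCoeff]
      ring
    have h1 := hu1 (n + 1)
    have h2 := hu2 (n + 1)
    rw [qPoch_succ (e u), qPoch_succ (e (τ - u))]
    rw [e_pow, ← e_add] at h1 h2 ⊢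
    rw [← e_add]
    push_cast at h1 h2 ⊢
    rw [show τ - u + (n + 1) * τ = (n + 2) * τ - u by ring] at h2 ⊢
    have h3 := qPoch_ne_zero_of_forall hu1 (n + 1)
    have h4 := qPoch_ne_zero_of_forall hu2 (n + 1)
    refine mul_left_cancel₀ (mul_ne_zero h1 h2) ((hsum.trans ih).trans ?_)
    generalize 1 - e (u + (n + 1) * τ) = A at h1 ⊢
    generalize 1 - e ((n + 2) * τ - u) = B at h2 ⊢
    field_simp

end EtaTheta

open Complex Filter Topology
namespace EtaTheta

/-! ### Infinite products and the Jacobi triple product -/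

/-- `(a;q)_∞`. -/
noncomputable def qPochInf (a q : ℂ) : ℂ := ∏' j : ℕ, (1 - a * q ^ j)

lemma summable_norm_mul_pow (a : ℂ) {q : ℂ} (hq : ‖q‖ < 1) :
    Summable fun j : ℕ => ‖-(a * q ^ j)‖ := by
  simp only [norm_neg, norm_mul, norm_pow]
  exact (summable_geometric_of_lt_one (norm_nonneg q) hq).mul_left _

lemma multipliable_qPoch (a : ℂ) {q : ℂ} (hq : ‖q‖ < 1) :
    Multipliable fun j : ℕ => 1 - a * q ^ j := by
  simpa [sub_eq_add_neg] using multipliable_one_add_of_summable (summable_norm_mul_pow a hq)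

lemma tendsto_qPoch (a : ℂ) {q : ℂ} (hq : ‖q‖ < 1) :
    Tendsto (qPoch a q) atTop (𝓝 (qPochInf a q)) :=
  (multipliable_qPoch a hq).hasProd.tendsto_prod_nat

lemma qPochInf_ne_zero {a q : ℂ} (hq : ‖q‖ < 1) (h : ∀ j : ℕ, 1 - a * q ^ j ≠ 0) :
    qPochInf a q ≠ 0 := by
  have := tprod_one_add_ne_zero_of_summable (f := fun j : ℕ => -(a * q ^ j))
    (fun j => by simpa [sub_eq_add_neg] using h j) (summable_norm_mul_pow a hq)
  simpa [qPochInf, sub_eq_add_neg] using this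

lemma qPochInf_self_ne_zero {τ : ℂ} (hτ : 0 < τ.im) : qPochInf (e τ) (e τ) ≠ 0 := by
  refine qPochInf_ne_zero (norm_e_lt_one hτ) fun j => ?_
  have := one_sub_e_ne_zero hτ (x := j + 1) (by positivity)
  rwa [e_pow, ← e_add, show τ + j * τ = ((j + 1 : ℝ) : ℂ) * τ by push_cast; ring]

lemma bounded_of_tendsto {f : ℕ → ℂ} {a : ℂ} (h : Tendsto f atTop (𝓝 a)) :
    ∃ C : ℝ, 0 ≤ C ∧ ∀ n, ‖f n‖ ≤ C := by
  obtain ⟨C, hC⟩ := h.norm.bddAbove_range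
  exact ⟨C, (norm_nonneg _).trans (hC ⟨0, rfl⟩), fun n => hC ⟨n, rfl⟩⟩

lemma tendsto_recipPoch {τ : ℂ} (hτ : 0 < τ.im) :
    Tendsto (recipPoch τ) atTop (𝓝 (qPochInf (e τ) (e τ))⁻¹) := by
  have h := (tendsto_qPoch (e τ) (norm_e_lt_one hτ)).inv₀ (qPochInf_self_ne_zero hτ)
  rw [← Nat.map_cast_int_atTop, tendsto_map'_iff]
  exact h.congr fun n => (recipPoch_of_nat τ n).symm

lemma recipPoch_bounded {τ : ℂ} (hτ : 0 < τ.im) :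
    ∃ C : ℝ, 0 ≤ C ∧ ∀ n, ‖recipPoch τ n‖ ≤ C := by
  obtain ⟨C, hC, h⟩ := bounded_of_tendsto
    ((tendsto_recipPoch hτ).comp tendsto_natCast_atTop_atTop)
  refine ⟨C, hC, fun n => ?_⟩
  rcases lt_or_ge n 0 with hn | hn
  · rw [recipPoch_of_neg _ hn]; simpa
  · obtain ⟨k, rfl⟩ := Int.eq_ofNat_of_zero_le hn
    exact h k

lemma summable_theta_term {τ : ℂ} (hτ : 0 < τ.im) (v : ℂ) :
    Summable fun r : ℤ => e (r * v) * e (r * (r - 1) / 2 * τ) := by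
  refine ((summable_jacobiTheta₂_term_iff (v - τ / 2) τ).mpr hτ).congr fun r => ?_
  rw [jacobiTheta₂_term, ← e_add, e]
  congr 1; ring

lemma summable_theta_term' {τ : ℂ} (hτ : 0 < τ.im) (v : ℂ) :
    Summable fun r : ℤ => e (r * v) * e (r * (r + 1) / 2 * τ) :=
  (summable_theta_term hτ (v + τ)).congr fun r => by
    rw [← e_add, ← e_add]; congr 1; ring

lemma norm_e_half_int (r : ℤ) : ‖e (r / 2)‖ = 1 := by
  have := norm_e_ofReal (r / 2); push_cast at this; exact this

lemma tendsto_add_natCast (r : ℤ) : Tendsto (fun N : ℕ => (N : ℤ) + r) atTop atTop :=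
  tendsto_atTop_add_const_right _ _ tendsto_natCast_atTop_atTop

/-- The Jacobi triple product. -/
lemma tripleProduct {τ : ℂ} (hτ : 0 < τ.im) (v : ℂ) :
    ∑' r : ℤ, e (r / 2) * e (r * v) * e (r * (r - 1) / 2 * τ) =
      qPochInf (e τ) (e τ) * qPochInf (e v) (e τ) * qPochInf (e (τ - v)) (e τ) := by
  have hq := norm_e_lt_one hτ
  obtain ⟨C, hC, hb⟩ := recipPoch_bounded hτ
  set P := qPochInf (e τ) (e τ) with hP
  have hP0 : P ≠ 0 := qPochInf_self_ne_zero hτ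
  have h1 : Tendsto (fun N : ℕ => ∑' r, tripleTerm τ v N r) atTop
      (𝓝 (∑' r : ℤ, e (r / 2) * e (r * v) * e (r * (r - 1) / 2 * τ) * (P⁻¹ * P⁻¹))) := by
    refine tendsto_tsum_of_dominated_convergence
      (bound := fun r : ℤ => ‖e (r * v) * e (r * (r - 1) / 2 * τ)‖ * (C * C))
      ((summable_theta_term hτ v).norm.mul_right _) (fun r => ?_) (Eventually.of_forall fun N r => ?_)
    · refine Tendsto.mul tendsto_const_nhds (Tendsto.mul ?_ ?_)
      · exact (tendsto_recipPoch hτ).comp (tendsto_add_natCast r)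
      · exact (tendsto_recipPoch hτ).comp (tendsto_add_natCast (-r))
    · rw [tripleTerm, norm_mul, norm_mul (recipPoch _ _), mul_assoc (e _), norm_mul (e (r / 2)),
        norm_e_half_int, one_mul]
      gcongr <;> exact hb _
  have h2 : Tendsto (fun N : ℕ => ∑' r, tripleTerm τ v N r) atTop
      (𝓝 (qPochInf (e v) (e τ) * qPochInf (e (τ - v)) (e τ) * P⁻¹)) := by
    simp only [tsum_tripleTerm hτ]
    refine ((tendsto_qPoch _ hq).mul (tendsto_qPoch _ hq)).mul
      ((tendsto_recipPoch hτ).comp ?_)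
    exact tendsto_natCast_atTop_atTop.const_mul_atTop' (by norm_num)
  have := tendsto_nhds_unique h1 h2
  rw [tsum_mul_right] at this
  generalize ∑' r : ℤ, e (r / 2) * e (r * v) * e (r * (r - 1) / 2 * τ) = S at this ⊢
  field_simp at this
  linear_combination this

lemma theta_product {τ : ℂ} (hτ : 0 < τ.im) (v : ℂ) :
    theta v τ = e (v / 2 + 1 / 4 + τ / 8) * (qPochInf (e τ) (e τ) * qPochInf (e (v + τ)) (e τ) *
      qPochInf (e (-v)) (e τ)) := by
  have := tripleProduct hτ (v + τ)
  rw [show τ - (v + τ) = -v by ring] at this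
  rw [← this, theta, ← tsum_mul_left]
  refine tsum_congr fun n => ?_
  simp only [← e_add]; congr 1; ring

/-- The zeros of the theta function are the lattice points. -/
lemma theta_eq_zero_iff {τ : ℂ} (hτ : 0 < τ.im) (v : ℂ) :
    theta v τ = 0 ↔ ∃ a b : ℤ, v = a * τ + b := by
  have hq := norm_e_lt_one hτ
  constructor
  · intro h
    rw [theta_product hτ] at h
    have h' := (mul_eq_zero.mp h).resolve_left (e_ne_zero _)
    rcases mul_eq_zero.mp h' with h' | h'
    · have h2 := (mul_eq_zero.mp h').resolve_left (qPochInf_self_ne_zero hτ)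
      by_contra! hc
      refine qPochInf_ne_zero hq (fun j hj => ?_) h2
      rw [e_pow, ← e_add, sub_eq_zero, eq_comm, e_eq_one_iff] at hj
      obtain ⟨n, hn⟩ := hj
      apply hc (-(j + 1)) n
      push_cast; linear_combination hn
    · by_contra! hc
      refine qPochInf_ne_zero hq (fun j hj => ?_) h'
      rw [e_pow, ← e_add, sub_eq_zero, eq_comm, e_eq_one_iff] at hj
      obtain ⟨n, hn⟩ := hj
      apply hc j (-n)
      push_cast; linear_combination -hn
  · rintro ⟨a, b, rfl⟩
    have hb : ∀ (b : ℤ) (v : ℂ), theta (v + b) τ = 0 ↔ theta v τ = 0 := by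
      intro b v
      induction b using Int.induction_on with
      | zero => simp
      | succ i ih => push_cast at *; rw [← add_assoc, theta_add_one, neg_eq_zero, ih]
      | pred i ih =>
        rw [← ih, ← neg_eq_zero, ← theta_add_one]; push_cast; ring_nf
    have ha : ∀ (a : ℤ) (v : ℂ), theta (v + a * τ) τ = 0 ↔ theta v τ = 0 := by
      intro a v
      induction a using Int.induction_on with
      | zero => simp
      | succ i ih =>
        push_cast at *
        rw [show v + (i + 1) * τ = v + i * τ + τ by ring, theta_add_tau, mul_eq_zero, ih]
        simp [e_ne_zero]
      | pred i ih =>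
        rw [← ih]
        push_cast
        rw [show v + -(i : ℂ) * τ = v + (-i - 1) * τ + τ by ring, theta_add_tau, mul_eq_zero]
        simp [e_ne_zero]
    rw [hb]
    simpa [theta_zero] using (ha a 0).mpr

/-- `1 - e(u) q^n` is bounded away from zero, uniformly in `n` and locally uniformly in `u`. -/
lemma exists_lower_bound_on {τ u₀ : ℂ} (hτ : 0 < τ.im) (s : Set ℤ)
    (hu : ∀ n ∈ s, 1 - e (u₀ + n * τ) ≠ 0) :
    ∃ c > 0, ∀ᶠ u in 𝓝 u₀, ∀ n ∈ s, c ≤ ‖1 - e (u + n * τ)‖ := by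
  classical
  obtain ⟨N, hN⟩ := exists_nat_gt ((|u₀.im| + 2) / τ.im)
  have hN' : |u₀.im| + 2 < N * τ.im := by rwa [div_lt_iff₀ hτ] at hN
  have hfin : ∀ n ∈ Finset.Icc (-N : ℤ) N, ∀ᶠ u in 𝓝 u₀,
      n ∈ s → ‖1 - e (u₀ + n * τ)‖ / 2 ≤ ‖1 - e (u + n * τ)‖ := by
    intro n _
    by_cases hns : n ∈ s
    swap
    · exact Eventually.of_forall fun _ h => absurd h hns
    have hc : ContinuousAt (fun u => ‖1 - e (u + n * τ)‖) u₀ := by fun_prop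
    have hpos : ‖1 - e (u₀ + n * τ)‖ / 2 < ‖1 - e (u₀ + n * τ)‖ :=
      half_lt_self (norm_pos_iff.mpr (hu n hns))
    exact (hc.eventually (lt_mem_nhds hpos)).mono fun u h _ => h.le
  rw [← Finset.eventually_all] at hfin
  have him : ∀ᶠ u in 𝓝 u₀, |u.im - u₀.im| < 1 := by
    have hc : ContinuousAt (fun u : ℂ => |u.im - u₀.im|) u₀ := by fun_prop
    exact hc.eventually (gt_mem_nhds (by simp))
  have hne : (Finset.Icc (-N : ℤ) N).Nonempty := ⟨0, by simp⟩
  set m := (Finset.Icc (-N : ℤ) N).inf' hne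
    (fun n => if n ∈ s then ‖1 - e (u₀ + n * τ)‖ / 2 else 1)
  have hm : 0 < m := by
    rw [Finset.lt_inf'_iff]
    intro n _
    split_ifs with hns
    · have := norm_pos_iff.mpr (hu n hns); positivity
    · exact one_pos
  refine ⟨min m (1 / 2), by positivity, ?_⟩
  filter_upwards [hfin, him] with u h1 h2 n hns
  by_cases hn : n ∈ Finset.Icc (-N : ℤ) N
  · refine (min_le_left _ _).trans ((Finset.inf'_le _ hn).trans ?_)
    rw [if_pos hns]
    exact h1 n hn hns
  · refine (min_le_right _ _).trans ?_
    rw [Finset.mem_Icc, not_and_or, not_le, not_le] at hn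
    have hlog : (1 / 2 : ℝ) ≥ Real.exp (-1) := by
      rw [Real.exp_neg]
      have := Real.add_one_le_exp 1
      rw [ge_iff_le, inv_le_comm₀ (Real.exp_pos _) (by norm_num)]; linarith
    have hi : (u + n * τ).im = u.im + n * τ.im := by simp
    have h3 := abs_lt.mp h2
    have h4 := neg_abs_le u₀.im
    have h5 := le_abs_self u₀.im
    have hpi := Real.pi_gt_three
    rcases hn with hn | hn
    · have hn' : (n : ℝ) * τ.im ≤ -N * τ.im := by
        gcongr; exact_mod_cast hn.le
      have : 2 ≤ ‖e (u + n * τ)‖ := by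
        rw [norm_e, hi]
        have : (1 : ℝ) ≤ -2 * Real.pi * (u.im + n * τ.im) := by nlinarith
        have := Real.add_one_le_exp (-2 * Real.pi * (u.im + n * τ.im))
        linarith
      have h6 := norm_sub_norm_le (e (u + n * τ)) 1
      rw [norm_one, norm_sub_rev] at h6
      linarith
    · have hn' : (N : ℝ) * τ.im ≤ n * τ.im := by
        gcongr; exact_mod_cast hn.le
      have : ‖e (u + n * τ)‖ ≤ 1 / 2 := by
        rw [norm_e, hi]
        refine le_trans (Real.exp_le_exp.mpr ?_) hlog
        nlinarith
      have h6 := norm_sub_norm_le 1 (e (u + n * τ))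
      rw [norm_one] at h6
      linarith

lemma exists_lower_bound {τ u₀ : ℂ} (hτ : 0 < τ.im) (hu : ∀ n : ℤ, 1 - e (u₀ + n * τ) ≠ 0) :
    ∃ c > 0, ∀ᶠ u in 𝓝 u₀, ∀ n : ℤ, c ≤ ‖1 - e (u + n * τ)‖ := by
  simpa using exists_lower_bound_on hτ Set.univ fun n _ => hu n

lemma exists_inv_bound {τ u : ℂ} (hτ : 0 < τ.im) (hu : ∀ n : ℤ, 1 - e (u + n * τ) ≠ 0) :
    ∃ C : ℝ, 0 ≤ C ∧ ∀ n : ℤ, ‖(1 - e (u + n * τ))⁻¹‖ ≤ C := by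
  obtain ⟨c, hc, h⟩ := exists_lower_bound hτ hu
  refine ⟨c⁻¹, by positivity, fun n => ?_⟩
  rw [norm_inv]
  exact inv_anti₀ hc (h.self_of_nhds n)

lemma factor_ne_zero_of {τ u : ℂ} (hu : ∀ n : ℤ, 1 - e (u + n * τ) ≠ 0) (j : ℕ) :
    1 - e u * e τ ^ j ≠ 0 ∧ 1 - e (τ - u) * e τ ^ j ≠ 0 := by
  constructor
  · rw [e_pow, ← e_add]; exact_mod_cast hu j
  · intro h
    rw [e_pow, ← e_add, sub_eq_zero] at h
    apply hu (-(j + 1))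
    rw [show u + ((-(j + 1) : ℤ) : ℂ) * τ = -(τ - u + j * τ) by push_cast; ring, e_neg, ← h]; simp

/-- Partial fractions of the reciprocal of the theta function. -/
lemma tsum_inv_theta {τ u : ℂ} (hτ : 0 < τ.im) (hu : ∀ n : ℤ, 1 - e (u + n * τ) ≠ 0) :
    ∑' r : ℤ, e (r / 2) * e (r * (r + 1) / 2 * τ) * (1 - e (u + r * τ))⁻¹ =
      qPochInf (e τ) (e τ) ^ 2 * (qPochInf (e u) (e τ) * qPochInf (e (τ - u)) (e τ))⁻¹ := by
  have hq := norm_e_lt_one hτ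
  obtain ⟨C, hC, hb⟩ := recipPoch_bounded hτ
  obtain ⟨D, hD, hd⟩ := exists_inv_bound hτ hu
  set P := qPochInf (e τ) (e τ) with hP
  have hP0 : P ≠ 0 := qPochInf_self_ne_zero hτ
  have h1 : Tendsto (fun n : ℕ => ∑' r : ℤ, pfCoeff τ n r * (1 - e (u + r * τ))⁻¹) atTop
      (𝓝 (∑' r : ℤ, e (r / 2) * e (r * (r + 1) / 2 * τ) * (P⁻¹ * P⁻¹) *
        (1 - e (u + r * τ))⁻¹)) := by
    refine tendsto_tsum_of_dominated_convergence
      (bound := fun r : ℤ => ‖e (r * 0) * e (r * (r + 1) / 2 * τ)‖ * (C * C) * D)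
      (((summable_theta_term' hτ 0).norm.mul_right _).mul_right _)
      (fun r => ?_) (Eventually.of_forall fun N r => ?_)
    · refine Tendsto.mul (Tendsto.mul tendsto_const_nhds (Tendsto.mul ?_ ?_)) tendsto_const_nhds
      · exact (tendsto_recipPoch hτ).comp (tendsto_add_natCast (-r))
      · simp only [add_assoc]
        exact (tendsto_recipPoch hτ).comp (tendsto_add_natCast (r + 1))
    · rw [norm_mul, pfCoeff, norm_mul, norm_mul (recipPoch _ _), norm_mul (e (r / 2)),
        norm_e_half_int, mul_zero, e_zero, one_mul, one_mul]
      gcongr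
      · exact hb _
      · exact hb _
      · exact hd r
  have h2 : Tendsto (fun n : ℕ => ∑' r : ℤ, pfCoeff τ n r * (1 - e (u + r * τ))⁻¹) atTop
      (𝓝 (qPochInf (e u) (e τ) * qPochInf (e (τ - u)) (e τ))⁻¹) := by
    simp only [tsum_partialFraction hτ hu]
    refine Tendsto.inv₀ ?_ (mul_ne_zero
      (qPochInf_ne_zero hq fun j => (factor_ne_zero_of hu j).1)
      (qPochInf_ne_zero hq fun j => (factor_ne_zero_of hu j).2))
    exact (((tendsto_qPoch _ hq).mul (tendsto_qPoch _ hq)).comp (tendsto_add_atTop_nat 1))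
  rw [← tendsto_nhds_unique h1 h2, ← tsum_mul_left]
  refine tsum_congr fun r => ?_
  field_simp

end EtaTheta

open Complex Filter Topology
namespace EtaTheta

/-! ### The universal mock theta function as an Appell sum -/

/-- The `n`-th summand of `∑_n (-q)_n q^{n(n+1)/2} / ((q)_{n-r} (q)_{n+r+1})`. -/
noncomputable def conjBaileyTerm (τ : ℂ) (r : ℤ) (n : ℕ) : ℂ :=
  qPoch (-e τ) (e τ) n * e (n * (n + 1) / 2 * τ) *
    (recipPoch τ (n - r) * recipPoch τ (n + r + 1))

lemma summable_nat_theta {τ : ℂ} (hτ : 0 < τ.im) :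
    Summable fun n : ℕ => ‖e (n * (n + 1) / 2 * τ)‖ := by
  have := ((summable_theta_term' hτ 0).norm).comp_injective Nat.cast_injective
  refine this.congr fun n => ?_
  simp

lemma qPoch_neg_bounded {τ : ℂ} (hτ : 0 < τ.im) :
    ∃ C : ℝ, 0 ≤ C ∧ ∀ n, ‖qPoch (-e τ) (e τ) n‖ ≤ C :=
  bounded_of_tendsto (tendsto_qPoch _ (norm_e_lt_one hτ))

lemma summable_conjBaileyTerm {τ : ℂ} (hτ : 0 < τ.im) (r : ℤ) :
    Summable (conjBaileyTerm τ r) := by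
  obtain ⟨C, hC, hb⟩ := recipPoch_bounded hτ
  obtain ⟨D, hD, hd⟩ := qPoch_neg_bounded hτ
  refine Summable.of_norm_bounded (((summable_nat_theta hτ).mul_left D).mul_right (C * C))
    fun n => ?_
  rw [conjBaileyTerm, norm_mul, norm_mul, norm_mul]
  gcongr
  · exact hd n
  · exact hb _
  · exact hb _

lemma tendsto_zero_of_summable_mul {f g : ℕ → ℂ} {C : ℝ} (hf : Summable fun n => ‖f n‖)
    (hg : ∀ n, ‖g n‖ ≤ C * ‖f n‖) : Tendsto g atTop (𝓝 0) :=
  squeeze_zero_norm hg (by simpa using hf.tendsto_atTop_zero.const_mul C)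

lemma conjBailey_rec {τ : ℂ} (hτ : 0 < τ.im) (r : ℤ) :
    ∑' n, conjBaileyTerm τ (r + 1) n = e ((r + 1) * τ) * ∑' n, conjBaileyTerm τ r n := by
  obtain ⟨C, hC, hb⟩ := recipPoch_bounded hτ
  obtain ⟨D, hD, hd⟩ := qPoch_neg_bounded hτ
  set G : ℕ → ℂ := fun n => -(1 - e ((r + 1) * τ)) * (qPoch (-e τ) (e τ) n *
    e (n * (n + 1) / 2 * τ) * (recipPoch τ (n - 1 - r) * recipPoch τ (n + r + 1))) with hG
  have hstep : ∀ n, conjBaileyTerm τ (r + 1) n - e ((r + 1) * τ) * conjBaileyTerm τ r n =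
      G (n + 1) - G n := by
    intro n
    have r1 := recipPoch_rec' hτ (show (n : ℤ) - r = n - 1 - r + 1 by ring)
    have r2 := recipPoch_rec' hτ (show (n : ℤ) + r + 2 = n + r + 1 + 1 by ring)
    simp only [hG, conjBaileyTerm, qPoch_succ]
    rw [show (n : ℤ) - (r + 1) = n - 1 - r by ring, show (n : ℤ) + (r + 1) + 1 = n + r + 2 by ring,
      show ((n + 1 : ℕ) : ℤ) - 1 - r = n - r by push_cast; ring,
      show ((n + 1 : ℕ) : ℤ) + r + 1 = n + r + 2 by push_cast; ring, r1, r2, e_pow]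
    have a1 : e (((n + 1 : ℕ) : ℂ) * ((n + 1 : ℕ) + 1) / 2 * τ) =
        e (n * (n + 1) / 2 * τ) * (e (n * τ) * e τ) := by
      simp only [← e_add]; congr 1; push_cast; ring
    have a2 : e ((((n : ℤ) + r + 2 : ℤ) : ℂ) * τ) = e (n * τ) * e ((r + 1) * τ) * e τ := by
      simp only [← e_add]; congr 1; push_cast; ring
    have a3 : e (n * τ) = e ((((n : ℤ) - r : ℤ) : ℂ) * τ) * e (r * τ) := by
      simp only [← e_add]; congr 1; push_cast; ring
    have a4 : e ((r + 1) * τ) = e (r * τ) * e τ := by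
      simp only [← e_add]; congr 1; ring
    rw [a1, a2, a3, a4]
    generalize e ((((n : ℤ) - r : ℤ) : ℂ) * τ) = X
    generalize e (r * τ) = Y
    ring
  have hs1 := summable_conjBaileyTerm hτ (r + 1)
  have hs2 := (summable_conjBaileyTerm hτ r).mul_left (e ((r + 1) * τ))
  have h1 := (hs1.sub hs2).hasSum.tendsto_sum_nat
  simp only [hstep, Finset.sum_range_sub] at h1
  have hG0 : G 0 = 0 := by
    simp only [hG]
    rcases lt_trichotomy r (-1) with h | rfl | h
    · rw [recipPoch_of_neg _ (show ((0 : ℕ) : ℤ) + r + 1 < 0 by omega)]; ring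
    · push_cast; simp
    · rw [recipPoch_of_neg _ (show ((0 : ℕ) : ℤ) - 1 - r < 0 by omega)]; ring
  have hGlim : Tendsto G atTop (𝓝 0) := by
    refine tendsto_zero_of_summable_mul (C := ‖1 - e ((r + 1) * τ)‖ * (D * (C * C)))
      (summable_nat_theta hτ) fun n => ?_
    simp only [hG]
    rw [norm_mul, norm_mul, norm_mul, norm_mul, norm_neg]
    have := hd n
    have := hb (n - 1 - r)
    have := hb (n + r + 1)
    calc _ ≤ ‖1 - e ((r + 1) * τ)‖ * (D * ‖e (n * (n + 1) / 2 * τ)‖ * (C * C)) := by gcongr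
      _ = _ := by ring
  rw [hG0] at h1
  have h2 := tendsto_nhds_unique h1 (hGlim.sub tendsto_const_nhds)
  simp only [← hstep] at h2
  rw [Summable.tsum_sub hs1 hs2, tsum_mul_left] at h2
  linear_combination h2

lemma conjBailey_eq_mul_zero {τ : ℂ} (hτ : 0 < τ.im) (r : ℤ) :
    ∑' n, conjBaileyTerm τ r n = e (r * (r + 1) / 2 * τ) * ∑' n, conjBaileyTerm τ 0 n := by
  induction r using Int.induction_on with
  | zero => simp
  | succ i ih =>
    rw [conjBailey_rec hτ, ih, ← mul_assoc, ← e_add]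
    congr 2; push_cast; ring
  | pred i ih =>
    have h := conjBailey_rec hτ (-(i : ℤ) - 1)
    rw [sub_add_cancel, ih] at h
    have h2 := e_ne_zero ((((-(i : ℤ) - 1 : ℤ) : ℂ) + 1) * τ)
    refine mul_left_cancel₀ h2 (h.symm.trans ?_)
    rw [← mul_assoc, ← e_add]
    congr 2; push_cast; ring

lemma tendsto_e_nat_mul {τ : ℂ} (hτ : 0 < τ.im) :
    Tendsto (fun r : ℕ => e (r * τ)) atTop (𝓝 0) := by
  simpa [e_pow] using tendsto_pow_atTop_nhds_zero_of_norm_lt_one (norm_e_lt_one hτ)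

lemma norm_e_mul_le_one {τ : ℂ} (hτ : 0 < τ.im) {x : ℝ} (hx : 0 ≤ x) : ‖e (x * τ)‖ ≤ 1 := by
  rw [norm_e, Real.exp_le_one_iff]
  simp only [mul_im, ofReal_re, ofReal_im, zero_mul, add_zero]
  have : 0 ≤ Real.pi * (x * τ.im) := by have := Real.pi_pos; positivity
  linarith

lemma conjBailey_zero {τ : ℂ} (hτ : 0 < τ.im) :
    ∑' n, conjBaileyTerm τ 0 n = qPochInf (-e τ) (e τ) * (qPochInf (e τ) (e τ))⁻¹ := by
  obtain ⟨C, hC, hb⟩ := recipPoch_bounded hτ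
  obtain ⟨D, hD, hd⟩ := qPoch_neg_bounded hτ
  set A : ℕ → ℕ → ℂ := fun r k => qPoch (-e τ) (e τ) (k + r) * (e (k * (k + 1) / 2 * τ) *
    e (r * (k * τ))) * (recipPoch τ k * recipPoch τ (2 * r + (k + 1))) with hA
  have h1 : ∀ r : ℕ, ∑' k, A r k = ∑' n, conjBaileyTerm τ 0 n := by
    intro r
    have h := conjBailey_eq_mul_zero hτ r
    have hz : ∑ n ∈ Finset.range r, conjBaileyTerm τ r n = 0 := by
      refine Finset.sum_eq_zero fun n hn => ?_
      rw [conjBaileyTerm, recipPoch_of_neg _ (show (n : ℤ) - r < 0 by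
        have := Finset.mem_range.mp hn; omega)]
      ring
    rw [← (summable_conjBaileyTerm hτ r).sum_add_tsum_nat_add r, hz, zero_add] at h
    refine mul_left_cancel₀ (e_ne_zero (((r : ℤ) : ℂ) * (((r : ℤ) : ℂ) + 1) / 2 * τ)) ?_
    rw [← h, ← tsum_mul_left]
    refine tsum_congr fun k => ?_
    simp only [hA, conjBaileyTerm]
    rw [show ((k + r : ℕ) : ℤ) - r = k by push_cast; ring,
      show ((k + r : ℕ) : ℤ) + r + 1 = 2 * r + (k + 1) by push_cast; ring]
    have : e (((k + r : ℕ) : ℂ) * (((k + r : ℕ) : ℂ) + 1) / 2 * τ) =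
        e (((r : ℤ) : ℂ) * (((r : ℤ) : ℂ) + 1) / 2 * τ) * (e (k * (k + 1) / 2 * τ) *
          e (r * (k * τ))) := by
      simp only [← e_add]; congr 1; push_cast; ring
    rw [this]; ring
  have h2 : Tendsto (fun r : ℕ => ∑' k, A r k) atTop (𝓝 (∑' k : ℕ, if k = 0 then
      qPochInf (-e τ) (e τ) * (qPochInf (e τ) (e τ))⁻¹ else 0)) := by
    refine tendsto_tsum_of_dominated_convergence
      (bound := fun k : ℕ => D * ‖e (k * (k + 1) / 2 * τ)‖ * (C * C))
      (((summable_nat_theta hτ).mul_left D).mul_right (C * C)) (fun k => ?_)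
      (Eventually.of_forall fun r k => ?_)
    · have t1 : Tendsto (fun r : ℕ => qPoch (-e τ) (e τ) (k + r)) atTop
          (𝓝 (qPochInf (-e τ) (e τ))) :=
        (tendsto_qPoch _ (norm_e_lt_one hτ)).comp
          (tendsto_atTop_mono (fun r => Nat.le_add_left r k) tendsto_id)
      have t2 : Tendsto (fun r : ℕ => recipPoch τ (2 * r + (k + 1))) atTop
          (𝓝 (qPochInf (e τ) (e τ))⁻¹) :=
        (tendsto_recipPoch hτ).comp (tendsto_atTop_add_const_right _ _
          (tendsto_natCast_atTop_atTop.const_mul_atTop' (by norm_num)))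
      rcases Nat.eq_zero_or_pos k with rfl | hk
      · simp only [hA, if_true]
        have := t1.mul t2
        simpa [recipPoch_zero] using this
      · rw [if_neg hk.ne']
        have t3 : Tendsto (fun r : ℕ => e (r * (k * τ))) atTop (𝓝 0) := by
          refine tendsto_e_nat_mul ?_
          have : (0 : ℝ) < k := by exact_mod_cast hk
          simpa using mul_pos this hτ
        have := (t1.mul (t3.const_mul (e (k * (k + 1) / 2 * τ)))).mul
          (t2.const_mul (recipPoch τ k))
        simpa using this
    · simp only [hA]
      rw [norm_mul, norm_mul, norm_mul, norm_mul]
      have h3 : ‖e (r * (k * τ))‖ ≤ 1 := by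
        have := norm_e_mul_le_one hτ (x := r * k) (by positivity)
        push_cast at this; rwa [mul_assoc] at this
      have := hd (k + r)
      have := hb k
      have := hb (2 * r + (k + 1))
      calc _ ≤ D * (‖e (k * (k + 1) / 2 * τ)‖ * 1) * (C * C) := by gcongr
        _ = _ := by ring
  simp only [h1, tsum_ite_eq] at h2
  exact tendsto_nhds_unique tendsto_const_nhds h2

lemma e_pow_triangle (τ : ℂ) (n : ℕ) : e τ ^ (n * (n + 1) / 2) = e (n * (n + 1) / 2 * τ) := by
  rw [e_pow]
  obtain ⟨k, hk⟩ := Nat.even_mul_succ_self n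
  have : (n : ℂ) * (n + 1) = k + k := by exact_mod_cast hk
  rw [this, hk, ← two_mul, Nat.mul_div_cancel_left _ two_pos]
  congr 1; ring

/-- The universal mock theta function `g₂` as an Appell sum. -/
lemma g2_eq_appell {τ u : ℂ} (hτ : 0 < τ.im) (hu : ∀ n : ℤ, 1 - e (u + n * τ) ≠ 0) :
    g2 (e u) (e τ) = qPochInf (-e τ) (e τ) * (qPochInf (e τ) (e τ))⁻¹ *
      ∑' r : ℤ, e (r / 2) * e (r * (r + 1) * τ) * (1 - e (u + r * τ))⁻¹ := by
  obtain ⟨C, hC, hb⟩ := recipPoch_bounded hτ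
  obtain ⟨D, hD, hd⟩ := qPoch_neg_bounded hτ
  obtain ⟨F, hF, hf⟩ := exists_inv_bound hτ hu
  set T : ℕ → ℤ → ℂ := fun n r => qPoch (-e τ) (e τ) n * e (n * (n + 1) / 2 * τ) *
    (pfCoeff τ n r * (1 - e (u + r * τ))⁻¹) with hT
  have h1 : ∀ n, g2Term (e u) (e τ) n = ∑' r, T n r := by
    intro n
    simp only [hT]
    rw [tsum_mul_left, tsum_partialFraction hτ hu, g2Term, e_pow_triangle, ← e_neg, ← e_add,
      div_eq_mul_inv, show -u + τ = τ - u by ring]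
  have hsum : Summable (Function.uncurry T) := by
    have hB := ((summable_theta_term' hτ 0).norm.mul_right (C * C)).mul_right F
    have hA := (summable_nat_theta hτ).mul_left D
    refine Summable.of_norm_bounded (Summable.mul_of_nonneg hA hB (fun n => by positivity)
      (fun n => by positivity)) ?_
    rintro ⟨n, r⟩
    simp only [Function.uncurry, hT, pfCoeff]
    simp only [norm_mul, norm_e_half_int, mul_zero, e_zero, one_mul]
    gcongr
    · exact hd n
    · exact hb _
    · exact hb _
    · exact hf r
  rw [g2, tsum_congr h1, ← hsum.tsum_comm, ← tsum_mul_left]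
  refine tsum_congr fun r => ?_
  have h2 : ∀ n, T n r = e (r / 2) * e (r * (r + 1) / 2 * τ) * (1 - e (u + r * τ))⁻¹ *
      conjBaileyTerm τ r n := by
    intro n; simp only [hT, pfCoeff, conjBaileyTerm]; ring
  rw [tsum_congr h2, tsum_mul_left, conjBailey_eq_mul_zero hτ, conjBailey_zero hτ]
  have h3 : e (r * (r + 1) * τ) = e (r * (r + 1) / 2 * τ) * e (r * (r + 1) / 2 * τ) := by
    rw [← e_add]; congr 1; ring
  rw [h3]; ring

end EtaTheta

open Complex Filter Topology
namespace EtaTheta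

/-! ### `μ(u, τ/2; τ)` in terms of the universal mock theta function -/

lemma hasProd_qPoch (a : ℂ) {q : ℂ} (hq : ‖q‖ < 1) :
    HasProd (fun j : ℕ => 1 - a * q ^ j) (qPochInf a q) := (multipliable_qPoch a hq).hasProd

lemma qPochInf_succ (a : ℂ) {q : ℂ} (hq : ‖q‖ < 1) :
    qPochInf a q = (1 - a) * qPochInf (a * q) q := by
  have h1 := (tendsto_qPoch a hq).comp (tendsto_add_atTop_nat 1)
  have h2 := (tendsto_qPoch (a * q) hq).const_mul (1 - a)
  refine tendsto_nhds_unique h1 (h2.congr fun n => ?_)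
  simp only [Function.comp, qPoch]
  rw [Finset.prod_range_succ', mul_comm, pow_zero, mul_one]
  congr 1
  refine Finset.prod_congr rfl fun j _ => ?_
  rw [pow_succ]; ring

lemma qPochInf_sq (a : ℂ) {Q : ℂ} (hQ : ‖Q‖ < 1) :
    qPochInf a Q = qPochInf a (Q ^ 2) * qPochInf (a * Q) (Q ^ 2) := by
  have hq : ‖Q ^ 2‖ < 1 := by
    rw [norm_pow]; exact pow_lt_one₀ (norm_nonneg _) hQ two_ne_zero
  rw [qPochInf, ← tprod_even_mul_odd]
  · simp only [qPochInf, pow_mul, pow_succ, pow_zero, one_mul]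
    congr 1
    refine tprod_congr fun j => ?_
    ring
  · simpa only [pow_mul] using multipliable_qPoch a hq
  · refine (multipliable_qPoch (a * Q) hq).congr fun j => ?_
    rw [← pow_mul, pow_succ]; ring

lemma qPochInf_mul_neg (a : ℂ) {Q : ℂ} (hQ : ‖Q‖ < 1) :
    qPochInf a Q * qPochInf (-a) Q = qPochInf (a ^ 2) (Q ^ 2) := by
  have hq : ‖Q ^ 2‖ < 1 := by
    rw [norm_pow]; exact pow_lt_one₀ (norm_nonneg _) hQ two_ne_zero
  refine ((hasProd_qPoch a hQ).mul (hasProd_qPoch (-a) hQ)).unique ?_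
  refine (hasProd_qPoch (a ^ 2) hq).congr_fun fun j => ?_
  ring

lemma summable_appell {τ u : ℂ} (hτ : 0 < τ.im) (hu : ∀ n : ℤ, 1 - e (u + n * τ) ≠ 0) (v : ℂ) :
    Summable fun r : ℤ => e (r / 2) * e (r * v) * e (r * (r + 1) / 2 * τ) *
      (1 - e (u + r * τ))⁻¹ := by
  obtain ⟨F, hF, hf⟩ := exists_inv_bound hτ hu
  refine Summable.of_norm_bounded ((summable_theta_term' hτ v).norm.mul_right F) fun r => ?_
  rw [norm_mul, mul_assoc (e (r / 2)), norm_mul (e (r / 2)), norm_e_half_int, one_mul]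
  gcongr
  exact hf r

/-- The Appell sum in the definition of `μ`. -/
noncomputable def appell (u v τ : ℂ) : ℂ :=
  ∑' r : ℤ, e (r / 2) * e (r * v) * e (r * (r + 1) / 2 * τ) * (1 - e (u + r * τ))⁻¹

lemma mu_eq (u v τ : ℂ) : mu u v τ = e (u / 2) / theta v τ * appell u v τ := by
  rw [mu, appell]
  congr 1
  refine tsum_congr fun n => ?_
  rw [neg_one_zpow_eq, div_eq_mul_inv, ← e_add u]

lemma half_ne_zero {τ u : ℂ} (hu : ∀ n : ℤ, 1 - e (u + n * τ) ≠ 0) (n : ℤ) :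
    1 - e (u / 2 + n * (τ / 2)) ≠ 0 := by
  intro h
  apply hu n
  rw [show u + n * τ = (u / 2 + n * (τ / 2)) + (u / 2 + n * (τ / 2)) by ring, e_add,
    ← sub_eq_zero.mp h]
  ring

lemma theta_half {τ : ℂ} (hτ : 0 < τ.im) :
    theta (τ / 2) τ * (I * e (τ / 8)) * qPochInf (-e (τ / 2)) (e (τ / 2)) =
      qPochInf (e (τ / 2)) (e (τ / 2)) := by
  have hτ2 : 0 < (τ / 2).im := by simpa using hτ
  have hQ := norm_e_lt_one hτ2
  have hq2 : e (τ / 2) ^ 2 = e τ := by rw [e_pow]; congr 1; push_cast; ring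
  have hq : ‖e τ‖ < 1 := norm_e_lt_one hτ
  have h1 := qPochInf_sq (e (τ / 2)) hQ
  have h2 := qPochInf_mul_neg (e (τ / 2)) hQ
  have h3 := qPochInf_succ (e (τ / 2)) hq
  have h4 := qPochInf_succ (e (-(τ / 2))) hq
  rw [← pow_two, hq2] at h1
  rw [hq2] at h2
  rw [← e_add, show -(τ / 2) + τ = τ / 2 by ring] at h4
  rw [← e_add] at h3
  have h5 : qPochInf (e τ) (e τ) ≠ 0 := qPochInf_self_ne_zero hτ
  rw [theta_product hτ, h4]
  rw [h1] at h2 ⊢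
  have hI : I = e (1 / 4) := by
    rw [e, show 2 * (Real.pi : ℂ) * I * (1 / 4) = (Real.pi / 2 * I) by ring,
      Complex.exp_pi_div_two_mul_I]
  have h6 : e (τ / 2 / 2 + 1 / 4 + τ / 8) * (I * e (τ / 8)) * (1 - e (-(τ / 2))) =
      1 - e (τ / 2) := by
    have a : e (-(τ / 2)) = (e (τ / 2))⁻¹ := e_neg _
    have b : e (τ / 2 / 2 + 1 / 4 + τ / 8) * (I * e (τ / 8)) = -e (τ / 2) := by
      rw [hI, ← e_add, ← e_add]; exact e_congr_neg 0 (by push_cast; ring)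
    rw [b, a]
    have := e_ne_zero (τ / 2)
    field_simp
    ring
  have h7 : qPochInf (e (τ / 2)) (e τ) * qPochInf (-e (τ / 2)) (e (τ / 2)) = 1 := by
    refine mul_right_cancel₀ h5 ?_
    rw [one_mul]; linear_combination h2
  calc _ = (e (τ / 2 / 2 + 1 / 4 + τ / 8) * (I * e (τ / 8)) * (1 - e (-(τ / 2)))) *
        qPochInf (e (τ / 2 + τ)) (e τ) * qPochInf (e τ) (e τ) *
        (qPochInf (e (τ / 2)) (e τ) * qPochInf (-e (τ / 2)) (e (τ / 2))) := by ring
    _ = _ := by rw [h6, ← h3, h7]; ring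

lemma hasProd_etaQuotient {τ u : ℂ} (hτ : 0 < τ.im) (hu : ∀ n : ℤ, 1 - e (u + n * τ) ≠ 0) :
    HasProd (fun j : ℕ => (1 - e τ ^ (j + 1)) * (1 + e (τ / 2) ^ (j + 1)) ^ 2 / jacobiFactor u τ j)
      (qPochInf (e τ) (e τ) * qPochInf (-e (τ / 2)) (e (τ / 2)) ^ 2 /
        (qPochInf (e u) (e τ) * qPochInf (e (τ - u)) (e τ))) := by
  have hQ : ‖e (τ / 2)‖ < 1 := norm_e_lt_one (by simpa using hτ)
  have hq : ‖e τ‖ < 1 := norm_e_lt_one hτ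
  have hu1 : qPochInf (e u) (e τ) ≠ 0 := qPochInf_ne_zero hq fun j => (factor_ne_zero_of hu j).1
  have hu2 : qPochInf (e (τ - u)) (e τ) ≠ 0 :=
    qPochInf_ne_zero hq fun j => (factor_ne_zero_of hu j).2
  have a1 := hasProd_qPoch (e τ) hq
  have a2 := hasProd_qPoch (-e (τ / 2)) hQ
  have a3 := hasProd_qPoch (e u) hq
  have a4 := hasProd_qPoch (e (τ - u)) hq
  rw [pow_two]
  refine ((a1.mul (a2.mul a2)).div₀ (a3.mul a4) (mul_ne_zero hu1 hu2)).congr_fun fun j => ?_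
  simp only [jacobiFactor]
  have b1 : e (-u) * e τ ^ (j + 1) = e (τ - u) * e τ ^ j := by
    rw [pow_succ, show τ - u = τ + -u by ring, e_add]; ring
  rw [b1]
  congr 1
  ring

lemma mu_half {τ u : ℂ} (hτ : 0 < τ.im) (hu : ∀ n : ℤ, 1 - e (u + n * τ) ≠ 0) :
    mu u (τ / 2) τ = I * e (τ / 8) * (g2 (e (u / 2)) (e (τ / 2)) -
      ∏' j : ℕ, ((1 - e τ ^ (j + 1)) * (1 + e (τ / 2) ^ (j + 1)) ^ 2 / jacobiFactor u τ j)) := by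
  have hτ2 : 0 < (τ / 2).im := by simpa using hτ
  have hQ := norm_e_lt_one hτ2
  have hq2 : e (τ / 2) ^ 2 = e τ := by rw [e_pow]; congr 1; push_cast; ring
  have hq : ‖e τ‖ < 1 := norm_e_lt_one hτ
  have hu1 : qPochInf (e u) (e τ) ≠ 0 := qPochInf_ne_zero hq fun j => (factor_ne_zero_of hu j).1
  have hu2 : qPochInf (e (τ - u)) (e τ) ≠ 0 :=
    qPochInf_ne_zero hq fun j => (factor_ne_zero_of hu j).2
  have hth := theta_half hτ
  have h2 := qPochInf_mul_neg (e (τ / 2)) hQ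
  rw [hq2] at h2
  have hP := qPochInf_self_ne_zero hτ
  have hP2 := qPochInf_self_ne_zero hτ2
  have hprod := (hasProd_etaQuotient hτ hu).tprod_eq
  have hg := g2_eq_appell hτ2 (half_ne_zero hu)
  have hsplit : ∑' r : ℤ, e (r / 2) * e (r * (r + 1) * (τ / 2)) *
      (1 - e (u / 2 + r * (τ / 2)))⁻¹ = appell u 0 τ + e (u / 2) * appell u (τ / 2) τ := by
    rw [appell, appell, ← tsum_mul_left, ← Summable.tsum_add (summable_appell hτ hu 0)
      ((summable_appell hτ hu (τ / 2)).mul_left _)]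
    refine tsum_congr fun r => ?_
    have c1 := half_ne_zero hu r
    have c2 := hu r
    have c3 : e (u + r * τ) = e (u / 2 + r * (τ / 2)) * e (u / 2 + r * (τ / 2)) := by
      rw [← e_add]; congr 1; ring
    have c4 : e (r * (r + 1) * (τ / 2)) = e (r * (r + 1) / 2 * τ) := by congr 1; ring
    have c5 : e (u / 2 + r * (τ / 2)) = e (u / 2) * e (r * (τ / 2)) := e_add _ _
    rw [c3] at c2 ⊢
    rw [c4, mul_zero, e_zero, mul_one]
    rw [c5] at c1 c2 ⊢
    generalize e (u / 2) = X at *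
    generalize e (r * (τ / 2)) = Y at *
    generalize e (r * (r + 1) / 2 * τ) = Z at *
    generalize e (r / 2 : ℂ) = W at *
    have c6 : (1 - X * Y)⁻¹ = (1 + X * Y) * (1 - X * Y * (X * Y))⁻¹ := by
      rw [eq_mul_inv_iff_mul_eq₀ c2, inv_mul_eq_iff_eq_mul₀ c1]; ring
    rw [c6]; ring
  have hA0 : appell u 0 τ = qPochInf (e τ) (e τ) ^ 2 *
      (qPochInf (e u) (e τ) * qPochInf (e (τ - u)) (e τ))⁻¹ := by
    rw [← tsum_inv_theta hτ hu, appell]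
    simp
  rw [hsplit, hA0] at hg
  rw [mu_eq, hg, hprod]
  have hN : qPochInf (-e (τ / 2)) (e (τ / 2)) ≠ 0 := by
    intro h0; rw [h0, mul_zero] at h2; exact hP h2.symm
  have ht0 : theta (τ / 2) τ ≠ 0 := by
    intro h0; rw [h0, zero_mul, zero_mul] at hth; exact hP2 hth.symm
  rw [← h2]
  rw [← hth]
  have hE := e_ne_zero (τ / 8)
  generalize qPochInf (-e (τ / 2)) (e (τ / 2)) = N at *
  generalize theta (τ / 2) τ = Θ at *
  generalize qPochInf (e u) (e τ) = A at *
  generalize qPochInf (e (τ - u)) (e τ) = B at *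
  generalize e (τ / 8) = E at *
  generalize e (u / 2) = X
  generalize appell u (τ / 2) τ = Y
  have hI := I_ne_zero
  field_simp
  ring

end EtaTheta

open Complex Filter Topology
namespace EtaTheta

/-! ### Elliptic transformations of `μ` -/

lemma one_sub_ne_zero_of_theta {τ u : ℂ} (hτ : 0 < τ.im) (hu : theta u τ ≠ 0) (n : ℤ) :
    1 - e (u + n * τ) ≠ 0 := by
  intro h
  rw [sub_eq_zero, eq_comm, e_eq_one_iff] at h
  obtain ⟨k, hk⟩ := h
  exact hu ((theta_eq_zero_iff hτ u).mpr ⟨-n, k, by push_cast; linear_combination hk⟩)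

lemma mu_add_one_left (u v τ : ℂ) : mu (u + 1) v τ = -mu u v τ := by
  have h1 : appell (u + 1) v τ = appell u v τ := by
    refine tsum_congr fun r => ?_
    rw [show u + 1 + r * τ = u + r * τ + 1 by ring, e_add_one]
  rw [mu_eq, mu_eq, h1, show (u + 1) / 2 = u / 2 + 1 / 2 by ring, e_add, e_half]
  ring

lemma mu_add_one_right (u v τ : ℂ) : mu u (v + 1) τ = -mu u v τ := by
  have h1 : appell u (v + 1) τ = appell u v τ := by
    refine tsum_congr fun r => ?_
    rw [mul_add, mul_one, e_add_int]
  rw [mu_eq, mu_eq, h1, theta_add_one]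
  ring

lemma mu_add_tau_both (u v τ : ℂ) : mu (u + τ) (v + τ) τ = mu u v τ := by
  have h1 : appell (u + τ) (v + τ) τ = -e (-v - τ) * appell u v τ := by
    rw [appell, appell, ← tsum_mul_left, ← tsum_shift _ (-1)]
    refine tsum_congr fun r => ?_
    rw [show u + τ + ((r + -1 : ℤ) : ℂ) * τ = u + r * τ by push_cast; ring, ← mul_assoc]
    congr 1
    rw [neg_mul]
    simp only [← e_add]
    exact e_congr_neg (-1) (by push_cast; ring)
  rw [mu_eq, mu_eq, h1, theta_add_tau]
  have h2 := e_ne_zero (-τ / 2 - v)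
  have h3 : e ((u + τ) / 2) * e (-v - τ) = e (u / 2) * e (-τ / 2 - v) := by
    simp only [← e_add]; congr 1; ring
  by_cases h : theta v τ = 0
  · simp [h]
  · generalize appell u v τ = A
    generalize theta v τ = B at *
    generalize e (-τ / 2 - v) = C at *
    field_simp
    linear_combination A * h3

lemma I_eq_e : I = e (1 / 4) := by
  rw [e, show 2 * (Real.pi : ℂ) * I * (1 / 4) = (Real.pi / 2 * I) by ring,
    Complex.exp_pi_div_two_mul_I]

lemma mu_add_tau_left {τ u v : ℂ} (hτ : 0 < τ.im) (hu : theta u τ ≠ 0) (hv : theta v τ ≠ 0) :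
    mu (u + τ) v τ = -e (u - v + τ / 2) * mu u v τ - I * e ((u - v) / 2 + 3 * τ / 8) := by
  have hu' := one_sub_ne_zero_of_theta hτ hu
  have hs : Summable fun r : ℤ => e (r / 2) * e (r * v) * e (r * (r - 1) / 2 * τ) := by
    have h := (summable_theta_term hτ v).norm
    refine Summable.of_norm (h.congr fun r => ?_)
    rw [mul_assoc, norm_mul (e (r / 2)), norm_e_half_int, one_mul]
  have hth : ∑' r : ℤ, e (r / 2) * e (r * v) * e (r * (r - 1) / 2 * τ) =
      e (v / 2 + 1 / 4 - τ / 8) * theta v τ := by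
    rw [theta, ← tsum_mul_left, ← tsum_shift _ 1]
    refine tsum_congr fun r => ?_
    simp only [← e_add]
    exact e_congr 0 (by push_cast; ring)
  have h1 : appell (u + τ) v τ = -e (-v) * (e (v / 2 + 1 / 4 - τ / 8) * theta v τ +
      e u * appell u v τ) := by
    rw [← hth, appell, appell, ← tsum_mul_left, ← Summable.tsum_add hs
      ((summable_appell hτ hu' v).mul_left _), ← tsum_mul_left, ← tsum_shift _ (-1)]
    refine tsum_congr fun r => ?_
    rw [show u + τ + ((r + -1 : ℤ) : ℂ) * τ = u + r * τ by push_cast; ring]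
    have a1 : e (((r + -1 : ℤ) : ℂ) / 2) * e (((r + -1 : ℤ) : ℂ) * v) *
        e (((r + -1 : ℤ) : ℂ) * (((r + -1 : ℤ) : ℂ) + 1) / 2 * τ) =
        -(e (-v) * (e (r / 2) * e (r * v) * e (r * (r - 1) / 2 * τ))) := by
      simp only [← e_add]; exact e_congr_neg (-1) (by push_cast; ring)
    have a2 : e u * (e (r / 2) * e (r * v) * e (r * (r + 1) / 2 * τ)) =
        e (r / 2) * e (r * v) * e (r * (r - 1) / 2 * τ) * e (u + r * τ) := by
      simp only [← e_add]; congr 1; ring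
    rw [a1, ← mul_assoc (e u), a2]
    have := hu' r
    generalize e (u + r * τ) = X at *
    field_simp
    ring
  rw [mu_eq, mu_eq, h1]
  have b1 : e ((u + τ) / 2) * e (-v) * e (v / 2 + 1 / 4 - τ / 8) =
      I * e ((u - v) / 2 + 3 * τ / 8) := by
    rw [I_eq_e]; simp only [← e_add]; congr 1; ring
  have b2 : e ((u + τ) / 2) * e (-v) * e u = e (u - v + τ / 2) * e (u / 2) := by
    simp only [← e_add]; congr 1; ring
  rw [← b1]
  generalize e (v / 2 + 1 / 4 - τ / 8) = Z
  generalize theta v τ = T at *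
  generalize appell u v τ = A
  generalize e (u - v + τ / 2) = B at *
  generalize e ((u + τ) / 2) = D at *
  field_simp
  linear_combination -A * b2

lemma mu_tau_add_one (u v τ : ℂ) : mu u v (τ + 1) = e (-1 / 8) * mu u v τ := by
  have h1 : appell u v (τ + 1) = appell u v τ := by
    refine tsum_congr fun r => ?_
    rw [show u + r * (τ + 1) = u + r * τ + r by ring, e_add_int]
    congr 2
    obtain ⟨k, hk⟩ := Int.even_mul_succ_self r
    have hk' : (r : ℂ) * (r + 1) = k + k := by exact_mod_cast hk
    refine e_congr k ?_
    linear_combination (1 / 2) * hk'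
  rw [mu_eq, mu_eq, h1, theta_tau_add_one]
  have : e (1 / 8) = (e (-1 / 8))⁻¹ := by rw [← e_neg]; congr 1; ring
  rw [this]
  have := e_ne_zero (-1 / 8)
  field_simp

/-! ### `μ` as a function of its first argument -/

lemma differentiableAt_tsum_of_bound {f : ℤ → ℂ → ℂ} {w : ℂ} {B : ℤ → ℝ} (hB : Summable B)
    (h : ∀ᶠ u in 𝓝 w, ∀ n, DifferentiableAt ℂ (f n) u ∧ ‖f n u‖ ≤ B n) :
    DifferentiableAt ℂ (fun u => ∑' n, f n u) w := by
  obtain ⟨U, hU, hUo, hw⟩ := eventually_nhds_iff.mp h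
  exact (differentiableOn_tsum_of_summable_norm hB
    (fun n u hu => (hU u hu n).1.differentiableWithinAt) hUo
    (fun n u hu => (hU u hu n).2)).differentiableAt (hUo.mem_nhds hw)

lemma differentiableAt_appell_on {τ u₀ : ℂ} (hτ : 0 < τ.im) (v : ℂ) (s : Set ℤ)
    (hu : ∀ n ∈ s, 1 - e (u₀ + n * τ) ≠ 0) :
    DifferentiableAt ℂ (fun u => ∑' r : ℤ, s.indicator (fun r : ℤ => e (r / 2) * e (r * v) *
      e (r * (r + 1) / 2 * τ) * (1 - e (u + r * τ))⁻¹) r) u₀ := by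
  obtain ⟨c, hc, hb⟩ := exists_lower_bound_on hτ s hu
  refine differentiableAt_tsum_of_bound ((summable_theta_term' hτ v).norm.mul_right c⁻¹) ?_
  filter_upwards [hb] with u hu' n
  by_cases hn : n ∈ s
  · simp only [Set.indicator_of_mem hn]
    have h1 := hu' n hn
    have h2 : 1 - e (u + n * τ) ≠ 0 := norm_pos_iff.mp (hc.trans_le h1)
    have h3 : DifferentiableAt ℂ (fun u => 1 - e (u + n * τ)) u := by fun_prop
    refine ⟨(h3.fun_inv h2).const_mul _, ?_⟩
    rw [norm_mul, mul_assoc (e (n / 2)), norm_mul (e (n / 2)), norm_e_half_int, one_mul, norm_inv]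
    gcongr
  · simp only [Set.indicator_of_notMem hn]
    refine ⟨by fun_prop, ?_⟩
    rw [norm_zero]; positivity

lemma differentiableAt_appell {τ u₀ : ℂ} (hτ : 0 < τ.im) (v : ℂ) (hu : theta u₀ τ ≠ 0) :
    DifferentiableAt ℂ (fun u => appell u v τ) u₀ := by
  have := differentiableAt_appell_on hτ v Set.univ fun n _ => one_sub_ne_zero_of_theta hτ hu n
  simpa [appell] using this

lemma differentiableAt_mu {τ u₀ : ℂ} (hτ : 0 < τ.im) (v : ℂ) (hu : theta u₀ τ ≠ 0) :
    DifferentiableAt ℂ (fun u => mu u v τ) u₀ := by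
  simp only [mu_eq]
  exact DifferentiableAt.mul (by fun_prop) (differentiableAt_appell hτ v hu)

lemma eventually_theta_ne_zero {τ : ℂ} (hτ : 0 < τ.im) : ∀ᶠ u in 𝓝[≠] (0 : ℂ), theta u τ ≠ 0 := by
  obtain ⟨c, hc, hb⟩ := exists_lower_bound_on (u₀ := 0) hτ {0}ᶜ (fun n hn => by
    have := one_sub_e_ne_zero hτ (x := n) (by exact_mod_cast hn)
    simpa using this)
  have h1 : ∀ᶠ u : ℂ in 𝓝 0, ‖u‖ < 1 := by
    have hc : ContinuousAt (fun u : ℂ => ‖u‖) 0 := by fun_prop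
    exact hc.eventually (gt_mem_nhds (by simp))
  filter_upwards [nhdsWithin_le_nhds hb, nhdsWithin_le_nhds h1, self_mem_nhdsWithin] with u h2 h3 h4
  intro h
  obtain ⟨a, b, hab⟩ := (theta_eq_zero_iff hτ u).mp h
  by_cases ha : a = 0
  · subst ha
    rw [Int.cast_zero, zero_mul, zero_add] at hab
    rw [hab, Complex.norm_intCast] at h3
    have : b = 0 := by
      have : |b| < 1 := by exact_mod_cast h3
      exact Int.abs_lt_one_iff.mp this
    exact h4 (by simp [hab, this])
  · have := h2 (-a) (by simpa using ha)
    rw [show u + ((-a : ℤ) : ℂ) * τ = b by rw [hab]; push_cast; ring, e_int] at this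
    simp at this; linarith

lemma tendsto_mul_inv_one_sub_e :
    Tendsto (fun u : ℂ => u * (1 - e u)⁻¹) (𝓝[≠] 0) (𝓝 (-(2 * Real.pi * I)⁻¹)) := by
  have h := (hasDerivAt_e 0).tendsto_slope_zero
  simp only [zero_add, e_zero, mul_one, smul_eq_mul] at h
  have := (h.inv₀ two_pi_I_ne_zero).neg
  refine this.congr fun u => ?_
  rw [mul_inv, inv_inv, ← neg_sub 1 (e u), inv_neg]; ring

lemma tendsto_mul_appell {τ : ℂ} (hτ : 0 < τ.im) (v : ℂ) :
    Tendsto (fun u => u * appell u v τ) (𝓝[≠] 0) (𝓝 (-(2 * Real.pi * I)⁻¹)) := by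
  have hd := differentiableAt_appell_on (u₀ := 0) hτ v {0}ᶜ (fun n hn => by
    have := one_sub_e_ne_zero hτ (x := n) (by exact_mod_cast hn)
    simpa using this)
  have h2 : Tendsto (fun u : ℂ => u) (𝓝[≠] 0) (𝓝 0) := nhdsWithin_le_nhds
  have h3 := tendsto_mul_inv_one_sub_e.add (h2.mul (hd.continuousAt.tendsto.mono_left
    nhdsWithin_le_nhds))
  rw [zero_mul, add_zero] at h3
  refine h3.congr' ?_
  filter_upwards [eventually_theta_ne_zero hτ] with u hu
  have hs := summable_appell hτ (one_sub_ne_zero_of_theta hτ hu) v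
  rw [← mul_add]
  congr 1
  rw [appell, hs.tsum_eq_add_tsum_ite 0]
  congr 1
  · simp
  · refine tsum_congr fun n => ?_
    by_cases hn : n = 0
    · simp [hn]
    · rw [if_neg hn, Set.indicator_of_mem (by simpa using hn)]

/-! ### Quasi-periodic functions -/

lemma exists_fundamental {τ : ℂ} (hτ : 0 < τ.im) (u : ℂ) :
    ∃ (a b : ℤ) (x y : ℝ), x ∈ Set.Icc (0 : ℝ) 1 ∧ y ∈ Set.Icc (0 : ℝ) 1 ∧
      u = x * τ + y + a * τ + b := by
  set X := u.im / τ.im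
  set Y := u.re - X * τ.re
  refine ⟨⌊X⌋, ⌊Y⌋, Int.fract X, Int.fract Y, ⟨Int.fract_nonneg _, (Int.fract_lt_one _).le⟩,
    ⟨Int.fract_nonneg _, (Int.fract_lt_one _).le⟩, ?_⟩
  have h1 : u = X * τ + Y := by
    apply Complex.ext
    · simp [Y]
    · simp [X, hτ.ne']
  have hX : (X : ℂ) = Int.fract X + (⌊X⌋ : ℂ) := by
    exact_mod_cast (Int.fract_add_floor X).symm
  have hY : (Y : ℂ) = Int.fract Y + (⌊Y⌋ : ℂ) := by
    exact_mod_cast (Int.fract_add_floor Y).symm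
  rw [h1, hX, hY]
  ring

/-- Doubly periodic entire functions are constant. -/
lemma eq_of_doubly_periodic {τ : ℂ} (hτ : 0 < τ.im) {F : ℂ → ℂ} (hF : Differentiable ℂ F)
    (h1 : ∀ u, F (u + 1) = F u) (h2 : ∀ u, F (u + τ) = F u) (u w : ℂ) : F u = F w := by
  have hb : ∀ (b : ℤ) (v : ℂ), F (v + b) = F v := by
    intro b v
    have := (show Function.Periodic F 1 from h1).int_mul b v
    simpa using this
  have ha : ∀ (a : ℤ) (v : ℂ), F (v + a * τ) = F v := fun a v =>
    (show Function.Periodic F τ from h2).int_mul a v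
  have hK : IsCompact ((fun p : ℝ × ℝ => (p.1 : ℂ) * τ + p.2) ''
      (Set.Icc (0 : ℝ) 1 ×ˢ Set.Icc (0 : ℝ) 1)) :=
    (isCompact_Icc.prod isCompact_Icc).image (by fun_prop)
  obtain ⟨C, hC⟩ := hK.exists_bound_of_continuousOn hF.continuous.continuousOn
  refine hF.apply_eq_apply_of_bounded ?_ u w
  refine isBounded_iff_forall_norm_le.mpr ⟨C, ?_⟩
  rintro _ ⟨u, rfl⟩
  obtain ⟨a, b, x, y, hx, hy, rfl⟩ := exists_fundamental hτ u
  rw [hb, ha]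
  exact hC _ ⟨(x, y), ⟨hx, hy⟩, rfl⟩

lemma theta_add_int_ne_zero {u τ : ℂ} : theta (u + 1) τ ≠ 0 ↔ theta u τ ≠ 0 := by
  rw [theta_add_one, neg_ne_zero]

lemma theta_add_tau_ne_zero {u τ : ℂ} : theta (u + τ) τ ≠ 0 ↔ theta u τ ≠ 0 := by
  rw [theta_add_tau]; simp [e_ne_zero]

/-- A function that is holomorphic off the lattice, with at most removable singularities, and
transforms like the reciprocal of `ϑ(u - v)`, vanishes. -/
lemma eq_zero_of_quasiperiodic {τ v : ℂ} (hτ : 0 < τ.im) (hv : theta v τ ≠ 0) {f : ℂ → ℂ}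
    (hd : ∀ u, theta u τ ≠ 0 → DifferentiableAt ℂ f u)
    (h0 : Tendsto (fun u => u * f u) (𝓝[≠] 0) (𝓝 0))
    (h1 : ∀ u, theta u τ ≠ 0 → f (u + 1) = -f u)
    (h2 : ∀ u, theta u τ ≠ 0 → f (u + τ) = -e (u - v + τ / 2) * f u)
    {u : ℂ} (hu : theta u τ ≠ 0) : f u = 0 := by
  have hopen : IsOpen {u | theta u τ ≠ 0} :=
    isOpen_ne_fun (differentiable_theta hτ).continuous continuous_const
  have hth : Differentiable ℂ fun u => theta (u - v) τ :=
    (differentiable_theta hτ).comp (differentiable_id.sub_const v)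
  set g : ℂ → ℂ := fun u => if theta u τ = 0 then 0 else f u * theta (u - v) τ with hg
  have hg' : ∀ u, theta u τ ≠ 0 → g u = f u * theta (u - v) τ := fun u hu => if_neg hu
  have g1 : ∀ u, g (u + 1) = g u := by
    intro u
    by_cases hu : theta u τ = 0
    · have : theta (u + 1) τ = 0 := by rw [theta_add_one, hu, neg_zero]
      simp only [hg, hu, this, if_true]
    · rw [hg' u hu, hg' _ (theta_add_int_ne_zero.mpr hu), h1 u hu,
        show u + 1 - v = u - v + 1 by ring, theta_add_one]
      ring
  have g2 : ∀ u, g (u + τ) = g u := by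
    intro u
    by_cases hu : theta u τ = 0
    · have : theta (u + τ) τ = 0 := by rw [theta_add_tau, hu, mul_zero]
      simp only [hg, hu, this, if_true]
    · rw [hg' u hu, hg' _ (theta_add_tau_ne_zero.mpr hu), h2 u hu,
        show u + τ - v = u - v + τ by ring, theta_add_tau]
      have : e (u - v + τ / 2) * e (-τ / 2 - (u - v)) = 1 := by
        rw [← e_add, ← e_zero]; congr 1; ring
      linear_combination (f u * theta (u - v) τ) * this
  have gd : ∀ u, theta u τ ≠ 0 → DifferentiableAt ℂ g u := by
    intro u hu
    refine ((hd u hu).mul (hth u)).congr_of_eventuallyEq ?_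
    filter_upwards [hopen.mem_nhds hu] with w hw using hg' w hw
  have per : ∀ (a b : ℤ) (u : ℂ), g (u + (a * τ + b)) = g u := by
    intro a b u
    rw [← add_assoc]
    have e1 := (show Function.Periodic g 1 from g1).int_mul b (u + a * τ)
    have e2 := (show Function.Periodic g τ from g2).int_mul a u
    rw [mul_one] at e1
    rw [e1, e2]
  set F : ℂ → ℂ := fun u => limUnder (𝓝[≠] u) g with hF
  have Feq : ∀ u, theta u τ ≠ 0 → F u = g u := fun u hu =>
    ((gd u hu).continuousAt.tendsto.mono_left nhdsWithin_le_nhds).limUnder_eq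
  have hev : ∀ᶠ u in 𝓝[≠] (0 : ℂ), theta u τ ≠ 0 := eventually_theta_ne_zero hτ
  have Fd : Differentiable ℂ F := by
    intro w
    by_cases hw : theta w τ ≠ 0
    · refine (gd w hw).congr_of_eventuallyEq ?_
      filter_upwards [hopen.mem_nhds hw] with x hx using Feq x hx
    · rw [not_not] at hw
      obtain ⟨a, b, rfl⟩ := (theta_eq_zero_iff hτ w).mp hw
      set w : ℂ := a * τ + b
      have hmap : Tendsto (fun x => x - w) (𝓝[≠] w) (𝓝[≠] 0) := by
        refine tendsto_nhdsWithin_iff.mpr ⟨?_, ?_⟩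
        · have : ContinuousAt (fun x => x - w) w := by fun_prop
          have h := this.tendsto
          rw [sub_self] at h
          exact h.mono_left nhdsWithin_le_nhds
        · filter_upwards [self_mem_nhdsWithin] with x hx
          simpa [sub_eq_zero] using hx
      have hne : ∀ᶠ x in 𝓝[≠] w, theta x τ ≠ 0 := by
        filter_upwards [hmap.eventually hev] with x hx h
        apply hx
        obtain ⟨c, d, hcd⟩ := (theta_eq_zero_iff hτ x).mp h
        exact (theta_eq_zero_iff hτ _).mpr ⟨c - a, d - b, by rw [hcd]; push_cast; ring⟩
      obtain ⟨U, hU, hUo, hwU⟩ := eventually_nhds_iff.mp (eventually_nhdsWithin_iff.mp hne)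
      have hdU : DifferentiableOn ℂ g (U \ {w}) := fun x hx =>
        (gd x (hU x hx.1 hx.2)).differentiableWithinAt
      have hlim : Tendsto (fun x => (x - w) * g x) (𝓝[≠] w) (𝓝 0) := by
        have h3 : Tendsto (fun x => x * g x) (𝓝[≠] 0) (𝓝 0) := by
          have h4 := h0.mul ((hth 0).continuousAt.tendsto.mono_left
            (nhdsWithin_le_nhds (s := {0}ᶜ)))
          rw [zero_mul] at h4
          refine h4.congr' ?_
          filter_upwards [hev] with x hx
          rw [hg' x hx]; ring
        refine (h3.comp hmap).congr fun x => ?_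
        simp only [Function.comp]
        rw [← per a b (x - w), sub_add_cancel]
      have hlo : (fun z => g z - g w) =o[𝓝[≠] w] fun z => (z - w)⁻¹ := by
        rw [Asymptotics.isLittleO_iff_tendsto']
        · have h5 : Tendsto (fun x => (x - w)) (𝓝[≠] w) (𝓝 0) :=
            hmap.mono_right nhdsWithin_le_nhds
          have h6 := hlim.sub (h5.mul_const (g w))
          rw [zero_mul, sub_zero] at h6
          refine h6.congr fun x => ?_
          rw [div_inv_eq_mul]; ring
        · filter_upwards [self_mem_nhdsWithin] with x hx h
          exact absurd (sub_eq_zero.mp (inv_eq_zero.mp h)) hx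
      have hup := Complex.differentiableOn_update_limUnder_of_isLittleO (hUo.mem_nhds hwU) hdU hlo
      refine (hup.differentiableAt (hUo.mem_nhds hwU)).congr_of_eventuallyEq ?_
      filter_upwards [hUo.mem_nhds hwU] with x hx
      by_cases hxw : x = w
      · subst hxw; simp [hF]
      · rw [Function.update_of_ne hxw, Feq x (hU x hx hxw)]
  have Fper : ∀ c, (∀ u, g (u + c) = g u) → ∀ u, F (u + c) = F u := by
    intro c hc u
    have h3 : map (fun x => x + c) (𝓝[≠] u) = 𝓝[≠] (u + c) :=
      (Homeomorph.addRight c).map_punctured_nhds_eq u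
    simp only [hF, limUnder]
    rw [← h3, map_map]
    congr 2
    exact funext hc
  have hconst := eq_of_doubly_periodic hτ Fd (Fper 1 g1) (Fper τ g2)
  have gz : ∀ u, theta u τ ≠ 0 → g u = 0 := by
    intro u hu
    rw [← Feq u hu, hconst u v, Feq v hv, hg' v hv, sub_self, theta_zero, mul_zero]
  have fz : ∀ u, theta u τ ≠ 0 → theta (u - v) τ ≠ 0 → f u = 0 := by
    intro u hu hu'
    have := gz u hu
    rw [hg' u hu] at this
    exact (mul_eq_zero.mp this).resolve_right hu'
  by_cases hu' : theta (u - v) τ ≠ 0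
  · exact fz u hu hu'
  · rw [not_not] at hu'
    obtain ⟨a, b, hab⟩ := (theta_eq_zero_iff hτ _).mp hu'
    have hmap : Tendsto (fun x => u + x) (𝓝[≠] 0) (𝓝 u) := by
      have : ContinuousAt (fun x => u + x) 0 := by fun_prop
      have h := this.tendsto
      rw [add_zero] at h
      exact h.mono_left nhdsWithin_le_nhds
    have h3 := (hd u hu).continuousAt.tendsto.comp hmap
    refine tendsto_nhds_unique h3 (tendsto_const_nhds.congr' ?_)
    filter_upwards [hev, hmap.eventually (hopen.mem_nhds hu)] with x hx hx2
    refine (fz _ hx2 fun h => hx ?_).symm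
    obtain ⟨c, d, hcd⟩ := (theta_eq_zero_iff hτ _).mp h
    exact (theta_eq_zero_iff hτ _).mpr ⟨c - a, d - b, by push_cast; linear_combination hcd - hab⟩

end EtaTheta

open Complex Filter Topology
namespace EtaTheta

/-! ### Holomorphic parameter integrals -/

open MeasureTheory in
lemma differentiableAt_integral_of_bound {μ : Measure ℝ} {f : ℂ → ℝ → ℂ} {w₀ : ℂ} {g : ℝ → ℝ}
    {U : Set ℂ} (hU : U ∈ 𝓝 w₀) (hg : Integrable g μ)
    (hm : ∀ w ∈ U, AEStronglyMeasurable (f w) μ)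
    (h : ∀ᵐ x ∂μ, ∀ w ∈ U, DifferentiableAt ℂ (fun w => f w x) w ∧ ‖f w x‖ ≤ g x) :
    DifferentiableAt ℂ (fun w => ∫ x, f w x ∂μ) w₀ := by
  obtain ⟨r, hr, hrU⟩ := Metric.mem_nhds_iff.mp hU
  have hr2 : 0 < r / 2 := by positivity
  have hmem : ∀ w ∈ Metric.ball w₀ (r / 2), Metric.closedBall w (r / 4) ⊆ U := by
    intro w hw z hz
    refine hrU ?_
    rw [Metric.mem_ball] at *
    rw [Metric.mem_closedBall] at hz
    linarith [dist_triangle z w w₀]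
  have hw₀ : w₀ ∈ U := mem_of_mem_nhds hU
  have hmeas : AEStronglyMeasurable (fun x => deriv (fun w => f w x) w₀) μ := by
    have ht : Tendsto (fun n : ℕ => ((n : ℂ) + 1)⁻¹) atTop (𝓝 0) := by
      have := tendsto_one_div_add_atTop_nhds_zero_nat (𝕜 := ℂ)
      simpa [one_div] using this
    have hU' : ∀ᶠ n : ℕ in atTop, w₀ + ((n : ℂ) + 1)⁻¹ ∈ U := by
      have h1 : Tendsto (fun n : ℕ => w₀ + ((n : ℂ) + 1)⁻¹) atTop (𝓝 w₀) := by
        simpa using ht.const_add w₀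
      exact h1.eventually hU
    obtain ⟨N, hN⟩ := eventually_atTop.mp hU'
    refine aestronglyMeasurable_of_tendsto_ae (u := atTop) (f := fun (n : ℕ) x =>
      (((n + N : ℕ) : ℂ) + 1) * (f (w₀ + (((n + N : ℕ) : ℂ) + 1)⁻¹) x - f w₀ x)) ?_ ?_
    · intro n
      exact ((hm _ (hN _ (Nat.le_add_left _ _))).sub (hm _ hw₀)).const_mul _
    · filter_upwards [h] with x hx
      have h2 := (hx w₀ hw₀).1.hasDerivAt.tendsto_slope_zero
      have h3 : Tendsto (fun n : ℕ => (((n + N : ℕ) : ℂ) + 1)⁻¹) atTop (𝓝[≠] 0) := by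
        refine tendsto_nhdsWithin_iff.mpr ⟨ht.comp (tendsto_add_atTop_nat N), ?_⟩
        refine Eventually.of_forall fun n => ?_
        have : ((n + N : ℕ) : ℂ) + 1 ≠ 0 := by
          exact_mod_cast Nat.succ_ne_zero (n + N)
        simpa using this
      refine (h2.comp h3).congr fun n => ?_
      simp [Function.comp]
  refine (hasDerivAt_integral_of_dominated_loc_of_deriv_le (F := f)
    (F' := fun w x => deriv (fun w => f w x) w) (bound := fun x => g x / (r / 4))
    (Metric.ball_mem_nhds w₀ hr2) ?_ ?_ hmeas ?_ (hg.div_const _) ?_).2.differentiableAt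
  · filter_upwards [hU] with w hw using hm w hw
  · refine hg.mono' (hm _ hw₀) ?_
    filter_upwards [h] with x hx using (hx _ hw₀).2
  · filter_upwards [h] with x hx w hw
    refine norm_deriv_le_of_forall_mem_sphere_norm_le (by positivity) ?_ fun z hz =>
      (hx z (hmem w hw (Metric.sphere_subset_closedBall hz))).2
    refine DifferentiableOn.diffContOnCl fun z hz => ?_
    exact (hx z (hmem w hw (Metric.closure_ball_subset_closedBall hz))).1.differentiableWithinAt
  · filter_upwards [h] with x hx w hw
    exact (hx w (hmem w hw (Metric.mem_closedBall_self (by positivity)))).1.hasDerivAt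

/-- A holomorphic function on a preconnected open set that is constant on the reals near a point
is constant. -/
lemma eq_of_constant_on_reals {F : ℂ → ℂ} {U : Set ℂ} (hU : IsOpen U) (hc : IsPreconnected U)
    (hF : DifferentiableOn ℂ F U) {a : ℝ} (ha : (a : ℂ) ∈ U)
    (h : ∀ᶠ x : ℝ in 𝓝 a, F x = F a) {w : ℂ} (hw : w ∈ U) : F w = F a := by
  refine (hF.analyticOnNhd hU).eqOn_of_preconnected_of_frequently_eq
    (g := fun _ => F a) analyticOnNhd_const hc ha ?_ hw
  have ht : Tendsto (fun x : ℝ => (x : ℂ)) (𝓝[≠] a) (𝓝[≠] (a : ℂ)) := by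
    refine tendsto_nhdsWithin_iff.mpr ⟨?_, ?_⟩
    · exact (continuous_ofReal.tendsto a).mono_left nhdsWithin_le_nhds
    · filter_upwards [self_mem_nhdsWithin] with x hx
      simpa using hx
  exact ht.frequently (Eventually.frequently (nhdsWithin_le_nhds h))

lemma integrable_exp_neg_mul_abs {c : ℝ} (hc : 0 < c) :
    MeasureTheory.Integrable fun x : ℝ => Real.exp (-c * |x|) := by
  have h : MeasureTheory.IntegrableOn (fun x : ℝ => Real.exp (-c * |x|)) (Set.Ioi 0) := by
    refine (exp_neg_integrableOn_Ioi 0 hc).congr_fun (fun x hx => ?_) measurableSet_Ioi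
    simp only [abs_of_pos (Set.mem_Ioi.mp hx)]
  have h' : MeasureTheory.IntegrableOn (fun x : ℝ => Real.exp (-c * |x|)) (Set.Iic 0) := by
    refine (integrableOn_exp_mul_Iic hc 0).congr_fun (fun x hx => ?_) measurableSet_Iic
    simp only [abs_of_nonpos (Set.mem_Iic.mp hx), neg_mul_neg]
  rw [← MeasureTheory.integrableOn_univ, ← Set.Iic_union_Ioi (a := (0 : ℝ))]
  exact h'.union h

/-! ### Lower bounds for `cosh` -/

lemma normSq_cosh (z : ℂ) : ‖cosh z‖ ^ 2 = Real.sinh z.re ^ 2 + Real.cos z.im ^ 2 := by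
  have h : cosh z = Real.cosh z.re * Real.cos z.im + Real.sinh z.re * Real.sin z.im * I := by
    conv_lhs => rw [← re_add_im z, cosh_add, cosh_mul_I, sinh_mul_I]
    push_cast
    ring
  rw [← normSq_eq_norm_sq, h, normSq_apply]
  simp only [add_re, mul_re, ofReal_re, ofReal_im, add_im, mul_im, I_re, I_im]
  have h1 := Real.cosh_sq z.re
  have h2 := Real.sin_sq_add_cos_sq z.im
  linear_combination Real.cos z.im ^ 2 * h1 + Real.sinh z.re ^ 2 * h2

lemma one_le_norm_cosh {z : ℂ} (h : |z.im| ≤ |z.re|) : 1 ≤ ‖cosh z‖ := by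
  have h1 := normSq_cosh z
  have h2 : |Real.sin z.im| ≤ |Real.sinh z.re| := by
    rw [Real.abs_sinh]
    calc |Real.sin z.im| ≤ |z.im| := Real.abs_sin_le_abs
      _ ≤ |z.re| := h
      _ ≤ Real.sinh |z.re| := Real.self_le_sinh_iff.mpr (abs_nonneg _)
  have h3 := sq_le_sq.mpr h2
  have h4 := Real.sin_sq_add_cos_sq z.im
  nlinarith [norm_nonneg (cosh z)]

lemma sinh_le_norm_cosh (z : ℂ) : Real.sinh |z.re| ≤ ‖cosh z‖ := by
  have h1 := normSq_cosh z
  rw [← Real.abs_sinh]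
  refine abs_le_of_sq_le_sq (by nlinarith [sq_nonneg (Real.cos z.im)]) (norm_nonneg _)

/-! ### Gaussian integrals divided by `cosh` -/

lemma norm_cexp_quadratic_le {A B : ℂ} {δ R : ℝ} (hδ : 0 < δ) (hA : A.re ≤ -δ) (hB : ‖B‖ ≤ R)
    (x : ℝ) : ‖cexp (A * x ^ 2 + B * x)‖ ≤ Real.exp (R ^ 2 / (2 * δ)) * Real.exp (-(δ / 2) * x ^ 2) := by
  rw [norm_exp, ← Real.exp_add]
  refine Real.exp_le_exp.mpr ?_
  have h1 : (A * x ^ 2 + B * x).re = A.re * x ^ 2 + B.re * x := by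
    rw [add_re, ← ofReal_pow, re_mul_ofReal, re_mul_ofReal]
  have h2 : B.re * x ≤ R * |x| := by
    calc B.re * x ≤ |B.re * x| := le_abs_self _
      _ = |B.re| * |x| := abs_mul _ _
      _ ≤ R * |x| := by gcongr; exact (abs_re_le_norm B).trans hB
  have h3 : R * |x| ≤ R ^ 2 / (2 * δ) + δ / 2 * x ^ 2 := by
    rw [← sq_abs x]
    have : R ^ 2 / (2 * δ) + δ / 2 * |x| ^ 2 - R * |x| = (R - δ * |x|) ^ 2 / (2 * δ) := by
      field_simp; ring
    have h4 : 0 ≤ (R - δ * |x|) ^ 2 / (2 * δ) := by positivity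
    linarith
  rw [h1]
  nlinarith [mul_le_mul_of_nonneg_right hA (sq_nonneg x)]

/-- The integral of `exp(Ax² + Bx) / cosh(πwx)`. -/
noncomputable def sechIntegral (A B w : ℂ) : ℂ :=
  ∫ x : ℝ, cexp (A * x ^ 2 + B * x) / cosh (Real.pi * w * x)

lemma one_le_norm_cosh_mul {w : ℂ} (hw : |w.im| ≤ |w.re|) (x : ℝ) :
    1 ≤ ‖cosh (Real.pi * w * x)‖ := by
  refine one_le_norm_cosh ?_
  rw [im_mul_ofReal, re_mul_ofReal, im_ofReal_mul, re_ofReal_mul, abs_mul, abs_mul, abs_mul,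
    abs_mul]
  gcongr

lemma continuous_sech {A B w : ℂ} (hw : |w.im| ≤ |w.re|) :
    Continuous fun x : ℝ => cexp (A * x ^ 2 + B * x) / cosh (Real.pi * w * x) := by
  refine Continuous.div (by fun_prop) (by fun_prop) fun x => ?_
  have := one_le_norm_cosh_mul hw x
  exact norm_pos_iff.mp (by linarith)

lemma integrable_sech {A B w : ℂ} (hA : A.re < 0) (hw : |w.im| ≤ |w.re|) :
    MeasureTheory.Integrable fun x : ℝ => cexp (A * x ^ 2 + B * x) / cosh (Real.pi * w * x) := by
  have hg := (integrable_exp_neg_mul_sq (b := -A.re / 2) (by linarith)).const_mul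
    (Real.exp (‖B‖ ^ 2 / (2 * -A.re)))
  refine hg.mono' (continuous_sech hw).aestronglyMeasurable (Eventually.of_forall fun x => ?_)
  rw [norm_div]
  refine (div_le_self (norm_nonneg _) (one_le_norm_cosh_mul hw x)).trans ?_
  exact norm_cexp_quadratic_le (by linarith) (by linarith) le_rfl x

lemma differentiableAt_sechIntegral {A B w : ℂ → ℂ} {s₀ : ℂ}
    (hA : ∀ᶠ s in 𝓝 s₀, DifferentiableAt ℂ A s) (hB : ∀ᶠ s in 𝓝 s₀, DifferentiableAt ℂ B s)
    (hw : ∀ᶠ s in 𝓝 s₀, DifferentiableAt ℂ w s)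
    (hA0 : (A s₀).re < 0) (hw0 : |(w s₀).im| < |(w s₀).re|) :
    DifferentiableAt ℂ (fun s => sechIntegral (A s) (B s) (w s)) s₀ := by
  have cA := hA.self_of_nhds.continuousAt
  have cB := hB.self_of_nhds.continuousAt
  have cw := hw.self_of_nhds.continuousAt
  set δ := -(A s₀).re / 2 with hδ
  have hδ0 : 0 < δ := by rw [hδ]; linarith
  have e1 : ∀ᶠ s in 𝓝 s₀, (A s).re < -δ := by
    have : ContinuousAt (fun s => (A s).re) s₀ := continuous_re.continuousAt.comp cA
    exact this.eventually (gt_mem_nhds (by rw [hδ]; linarith))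
  have e2 : ∀ᶠ s in 𝓝 s₀, ‖B s‖ < ‖B s₀‖ + 1 :=
    cB.norm.eventually (gt_mem_nhds (by linarith))
  have e3 : ∀ᶠ s in 𝓝 s₀, |(w s).im| < |(w s).re| := by
    have h1 : ContinuousAt (fun s => |(w s).im|) s₀ := (continuous_im.continuousAt.comp cw).abs
    have h2 : ContinuousAt (fun s => |(w s).re|) s₀ := (continuous_re.continuousAt.comp cw).abs
    exact h1.eventually_lt h2 hw0
  have hev := (hA.and (hB.and (hw.and (e1.and (e2.and e3)))))
  have hg := (integrable_exp_neg_mul_sq (b := δ / 2) (by linarith)).const_mul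
    (Real.exp ((‖B s₀‖ + 1) ^ 2 / (2 * δ)))
  refine differentiableAt_integral_of_bound hev hg ?_ (Eventually.of_forall fun x s hs => ?_)
  · rintro s ⟨-, -, -, -, -, h⟩
    exact (continuous_sech h.le).aestronglyMeasurable
  · obtain ⟨a1, a2, a3, a4, a5, a6⟩ := hs
    have hc := one_le_norm_cosh_mul a6.le x
    refine ⟨DifferentiableAt.fun_div (by fun_prop) (by fun_prop)
      (norm_pos_iff.mp (by linarith)), ?_⟩
    rw [norm_div]
    refine (div_le_self (norm_nonneg _) hc).trans ?_
    exact norm_cexp_quadratic_le hδ0 a4.le a5.le x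

lemma sechIntegral_scale {A B w : ℂ} {r : ℝ} (hr : 0 < r) :
    r * sechIntegral (A * r ^ 2) (B * r) (w * r) = sechIntegral A B w := by
  have h := MeasureTheory.Measure.integral_comp_mul_left
    (fun x : ℝ => cexp (A * x ^ 2 + B * x) / cosh (Real.pi * w * x)) r
  rw [sechIntegral, sechIntegral]
  have h2 : ∀ x : ℝ, cexp (A * ((r * x : ℝ) : ℂ) ^ 2 + B * ((r * x : ℝ) : ℂ)) /
      cosh (Real.pi * w * ((r * x : ℝ) : ℂ)) =
      cexp (A * r ^ 2 * x ^ 2 + B * r * x) / cosh (Real.pi * (w * r) * x) := by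
    intro x; push_cast; congr 2 <;> ring
  simp only [h2] at h
  rw [h, abs_of_pos (inv_pos.mpr hr), Complex.real_smul, ← mul_assoc]
  have : (r : ℂ) ≠ 0 := by exact_mod_cast hr.ne'
  push_cast
  rw [mul_inv_cancel₀ this, one_mul]

/-- Rotating the line of integration. -/
lemma sechIntegral_rotate {τ B w : ℂ} (hτ : 0 < τ.im) (h1 : 0 < (τ * w).im)
    (h2 : 0 < (τ * w ^ 2).im) (h3 : |w.im| < w.re) :
    w * sechIntegral (Real.pi * I * τ * w ^ 2) (B * w) w =
      sechIntegral (Real.pi * I * τ) B 1 := by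
  set U : Set ℂ := {w | 0 < (τ * w).im ∧ 0 < (τ * w ^ 2).im ∧ |w.im| < w.re}
  have hre : ∀ w : ℂ, (Real.pi * I * τ * w ^ 2).re = -Real.pi * (τ * w ^ 2).im := by
    intro w
    rw [show Real.pi * I * τ * w ^ 2 = ((Real.pi : ℝ) : ℂ) * (I * (τ * w ^ 2)) by ring,
      re_ofReal_mul, I_mul_re]; ring
  have hU : IsOpen U := by
    have c1 : Continuous fun w : ℂ => (τ * w).im := by fun_prop
    have c2 : Continuous fun w : ℂ => (τ * w ^ 2).im := by fun_prop
    have c3 : Continuous fun w : ℂ => |w.im| := by fun_prop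
    exact (isOpen_lt continuous_const c1).inter ((isOpen_lt continuous_const c2).inter
      (isOpen_lt c3 continuous_re))
  have hone : (1 : ℂ) ∈ U := by simp [U, hτ]
  have hstar : StarConvex ℝ (1 : ℂ) U := by
    rintro w ⟨a1, a2, a3⟩ a b ha hb hab
    have hw : a • (1 : ℂ) + b • w = a + b * w := by simp
    rw [hw]
    have e1 : (τ * (a + b * w)).im = a * τ.im + b * (τ * w).im := by
      rw [show τ * (a + b * w) = (a : ℂ) * τ + (b : ℂ) * (τ * w) by ring, add_im, im_ofReal_mul,
        im_ofReal_mul]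
    have e2 : (τ * (a + b * w) ^ 2).im = a ^ 2 * τ.im + 2 * a * b * (τ * w).im +
        b ^ 2 * (τ * w ^ 2).im := by
      rw [show τ * (a + b * w) ^ 2 = ((a ^ 2 : ℝ) : ℂ) * τ + ((2 * a * b : ℝ) : ℂ) * (τ * w) +
        ((b ^ 2 : ℝ) : ℂ) * (τ * w ^ 2) by push_cast; ring, add_im, add_im, im_ofReal_mul,
        im_ofReal_mul, im_ofReal_mul]
    rcases ha.eq_or_lt with h0 | h0
    · subst h0
      rw [zero_add] at hab
      subst hab
      simpa using ⟨a1, a2, a3⟩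
    · refine ⟨?_, ?_, ?_⟩
      · rw [e1]; nlinarith [mul_pos h0 hτ, mul_nonneg hb a1.le]
      · rw [e2]; have := mul_pos (pow_pos h0 2) hτ
        have := mul_nonneg (mul_nonneg h0.le hb) a1.le
        have := mul_nonneg (sq_nonneg b) a2.le
        nlinarith
      · simp only [add_im, ofReal_im, im_ofReal_mul, add_re, ofReal_re, re_ofReal_mul, zero_add]
        rw [abs_mul, abs_of_nonneg hb]
        nlinarith [mul_le_mul_of_nonneg_left a3.le hb]
  have key := eq_of_constant_on_reals (F := fun w => w * sechIntegral (Real.pi * I * τ * w ^ 2)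
    (B * w) w) hU (hstar.isPathConnected hone).isConnected.isPreconnected (a := 1) ?_ (by simpa) ?_
    (w := w) ⟨h1, h2, h3⟩
  · simpa using key
  · intro w ⟨a1, a2, a3⟩
    refine DifferentiableAt.differentiableWithinAt (DifferentiableAt.fun_mul differentiableAt_fun_id ?_)
    refine differentiableAt_sechIntegral (A := fun w => Real.pi * I * τ * w ^ 2)
      (B := fun w => B * w) (w := fun w => w) (Eventually.of_forall fun s => by fun_prop)
      (Eventually.of_forall fun s => by fun_prop) (Eventually.of_forall fun s => by fun_prop) ?_ ?_
    · rw [hre]; nlinarith [Real.pi_pos]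
    · exact a3.trans_le (le_abs_self _)
  · filter_upwards [lt_mem_nhds (zero_lt_one (α := ℝ))] with r hr
    have := sechIntegral_scale (A := Real.pi * I * τ) (B := B) (w := 1) hr
    simp only [one_mul] at this
    simp only [this]
    simp

end EtaTheta

open Complex Filter Topology
namespace EtaTheta

/-! ### Shifting the line of integration -/

open MeasureTheory in
lemma integral_horizontal_line_eq {f : ℂ → ℂ} {p q C c : ℝ} (hc : 0 < c)
    (hf : ∀ w : ℂ, p < w.im → w.im < q → DifferentiableAt ℂ f w)
    (hb : ∀ w : ℂ, p < w.im → w.im < q → ‖f w‖ ≤ C * Real.exp (-c * |w.re|))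
    {a b : ℝ} (ha : p < a) (ha' : a < q) (hb1 : p < b) (hb2 : b < q) :
    ∫ x : ℝ, f (x + b * I) = ∫ x : ℝ, f (x + a * I) := by
  set U : Set ℂ := {s | p < a + s.im ∧ a + s.im < q}
  have c1 : Continuous fun s : ℂ => a + s.im := by fun_prop
  have hU : IsOpen U := (isOpen_lt continuous_const c1).inter (isOpen_lt c1 continuous_const)
  have hconv : Convex ℝ U := by
    intro s hs t ht u v hu hv huv
    obtain ⟨h1, h2⟩ := hs
    obtain ⟨h3, h4⟩ := ht
    have e1 : (u • s + v • t).im = u * s.im + v * t.im := by simp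
    have e2 : a + (u * s.im + v * t.im) = u * (a + s.im) + v * (a + t.im) := by
      linear_combination -a * huv
    simp only [U, Set.mem_ofPred_eq, e1, e2]
    constructor
    · rcases hu.eq_or_lt with h0 | h0
      · subst h0; rw [zero_add] at huv; subst huv; linarith
      · nlinarith
    · rcases hu.eq_or_lt with h0 | h0
      · subst h0; rw [zero_add] at huv; subst huv; linarith
      · nlinarith
  have him : ∀ (x : ℝ) (s : ℂ), ((x : ℂ) + a * I + s).im = a + s.im := by intro x s; simp
  have hre : ∀ (x : ℝ) (s : ℂ), ((x : ℂ) + a * I + s).re = x + s.re := by intro x s; simp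
  have hC : 0 ≤ C := by
    have := (norm_nonneg _).trans (hb (a * I) (by simpa) (by simpa))
    exact nonneg_of_mul_nonneg_left this (Real.exp_pos _)
  have key := eq_of_constant_on_reals (F := fun s => ∫ x : ℝ, f (x + a * I + s)) hU
    hconv.isPreconnected (a := 0) ?_ (by simp [U, ha, ha']) ?_ (w := (b - a) * I)
    (by simp [U, hb1, hb2])
  · simp only [ofReal_zero, add_zero] at key
    rw [← key]
    congr 1; ext x; congr 1; ring
  · intro s₀ hs₀
    refine DifferentiableAt.differentiableWithinAt ?_
    have hnb : U ∩ {s | |s.re| < |s₀.re| + 1} ∈ 𝓝 s₀ := by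
      refine inter_mem (hU.mem_nhds hs₀) ?_
      have c2 : Continuous fun s : ℂ => |s.re| := by fun_prop
      exact (isOpen_lt c2 continuous_const).mem_nhds (by simp)
    refine differentiableAt_integral_of_bound hnb
      ((integrable_exp_neg_mul_abs hc).const_mul (C * Real.exp (c * (|s₀.re| + 1)))) ?_
      (Eventually.of_forall fun x s hs => ?_)
    · rintro s ⟨⟨h1, h2⟩, -⟩
      refine Continuous.aestronglyMeasurable ?_
      rw [continuous_iff_continuousAt]
      intro x
      have h3 := (hf ((x : ℂ) + a * I + s) (by rwa [him]) (by rwa [him])).continuousAt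
      have h4 : ContinuousAt (fun x : ℝ => (x : ℂ) + a * I + s) x := by fun_prop
      exact ContinuousAt.comp (f := fun x : ℝ => (x : ℂ) + a * I + s) h3 h4
    · obtain ⟨⟨h1, h2⟩, h3⟩ := hs
      constructor
      · have h4 := hf ((x : ℂ) + a * I + s) (by rwa [him]) (by rwa [him])
        exact h4.comp (f := fun s : ℂ => (x : ℂ) + a * I + s) s (by fun_prop)
      · refine (hb _ (by rwa [him]) (by rwa [him])).trans ?_
        rw [mul_assoc, ← Real.exp_add, hre]
        refine mul_le_mul_of_nonneg_left (Real.exp_le_exp.mpr ?_) hC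
        have h5 : |x| ≤ |x + s.re| + |s.re| := by
          have := abs_add_le (x + s.re) (-s.re); simpa using this
        rw [Set.mem_ofPred_eq] at h3
        nlinarith
  · refine Eventually.of_forall fun r => ?_
    have := integral_add_right_eq_self (μ := volume) (fun x : ℝ => f (x + a * I)) r
    simp only [ofReal_zero, add_zero]
    rw [← this]
    congr 1; ext x; congr 1; push_cast; ring

/-! ### The Mordell integral -/

/-- Zwegers' function `h(z;τ)`. -/
noncomputable def mordell (z τ : ℂ) : ℂ := sechIntegral (Real.pi * I * τ) (-2 * Real.pi * z) 1

lemma pi_I_mul_re (τ : ℂ) : (Real.pi * I * τ).re = -(Real.pi * τ.im) := by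
  rw [mul_assoc, re_ofReal_mul, I_mul_re]; ring

lemma pi_I_mul_re_neg {τ : ℂ} (hτ : 0 < τ.im) : (Real.pi * I * τ).re < 0 := by
  rw [pi_I_mul_re]; have := mul_pos Real.pi_pos hτ; linarith

lemma differentiable_mordell {τ : ℂ} (hτ : 0 < τ.im) : Differentiable ℂ fun z => mordell z τ := by
  intro z
  exact differentiableAt_sechIntegral (A := fun _ => Real.pi * I * τ)
    (B := fun z => -2 * Real.pi * z) (w := fun _ => 1) (Eventually.of_forall fun s => by fun_prop)
    (Eventually.of_forall fun s => by fun_prop) (Eventually.of_forall fun s => by fun_prop)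
    (pi_I_mul_re_neg hτ) (by simp)

lemma inv_sqrt {τ : ℂ} (hτ : 0 < τ.im) : (1 / (-I * τ)) ^ (1 / 2 : ℂ) = ((-I * τ) ^ (1 / 2 : ℂ))⁻¹ := by
  rw [one_div (-I * τ), inv_cpow]
  intro h
  have h2 := arg_eq_pi_iff.mp h
  simp at h2
  linarith [h2.1]

lemma integral_gaussian_e {τ : ℂ} (hτ : 0 < τ.im) (w : ℂ) :
    ∫ x : ℝ, cexp (Real.pi * I * τ * x ^ 2 + -2 * Real.pi * w * x) =
      ((-I * τ) ^ (1 / 2 : ℂ))⁻¹ * e (w ^ 2 / (2 * τ)) := by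
  have h := integral_cexp_quadratic (pi_I_mul_re_neg hτ) (-2 * Real.pi * w) 0
  simp only [add_zero] at h
  rw [h]
  have hπ : (Real.pi : ℂ) ≠ 0 := by exact_mod_cast Real.pi_ne_zero
  have hτ0 := ne_zero_of_im_pos hτ
  congr 1
  · rw [← inv_sqrt hτ]
    congr 1
    field_simp
  · rw [e]
    congr 1
    field_simp
    linear_combination (-4 * Real.pi * w ^ 2) * I_sq

lemma mordell_add_one {τ : ℂ} (hτ : 0 < τ.im) (z : ℂ) :
    mordell z τ + mordell (z + 1) τ =
      2 * ((-I * τ) ^ (1 / 2 : ℂ))⁻¹ * e ((z + 1 / 2) ^ 2 / (2 * τ)) := by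
  have hA := pi_I_mul_re_neg hτ
  have h1 : |(1 : ℂ).im| ≤ |(1 : ℂ).re| := by simp
  rw [mul_assoc, ← integral_gaussian_e hτ, mordell, mordell, sechIntegral, sechIntegral,
    ← MeasureTheory.integral_add (integrable_sech hA h1) (integrable_sech hA h1),
    ← MeasureTheory.integral_const_mul]
  congr 1
  ext x
  have hc : cosh (Real.pi * 1 * x) ≠ 0 := by
    have := one_le_norm_cosh_mul h1 x
    exact norm_pos_iff.mp (by linarith)
  rw [← add_div, div_eq_iff hc, cosh]
  have e1 : cexp (Real.pi * I * τ * x ^ 2 + -2 * Real.pi * z * x) =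
      cexp (Real.pi * I * τ * x ^ 2 + -2 * Real.pi * (z + 1 / 2) * x) * cexp (Real.pi * 1 * x) := by
    rw [← exp_add]; congr 1; ring
  have e2 : cexp (Real.pi * I * τ * x ^ 2 + -2 * Real.pi * (z + 1) * x) =
      cexp (Real.pi * I * τ * x ^ 2 + -2 * Real.pi * (z + 1 / 2) * x) *
        cexp (-(Real.pi * 1 * x)) := by
    rw [← exp_add]; congr 1; ring
  rw [e1, e2]
  ring

lemma cosh_le_real (x : ℝ) : Real.exp |x| ≤ 2 * Real.cosh x := by
  rw [← Real.cosh_abs, Real.cosh_eq]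
  linarith [Real.exp_pos (-|x|)]

lemma integrable_inv_cosh : MeasureTheory.Integrable fun x : ℝ => (Real.cosh (Real.pi * x))⁻¹ := by
  refine ((integrable_exp_neg_mul_abs Real.pi_pos).const_mul 2).mono' ?_
    (Eventually.of_forall fun x => ?_)
  · refine Continuous.aestronglyMeasurable (Continuous.inv₀ (by fun_prop) fun x => ?_)
    exact (Real.cosh_pos _).ne'
  · have h1 := cosh_le_real (Real.pi * x)
    rw [abs_mul, abs_of_pos Real.pi_pos] at h1
    rw [norm_inv, Real.norm_of_nonneg (Real.cosh_pos _).le, neg_mul, Real.exp_neg,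
      inv_le_comm₀ (Real.cosh_pos _) (by positivity), mul_inv, inv_inv]
    linarith

lemma integral_inv_cosh : ∫ x : ℝ, (Real.cosh (Real.pi * x))⁻¹ = 1 := by
  have h := MeasureTheory.integral_of_hasDerivAt_of_tendsto
    (f := fun x : ℝ => 2 / Real.pi * Real.arctan (Real.exp (Real.pi * x)))
    (f' := fun x : ℝ => (Real.cosh (Real.pi * x))⁻¹) (m := 0) (n := 1) ?_ integrable_inv_cosh ?_ ?_
  · simpa using h
  · intro x
    have h1 : HasDerivAt (fun x : ℝ => Real.pi * x) Real.pi x := by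
      simpa using (hasDerivAt_id x).const_mul Real.pi
    have h2 := (h1.exp.arctan).const_mul (2 / Real.pi)
    refine h2.congr_deriv ?_
    rw [Real.cosh_eq, Real.exp_neg]
    have := Real.exp_pos (Real.pi * x)
    have := Real.pi_pos
    field_simp
    ring
  · have h1 : Tendsto (fun x : ℝ => Real.exp (Real.pi * x)) atBot (𝓝 0) :=
      Real.tendsto_exp_atBot.comp (tendsto_id.const_mul_atBot Real.pi_pos)
    have h2 := ((Real.continuous_arctan.tendsto 0).comp h1).const_mul (2 / Real.pi)
    simpa using h2
  · have h1 : Tendsto (fun x : ℝ => Real.exp (Real.pi * x)) atTop atTop :=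
      Real.tendsto_exp_atTop.comp (tendsto_id.const_mul_atTop Real.pi_pos)
    have h2 := ((Real.tendsto_arctan_atTop.mono_right nhdsWithin_le_nhds).comp h1).const_mul
      (2 / Real.pi)
    have h3 : 2 / Real.pi * (Real.pi / 2) = 1 := by
      have := Real.pi_pos; field_simp
    rwa [h3] at h2

lemma integral_inv_cosh_complex : ∫ x : ℝ, (cosh (Real.pi * x : ℂ))⁻¹ = 1 := by
  have h : ∀ x : ℝ, (cosh (Real.pi * x : ℂ))⁻¹ = (((Real.cosh (Real.pi * x))⁻¹ : ℝ) : ℂ) := by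
    intro x; push_cast; rfl
  simp only [h]
  rw [integral_complex_ofReal, integral_inv_cosh, ofReal_one]

lemma cosh_pi_ne_zero {w : ℂ} (h1 : -(1 / 2) < w.im) (h2 : w.im < 3 / 2) (hw : w ≠ I / 2) :
    cosh (Real.pi * w) ≠ 0 := by
  intro h
  have h3 := normSq_cosh (Real.pi * w)
  rw [h, norm_zero, re_ofReal_mul, im_ofReal_mul] at h3
  have h4 : Real.sinh (Real.pi * w.re) = 0 := by nlinarith [sq_nonneg (Real.cos (Real.pi * w.im))]
  have h5 : Real.cos (Real.pi * w.im) = 0 := by nlinarith [sq_nonneg (Real.sinh (Real.pi * w.re))]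
  rw [Real.sinh_eq_zero] at h4
  have h6 : w.re = 0 := by simpa [Real.pi_ne_zero] using h4
  rw [Real.cos_eq_zero_iff] at h5
  obtain ⟨k, hk⟩ := h5
  have h7 : w.im = k + 1 / 2 := by
    have := Real.pi_pos
    have h8 : Real.pi * (w.im - (k + 1 / 2)) = 0 := by linear_combination hk
    rcases mul_eq_zero.mp h8 with h | h <;> linarith
  have h8 : -1 < k := by
    have : (-1 : ℝ) < k := by linarith
    exact_mod_cast this
  have h9 : k < 1 := by
    have : (k : ℝ) < 1 := by linarith
    exact_mod_cast this
  have h10 : k = 0 := by omega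
  apply hw
  apply Complex.ext
  · simp [h6]
  · simp [h7, h10]

lemma exp_le_four_sinh {x : ℝ} (hx : 1 ≤ x) : Real.exp x ≤ 4 * Real.sinh x := by
  rw [Real.sinh_eq]
  have h1 : Real.exp (-x) ≤ Real.exp 0 := Real.exp_le_exp.mpr (by linarith)
  have h2 := Real.add_one_le_exp x
  rw [Real.exp_zero] at h1
  linarith

lemma mordell_add_tau {τ : ℂ} (hτ : 0 < τ.im) (z : ℂ) :
    mordell z τ + e (-z - τ / 2) * mordell (z + τ) τ = 2 * e (-z / 2 - τ / 8) := by
  set G : ℂ → ℂ := fun w => cexp (Real.pi * I * τ * w ^ 2 + -2 * Real.pi * z * w) with hG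
  set G₀ := G (I / 2) with hG₀
  have hGd : Differentiable ℂ G := by rw [hG]; fun_prop
  have hCd : Differentiable ℂ fun w : ℂ => cosh (Real.pi * w) := by fun_prop
  set K : ℂ → ℂ := dslope (fun w : ℂ => cosh (Real.pi * w)) (I / 2) with hK
  have hc0 : cosh (Real.pi * (I / 2)) = 0 := by
    rw [show (Real.pi : ℂ) * (I / 2) = ((Real.pi / 2 : ℝ) : ℂ) * I by push_cast; ring, cosh_mul_I,
      ← ofReal_cos, Real.cos_pi_div_two, ofReal_zero]
  have hKd : Differentiable ℂ K := fun w =>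
    ((differentiableOn_dslope (c := I / 2) univ_mem).mpr hCd.differentiableOn).differentiableAt
      univ_mem
  have hDd : Differentiable ℂ (dslope G (I / 2)) := fun w =>
    ((differentiableOn_dslope (c := I / 2) univ_mem).mpr hGd.differentiableOn).differentiableAt
      univ_mem
  have hK0 : ∀ w : ℂ, -(1 / 2) < w.im → w.im < 3 / 2 → K w ≠ 0 := by
    intro w h1 h2
    by_cases hw : w = I / 2
    · have h3 : HasDerivAt (fun w : ℂ => cosh (Real.pi * w)) (sinh (Real.pi * (I / 2)) * Real.pi)
          (I / 2) := by
        have := (hasDerivAt_id (I / 2 : ℂ)).const_mul (Real.pi : ℂ)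
        simp only [id, mul_one] at this
        exact this.ccosh
      rw [hw, hK, dslope_same, h3.deriv,
        show (Real.pi : ℂ) * (I / 2) = ((Real.pi / 2 : ℝ) : ℂ) * I by push_cast; ring, sinh_mul_I,
        ← ofReal_sin, Real.sin_pi_div_two]
      simp [Real.pi_ne_zero]
    · rw [hK, dslope_of_ne _ hw, slope_def_field, hc0, sub_zero]
      exact div_ne_zero (cosh_pi_ne_zero h1 h2 hw) (sub_ne_zero.mpr hw)
  set f : ℂ → ℂ := fun w => dslope G (I / 2) w / K w with hf
  have hfe : ∀ w : ℂ, w ≠ I / 2 → f w = (G w - G₀) / cosh (Real.pi * w) := by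
    intro w hw
    simp only [hf, hK]
    rw [dslope_of_ne _ hw, dslope_of_ne _ hw, slope_def_field, slope_def_field, hc0, sub_zero,
      div_div_div_cancel_right₀ (sub_ne_zero.mpr hw)]
  have hfd : ∀ w : ℂ, -(1 / 2) < w.im → w.im < 3 / 2 → DifferentiableAt ℂ f w := fun w h1 h2 =>
    (hDd w).fun_div (hKd w) (hK0 w h1 h2)
  obtain ⟨C₁, hC₁⟩ := ((isCompact_Icc (a := (-1 : ℝ)) (b := 1)).reProdIm
    (isCompact_Icc (a := (-1 / 4 : ℝ)) (b := 5 / 4))).exists_bound_of_continuousOn (f := f) (by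
      intro w hw
      rw [mem_reProdIm] at hw
      exact (hfd w (by linarith [hw.2.1]) (by linarith [hw.2.2])).continuousAt.continuousWithinAt)
  obtain ⟨C₂, hC₂⟩ : ∃ C₂ : ℝ, ∀ w : ℂ, -1 / 4 ≤ w.im → w.im ≤ 5 / 4 → ‖G w‖ ≤ C₂ := by
    refine ⟨Real.exp ((2 * Real.pi * ‖τ‖ * 2 + 2 * Real.pi * ‖z‖) ^ 2 / (2 * (Real.pi * τ.im))) *
      Real.exp (Real.pi * ‖τ‖ * 4 + 2 * Real.pi * ‖z‖ * 2), fun w h1 h2 => ?_⟩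
    have habs : |w.im| ≤ 2 := abs_le.mpr ⟨by linarith, by linarith⟩
    have e1 : G w = cexp (Real.pi * I * τ * (w.re : ℂ) ^ 2 +
        (-(2 * Real.pi * τ * w.im + 2 * Real.pi * z)) * (w.re : ℂ)) *
        cexp (-(Real.pi * τ * I * w.im ^ 2 + 2 * Real.pi * z * (I * w.im))) := by
      rw [← exp_add]
      simp only [hG]
      congr 1
      conv_lhs => rw [← re_add_im w]
      linear_combination (2 * Real.pi * τ * w.re * w.im + Real.pi * I * τ * w.im ^ 2) * I_sq
    have hpi : ‖(Real.pi : ℂ)‖ = Real.pi := by rw [norm_real, Real.norm_of_nonneg Real.pi_pos.le]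
    rw [e1, norm_mul]
    refine mul_le_mul ?_ ?_ (norm_nonneg _) (Real.exp_pos _).le
    · refine (norm_cexp_quadratic_le (δ := Real.pi * τ.im) (mul_pos Real.pi_pos hτ)
        (pi_I_mul_re τ).le (R := 2 * Real.pi * ‖τ‖ * 2 + 2 * Real.pi * ‖z‖) ?_ _).trans ?_
      · rw [norm_neg]
        refine (norm_add_le _ _).trans ?_
        simp only [norm_mul, hpi, norm_real, RCLike.norm_ofNat, Real.norm_eq_abs]
        gcongr
      · refine mul_le_of_le_one_right (Real.exp_pos _).le (Real.exp_le_one_iff.mpr ?_)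
        have := mul_pos Real.pi_pos hτ
        nlinarith [sq_nonneg w.re]
    · rw [norm_exp]
      refine Real.exp_le_exp.mpr ((re_le_norm _).trans ?_)
      rw [norm_neg]
      refine (norm_add_le _ _).trans ?_
      simp only [norm_mul, hpi, norm_real, RCLike.norm_ofNat, Real.norm_eq_abs, norm_pow, norm_I,
        mul_one, one_mul]
      have : |w.im| ^ 2 ≤ 4 := by nlinarith [abs_nonneg w.im]
      gcongr
  have hC₂0 : 0 ≤ C₂ := (norm_nonneg _).trans (hC₂ 0 (by norm_num) (by norm_num))
  have hbound : ∀ w : ℂ, -1 / 4 < w.im → w.im < 5 / 4 →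
      ‖f w‖ ≤ (|C₁| * Real.exp Real.pi + 4 * (C₂ + ‖G₀‖)) * Real.exp (-Real.pi * |w.re|) := by
    intro w h1 h2
    have hp := Real.pi_pos
    by_cases hw : |w.re| ≤ 1
    · have h3 := hC₁ w (by
        rw [mem_reProdIm]; exact ⟨abs_le.mp hw, h1.le, h2.le⟩)
      have h4 : 1 ≤ Real.exp Real.pi * Real.exp (-Real.pi * |w.re|) := by
        rw [← Real.exp_add]; exact Real.one_le_exp (by nlinarith)
      have h5 : 0 ≤ 4 * (C₂ + ‖G₀‖) * Real.exp (-Real.pi * |w.re|) := by positivity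
      nlinarith [mul_le_mul_of_nonneg_left h4 (abs_nonneg C₁), le_abs_self C₁]
    · push Not at hw
      have hne : w ≠ I / 2 := by rintro rfl; simp at hw; linarith
      rw [hfe w hne, norm_div]
      have h3 := sinh_le_norm_cosh (Real.pi * w)
      rw [re_ofReal_mul, abs_mul, abs_of_pos hp] at h3
      have h4 := exp_le_four_sinh (x := Real.pi * |w.re|) (by nlinarith [Real.pi_gt_three])
      have h5 : ‖G w - G₀‖ ≤ C₂ + ‖G₀‖ := (norm_sub_le _ _).trans (by linarith [hC₂ w h1.le h2.le])
      have h6 : 0 < Real.exp (Real.pi * |w.re|) := Real.exp_pos _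
      have h7 : 0 ≤ C₂ + ‖G₀‖ := by positivity
      calc ‖G w - G₀‖ / ‖cosh (Real.pi * w)‖ ≤ (C₂ + ‖G₀‖) / (Real.exp (Real.pi * |w.re|) / 4) := by
            gcongr; linarith
        _ = 4 * (C₂ + ‖G₀‖) * Real.exp (-Real.pi * |w.re|) := by
            rw [neg_mul, Real.exp_neg]; field_simp
        _ ≤ _ := by gcongr; nlinarith [abs_nonneg C₁, Real.exp_pos Real.pi]
  have hshift := integral_horizontal_line_eq Real.pi_pos (fun w h1 h2 => hfd w (by linarith)
    (by linarith)) hbound (a := 0) (b := 1) (by norm_num) (by norm_num) (by norm_num) (by norm_num)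
  simp only [ofReal_zero, zero_mul, add_zero, ofReal_one, one_mul] at hshift
  have hA := pi_I_mul_re_neg hτ
  have hone : |(1 : ℂ).im| ≤ |(1 : ℂ).re| := by simp
  have hi : MeasureTheory.Integrable fun x : ℝ => G₀ * (cosh (Real.pi * x : ℂ))⁻¹ := by
    refine MeasureTheory.Integrable.const_mul ?_ _
    have h : ∀ x : ℝ, (cosh (Real.pi * x : ℂ))⁻¹ = (((Real.cosh (Real.pi * x))⁻¹ : ℝ) : ℂ) := by
      intro x; push_cast; rfl
    simp only [h]
    exact integrable_inv_cosh.ofReal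
  have i0 : ∫ x : ℝ, f x = mordell z τ - G₀ := by
    have h1 : ∀ x : ℝ, f x = cexp (Real.pi * I * τ * x ^ 2 + -2 * Real.pi * z * x) /
        cosh (Real.pi * 1 * x) - G₀ * (cosh (Real.pi * x : ℂ))⁻¹ := by
      intro x
      rw [hfe _ (fun h => by simpa using congrArg Complex.im h)]
      rw [mul_one, sub_div, ← div_eq_mul_inv]
    simp only [h1]
    rw [MeasureTheory.integral_sub (integrable_sech hA hone) hi, MeasureTheory.integral_const_mul,
      integral_inv_cosh_complex, mul_one G₀]
    rfl
  have i1 : ∫ x : ℝ, f (x + I) = G₀ - e (-z - τ / 2) * mordell (z + τ) τ := by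
    have h1 : ∀ x : ℝ, f (x + I) = G₀ * (cosh (Real.pi * x : ℂ))⁻¹ - e (-z - τ / 2) *
        (cexp (Real.pi * I * τ * x ^ 2 + -2 * Real.pi * (z + τ) * x) / cosh (Real.pi * 1 * x)) := by
      intro x
      have hne : (x : ℂ) + I ≠ I / 2 := fun h => by
        have := congrArg Complex.im h
        norm_num at this
      have hcs : cosh (Real.pi * ((x : ℂ) + I)) = -cosh (Real.pi * x) := by
        rw [mul_add, cosh_add, cosh_mul_I, sinh_mul_I]; simp
      rw [hfe _ hne, hcs, mul_one]
      have : G (x + I) = e (-z - τ / 2) *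
          cexp (Real.pi * I * τ * x ^ 2 + -2 * Real.pi * (z + τ) * x) := by
        rw [e, ← exp_add]
        simp only [hG]
        congr 1
        linear_combination (2 * Real.pi * τ * x + Real.pi * I * τ) * I_sq
      rw [this, div_neg, ← div_eq_mul_inv]
      ring
    simp only [h1]
    rw [MeasureTheory.integral_sub hi ((integrable_sech hA hone).const_mul _),
      MeasureTheory.integral_const_mul, integral_inv_cosh_complex, mul_one G₀,
      MeasureTheory.integral_const_mul]
    rfl
  rw [i0, i1] at hshift
  have hG0 : G₀ = e (-z / 2 - τ / 8) := by
    simp only [hG₀, hG, e]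
    congr 1
    linear_combination (Real.pi * I * τ / 4) * I_sq
  rw [← hG0]
  linear_combination -hshift

/-- The Mordell integral at a point that moves with `τ` continues across the nonzero reals. -/
lemma exists_analyticAt_mordell (α β : ℂ) {y : ℝ} (hy : y ≠ 0) :
    ∃ A : ℂ → ℂ, AnalyticAt ℂ A y ∧
      ∀ᶠ τ in 𝓝 (y : ℂ), 0 < τ.im → mordell (α * τ + β) τ = A τ := by
  obtain ⟨s, hs, hs1⟩ : ∃ s : ℝ, 0 < s * y ∧ s ^ 2 = 1 := by
    rcases hy.lt_or_gt with h | h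
    · exact ⟨-1, by linarith, by norm_num⟩
    · exact ⟨1, by linarith, by norm_num⟩
  set w : ℂ := 1 + (s / 2 : ℝ) * I with hw
  have wim : w.im = s / 2 := by simp [hw]
  have wre : w.re = 1 := by simp [hw]
  have hlt : |w.im| < w.re := by
    rw [wim, wre]
    have : (s / 2) ^ 2 < 1 ^ 2 := by rw [div_pow, hs1]; norm_num
    exact abs_lt_of_sq_lt_sq this (by norm_num)
  have w2 : w ^ 2 = (3 / 4 : ℝ) + s * I := by
    rw [hw]
    have : (s : ℂ) ^ 2 = 1 := by exact_mod_cast hs1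
    push_cast
    linear_combination (s ^ 2 / 4 : ℂ) * I_sq - this / 4
  have him1 : ∀ τ : ℂ, (τ * w).im = s / 2 * τ.re + τ.im := by
    intro τ; rw [mul_im, wim, wre]; ring
  have him2 : ∀ τ : ℂ, (τ * w ^ 2).im = s * τ.re + 3 / 4 * τ.im := by
    intro τ; rw [mul_im, w2]; simp; ring
  set A : ℂ → ℂ := fun τ => w * sechIntegral (Real.pi * I * τ * w ^ 2)
    (-2 * Real.pi * (α * τ + β) * w) w
  have hre : ∀ τ : ℂ, (Real.pi * I * τ * w ^ 2).re = -(Real.pi * (τ * w ^ 2).im) := by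
    intro τ; rw [mul_assoc _ τ, pi_I_mul_re]
  have hA : ∀ τ : ℂ, 0 < (τ * w ^ 2).im → DifferentiableAt ℂ A τ := by
    intro τ hτ
    refine DifferentiableAt.const_mul ?_ _
    refine differentiableAt_sechIntegral (A := fun τ => Real.pi * I * τ * w ^ 2)
      (B := fun τ => -2 * Real.pi * (α * τ + β) * w) (w := fun _ => w)
      (Eventually.of_forall fun s => by fun_prop)
      (Eventually.of_forall fun s => by fun_prop) (Eventually.of_forall fun s => by fun_prop) ?_
      (hlt.trans_le (le_abs_self _))
    rw [hre]; have := mul_pos Real.pi_pos hτ; linarith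
  have c2 : Continuous fun τ : ℂ => (τ * w ^ 2).im := by fun_prop
  have hopen : {τ : ℂ | 0 < (τ * w ^ 2).im} ∈ 𝓝 (y : ℂ) :=
    (isOpen_lt continuous_const c2).mem_nhds (by
      rw [Set.mem_ofPred_eq, him2]; simpa using hs)
  have c3 : Continuous fun τ : ℂ => s * τ.re := by fun_prop
  have hopen' : {τ : ℂ | 0 < s * τ.re} ∈ 𝓝 (y : ℂ) :=
    (isOpen_lt continuous_const c3).mem_nhds (by simpa using hs)
  refine ⟨A, ?_, ?_⟩
  · refine DifferentiableOn.analyticAt (s := {τ : ℂ | 0 < (τ * w ^ 2).im}) (fun τ hτ => ?_) hopen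
    exact (hA τ hτ).differentiableWithinAt
  · filter_upwards [hopen, hopen'] with τ h1 h2 hτ
    exact (sechIntegral_rotate hτ (by rw [him1]; linarith) h1 hlt).symm

end EtaTheta

open Complex Filter Topology
namespace EtaTheta

/-! ### Square roots -/

lemma mul_cpow_of_arg {x y : ℂ} (s : ℂ) (hx : x ≠ 0) (hy : y ≠ 0)
    (h : arg x + arg y ∈ Set.Ioc (-Real.pi) Real.pi) : (x * y) ^ s = x ^ s * y ^ s := by
  rw [cpow_def_of_ne_zero (mul_ne_zero hx hy), cpow_def_of_ne_zero hx, cpow_def_of_ne_zero hy,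
    (log_mul_eq_add_log_iff hx hy).mpr h, add_mul, exp_add]

lemma mul_cpow_of_re_pos {x y : ℂ} (s : ℂ) (hx : 0 < x.re) (hy : 0 < y.re) :
    (x * y) ^ s = x ^ s * y ^ s := by
  refine mul_cpow_of_arg s (by rintro rfl; simp at hx) (by rintro rfl; simp at hy) ?_
  have h1 := abs_lt.mp (abs_arg_lt_pi_div_two_iff.mpr (Or.inl hx))
  have h2 := abs_lt.mp (abs_arg_lt_pi_div_two_iff.mpr (Or.inl hy))
  constructor <;> linarith [h1.1, h1.2, h2.1, h2.2]

lemma neg_I_cpow_half : (-I) ^ (1 / 2 : ℂ) = e (-1 / 8) := by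
  rw [cpow_def_of_ne_zero (by simp), log_neg_I, e]
  congr 1; ring

lemma neg_I_mul_cpow_half {w : ℂ} (hw : 0 < w.im) :
    (-I * w) ^ (1 / 2 : ℂ) = e (-1 / 8) * w ^ (1 / 2 : ℂ) := by
  rw [mul_cpow_of_arg _ (by simp) (ne_zero_of_im_pos hw), neg_I_cpow_half]
  rw [arg_neg_I]
  have h1 := arg_le_pi w
  have h2 : 0 ≤ arg w := arg_nonneg_iff.mpr hw.le
  constructor <;> linarith [Real.pi_pos]

lemma cpow_half_sq (w : ℂ) : (w ^ (1 / 2 : ℂ)) ^ 2 = w := by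
  rw [← cpow_nat_mul]; simp

lemma cpow_neg_half (w : ℂ) : w ^ (-1 / 2 : ℂ) = (w ^ (1 / 2 : ℂ))⁻¹ := by
  rw [neg_div, cpow_neg]

lemma cpow_half_ne_zero {w : ℂ} (hw : w ≠ 0) : w ^ (1 / 2 : ℂ) ≠ 0 := by
  intro h
  have := cpow_half_sq w
  rw [h] at this
  exact hw (by simpa using this.symm)

lemma one_half_cpow_half : (1 / 2 : ℂ) ^ (1 / 2 : ℂ) = ((√2 / 2 : ℝ) : ℂ) := by
  rw [show (1 / 2 : ℂ) = ((1 / 2 : ℝ) : ℂ) by push_cast; rfl,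
    ← ofReal_cpow (by norm_num), ← Real.sqrt_eq_rpow]
  congr 1
  rw [Real.sqrt_div' _ (by norm_num), Real.sqrt_one, Real.sqrt_div_self']

lemma e_eighth : e (1 / 8) = (1 + I) * ((√2 / 2 : ℝ) : ℂ) := by
  rw [e, show 2 * (Real.pi : ℂ) * I * (1 / 8) = ((Real.pi / 4 : ℝ) : ℂ) * I by push_cast; ring,
    exp_mul_I, ← ofReal_cos, ← ofReal_sin, Real.cos_pi_div_four, Real.sin_pi_div_four]
  ring

/-! ### Transformation of `μ` under `S` -/

lemma div_two_mul_I (w : ℂ) : w / (2 * I) = -I / 2 * w := by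
  rw [div_eq_mul_inv, mul_inv, inv_I]; ring

lemma mu_S {τ u v : ℂ} (hτ : 0 < τ.im) (hu : theta u τ ≠ 0) (hv : theta v τ ≠ 0) :
    mu u v τ + ((-I * τ) ^ (1 / 2 : ℂ))⁻¹ * e ((u - v) ^ 2 / (2 * τ)) * mu (u / τ) (v / τ) (-1 / τ) =
      mordell (u - v) τ / (2 * I) := by
  have h0 := ne_zero_of_im_pos hτ
  have hτ' := neg_inv_im_pos hτ
  have hs := sqrt_ne_zero hτ
  have hs2 := cpow_half_sq (-I * τ)
  have hne : ∀ {w}, theta w τ ≠ 0 → theta (w / τ) (-1 / τ) ≠ 0 := by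
    intro w hw
    rw [theta_S hτ]
    exact mul_ne_zero (mul_ne_zero (mul_ne_zero (by simp) hs) (e_ne_zero _)) hw
  set r := (-I * τ) ^ (1 / 2 : ℂ) with hr
  have key := eq_zero_of_quasiperiodic (f := fun u => mu u v τ + r⁻¹ * e ((u - v) ^ 2 / (2 * τ)) *
    mu (u / τ) (v / τ) (-1 / τ) - mordell (u - v) τ / (2 * I)) hτ hv ?_ ?_ ?_ ?_ hu
  · exact sub_eq_zero.mp key
  · intro u hu
    have d1 := differentiableAt_mu hτ v hu
    have d2 : DifferentiableAt ℂ (fun u => mu (u / τ) (v / τ) (-1 / τ)) u :=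
      (differentiableAt_mu hτ' (v / τ) (hne hu)).comp u (f := fun u => u / τ) (by fun_prop)
    have d3 : DifferentiableAt ℂ (fun u => mordell (u - v) τ) u :=
      (differentiable_mordell hτ).differentiableAt.comp u (f := fun u => u - v) (by fun_prop)
    fun_prop
  · have t1 : ∀ {σ : ℂ} (v : ℂ), 0 < σ.im → Tendsto (fun u => u * mu u v σ) (𝓝[≠] 0)
        (𝓝 (-(2 * Real.pi * I)⁻¹ / theta v σ)) := by
      intro σ v hσ
      have c : ContinuousAt (fun u : ℂ => e (u / 2) / theta v σ) 0 := by
        have : ContinuousAt (fun u : ℂ => e (u / 2)) 0 := by fun_prop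
        exact this.div_const _
      have := (c.tendsto.mono_left nhdsWithin_le_nhds).mul (tendsto_mul_appell hσ v)
      simp only [zero_div, e_zero] at this
      rw [one_div_mul_eq_div] at this
      refine this.congr fun u => ?_
      rw [mu_eq]; ring
    have hm : Tendsto (fun u : ℂ => u / τ) (𝓝[≠] 0) (𝓝[≠] 0) := by
      refine tendsto_nhdsWithin_iff.mpr ⟨?_, ?_⟩
      · have : ContinuousAt (fun u : ℂ => u / τ) 0 := by fun_prop
        have h := this.tendsto
        rw [zero_div] at h
        exact h.mono_left nhdsWithin_le_nhds
      · filter_upwards [self_mem_nhdsWithin] with u hu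
        simpa [h0] using hu
    have t2 := ((t1 (v / τ) hτ').comp hm).const_mul τ
    have c2 : ContinuousAt (fun u : ℂ => r⁻¹ * e ((u - v) ^ 2 / (2 * τ))) 0 := by fun_prop
    have t3 := (c2.tendsto.mono_left nhdsWithin_le_nhds).mul t2
    have c4 : ContinuousAt (fun u : ℂ => u * (mordell (u - v) τ / (2 * I))) 0 := by
      have d3 : DifferentiableAt ℂ (fun u => mordell (u - v) τ) 0 :=
        (differentiable_mordell hτ).differentiableAt.comp 0 (f := fun u => u - v) (by fun_prop)
      have := d3.continuousAt
      fun_prop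
    have t4 := ((t1 v hτ).add t3).sub (c4.tendsto.mono_left nhdsWithin_le_nhds)
    convert t4 using 2 with u
    · simp only [Function.comp]
      have : τ * (u / τ * mu (u / τ) (v / τ) (-1 / τ)) = u * mu (u / τ) (v / τ) (-1 / τ) := by
        field_simp
      rw [this]; ring
    · rw [theta_S hτ, ← hr]
      have hE := e_ne_zero (v ^ 2 / (2 * τ))
      have hE2 : e ((0 - v) ^ 2 / (2 * τ)) = e (v ^ 2 / (2 * τ)) := by rw [zero_sub, neg_sq]
      rw [hE2]
      generalize e (v ^ 2 / (2 * τ)) = E at *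
      generalize theta v τ = T at *
      have hpi : (Real.pi : ℂ) ≠ 0 := by exact_mod_cast Real.pi_ne_zero
      have hT := hv
      field_simp
      have : r ^ 2 * I = τ := by rw [hs2]; linear_combination (-τ) * I_sq
      rw [zero_mul]
      linear_combination this
  · intro u hu
    have e1 : (u + 1) / τ = u / τ - (-1 / τ) := by ring
    have m1 : mu (u / τ) (v / τ) (-1 / τ) = -e ((u - v) / τ + 1 / (2 * τ)) *
        mu ((u + 1) / τ) (v / τ) (-1 / τ) - I * e ((u - v) / (2 * τ) + 1 / (8 * τ)) := by
      have hu1 : theta ((u + 1) / τ) (-1 / τ) ≠ 0 := hne (theta_add_int_ne_zero.mpr hu)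
      have := mu_add_tau_left hτ' hu1 (hne hv)
      rw [e1, sub_add_cancel, ← e1] at this
      have c1 : (u + 1) / τ - v / τ + -1 / τ / 2 = (u - v) / τ + 1 / (2 * τ) := by field_simp; ring
      have c2 : ((u + 1) / τ - v / τ) / 2 + 3 * (-1 / τ) / 8 = (u - v) / (2 * τ) + 1 / (8 * τ) := by
        field_simp; ring
      rw [this, c1, c2]
    have h1 := mordell_add_one hτ (u - v)
    rw [show u - v + 1 = u + 1 - v by ring, ← hr] at h1
    simp only [mu_add_one_left]
    rw [m1]
    have a1 : e ((u - v) ^ 2 / (2 * τ)) * e ((u - v) / τ + 1 / (2 * τ)) =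
        e ((u + 1 - v) ^ 2 / (2 * τ)) := by
      rw [← e_add]; congr 1; field_simp; ring
    have a2 : e ((u - v) ^ 2 / (2 * τ)) * e ((u - v) / (2 * τ) + 1 / (8 * τ)) =
        e ((u - v + 1 / 2) ^ 2 / (2 * τ)) := by
      rw [← e_add]; congr 1; field_simp; ring
    have h1' : mordell (u + 1 - v) τ = 2 * r⁻¹ * e ((u - v + 1 / 2) ^ 2 / (2 * τ)) -
      mordell (u - v) τ := by linear_combination h1
    rw [h1', ← a2, ← a1]
    simp only [div_two_mul_I]
    ring
  · intro u hu
    have h2 := mordell_add_tau hτ (u - v)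
    rw [show u - v + τ = u + τ - v by ring] at h2
    have a0 : e (u - v + τ / 2) * e (-(u - v) - τ / 2) = 1 := by
      rw [← e_add, ← e_zero]; congr 1; ring
    have a1 : e (u - v + τ / 2) * e (-(u - v) / 2 - τ / 8) = e ((u - v) / 2 + 3 * τ / 8) := by
      rw [← e_add]; congr 1; ring
    have h2' : mordell (u + τ - v) τ = e (u - v + τ / 2) * (2 * e (-(u - v) / 2 - τ / 8) -
        mordell (u - v) τ) := by
      linear_combination (e (u - v + τ / 2)) * h2 - mordell (u + τ - v) τ * a0
    have e1 : (u + τ) / τ = u / τ + 1 := by field_simp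
    have a2 : e ((u + τ - v) ^ 2 / (2 * τ)) = e ((u - v) ^ 2 / (2 * τ)) * e (u - v + τ / 2) := by
      rw [← e_add]; congr 1; field_simp; ring
    simp only [mu_add_tau_left hτ hu hv, e1, mu_add_one_left, h2', a2]
    simp only [div_two_mul_I]
    rw [← a1]
    ring

/-! ### Transformation of `μ` under `M₁` and `M₂` -/

lemma div_linear_im_pos {τ : ℂ} (hτ : 0 < τ.im) (r : ℝ) : 0 < (τ / (r * τ + 1)).im := by
  have h1 : (r : ℂ) * τ + 1 ≠ 0 := by
    intro h
    have h2 := congrArg Complex.im h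
    have h3 := congrArg Complex.re h
    simp at h2 h3
    rcases h2 with h2 | h2
    · simp [h2] at h3
    · linarith
  have h2 : 0 < normSq ((r : ℂ) * τ + 1) := normSq_pos.mpr h1
  rw [div_im]
  have : τ.im * ((r : ℂ) * τ + 1).re / normSq ((r : ℂ) * τ + 1) -
      τ.re * ((r : ℂ) * τ + 1).im / normSq ((r : ℂ) * τ + 1) =
      τ.im / normSq ((r : ℂ) * τ + 1) := by simp; ring
  rw [this]
  positivity

lemma two_mul_add_one_im {τ : ℂ} (hτ : 0 < τ.im) : 0 < (2 * τ + 1).im := by simp [hτ]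

lemma theta_M2 {τ : ℂ} (hτ : 0 < τ.im) (v : ℂ) :
    theta (v / (2 * τ + 1)) (τ / (2 * τ + 1)) =
      -I * (2 * τ + 1) ^ (1 / 2 : ℂ) * e (v ^ 2 / (2 * τ + 1)) * theta v τ := by
  have h0 := ne_zero_of_im_pos hτ
  have h1 := ne_zero_of_im_pos (two_mul_add_one_im hτ)
  set σ : ℂ := -1 / τ - 1 - 1 with hσ
  have hσi : 0 < σ.im := by simpa [hσ] using neg_inv_im_pos hτ
  have hσ0 := ne_zero_of_im_pos hσi
  have hσe : σ = -(2 * τ + 1) / τ := by rw [hσ]; field_simp; ring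
  have a1 := theta_S hσi (v / τ)
  have a2 := theta_S hτ v
  have a3 : theta (v / τ) (-1 / τ) = e (1 / 8) * (e (1 / 8) * theta (v / τ) σ) := by
    rw [← theta_tau_add_one, ← theta_tau_add_one, hσ]; congr 1; ring
  have a4 : v / τ / σ = -(v / (2 * τ + 1)) := by rw [hσe]; field_simp
  have a5 : -1 / σ = τ / (2 * τ + 1) := by rw [hσe]; field_simp
  rw [a4, a5, theta_neg] at a1
  have a6 : (-I * σ) ^ (1 / 2 : ℂ) * (-I * τ) ^ (1 / 2 : ℂ) = (2 * τ + 1) ^ (1 / 2 : ℂ) := by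
    rw [← mul_cpow_of_re_pos _ (by simpa using hσi) (by simpa using hτ)]
    congr 1
    rw [hσe]; field_simp; rw [I_sq]; ring
  have a7 : e (1 / 8) * e (1 / 8) = I := by rw [I_eq_e, ← e_add]; congr 1; ring
  have a8 : theta (v / τ) σ = -I * theta (v / τ) (-1 / τ) := by
    rw [a3, ← mul_assoc (e _), a7, ← mul_assoc]; simp
  have a9 : e ((v / τ) ^ 2 / (2 * σ)) * e (v ^ 2 / (2 * τ)) = e (v ^ 2 / (2 * τ + 1)) := by
    rw [← e_add, hσe]
    congr 1
    have hτd : τ = (2 * τ + 1 - 1) / 2 := by ring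
    generalize 2 * τ + 1 = d at *
    have hd0 : d - 1 ≠ 0 := by intro h; rw [h] at hτd; simp at hτd; exact h0 hτd
    rw [hτd]
    field_simp
    ring
  rw [a8, a2] at a1
  rw [← a6, ← a9]
  linear_combination -a1 - (-I * (-I * σ) ^ (1 / 2 : ℂ) * e ((v / τ) ^ 2 / (2 * σ)) * (-I * τ) ^ (1 / 2 : ℂ) * e (v ^ 2 / (2 * τ)) * theta v τ) * I_sq

/-- The period function of `μ` for `M₂`. -/
noncomputable def mordellTwo (z τ : ℂ) : ℂ :=
  e (-3 / 16) * ((√2 / 4 : ℝ) : ℂ) * (mordell (z - 1 / 4) (τ + 1 / 2) + mordell (z + 1 / 4) (τ + 1 / 2))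

lemma sqrt_two_cast_sq : ((√2 / 2 : ℝ) : ℂ) ^ 2 = 1 / 2 := by
  rw [← ofReal_pow, div_pow, Real.sq_sqrt (by norm_num)]; norm_num

lemma neg_I_mul_add_half {τ : ℂ} (hτ : 0 < τ.im) :
    (-I * (τ + 1 / 2)) ^ (1 / 2 : ℂ) =
      e (-1 / 8) * ((√2 / 2 : ℝ) : ℂ) * (2 * τ + 1) ^ (1 / 2 : ℂ) := by
  have h1 : 0 < (τ + 1 / 2).im := by simpa using hτ
  have h2 : τ + 1 / 2 = 1 / 2 * (2 * τ + 1) := by ring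
  rw [neg_I_mul_cpow_half h1, h2, mul_cpow_of_arg _ (by norm_num)
    (ne_zero_of_im_pos (two_mul_add_one_im hτ)), one_half_cpow_half]
  · ring
  · have : arg (1 / 2 : ℂ) = 0 := by
      rw [show (1 / 2 : ℂ) = ((1 / 2 : ℝ) : ℂ) by push_cast; rfl]
      exact arg_ofReal_of_nonneg (by norm_num)
    rw [this, zero_add]
    exact ⟨neg_pi_lt_arg _, arg_le_pi _⟩

lemma mordell_half_add_one {τ : ℂ} (hτ : 0 < τ.im) (z : ℂ) :
    e (-3 / 16) * ((√2 / 4 : ℝ) : ℂ) * (mordell z (τ + 1 / 2) + mordell (z + 1) (τ + 1 / 2)) =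
      ((2 * τ + 1) ^ (1 / 2 : ℂ))⁻¹ * e (-1 / 16) * e ((z + 1 / 2) ^ 2 / (2 * τ + 1)) := by
  have h1 : 0 < (τ + 1 / 2).im := by simpa using hτ
  have hr := cpow_half_ne_zero (ne_zero_of_im_pos (two_mul_add_one_im hτ))
  have hq := sqrt_two_cast_sq
  have hq0 : ((√2 / 2 : ℝ) : ℂ) ≠ 0 := by intro h; rw [h] at hq; norm_num at hq
  have hq4 : ((√2 / 4 : ℝ) : ℂ) = ((√2 / 2 : ℝ) : ℂ) / 2 := by push_cast; ring
  rw [mordell_add_one h1, neg_I_mul_add_half hτ, hq4,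
    show 2 * (τ + 1 / 2) = 2 * τ + 1 by ring]
  have a1 : e (-3 / 16) = e (-1 / 8) * e (-1 / 16) := by rw [← e_add]; congr 1; ring
  rw [a1]
  have hE := e_ne_zero (-1 / 8)
  generalize e ((z + 1 / 2) ^ 2 / (2 * τ + 1)) = E at *
  generalize e (-1 / 8) = E1 at *
  generalize e (-1 / 16) = E2 at *
  field_simp

lemma mordellTwo_add_one {τ : ℂ} (hτ : 0 < τ.im) (z : ℂ) :
    mordellTwo z τ + mordellTwo (z + 1) τ = ((2 * τ + 1) ^ (1 / 2 : ℂ))⁻¹ * e (-1 / 16) *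
      (e ((z + 1 / 4) ^ 2 / (2 * τ + 1)) + e ((z + 3 / 4) ^ 2 / (2 * τ + 1))) := by
  have a1 := mordell_half_add_one hτ (z - 1 / 4)
  have a2 := mordell_half_add_one hτ (z + 1 / 4)
  rw [show z - 1 / 4 + 1 = z + 1 - 1 / 4 by ring, show z - 1 / 4 + 1 / 2 = z + 1 / 4 by ring] at a1
  rw [show z + 1 / 4 + 1 = z + 1 + 1 / 4 by ring, show z + 1 / 4 + 1 / 2 = z + 3 / 4 by ring] at a2
  rw [mordellTwo, mordellTwo]
  linear_combination a1 + a2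

lemma mordell_shift {σ : ℂ} (hσ : 0 < σ.im) (w : ℂ) :
    mordell (w + σ) σ = 2 * e (w / 2 + 3 * σ / 8) - e (w + σ / 2) * mordell w σ := by
  have h2 := mordell_add_tau hσ w
  have a0 : e (w + σ / 2) * e (-w - σ / 2) = 1 := by
    rw [← e_add, ← e_zero]; congr 1; ring
  have a1 : e (w + σ / 2) * e (-w / 2 - σ / 8) = e (w / 2 + 3 * σ / 8) := by
    rw [← e_add]; congr 1; ring
  linear_combination (e (w + σ / 2)) * h2 - mordell (w + σ) σ * a0 + 2 * a1

lemma e_sum_sixteenths : ((√2 / 2 : ℝ) : ℂ) * (e (-3 / 8) + e (-1 / 8)) = -I := by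
  have h1 : e (-1 / 8) = (e (1 / 8))⁻¹ := by rw [← e_neg]; congr 1; ring
  have h2 : e (-3 / 8) = -e (1 / 8) := e_congr_neg (-1) (by push_cast; ring)
  have hq := sqrt_two_cast_sq
  have h3 : e (1 / 8) ≠ 0 := e_ne_zero _
  rw [h1, h2]
  have h4 := e_eighth
  generalize e (1 / 8) = E at *
  generalize ((√2 / 2 : ℝ) : ℂ) = q at *
  field_simp
  subst h4
  linear_combination (-2 * I * q) * hq - (q ^ 3) * I_sq + q * I_sq

lemma mordellTwo_add_tau_aux {τ : ℂ} (hτ : 0 < τ.im) (z : ℂ) :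
    mordellTwo (z + τ) τ = -I * e (z / 2 + 3 * τ / 8) + e (-3 / 16) * ((√2 / 4 : ℝ) : ℂ) *
      (e (z + τ / 2) * (mordell (z - 3 / 4) (τ + 1 / 2) - mordell (z - 1 / 4) (τ + 1 / 2))) := by
  have h1 : 0 < (τ + 1 / 2).im := by simpa using hτ
  have a1 := mordell_shift h1 (z - 3 / 4)
  have a2 := mordell_shift h1 (z - 1 / 4)
  rw [show z - 3 / 4 + (τ + 1 / 2) = z + τ - 1 / 4 by ring] at a1
  rw [show z - 1 / 4 + (τ + 1 / 2) = z + τ + 1 / 4 by ring] at a2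
  have b1 : e (z - 3 / 4 + (τ + 1 / 2) / 2) = -e (z + τ / 2) := e_congr_neg (-1) (by push_cast; ring)
  have b2 : e (z - 1 / 4 + (τ + 1 / 2) / 2) = e (z + τ / 2) := by congr 1; ring
  have b3 : e ((z - 3 / 4) / 2 + 3 * (τ + 1 / 2) / 8) = e (-3 / 16) * e (z / 2 + 3 * τ / 8) := by
    rw [← e_add]; congr 1; ring
  have b4 : e ((z - 1 / 4) / 2 + 3 * (τ + 1 / 2) / 8) = e (1 / 16) * e (z / 2 + 3 * τ / 8) := by
    rw [← e_add]; congr 1; ring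
  have b5 := e_sum_sixteenths
  have b6 : e (-3 / 16) * e (-3 / 16) = e (-3 / 8) := by rw [← e_add]; congr 1; ring
  have b7 : e (-3 / 16) * e (1 / 16) = e (-1 / 8) := by rw [← e_add]; congr 1; ring
  have hq4 : ((√2 / 4 : ℝ) : ℂ) = ((√2 / 2 : ℝ) : ℂ) / 2 := by push_cast; ring
  rw [mordellTwo, a1, a2, b1, b2, b3, b4, hq4, ← b5, ← b6, ← b7]
  ring

lemma mordellTwo_add_tau {τ : ℂ} (hτ : 0 < τ.im) (z : ℂ) :
    mordellTwo (z + τ) τ = -e (z + τ / 2) * mordellTwo z τ - I * e (z / 2 + 3 * τ / 8) +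
      ((2 * τ + 1) ^ (1 / 2 : ℂ))⁻¹ * e (-1 / 16) * e ((z + τ + 1 / 4) ^ 2 / (2 * τ + 1)) := by
  have h0 := ne_zero_of_im_pos (two_mul_add_one_im hτ)
  have a1 := mordell_half_add_one hτ (z - 3 / 4)
  rw [show z - 3 / 4 + 1 = z + 1 / 4 by ring] at a1
  have a2 : e ((z + τ + 1 / 4) ^ 2 / (2 * τ + 1)) =
      e ((z - 3 / 4 + 1 / 2) ^ 2 / (2 * τ + 1)) * e (z + τ / 2) := by
    rw [← e_add]
    congr 1
    have hτd : τ = (2 * τ + 1 - 1) / 2 := by ring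
    generalize 2 * τ + 1 = d at *
    rw [hτd]
    field_simp
    ring
  rw [mordellTwo_add_tau_aux hτ, a2, mordellTwo]
  linear_combination (e (z + τ / 2)) * a1

lemma tendsto_mul_mu {σ : ℂ} (v : ℂ) (hσ : 0 < σ.im) : Tendsto (fun u => u * mu u v σ) (𝓝[≠] 0)
    (𝓝 (-(2 * Real.pi * I)⁻¹ / theta v σ)) := by
  have c : ContinuousAt (fun u : ℂ => e (u / 2) / theta v σ) 0 := by
    have : ContinuousAt (fun u : ℂ => e (u / 2)) 0 := by fun_prop
    exact this.div_const _
  have := (c.tendsto.mono_left nhdsWithin_le_nhds).mul (tendsto_mul_appell hσ v)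
  simp only [zero_div, e_zero] at this
  rw [one_div_mul_eq_div] at this
  refine this.congr fun u => ?_
  rw [mu_eq]; ring

lemma tendsto_div_punctured {c : ℂ} (hc : c ≠ 0) :
    Tendsto (fun u : ℂ => u / c) (𝓝[≠] 0) (𝓝[≠] 0) := by
  refine tendsto_nhdsWithin_iff.mpr ⟨?_, ?_⟩
  · have : ContinuousAt (fun u : ℂ => u / c) 0 := by fun_prop
    have h := this.tendsto
    rw [zero_div] at h
    exact h.mono_left nhdsWithin_le_nhds
  · filter_upwards [self_mem_nhdsWithin] with u hu
    simpa [hc] using hu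

lemma mu_sub_tau {τ u v : ℂ} (hτ : 0 < τ.im) (hu : theta (u - τ) τ ≠ 0) (hv : theta v τ ≠ 0) :
    mu (u - τ) v τ = -e (-(u - v) + τ / 2) * (mu u v τ + I * e ((u - v) / 2 - τ / 8)) := by
  have h := mu_add_tau_left hτ hu hv
  rw [sub_add_cancel] at h
  have a0 : e (-(u - v) + τ / 2) * e (u - τ - v + τ / 2) = 1 := by
    rw [← e_add, ← e_zero]; congr 1; ring
  have a1 : e ((u - τ - v) / 2 + 3 * τ / 8) = e ((u - v) / 2 - τ / 8) := by congr 1; ring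
  rw [a1] at h
  linear_combination (e (-(u - v) + τ / 2)) * h - mu (u - τ) v τ * a0

lemma theta_sub_tau_ne_zero {u τ : ℂ} : theta (u - τ) τ ≠ 0 ↔ theta u τ ≠ 0 := by
  rw [← theta_add_tau_ne_zero (u := u - τ), sub_add_cancel]

lemma mu_M2 {τ u v : ℂ} (hτ : 0 < τ.im) (hu : theta u τ ≠ 0) (hv : theta v τ ≠ 0) :
    mu u v τ + I * ((2 * τ + 1) ^ (1 / 2 : ℂ))⁻¹ * e ((u - v) ^ 2 / (2 * τ + 1)) *
      mu (u / (2 * τ + 1)) (v / (2 * τ + 1)) (τ / (2 * τ + 1)) = mordellTwo (u - v) τ := by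
  have h0 := ne_zero_of_im_pos (two_mul_add_one_im hτ)
  have hτ' : 0 < (τ / (2 * τ + 1)).im := by
    have := div_linear_im_pos hτ 2
    exact_mod_cast this
  have hs := cpow_half_ne_zero h0
  have hs2 := cpow_half_sq (2 * τ + 1)
  have h1' : 0 < (τ + 1 / 2).im := by simpa using hτ
  have hne : ∀ {w}, theta w τ ≠ 0 → theta (w / (2 * τ + 1)) (τ / (2 * τ + 1)) ≠ 0 := by
    intro w hw
    rw [theta_M2 hτ]
    exact mul_ne_zero (mul_ne_zero (mul_ne_zero (by simp) hs) (e_ne_zero _)) hw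
  have hP : Differentiable ℂ fun z => mordellTwo z τ := by
    have h := differentiable_mordell h1'
    have d1 : Differentiable ℂ fun z => mordell (z - 1 / 4) (τ + 1 / 2) :=
      h.comp (f := fun z => z - 1 / 4) (by fun_prop)
    have d2 : Differentiable ℂ fun z => mordell (z + 1 / 4) (τ + 1 / 2) :=
      h.comp (f := fun z => z + 1 / 4) (by fun_prop)
    unfold mordellTwo
    fun_prop
  set d := 2 * τ + 1 with hd
  set r := d ^ (1 / 2 : ℂ) with hr
  set σ := τ / d with hσ
  have hτd : τ = (d - 1) / 2 := by rw [hd]; ring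
  clear_value σ r d
  have key := eq_zero_of_quasiperiodic (f := fun u => mu u v τ + I * r⁻¹ * e ((u - v) ^ 2 / d) *
    mu (u / d) (v / d) σ - mordellTwo (u - v) τ) hτ hv ?_ ?_ ?_ ?_ hu
  · exact sub_eq_zero.mp key
  · intro u hu
    have d1 := differentiableAt_mu hτ v hu
    have d2 : DifferentiableAt ℂ (fun u => mu (u / d) (v / d) σ) u :=
      (differentiableAt_mu hτ' (v / d) (hne hu)).comp u (f := fun u => u / d) (by fun_prop)
    have d3 : DifferentiableAt ℂ (fun u => mordellTwo (u - v) τ) u :=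
      hP.differentiableAt.comp u (f := fun u => u - v) (by fun_prop)
    fun_prop
  · have t2 := ((tendsto_mul_mu (v / d) hτ').comp (tendsto_div_punctured h0)).const_mul d
    have c2 : ContinuousAt (fun u : ℂ => I * r⁻¹ * e ((u - v) ^ 2 / d)) 0 := by fun_prop
    have t3 := (c2.tendsto.mono_left nhdsWithin_le_nhds).mul t2
    have c4 : ContinuousAt (fun u : ℂ => u * mordellTwo (u - v) τ) 0 := by
      have d3 : DifferentiableAt ℂ (fun u => mordellTwo (u - v) τ) 0 :=
        hP.differentiableAt.comp 0 (f := fun u => u - v) (by fun_prop)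
      have := d3.continuousAt
      fun_prop
    have t4 := ((tendsto_mul_mu v hτ).add t3).sub (c4.tendsto.mono_left nhdsWithin_le_nhds)
    convert t4 using 2 with u
    · simp only [Function.comp]
      have : d * (u / d * mu (u / d) (v / d) σ) = u * mu (u / d) (v / d) σ := by
        field_simp
      rw [this]; ring
    · rw [hσ, hd, theta_M2 hτ, ← hd, ← hr]
      have hE := e_ne_zero (v ^ 2 / d)
      have hE2 : e ((0 - v) ^ 2 / d) = e (v ^ 2 / d) := by rw [zero_sub, neg_sq]
      rw [hE2]
      generalize e (v ^ 2 / d) = E at *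
      generalize theta v τ = T at *
      have hpi : (Real.pi : ℂ) ≠ 0 := by exact_mod_cast Real.pi_ne_zero
      have hT := hv
      field_simp
      rw [zero_mul]
      linear_combination hs2
  · intro u hu
    have hu1 : theta (u / d - σ - σ) σ ≠ 0 :=
      theta_sub_tau_ne_zero.mpr (theta_sub_tau_ne_zero.mpr (hne hu))
    have e1 : (u + 1) / d = u / d - σ - σ + 1 := by
      rw [hσ, hτd]; field_simp; ring
    have m1 := mu_sub_tau hτ' (theta_sub_tau_ne_zero.mpr (hne hu)) (hne hv)
    have m2 := mu_sub_tau hτ' hu1 (hne hv)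
    have h1 := mordellTwo_add_one hτ (u - v)
    rw [show u - v + 1 = u + 1 - v by ring, ← hd, ← hr] at h1
    have h1' : mordellTwo (u + 1 - v) τ = r⁻¹ * e (-1 / 16) * (e ((u - v + 1 / 4) ^ 2 / d) +
      e ((u - v + 3 / 4) ^ 2 / d)) - mordellTwo (u - v) τ := by linear_combination h1
    simp only [e1, mu_add_one_left, m2, m1, h1']
    have a1 : e ((u + 1 - v) ^ 2 / d) * (e (-(u / d - σ - v / d) + σ / 2) *
        e (-(u / d - v / d) + σ / 2)) = e ((u - v) ^ 2 / d) := by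
      simp only [← e_add]
      refine e_congr 1 ?_
      rw [hσ, hτd]; field_simp; push_cast; ring
    have a2 : e ((u - v) ^ 2 / d) * e ((u / d - v / d) / 2 - σ / 8) =
        e (-1 / 16) * e ((u - v + 1 / 4) ^ 2 / d) := by
      simp only [← e_add]
      congr 1
      rw [hσ, hτd]; field_simp; ring
    have a3 : e ((u + 1 - v) ^ 2 / d) * (e (-(u / d - σ - v / d) + σ / 2) *
        e ((u / d - σ - v / d) / 2 - σ / 8)) = -(e (-1 / 16) * e ((u - v + 3 / 4) ^ 2 / d)) := by
      simp only [← e_add]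
      refine e_congr_neg 0 ?_
      rw [hσ, hτd]; field_simp; push_cast; ring
    linear_combination (-I * r⁻¹ * mu (u / d) (v / d) σ - I ^ 2 * r⁻¹ * e ((u / d - v / d) / 2 - σ / 8)) * a1 +
      (-I ^ 2 * r⁻¹) * a2 + (I ^ 2 * r⁻¹) * a3 - (r⁻¹ * e (-1 / 16) * (e ((u - v + 1 / 4) ^ 2 / d) +
      e ((u - v + 3 / 4) ^ 2 / d))) * I_sq
  · intro u hu
    have e1 : (u + τ) / d = u / d + σ := by rw [hσ]; ring
    have h2 := mordellTwo_add_tau hτ (u - v)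
    rw [show u - v + τ = u + τ - v by ring, ← hd, ← hr] at h2
    simp only [mu_add_tau_left hτ hu hv, e1, mu_add_tau_left hτ' (hne hu) (hne hv), h2]
    have a2 : e ((u + τ - v) ^ 2 / d) * e (u / d - v / d + σ / 2) =
        e ((u - v) ^ 2 / d) * e (u - v + τ / 2) := by
      simp only [← e_add]
      congr 1
      rw [hσ, hτd]; field_simp; ring
    have a3 : e ((u + τ - v) ^ 2 / d) * e ((u / d - v / d) / 2 + 3 * σ / 8) =
        e (-1 / 16) * e ((u + τ - v + 1 / 4) ^ 2 / d) := by
      simp only [← e_add]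
      congr 1
      rw [hσ, hτd]; field_simp; ring
    linear_combination (-I * r⁻¹ * mu (u / d) (v / d) σ) * a2 - I ^ 2 * r⁻¹ * a3 -
      (r⁻¹ * e (-1 / 16) * e ((u + τ - v + 1 / 4) ^ 2 / d)) * I_sq

lemma mu_M1 {τ u v : ℂ} (hτ : 0 < τ.im) (hu : theta u τ ≠ 0) (hv : theta v τ ≠ 0) :
    mu u v τ - (zeta 8)⁻¹ * ((τ + 1) ^ (1 / 2 : ℂ))⁻¹ * e ((u - v) ^ 2 / (2 * (τ + 1))) *
      mu (u / (τ + 1)) (v / (τ + 1)) (τ / (τ + 1)) =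
      e (1 / 8) * (mordell (u - v) (τ + 1) / (2 * I)) := by
  have h1 : 0 < (τ + 1).im := by simpa using hτ
  have h0 := ne_zero_of_im_pos h1
  have hne : ∀ {w}, theta w τ ≠ 0 → theta w (τ + 1) ≠ 0 := by
    intro w hw
    rw [theta_tau_add_one]; exact mul_ne_zero (e_ne_zero _) hw
  have hS := mu_S h1 (hne hu) (hne hv)
  have a1 : mu (u / (τ + 1)) (v / (τ + 1)) (τ / (τ + 1)) = e (-1 / 8) *
      mu (u / (τ + 1)) (v / (τ + 1)) (-1 / (τ + 1)) := by
    rw [← mu_tau_add_one]; congr 1; field_simp; ring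
  rw [← hS, a1, mu_tau_add_one, neg_I_mul_cpow_half h1, zeta, ← e_neg]
  have b1 : e (1 / 8) * e (-1 / 8) = 1 := by rw [← e_add, ← e_zero]; congr 1; ring
  have b2 : e (-(1 / ((8 : ℕ) : ℂ))) = e (-1 / 8) := by congr 1; push_cast; ring
  have b3 : e (-1 / 8) * e (-1 / 8) = -(e (1 / 8) * (e (-1 / 8))⁻¹) := by
    rw [← e_neg, ← e_add, ← e_add]; exact e_congr_neg (-1) (by push_cast; ring)
  rw [b2]
  generalize mu (u / (τ + 1)) (v / (τ + 1)) (-1 / (τ + 1)) = M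
  generalize e ((u - v) ^ 2 / (2 * (τ + 1))) = E
  rw [mul_inv]
  linear_combination (-mu u v τ) * b1 - ((τ + 1) ^ (1 / 2 : ℂ))⁻¹ * E * M * b3

end EtaTheta

open Complex Filter Topology
namespace EtaTheta

/-! ### Theta functions with characteristics of weight `3/2` on the imaginary axis -/

/-- The sum of `ν e(νB) exp(-πν²t)` over `ν ∈ A + ℤ`. -/
noncomputable def oddTheta (A B t : ℝ) : ℂ :=
  ∑' n : ℤ, ((n : ℂ) + A) * e (((n : ℂ) + A) * B) * cexp (-Real.pi * ((n : ℂ) + A) ^ 2 * t)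

lemma norm_oddTheta_term (A B t : ℝ) (n : ℤ) :
    ‖((n : ℂ) + A) * e (((n : ℂ) + A) * B) * cexp (-Real.pi * ((n : ℂ) + A) ^ 2 * t)‖ =
      HurwitzKernelBounds.f_int 1 A t n := by
  rw [norm_mul, norm_mul, show ((n : ℂ) + A) * B = (((n + A) * B : ℝ) : ℂ) by push_cast; ring,
    norm_e_ofReal, show -(Real.pi : ℂ) * ((n : ℂ) + A) ^ 2 * t =
      ((-Real.pi * (n + A) ^ 2 * t : ℝ) : ℂ) by push_cast; ring, norm_exp, ofReal_re,
    show (n : ℂ) + A = ((n + A : ℝ) : ℂ) by push_cast; ring, norm_real, Real.norm_eq_abs,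
    HurwitzKernelBounds.f_int, pow_one, mul_one]

lemma summable_oddTheta (A B : ℝ) {t : ℝ} (ht : 0 < t) :
    Summable fun n : ℤ => ((n : ℂ) + A) * e (((n : ℂ) + A) * B) *
      cexp (-Real.pi * ((n : ℂ) + A) ^ 2 * t) := by
  refine Summable.of_norm ?_
  simp only [norm_oddTheta_term]
  exact HurwitzKernelBounds.summable_f_int 1 A ht

lemma norm_oddTheta_le (A B : ℝ) {t : ℝ} (ht : 0 < t) :
    ‖oddTheta A B t‖ ≤ HurwitzKernelBounds.F_int 1 A t := by
  have h := norm_tsum_le_tsum_norm (f := fun n : ℤ => ((n : ℂ) + A) * e (((n : ℂ) + A) * B) *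
      cexp (-Real.pi * ((n : ℂ) + A) ^ 2 * t)) (by
    simp only [norm_oddTheta_term]
    exact HurwitzKernelBounds.summable_f_int 1 A ht)
  simp only [norm_oddTheta_term] at h
  exact h

lemma I_mul_ofReal_im_pos {t : ℝ} (ht : 0 < t) : 0 < (I * (t : ℂ)).im := by simpa using ht

lemma oddTheta_eq (A B : ℝ) {t : ℝ} (ht : 0 < t) :
    oddTheta A B t = e (A * B) * cexp (-Real.pi * A ^ 2 * t) *
      ((2 * Real.pi * I)⁻¹ * jacobiTheta₂' (B + I * A * t) (I * t) +
        A * jacobiTheta₂ (B + I * A * t) (I * t)) := by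
  have h1 := (hasSum_jacobiTheta₂'_term (B + I * A * t) (I_mul_ofReal_im_pos ht)).mul_left
    (2 * Real.pi * I)⁻¹
  have h2 := (hasSum_jacobiTheta₂_term (B + I * A * t) (I_mul_ofReal_im_pos ht)).mul_left (A : ℂ)
  rw [← ((h1.add h2).mul_left (e (A * B) * cexp (-Real.pi * A ^ 2 * t))).tsum_eq, oddTheta]
  refine tsum_congr fun n => ?_
  have hpi := two_pi_I_ne_zero
  have h3 : (2 * Real.pi * I)⁻¹ * (2 * Real.pi * I * n) = (n : ℂ) := by
    rw [← mul_assoc, inv_mul_cancel₀ hpi, one_mul]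
  rw [jacobiTheta₂'_term, ← mul_assoc (2 * Real.pi * I)⁻¹, h3, ← add_mul, jacobiTheta₂_term]
  have h4 : e (((n : ℂ) + A) * B) * cexp (-Real.pi * ((n : ℂ) + A) ^ 2 * t) =
      e (A * B) * cexp (-Real.pi * A ^ 2 * t) *
        cexp (2 * Real.pi * I * n * (B + I * A * t) + Real.pi * I * n ^ 2 * (I * t)) := by
    rw [e, e, ← exp_add, ← exp_add, ← exp_add]
    congr 1
    linear_combination (-2 * Real.pi * n * A * t - Real.pi * n ^ 2 * t) * I_sq
  rw [mul_assoc, h4]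
  ring

lemma continuousOn_oddTheta (A B : ℝ) : ContinuousOn (oddTheta A B) (Set.Ioi 0) := by
  intro t ht
  have ht' : (0 : ℝ) < t := ht
  have c0 : ContinuousAt (fun t : ℝ => (((B : ℂ) + I * A * t, I * t) : ℂ × ℂ)) t := by fun_prop
  have c1 : ContinuousAt (fun t : ℝ => jacobiTheta₂' (B + I * A * t) (I * t)) t :=
    ContinuousAt.comp (f := fun t : ℝ => (((B : ℂ) + I * A * t, I * t) : ℂ × ℂ))
      (g := fun p : ℂ × ℂ => jacobiTheta₂' p.1 p.2)
      (continuousAt_jacobiTheta₂' _ (I_mul_ofReal_im_pos ht')) c0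
  have c2 : ContinuousAt (fun t : ℝ => jacobiTheta₂ (B + I * A * t) (I * t)) t :=
    ContinuousAt.comp (f := fun t : ℝ => (((B : ℂ) + I * A * t, I * t) : ℂ × ℂ))
      (g := fun p : ℂ × ℂ => jacobiTheta₂ p.1 p.2)
      (continuousAt_jacobiTheta₂ _ (I_mul_ofReal_im_pos ht')) c0
  have c3 : ContinuousAt (fun t : ℝ => e (A * B) * cexp (-Real.pi * A ^ 2 * t) *
      ((2 * Real.pi * I)⁻¹ * jacobiTheta₂' (B + I * A * t) (I * t) +
        A * jacobiTheta₂ (B + I * A * t) (I * t))) t := by fun_prop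
  refine (c3.congr ?_).continuousWithinAt
  filter_upwards [lt_mem_nhds ht'] with s hs using (oddTheta_eq A B hs).symm

lemma oddTheta_inv (A B : ℝ) {t : ℝ} (ht : 0 < t) :
    oddTheta A B t = -I * ((t ^ (-(3 / 2) : ℝ) : ℝ) : ℂ) * e (A * B) * oddTheta (-B) A (1 / t) := by
  have ht' : 0 < 1 / t := by positivity
  have htc : (t : ℂ) ≠ 0 := by exact_mod_cast ht.ne'
  rw [oddTheta_eq A B ht, oddTheta_eq (-B) A ht', jacobiTheta₂'_functional_equation,
    jacobiTheta₂_functional_equation (B + I * A * t)]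
  have e1 : ((B : ℂ) + I * A * t) / (I * t) = A + I * ((-B : ℝ) : ℂ) * ((1 / t : ℝ) : ℂ) := by
    push_cast; field_simp; linear_combination (B : ℂ) * I_sq
  have e2 : -1 / (I * (t : ℂ)) = I * ((1 / t : ℝ) : ℂ) := by
    push_cast; field_simp; linear_combination -I_sq
  have e3 : (-I * (I * (t : ℂ))) ^ (1 / 2 : ℂ) = ((√t : ℝ) : ℂ) := by
    rw [show -I * (I * (t : ℂ)) = (t : ℂ) by linear_combination (-t : ℂ) * I_sq,
      Real.sqrt_eq_rpow, ofReal_cpow ht.le]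
    push_cast; rfl
  have e4 : t ^ (-(3 / 2) : ℝ) = (√t)⁻¹ / t := by
    rw [Real.sqrt_eq_rpow, ← Real.rpow_neg ht.le]
    nth_rw 3 [← Real.rpow_one t]
    rw [← Real.rpow_sub ht]
    norm_num
  rw [e1, e2, e3, e4]
  have e5 : cexp (-Real.pi * A ^ 2 * t) * cexp (-Real.pi * I * (B + I * A * t) ^ 2 / (I * t)) =
      e (((-B : ℝ) : ℂ) * A) * cexp (-Real.pi * ((-B : ℝ) : ℂ) ^ 2 * ((1 / t : ℝ) : ℂ)) := by
    rw [e, ← exp_add, ← exp_add]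
    congr 1
    push_cast
    field_simp
    linear_combination (-A ^ 2 * t ^ 2 : ℂ) * I_sq
  generalize jacobiTheta₂' (A + I * ((-B : ℝ) : ℂ) * ((1 / t : ℝ) : ℂ)) (I * ((1 / t : ℝ) : ℂ)) = J'
  generalize jacobiTheta₂ (A + I * ((-B : ℝ) : ℂ) * ((1 / t : ℝ) : ℂ)) (I * ((1 / t : ℝ) : ℂ)) = J
  set X := cexp (-Real.pi * I * (B + I * A * t) ^ 2 / (I * t))
  set Y := cexp (-Real.pi * A ^ 2 * t)
  set E := e (((-B : ℝ) : ℂ) * A)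
  set Z := cexp (-Real.pi * ((-B : ℝ) : ℂ) ^ 2 * ((1 / t : ℝ) : ℂ))
  have hs : ((√t : ℝ) : ℂ) ≠ 0 := by exact_mod_cast (Real.sqrt_pos.mpr ht).ne'
  have hpi : (Real.pi : ℂ) ≠ 0 := by exact_mod_cast Real.pi_ne_zero
  have hL : e (A * B) * Y * ((2 * Real.pi * I)⁻¹ * (1 / ((√t : ℝ) : ℂ) * X / (I * t) *
      (J' - 2 * Real.pi * I * (B + I * A * t) * J)) + A * (1 / ((√t : ℝ) : ℂ) * X * J)) =
      e (A * B) * (Y * X) * (((√t : ℝ) : ℂ)⁻¹ / t) * ((2 * Real.pi * I)⁻¹ * J' / I +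
        (-(B / I)) * J) := by
    field_simp
    ring
  have hR : -I * (((√t)⁻¹ / t : ℝ) : ℂ) * e (A * B) * (E * Z * ((2 * Real.pi * I)⁻¹ * J' +
      ((-B : ℝ) : ℂ) * J)) = e (A * B) * (E * Z) * (((√t : ℝ) : ℂ)⁻¹ / t) *
      ((2 * Real.pi * I)⁻¹ * J' * (-I) + (B * I) * J) := by
    push_cast; ring
  rw [hL, hR, e5, div_I, div_I]
  ring

lemma oddTheta_isBigO (A B : ℝ) : ∃ p, 0 < p ∧
    oddTheta A B =O[atTop] fun t => Real.exp (-p * t) := by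
  obtain ⟨p, hp, h⟩ := HurwitzKernelBounds.isBigO_atTop_F_int_one A
  refine ⟨p, hp, Asymptotics.IsBigO.trans (Asymptotics.IsBigO.of_bound 1 ?_) h⟩
  filter_upwards [eventually_gt_atTop 0] with t ht
  rw [one_mul]
  exact (norm_oddTheta_le A B ht).trans (le_abs_self _)

open MeasureTheory in
lemma integrableOn_oddTheta (A B : ℝ) : IntegrableOn (oddTheta A B) (Set.Ioi 0) := by
  rw [← Set.Ioc_union_Ioi_eq_Ioi (zero_le_one (α := ℝ))]
  refine IntegrableOn.union ?_ ?_
  · obtain ⟨p, hp, h⟩ := oddTheta_isBigO (-B) A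
    have h2 : (fun t : ℝ => t ^ (3 / 2 : ℝ)) =o[atTop] fun t => Real.exp (p * t) :=
      isLittleO_rpow_exp_pos_mul_atTop _ hp
    have h3 := (h2.isBigO.mul h.norm_left).bound
    obtain ⟨c, hc⟩ := h3
    obtain ⟨T, hT⟩ := eventually_atTop.mp hc
    obtain ⟨C₁, hC₁⟩ := (isCompact_Icc (a := (1 : ℝ)) (b := max T 1)).exists_bound_of_continuousOn
      (f := fun t : ℝ => ((t ^ (3 / 2 : ℝ) : ℝ) : ℂ) * oddTheta (-B) A t) (by
        refine ContinuousOn.mul ?_ ((continuousOn_oddTheta _ _).mono fun t ht => ?_)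
        · exact (Complex.continuous_ofReal.comp_continuousOn (ContinuousOn.rpow_const
            continuousOn_id fun t ht => Or.inr (by norm_num)))
        · exact lt_of_lt_of_le one_pos ht.1)
    refine IntegrableOn.of_bound (C := max c C₁) (by simp)
      (((continuousOn_oddTheta A B).mono fun t ht => ht.1).aestronglyMeasurable measurableSet_Ioc) ?_
    refine (ae_restrict_iff' measurableSet_Ioc).mpr (Eventually.of_forall fun t ht => ?_)
    have ht1 : 1 ≤ 1 / t := by rw [le_div_iff₀ ht.1]; linarith [ht.2]
    rw [oddTheta_inv A B ht.1, norm_mul, norm_mul, norm_mul, norm_neg, norm_I, one_mul,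
      ← ofReal_mul, norm_e_ofReal, mul_one, norm_real, Real.norm_of_nonneg (Real.rpow_nonneg ht.1.le _)]
    have e1 : t ^ (-(3 / 2) : ℝ) = (1 / t) ^ (3 / 2 : ℝ) := by
      rw [one_div, Real.inv_rpow ht.1.le, Real.rpow_neg ht.1.le]
    rw [e1]
    have hnn : 0 ≤ (1 / t) ^ (3 / 2 : ℝ) := Real.rpow_nonneg (by linarith) _
    by_cases h4 : 1 / t ≤ max T 1
    · have := hC₁ (1 / t) ⟨ht1, h4⟩
      rw [norm_mul, norm_real, Real.norm_of_nonneg hnn] at this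
      exact this.trans (le_max_right _ _)
    · push Not at h4
      have h5 := hT (1 / t) ((le_max_left _ _).trans h4.le)
      rw [norm_mul, Real.norm_of_nonneg hnn, norm_norm, ← Real.exp_add] at h5
      refine le_trans ?_ (le_max_left _ _)
      simpa using h5
  · obtain ⟨p, hp, h⟩ := oddTheta_isBigO A B
    have h1 : ContinuousOn (oddTheta A B) (Set.Ici 1) :=
      (continuousOn_oddTheta A B).mono fun t ht => Set.mem_Ioi.mpr (one_pos.trans_le ht)
    have h2 := integrable_of_isBigO_exp_neg hp h1.norm h.norm_left
    exact (integrable_norm_iff ((h1.mono Set.Ioi_subset_Ici_self).aestronglyMeasurable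
      measurableSet_Ioi)).mp h2

end EtaTheta

open Complex Filter Topology
namespace EtaTheta

/-! ### A Laplace transform -/

lemma rpow_neg_three_halves {t : ℝ} (ht : 0 < t) : t ^ (-(3 / 2) : ℝ) = (√t)⁻¹ / t := by
  rw [Real.sqrt_eq_rpow, ← Real.rpow_neg ht.le]
  nth_rw 3 [← Real.rpow_one t]
  rw [← Real.rpow_sub ht]
  norm_num

/-- The integral of `exp(-πy²)` from `0` to `s`. -/
noncomputable def gaussPrimitive (s : ℝ) : ℝ := ∫ y in (0 : ℝ)..s, Real.exp (-Real.pi * y ^ 2)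

lemma hasDerivAt_gaussPrimitive (s : ℝ) :
    HasDerivAt gaussPrimitive (Real.exp (-Real.pi * s ^ 2)) s := by
  have hc : Continuous fun y : ℝ => Real.exp (-Real.pi * y ^ 2) := by fun_prop
  exact intervalIntegral.integral_hasDerivAt_right (hc.intervalIntegrable _ _)
    hc.stronglyMeasurable.stronglyMeasurableAtFilter hc.continuousAt

lemma tendsto_gaussPrimitive : Tendsto gaussPrimitive atTop (𝓝 (1 / 2)) := by
  have h := MeasureTheory.intervalIntegral_tendsto_integral_Ioi (f := fun y : ℝ =>
    Real.exp (-Real.pi * y ^ 2)) 0 (integrable_exp_neg_mul_sq Real.pi_pos).integrableOn tendsto_id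
  rw [integral_gaussian_Ioi, div_self Real.pi_ne_zero, Real.sqrt_one] at h
  exact h

lemma gaussPrimitive_neg (s : ℝ) : gaussPrimitive (-s) = -gaussPrimitive s := by
  have h := intervalIntegral.integral_comp_neg (a := 0) (b := s)
    (fun y : ℝ => Real.exp (-Real.pi * y ^ 2))
  simp only [neg_sq, neg_zero] at h
  rw [gaussPrimitive, gaussPrimitive, h, intervalIntegral.integral_symm]

lemma tendsto_gaussPrimitive_atBot : Tendsto gaussPrimitive atBot (𝓝 (-(1 / 2))) := by
  have h := (tendsto_gaussPrimitive.comp tendsto_neg_atBot_atTop).neg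
  refine h.congr fun s => ?_
  simp [Function.comp, gaussPrimitive_neg]

open MeasureTheory in
lemma laplace_gaussian {n x : ℝ} (hn : 0 < n) (hx : 0 < x) :
    IntegrableOn (fun t : ℝ => n * t ^ (-(3 / 2) : ℝ) *
      Real.exp (-Real.pi * n ^ 2 / t - Real.pi * x ^ 2 * t)) (Set.Ioi 0) ∧
    ∫ t in Set.Ioi (0 : ℝ), n * t ^ (-(3 / 2) : ℝ) *
      Real.exp (-Real.pi * n ^ 2 / t - Real.pi * x ^ 2 * t) = Real.exp (-2 * Real.pi * n * x) := by
  set p := Real.exp (-2 * Real.pi * n * x) with hp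
  set q := Real.exp (2 * Real.pi * n * x) with hq
  set F₀ : ℝ → ℝ := fun t => p * gaussPrimitive (x * √t - n / √t) -
    q * gaussPrimitive (x * √t + n / √t) with hF₀
  set L : ℝ := -(p + q) / 2
  set F : ℝ → ℝ := fun t => if t ≤ 0 then L else F₀ t with hF
  have hFpos : ∀ t, 0 < t → F t = F₀ t := fun t ht => if_neg (not_le.mpr ht)
  have t1 : Tendsto (fun t : ℝ => x * √t) atTop atTop := Real.tendsto_sqrt_atTop.const_mul_atTop hx
  have t2 : Tendsto (fun t : ℝ => n / √t) atTop (𝓝 0) :=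
    tendsto_const_nhds.div_atTop Real.tendsto_sqrt_atTop
  have s0 : Tendsto (fun t : ℝ => √t) (𝓝[>] 0) (𝓝 0) := by
    have := (Real.continuous_sqrt.tendsto 0).mono_left (nhdsWithin_le_nhds (s := Set.Ioi (0 : ℝ)))
    rwa [Real.sqrt_zero] at this
  have s0' : Tendsto (fun t : ℝ => √t) (𝓝[>] 0) (𝓝[>] 0) := by
    refine tendsto_nhdsWithin_iff.mpr ⟨s0, ?_⟩
    filter_upwards [self_mem_nhdsWithin] with t ht using Real.sqrt_pos.mpr ht
  have s1 : Tendsto (fun t : ℝ => x * √t) (𝓝[>] 0) (𝓝 0) := by simpa using s0.const_mul x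
  have s2 : Tendsto (fun t : ℝ => n / √t) (𝓝[>] 0) atTop := by
    simp only [div_eq_mul_inv]
    exact (tendsto_inv_nhdsGT_zero.comp s0').const_mul_atTop hn
  have hcont : ContinuousWithinAt F (Set.Ici 0) 0 := by
    rw [← Set.Ioi_insert, continuousWithinAt_insert_self]
    have e1 : F 0 = L := if_pos le_rfl
    rw [ContinuousWithinAt, e1]
    have l1 : Tendsto (fun t : ℝ => x * √t - n / √t) (𝓝[>] 0) atBot := by
      simp only [sub_eq_add_neg]
      exact s1.add_atBot (tendsto_neg_atTop_atBot.comp s2)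
    have l2 : Tendsto (fun t : ℝ => x * √t + n / √t) (𝓝[>] 0) atTop := s1.add_atTop s2
    have l3 := ((tendsto_gaussPrimitive_atBot.comp l1).const_mul p).sub
      ((tendsto_gaussPrimitive.comp l2).const_mul q)
    have e2 : p * -(1 / 2) - q * (1 / 2) = L := by simp only [L]; ring
    rw [e2] at l3
    refine l3.congr' ?_
    filter_upwards [self_mem_nhdsWithin] with t ht using (hFpos t ht).symm
  have hderiv : ∀ t ∈ Set.Ioi (0 : ℝ), HasDerivAt F (n * t ^ (-(3 / 2) : ℝ) *
      Real.exp (-Real.pi * n ^ 2 / t - Real.pi * x ^ 2 * t)) t := by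
    intro t ht
    have ht' : 0 < t := ht
    have hs := Real.sqrt_pos.mpr ht'
    have hsq := Real.sq_sqrt ht'.le
    have d1 := (Real.hasDerivAt_sqrt ht'.ne').const_mul x
    have d2 := ((hasDerivAt_const t n).div (Real.hasDerivAt_sqrt ht'.ne') hs.ne')
    have d3 := ((hasDerivAt_gaussPrimitive _).comp t (d1.sub d2)).const_mul p
    have d4 := ((hasDerivAt_gaussPrimitive _).comp t (d1.add d2)).const_mul q
    have d5 := d3.sub d4
    have d6 : HasDerivAt F _ t := d5.congr_of_eventuallyEq (by
      filter_upwards [lt_mem_nhds ht'] with s hs using hFpos s hs)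
    refine d6.congr_deriv ?_
    have e1 : p * Real.exp (-Real.pi * (x * √t - n / √t) ^ 2) =
        Real.exp (-Real.pi * n ^ 2 / t - Real.pi * x ^ 2 * t) := by
      rw [hp, ← Real.exp_add]
      congr 1
      have : (x * √t - n / √t) ^ 2 = x ^ 2 * t - 2 * n * x + n ^ 2 / t := by
        nth_rw 4 [← hsq]; nth_rw 3 [← hsq]; field_simp; ring
      rw [this]; ring
    have e2 : q * Real.exp (-Real.pi * (x * √t + n / √t) ^ 2) =
        Real.exp (-Real.pi * n ^ 2 / t - Real.pi * x ^ 2 * t) := by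
      rw [hq, ← Real.exp_add]
      congr 1
      have : (x * √t + n / √t) ^ 2 = x ^ 2 * t + 2 * n * x + n ^ 2 / t := by
        nth_rw 4 [← hsq]; nth_rw 3 [← hsq]; field_simp; ring
      rw [this]; ring
    simp only [Pi.sub_apply, Pi.add_apply, Pi.div_apply]
    rw [← mul_assoc, ← mul_assoc, e1, e2, rpow_neg_three_halves ht']
    rw [hsq]
    field_simp
    ring
  have hlim : Tendsto F atTop (𝓝 ((p - q) / 2)) := by
    have l1 : Tendsto (fun t : ℝ => x * √t - n / √t) atTop atTop := by
      simp only [sub_eq_add_neg]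
      exact t1.atTop_add t2.neg
    have l2 : Tendsto (fun t : ℝ => x * √t + n / √t) atTop atTop := t1.atTop_add t2
    have l3 := ((tendsto_gaussPrimitive.comp l1).const_mul p).sub
      ((tendsto_gaussPrimitive.comp l2).const_mul q)
    have e2 : p * (1 / 2) - q * (1 / 2) = (p - q) / 2 := by ring
    rw [e2] at l3
    refine l3.congr' ?_
    filter_upwards [eventually_gt_atTop 0] with t ht using (hFpos t ht).symm
  have hnn : ∀ t ∈ Set.Ioi (0 : ℝ), 0 ≤ n * t ^ (-(3 / 2) : ℝ) *
      Real.exp (-Real.pi * n ^ 2 / t - Real.pi * x ^ 2 * t) := by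
    intro t ht
    have := Real.rpow_nonneg (le_of_lt ht) (-(3 / 2))
    positivity
  refine ⟨integrableOn_Ioi_deriv_of_nonneg hcont hderiv hnn hlim, ?_⟩
  rw [integral_Ioi_of_hasDerivAt_of_nonneg hcont hderiv hnn hlim]
  have e1 : F 0 = L := if_pos le_rfl
  rw [e1]
  simp only [L]
  ring

/-! ### The Laplace transform of a theta function of weight `3/2` -/

/-- The kernel `exp(2πbw) / cosh(π(w - ia))`. -/
noncomputable def sechKernel (a b : ℝ) (w : ℂ) : ℂ :=
  cexp (2 * Real.pi * b * w) / cosh (Real.pi * (w - a * I))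

lemma cosh_ne_zero_of_im {z : ℂ} (h : |z.im| < Real.pi / 2) : cosh z ≠ 0 := by
  intro h0
  have h1 := normSq_cosh z
  rw [h0, norm_zero] at h1
  have h2 : 0 < Real.cos z.im := Real.cos_pos_of_mem_Ioo ⟨(abs_lt.mp h).1, (abs_lt.mp h).2⟩
  nlinarith [sq_nonneg (Real.sinh z.re), pow_pos h2 2]

lemma sechKernel_pos {a b : ℝ} {y : ℝ} (hy : 0 < y) :
    (1 - e (a + 1 / 2) * cexp (-2 * Real.pi * y))⁻¹ * (-I * e (a + 1 / 2) *
      cexp (-2 * Real.pi * (1 / 2 - b) * y)) = I / 2 * e (a / 2) * sechKernel a b y := by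
  have h1 : e (a + 1 / 2) = -(e (a / 2) * e (a / 2)) := by
    rw [← e_add]; exact e_congr_neg 0 (by push_cast; ring)
  have h2 : cexp (Real.pi * ((y : ℂ) - a * I)) = cexp (Real.pi * y) * (e (a / 2))⁻¹ := by
    rw [← e_neg, e, ← exp_add]; congr 1; ring
  have h3 : cexp (-(Real.pi * ((y : ℂ) - a * I))) = (cexp (Real.pi * y))⁻¹ * e (a / 2) := by
    rw [← exp_neg, e, ← exp_add]; congr 1; ring
  have h4 : cexp (-2 * Real.pi * y) = (cexp (Real.pi * y))⁻¹ * (cexp (Real.pi * y))⁻¹ := by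
    rw [← exp_neg, ← exp_add]; congr 1; ring
  have h5 : cexp (-2 * Real.pi * (1 / 2 - b) * y) = (cexp (Real.pi * y))⁻¹ *
      cexp (2 * Real.pi * b * y) := by
    rw [← exp_neg, ← exp_add]; congr 1; ring
  have h6 : ‖e (a / 2)‖ = 1 := by exact_mod_cast norm_e_ofReal (a / 2)
  have h7 : ‖cexp (Real.pi * y)‖ = Real.exp (Real.pi * y) := by
    rw [norm_exp]; simp
  have h8 : 1 < Real.exp (Real.pi * y) := Real.one_lt_exp_iff.mpr (mul_pos Real.pi_pos hy)
  rw [sechKernel, cosh, h2, h3, h1, h4, h5]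
  have hE := e_ne_zero (a / 2)
  have hX := exp_ne_zero (Real.pi * y)
  generalize cexp (2 * Real.pi * b * y) = W
  generalize e (a / 2) = E at *
  generalize cexp (Real.pi * y) = X at *
  have h9 : X * X + E * E ≠ 0 := by
    intro h
    have h10 : X * X = -(E * E) := by linear_combination h
    have := congrArg norm h10
    rw [norm_neg, norm_mul, norm_mul, h6, h7] at this
    nlinarith
  have h11 : 1 - -(E * E) * (X⁻¹ * X⁻¹) = (X * X + E * E) / (X * X) := by field_simp; ring
  have h12 : (X * E⁻¹ + X⁻¹ * E) / 2 = (X * X + E * E) / (2 * (X * E)) := by field_simp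
  rw [h11, h12]
  field_simp

lemma sechKernel_neg {a b : ℝ} {y : ℝ} (hy : 0 < y) :
    (1 - e (-(a + 1 / 2)) * cexp (-2 * Real.pi * y))⁻¹ * (I *
      cexp (-2 * Real.pi * (b + 1 / 2) * y)) = I / 2 * e (a / 2) * sechKernel a b (-y) := by
  have h := sechKernel_pos (a := -a) (b := -b) hy
  have h1 : e (((-a : ℝ) : ℂ) + 1 / 2) = e (-(a + 1 / 2)) := e_congr 1 (by push_cast; ring)
  have h2 : e (-(a + 1 / 2)) = -(e (a / 2) * e (a / 2))⁻¹ := by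
    rw [← e_add, ← e_neg]; exact e_congr_neg (-1) (by push_cast; ring)
  have h3 : e (((-a : ℝ) : ℂ) / 2) = (e (a / 2))⁻¹ := by
    rw [← e_neg]; congr 1; push_cast; ring
  have h4 : sechKernel (-a) (-b) y = sechKernel a b (-y) := by
    rw [sechKernel, sechKernel, ← cosh_neg]
    congr 2 <;> push_cast <;> ring
  have h5 : cexp (-2 * Real.pi * (1 / 2 - ((-b : ℝ) : ℂ)) * y) =
      cexp (-2 * Real.pi * (b + 1 / 2) * y) := by congr 1; push_cast; ring
  rw [h1, h3, h4, h5] at h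
  have hE := e_ne_zero (a / 2)
  generalize (1 - e (-(a + 1 / 2)) * cexp (-2 * Real.pi * y))⁻¹ = Z at *
  rw [h2] at h
  generalize e (a / 2) = E at *
  field_simp at h ⊢
  linear_combination h

open MeasureTheory in
lemma integral_oddTheta_mul_exp {a b : ℝ} (hb : |b| < 1 / 2) {x : ℝ} (hx : x ≠ 0) :
    ∫ t in Set.Ioi (0 : ℝ), oddTheta (a + 1 / 2) (b + 1 / 2) t * cexp (-Real.pi * x ^ 2 * t) =
      I / 2 * e (a / 2) * (sechKernel a b x + sechKernel a b (-x)) := by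
  obtain ⟨hb1, hb2⟩ := abs_lt.mp hb
  set y := |x| with hy
  have hy0 : 0 < y := abs_pos.mpr hx
  have hsymm : sechKernel a b x + sechKernel a b (-x) = sechKernel a b y + sechKernel a b (-y) := by
    rcases abs_choice x with h | h
    · rw [hy, h]
    · rw [hy, h]; push_cast; rw [neg_neg, add_comm]
  have hxy : x ^ 2 = y ^ 2 := (sq_abs x).symm
  set A := a + 1 / 2 with hA
  set B := b + 1 / 2 with hB
  have hν : ∀ k : ℤ, (k : ℝ) + -B ≠ 0 := by
    intro k h
    rcases le_or_gt k 0 with hk | hk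
    · have : (k : ℝ) ≤ 0 := by exact_mod_cast hk
      linarith
    · have : (1 : ℝ) ≤ k := by exact_mod_cast hk
      linarith
  set s : ℤ → ℂ := fun k => -I * e (k * A) * ((SignType.sign ((k : ℝ) + -B) : ℝ) : ℂ) with hs
  have hsn : ∀ k, ‖s k‖ = 1 := by
    intro k
    simp only [hs]
    rw [norm_mul, norm_mul, norm_neg, norm_I, one_mul,
      show (k : ℂ) * A = ((k * A : ℝ) : ℂ) by push_cast; ring, norm_e_ofReal, one_mul, norm_real]
    rcases lt_or_gt_of_ne (hν k) with h | h
    · simp [sign_neg h]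
    · simp [sign_pos h]
  set f : ℤ → ℝ → ℝ := fun k t => |(k : ℝ) + -B| * t ^ (-(3 / 2) : ℝ) *
    Real.exp (-Real.pi * |(k : ℝ) + -B| ^ 2 / t - Real.pi * y ^ 2 * t) with hf
  have hfi := fun k => laplace_gaussian (abs_pos.mpr (hν k)) hy0
  have hfn : ∀ k t, 0 < t → 0 ≤ f k t := by
    intro k t ht
    have := Real.rpow_nonneg ht.le (-(3 / 2))
    simp only [hf]; positivity
  have heq : ∀ t : ℝ, 0 < t → oddTheta A B t * cexp (-Real.pi * x ^ 2 * t) =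
      ∑' k, s k * f k t := by
    intro t ht
    rw [oddTheta_inv A B ht, oddTheta, ← tsum_mul_left, ← tsum_mul_right]
    refine tsum_congr fun k => ?_
    have e1 : e (A * B) * e (((k : ℂ) + ((-B : ℝ) : ℂ)) * A) = e (k * A) := by
      rw [← e_add]; congr 1; push_cast; ring
    have e2 : cexp (-Real.pi * ((k : ℂ) + ((-B : ℝ) : ℂ)) ^ 2 * ((1 / t : ℝ) : ℂ)) *
        cexp (-Real.pi * x ^ 2 * t) =
        ((Real.exp (-Real.pi * |(k : ℝ) + -B| ^ 2 / t - Real.pi * y ^ 2 * t) : ℝ) : ℂ) := by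
      rw [← exp_add, sq_abs, ← hxy]
      push_cast
      congr 1
      field_simp
      ring
    have e3 : (k : ℂ) + ((-B : ℝ) : ℂ) = ((SignType.sign ((k : ℝ) + -B) : ℝ) : ℂ) *
        ((|(k : ℝ) + -B| : ℝ) : ℂ) := by
      rw [← ofReal_mul, sign_mul_abs]; push_cast; ring
    simp only [hs, hf]
    rw [ofReal_mul, ← e2, ofReal_mul, ← e1]
    linear_combination (-I * e (A * B) * ((t ^ (-(3 / 2) : ℝ) : ℝ) : ℂ) *
      e (((k : ℂ) + ((-B : ℝ) : ℂ)) * A) *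
      cexp (-Real.pi * ((k : ℂ) + ((-B : ℝ) : ℂ)) ^ 2 * ((1 / t : ℝ) : ℂ)) *
      cexp (-Real.pi * x ^ 2 * t)) * e3
  have hG : HasSum (fun k : ℤ => s k * Real.exp (-2 * Real.pi * |(k : ℝ) + -B| * y))
      (I / 2 * e (a / 2) * (sechKernel a b y + sechKernel a b (-y))) := by
    rw [← (Equiv.addRight (1 : ℤ)).hasSum_iff]
    have hr : ‖cexp (-2 * Real.pi * y)‖ < 1 := by
      rw [norm_exp]
      have : (-2 * Real.pi * y : ℂ).re = -(2 * Real.pi * y) := by simp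
      rw [this, Real.exp_lt_one_iff]
      have := mul_pos Real.pi_pos hy0
      linarith
    have hr1 : ‖e (a + 1 / 2) * cexp (-2 * Real.pi * y)‖ < 1 := by
      have : ‖e ((a : ℂ) + 1 / 2)‖ = 1 := by
        simpa using norm_e_ofReal (a + 1 / 2)
      rw [norm_mul, this, one_mul]; exact hr
    have hr2 : ‖e (-(a + 1 / 2)) * cexp (-2 * Real.pi * y)‖ < 1 := by
      have : ‖e (-((a : ℂ) + 1 / 2))‖ = 1 := by
        simpa using norm_e_ofReal (-(a + 1 / 2))
      rw [norm_mul, this, one_mul]; exact hr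
    have g1 := (hasSum_geometric_of_norm_lt_one hr1).mul_right (-I * e (a + 1 / 2) *
      cexp (-2 * Real.pi * (1 / 2 - b) * y))
    have g2 := (hasSum_geometric_of_norm_lt_one hr2).mul_right (I *
      cexp (-2 * Real.pi * (b + 1 / 2) * y))
    rw [sechKernel_pos hy0] at g1
    rw [sechKernel_neg hy0] at g2
    rw [mul_add]
    refine HasSum.of_nat_of_neg_add_one (g1.congr_fun fun m => ?_) (g2.congr_fun fun m => ?_)
    · have hp : 0 < (((m : ℤ) + 1 : ℤ) : ℝ) + -B := by
        push_cast
        have : (0 : ℝ) ≤ m := Nat.cast_nonneg m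
        linarith
      simp only [Function.comp, Equiv.coe_addRight, hs]
      rw [sign_pos hp, abs_of_pos hp, mul_pow, e_pow, ← exp_nat_mul]
      have e1 : e ((((m : ℤ) + 1 : ℤ) : ℂ) * A) = e (m * (a + 1 / 2)) * e (a + 1 / 2) := by
        rw [← e_add, hA]; congr 1; push_cast; ring
      have e2 : ((Real.exp (-2 * Real.pi * ((((m : ℤ) + 1 : ℤ) : ℝ) + -B) * y) : ℝ) : ℂ) =
          cexp (m * (-2 * Real.pi * y)) * cexp (-2 * Real.pi * (1 / 2 - b) * y) := by
        rw [← exp_add, hB]; push_cast; congr 1; ring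
      rw [e1, e2]
      simp
      ring
    · have hp : (((-((m : ℤ) + 1) + 1 : ℤ)) : ℝ) + -B < 0 := by
        push_cast
        have : (0 : ℝ) ≤ m := Nat.cast_nonneg m
        linarith
      simp only [Function.comp, Equiv.coe_addRight, hs]
      rw [sign_neg hp, abs_of_neg hp, mul_pow, e_pow, ← exp_nat_mul]
      have e1 : e (((-((m : ℤ) + 1) + 1 : ℤ) : ℂ) * A) = e (m * (-(a + 1 / 2))) := by
        rw [hA]; congr 1; push_cast; ring
      have e2 : ((Real.exp (-2 * Real.pi * (-((((-((m : ℤ) + 1) + 1 : ℤ)) : ℝ) + -B)) * y) : ℝ) : ℂ) =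
          cexp (m * (-2 * Real.pi * y)) * cexp (-2 * Real.pi * (b + 1 / 2) * y) := by
        rw [← exp_add, hB]; push_cast; congr 1; ring
      rw [e1, e2]
      simp
      ring
  have hint : ∀ k, ∫ t in Set.Ioi (0 : ℝ), ‖s k * f k t‖ =
      Real.exp (-2 * Real.pi * |(k : ℝ) + -B| * y) := by
    intro k
    rw [← (hfi k).2]
    refine setIntegral_congr_fun measurableSet_Ioi fun t ht => ?_
    rw [norm_mul, hsn, one_mul, norm_real, Real.norm_of_nonneg (hfn k t ht)]
  have key := hasSum_integral_of_summable_integral_norm (μ := volume.restrict (Set.Ioi (0 : ℝ)))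
    (F := fun k t => s k * f k t) (fun k => (hfi k).1.ofReal.const_mul (s k)) (by
      simp only [hint]
      have := hG.summable.norm
      refine this.congr fun k => ?_
      rw [norm_mul, hsn, one_mul, norm_real, Real.norm_of_nonneg (Real.exp_pos _).le])
  rw [hsymm, setIntegral_congr_fun measurableSet_Ioi heq]
  refine key.unique ?_
  refine hG.congr_fun fun k => ?_
  rw [integral_const_mul, integral_complex_ofReal, (hfi k).2]

end EtaTheta

open Complex Filter Topology
namespace EtaTheta

/-! ### Mordell integrals as Eichler integrals -/

lemma exists_gaussian_strip_bound {τ : ℂ} (hτ : 0 < τ.im) (B : ℂ) : ∃ C : ℝ, 0 ≤ C ∧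
    ∀ w : ℂ, |w.im| ≤ 1 → ‖cexp (Real.pi * I * τ * w ^ 2 + B * w)‖ ≤ C * Real.exp (-1 * |w.re|) := by
  have hδ : 0 < Real.pi * τ.im := mul_pos Real.pi_pos hτ
  set δ := Real.pi * τ.im with hδe
  set R := 2 * Real.pi * ‖τ‖ + ‖B‖
  refine ⟨Real.exp (R ^ 2 / (2 * δ)) * Real.exp (1 / (2 * δ)) * Real.exp (Real.pi * ‖τ‖ + ‖B‖),
    by positivity, fun w hw => ?_⟩
  have hpi : ‖(Real.pi : ℂ)‖ = Real.pi := by rw [norm_real, Real.norm_of_nonneg Real.pi_pos.le]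
  have e1 : cexp (Real.pi * I * τ * w ^ 2 + B * w) = cexp (Real.pi * I * τ * (w.re : ℂ) ^ 2 +
      (-(2 * Real.pi * τ * w.im) + B) * (w.re : ℂ)) *
      cexp (-(Real.pi * τ * I * w.im ^ 2) + B * (I * w.im)) := by
    rw [← exp_add]
    congr 1
    conv_lhs => rw [← re_add_im w]
    linear_combination (2 * Real.pi * τ * w.re * w.im + Real.pi * I * τ * w.im ^ 2) * I_sq
  have b1 : ‖cexp (Real.pi * I * τ * (w.re : ℂ) ^ 2 +
      (-(2 * Real.pi * τ * w.im) + B) * (w.re : ℂ))‖ ≤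
      Real.exp (R ^ 2 / (2 * δ)) * (Real.exp (1 / (2 * δ)) * Real.exp (-1 * |w.re|)) := by
    refine (norm_cexp_quadratic_le hδ (pi_I_mul_re τ).le (R := R) ?_ _).trans ?_
    · refine (norm_add_le _ _).trans ?_
      rw [norm_neg]
      simp only [norm_mul, hpi, norm_real, RCLike.norm_ofNat, Real.norm_eq_abs, R]
      have := mul_le_mul_of_nonneg_left hw (by positivity : 0 ≤ 2 * Real.pi * ‖τ‖)
      linarith
    · rw [← Real.exp_add (1 / (2 * δ))]
      refine mul_le_mul_of_nonneg_left (Real.exp_le_exp.mpr ?_) (Real.exp_pos _).le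
      rw [← sq_abs w.re]
      have h1 : 1 / (2 * δ) + -1 * |w.re| - -(δ / 2) * |w.re| ^ 2 =
          (1 - δ * |w.re|) ^ 2 / (2 * δ) := by field_simp; ring
      have h2 : 0 ≤ (1 - δ * |w.re|) ^ 2 / (2 * δ) := by positivity
      linarith
  have b2 : ‖cexp (-(Real.pi * τ * I * w.im ^ 2) + B * (I * w.im))‖ ≤
      Real.exp (Real.pi * ‖τ‖ + ‖B‖) := by
    rw [norm_exp]
    refine Real.exp_le_exp.mpr ((re_le_norm _).trans ((norm_add_le _ _).trans ?_))
    rw [norm_neg]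
    simp only [norm_mul, hpi, norm_real, Real.norm_eq_abs, norm_pow, norm_I, mul_one, one_mul]
    have h1 : |w.im| ^ 2 ≤ 1 := by nlinarith [abs_nonneg w.im]
    have h2 := mul_le_mul_of_nonneg_left h1 (by positivity : 0 ≤ Real.pi * ‖τ‖)
    have h3 := mul_le_mul_of_nonneg_left hw (norm_nonneg B)
    linarith
  rw [e1, norm_mul]
  calc _ ≤ Real.exp (R ^ 2 / (2 * δ)) * (Real.exp (1 / (2 * δ)) * Real.exp (-1 * |w.re|)) *
        Real.exp (Real.pi * ‖τ‖ + ‖B‖) := by gcongr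
    _ = _ := by ring

lemma cos_le_norm_cosh {z : ℂ} {s : ℝ} (h : |z.im| ≤ s) (hs : s ≤ Real.pi) :
    Real.cos s ≤ ‖cosh z‖ := by
  have h1 := normSq_cosh z
  have h2 : Real.cos s ≤ Real.cos z.im := by
    rw [← Real.cos_abs z.im]
    exact Real.cos_le_cos_of_nonneg_of_le_pi (abs_nonneg _) hs h
  refine h2.trans ((le_abs_self _).trans (abs_le_of_sq_le_sq ?_ (norm_nonneg _)))
  nlinarith [sq_nonneg (Real.sinh z.re)]

/-- The integrand of the Mordell integral on a shifted line. -/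
noncomputable def shiftedIntegrand (a b : ℝ) (σ w : ℂ) : ℂ :=
  cexp (Real.pi * I * σ * w ^ 2) * sechKernel a b w

lemma shiftedIntegrand_bound {a b : ℝ} {σ : ℂ} (ha : |a| < 1 / 2) (hσ : 0 < σ.im) :
    ∃ p q C : ℝ, p < 0 ∧ 0 < q ∧ p < a ∧ a < q ∧
      (∀ w : ℂ, p < w.im → w.im < q → DifferentiableAt ℂ (shiftedIntegrand a b σ) w) ∧
      (∀ w : ℂ, p < w.im → w.im < q → ‖shiftedIntegrand a b σ w‖ ≤ C * Real.exp (-1 * |w.re|)) := by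
  obtain ⟨C, hC0, hC⟩ := exists_gaussian_strip_bound hσ (2 * Real.pi * b)
  set η := (1 / 2 - |a|) / 2 with hη
  have hη0 : 0 < η := by rw [hη]; linarith
  have ha1 := neg_abs_le a
  have ha2 := le_abs_self a
  have ha0 := abs_nonneg a
  have hpi := Real.pi_pos
  have hstrip : ∀ w : ℂ, min 0 a - η < w.im → w.im < max 0 a + η →
      |w.im| ≤ 1 ∧ |(Real.pi * (w - a * I)).im| ≤ Real.pi * (1 / 2 - η) := by
    intro w h1 h2
    have e1 : (Real.pi * (w - a * I)).im = Real.pi * (w.im - a) := by simp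
    rw [e1, abs_mul, abs_of_pos hpi]
    rcases le_total 0 a with h | h
    · rw [min_eq_left h] at h1
      rw [max_eq_right h] at h2
      rw [abs_of_nonneg h] at hη
      refine ⟨abs_le.mpr ⟨by linarith, by linarith⟩, mul_le_mul_of_nonneg_left
        (abs_le.mpr ⟨by linarith, by linarith⟩) hpi.le⟩
    · rw [min_eq_right h] at h1
      rw [max_eq_left h] at h2
      rw [abs_of_nonpos h] at hη
      refine ⟨abs_le.mpr ⟨by linarith, by linarith⟩, mul_le_mul_of_nonneg_left
        (abs_le.mpr ⟨by linarith, by linarith⟩) hpi.le⟩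
  have hlt : Real.pi * (1 / 2 - η) < Real.pi / 2 := by nlinarith
  have hη2 : η ≤ 1 / 4 := by rw [hη]; linarith
  have hκ : 0 < Real.cos (Real.pi * (1 / 2 - η)) :=
    Real.cos_pos_of_mem_Ioo ⟨by nlinarith, hlt⟩
  refine ⟨min 0 a - η, max 0 a + η, C / Real.cos (Real.pi * (1 / 2 - η)),
    by linarith [min_le_left 0 a], by linarith [le_max_left 0 a], by linarith [min_le_right 0 a],
    by linarith [le_max_right 0 a], fun w h1 h2 => ?_, fun w h1 h2 => ?_⟩
  · have h3 := (hstrip w h1 h2).2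
    have h4 : cosh (Real.pi * (w - a * I)) ≠ 0 := cosh_ne_zero_of_im (h3.trans_lt hlt)
    unfold shiftedIntegrand sechKernel
    refine DifferentiableAt.fun_mul (by fun_prop) (DifferentiableAt.fun_div (by fun_prop)
      (by fun_prop) h4)
  · obtain ⟨h3, h4⟩ := hstrip w h1 h2
    have h5 := cos_le_norm_cosh h4 (by nlinarith)
    rw [shiftedIntegrand, sechKernel, ← mul_div_assoc, ← exp_add, norm_div, div_mul_eq_mul_div]
    gcongr
    exact hC w h3

lemma shiftedIntegrand_integrable {a b : ℝ} {σ : ℂ} (ha : |a| < 1 / 2) (hσ : 0 < σ.im) :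
    MeasureTheory.Integrable fun x : ℝ => shiftedIntegrand a b σ x := by
  obtain ⟨p, q, C, hp, hq, -, -, hd, hb⟩ := shiftedIntegrand_bound (b := b) ha hσ
  refine ((integrable_exp_neg_mul_abs one_pos).const_mul C).mono' ?_
    (Eventually.of_forall fun x => ?_)
  · refine Continuous.aestronglyMeasurable (continuous_iff_continuousAt.mpr fun x => ?_)
    have h := (hd x (by simpa) (by simpa)).continuousAt
    exact ContinuousAt.comp (f := fun x : ℝ => (x : ℂ)) h continuous_ofReal.continuousAt
  · have := hb x (by simpa) (by simpa)
    simpa using this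

lemma integral_shiftedIntegrand {a b : ℝ} {σ : ℂ} (ha : |a| < 1 / 2) (hσ : 0 < σ.im) :
    ∫ x : ℝ, shiftedIntegrand a b σ x =
      e (-a ^ 2 * σ / 2 + a * b) * mordell (a * σ - b) σ := by
  obtain ⟨p, q, C, hp, hq, hpa, haq, hd, hb⟩ := shiftedIntegrand_bound (b := b) ha hσ
  have h := integral_horizontal_line_eq one_pos hd hb hp hq hpa haq
  simp only [ofReal_zero, zero_mul, add_zero] at h
  rw [← h, mordell, sechIntegral, ← MeasureTheory.integral_const_mul]
  congr 1
  ext x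
  rw [shiftedIntegrand, sechKernel, ← mul_div_assoc, ← mul_div_assoc, e, ← exp_add, ← exp_add]
  congr 2
  · linear_combination (2 * Real.pi * σ * x * a + Real.pi * σ * I * a ^ 2) * I_sq
  · ring

lemma add_I_mul_im_pos {σ : ℂ} (hσ : 0 < σ.im) {t : ℝ} (ht : 0 < t) : 0 < (σ + t * I).im := by
  simp; linarith

open MeasureTheory in
/-- The Mordell integral as an Eichler integral of a theta function of weight `3/2`. -/
lemma eichler_mordell {a b : ℝ} {σ : ℂ} (ha : |a| < 1 / 2) (hb : |b| < 1 / 2) (hσ : 0 < σ.im) :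
    ∫ t in Set.Ioi (0 : ℝ), oddTheta (a + 1 / 2) (b + 1 / 2) t *
      ((-I * (σ + t * I)) ^ (1 / 2 : ℂ))⁻¹ =
      I * e (a / 2 - a ^ 2 * σ / 2 + a * b) * mordell (a * σ - b) σ := by
  set g := oddTheta (a + 1 / 2) (b + 1 / 2)
  have hg : IntegrableOn g (Set.Ioi 0) := integrableOn_oddTheta _ _
  have h1 : ∀ t ∈ Set.Ioi (0 : ℝ), g t * ((-I * (σ + t * I)) ^ (1 / 2 : ℂ))⁻¹ =
      ∫ x : ℝ, g t * (cexp (Real.pi * I * σ * x ^ 2) * cexp (-Real.pi * x ^ 2 * t)) := by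
    intro t ht
    have h := integral_gaussian_e (add_I_mul_im_pos hσ ht) 0
    rw [show (0 : ℂ) ^ 2 / (2 * (σ + t * I)) = 0 by simp, e_zero, mul_one] at h
    rw [← h, ← integral_const_mul]
    congr 1
    ext x
    rw [← exp_add]
    congr 2
    linear_combination (Real.pi * t * x ^ 2 : ℂ) * I_sq
  rw [setIntegral_congr_fun measurableSet_Ioi h1]
  have hint : Integrable (Function.uncurry fun (t x : ℝ) =>
      g t * (cexp (Real.pi * I * σ * x ^ 2) * cexp (-Real.pi * x ^ 2 * t)))
      ((volume.restrict (Set.Ioi 0)).prod volume) := by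
    have hq : Integrable fun x : ℝ => cexp (Real.pi * I * σ * x ^ 2) := by
      have := integrable_cexp_quadratic' (pi_I_mul_re_neg hσ) 0 0
      simpa using this
    have hm := Integrable.mul_prod hg.integrable hq
    refine hm.mono ?_ ?_
    · refine AEStronglyMeasurable.mul hg.aestronglyMeasurable.comp_fst ?_
      refine Continuous.aestronglyMeasurable ?_
      fun_prop
    · have hset : ∀ᵐ p : ℝ × ℝ ∂((volume.restrict (Set.Ioi 0)).prod volume), 0 < p.1 := by
        have h : ∀ᵐ t ∂(volume.restrict (Set.Ioi (0 : ℝ))), 0 < t :=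
          ae_restrict_mem measurableSet_Ioi
        exact Measure.quasiMeasurePreserving_fst.ae h
      filter_upwards [hset] with p hp
      simp only [Function.uncurry]
      rw [← mul_assoc, norm_mul _ (cexp (-Real.pi * p.2 ^ 2 * p.1))]
      refine mul_le_of_le_one_right (norm_nonneg _) ?_
      rw [show -(Real.pi : ℂ) * p.2 ^ 2 * p.1 = ((-Real.pi * p.2 ^ 2 * p.1 : ℝ) : ℂ) by
        push_cast; ring, norm_exp, ofReal_re, Real.exp_le_one_iff]
      have := Real.pi_pos
      have := mul_nonneg (mul_nonneg this.le (sq_nonneg p.2)) hp.le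
      linarith
  rw [integral_integral_swap hint]
  have h2 : ∀ᵐ x : ℝ, ∫ t in Set.Ioi (0 : ℝ), g t * (cexp (Real.pi * I * σ * x ^ 2) *
      cexp (-Real.pi * x ^ 2 * t)) = I / 2 * e (a / 2) * (shiftedIntegrand a b σ x +
        shiftedIntegrand a b σ ((-x : ℝ) : ℂ)) := by
    have : ∀ᵐ x : ℝ, x ≠ 0 := by simp [ae_iff]
    filter_upwards [this] with x hx
    have h3 := integral_oddTheta_mul_exp (a := a) hb hx
    have h4 : ∀ t : ℝ, g t * (cexp (Real.pi * I * σ * x ^ 2) * cexp (-Real.pi * x ^ 2 * t)) =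
        cexp (Real.pi * I * σ * x ^ 2) * (g t * cexp (-Real.pi * x ^ 2 * t)) := fun t => by ring
    simp only [h4]
    rw [integral_const_mul, h3, shiftedIntegrand, shiftedIntegrand]
    push_cast
    rw [neg_sq]
    ring
  rw [integral_congr_ae h2, integral_const_mul]
  have hi := shiftedIntegrand_integrable (b := b) ha hσ
  rw [integral_add hi (hi.comp_neg (f := fun x : ℝ => shiftedIntegrand a b σ x)),
    integral_neg_eq_self (fun x : ℝ => shiftedIntegrand a b σ x), integral_shiftedIntegrand ha hσ]
  have h5 : e (a / 2 - a ^ 2 * σ / 2 + a * b) = e (a / 2) * e (-a ^ 2 * σ / 2 + a * b) := by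
    rw [← e_add]; congr 1; ring
  rw [h5]
  ring

end EtaTheta

open Complex Filter Topology
namespace EtaTheta

/-! ### The laws of the pieces on the upper half-plane -/

lemma theta_ne_zero_of_not_int {A B : ℚ} {τ : ℂ} (hτ : 0 < τ.im) (h : A.den ≠ 1 ∨ B.den ≠ 1) :
    theta (A * τ + B) τ ≠ 0 := by
  rw [Ne, theta_eq_zero_iff hτ]
  rintro ⟨a, b, hab⟩
  have him := congrArg im hab
  have hre := congrArg re hab
  rw [← ofReal_ratCast, ← ofReal_ratCast, ← ofReal_intCast, ← ofReal_intCast] at him hre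
  simp only [add_im, re_ofReal_mul, im_ofReal_mul, ofReal_im, add_re, ofReal_re, add_zero] at him hre
  have hA : (A : ℝ) = a := mul_right_cancel₀ hτ.ne' him
  rw [hA] at hre
  have hB : (B : ℝ) = b := by linarith
  rcases h with h | h
  · exact h (by rw [show A = (a : ℚ) by exact_mod_cast hA]; simp)
  · exact h (by rw [show B = (b : ℚ) by exact_mod_cast hB]; simp)

/-- The coefficients of `vArg n τ = a τ + b`. -/
def vCoeff (n : ℕ) : ℚ × ℚ :=
  match n with
  | 1 => (1 / 2, 0)
  | 2 => (1 / 2, -1 / 2)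
  | 3 => (1 / 3, 0)
  | 4 => (1 / 3, -1 / 2)
  | 5 => (1 / 4, 0)
  | 6 => (1 / 4, -1 / 2)
  | 7 => (1 / 6, 0)
  | 8 => (1 / 6, -1 / 2)
  | _ => (0, 0)

lemma vArg_eq (n : ℕ) (τ : ℂ) : vArg n τ = (vCoeff n).1 * τ + (vCoeff n).2 := by
  unfold vArg vCoeff
  split <;> push_cast <;> ring

lemma uArg_eq (p : Piece) (n : ℕ) (τ : ℂ) :
    p.uArg n τ = ((vCoeff n).1 + p.α : ℚ) * τ + ((vCoeff n).2 + p.β : ℚ) := by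
  rw [Piece.uArg, vArg_eq]; push_cast; ring

lemma vCoeff_cases {n : ℕ} (h1 : 1 ≤ n) (h8 : n ≤ 8) :
    ((vCoeff n).2 = 0 ∨ (vCoeff n).2 = -1 / 2) ∧ (vCoeff n).1.den ≠ 1 := by
  interval_cases n <;> simp only [vCoeff] <;> decide +kernel

lemma pieces_cases {m : ℕ} {p : Piece} (hp : p ∈ pieces m) :
    (-1 / 2 < p.α ∧ p.α < 0) ∧ ((p.β = 1 / 2 ∧ p.w = -1 ∧ ellConst m = 2) ∨
      (p.β = 0 ∧ p.w = I ∧ ellConst m = 1)) := by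
  unfold pieces at hp
  split at hp <;> simp only [List.mem_cons, List.not_mem_nil, or_false] at hp
  case h_4 => rcases hp with rfl | rfl <;> norm_num [ellConst]
  all_goals subst hp; norm_num [ellConst]

lemma uArg_den {m n : ℕ} (hmn : Admissible m n) {p : Piece} (hp : p ∈ pieces m) :
    ((vCoeff n).1 + p.α).den ≠ 1 ∨ ((vCoeff n).2 + p.β).den ≠ 1 := by
  obtain ⟨h1, h2, h3, h4, h5⟩ := hmn
  interval_cases m <;> simp only [pieces, List.mem_cons, List.not_mem_nil, or_false] at hp <;>
    interval_cases n <;> first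
      | (exfalso; revert h5; simp; done)
      | (subst hp; simp only [vCoeff]; decide +kernel)
      | (rcases hp with rfl | rfl <;> simp only [vCoeff] <;> decide +kernel)

lemma theta_uArg_ne_zero {m n : ℕ} (hmn : Admissible m n) {p : Piece} (hp : p ∈ pieces m) {τ : ℂ}
    (hτ : 0 < τ.im) : theta (p.uArg n τ) τ ≠ 0 := by
  rw [uArg_eq]; exact theta_ne_zero_of_not_int hτ (uArg_den hmn hp)

lemma theta_vArg_ne_zero {m n : ℕ} (hmn : Admissible m n) {τ : ℂ} (hτ : 0 < τ.im) :
    theta (vArg n τ) τ ≠ 0 := by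
  rw [vArg_eq]; exact theta_ne_zero_of_not_int hτ (Or.inl (vCoeff_cases hmn.2.2.1 hmn.2.2.2.1).2)

lemma sum_map_add_mul {ι : Type*} {L : List ι} {f g h : ι → ℂ} {c : ℂ}
    (H : ∀ p ∈ L, f p + c * g p = h p) : (L.map f).sum + c * (L.map g).sum = (L.map h).sum := by
  induction L with
  | nil => simp
  | cons a L ih =>
    have h1 := ih fun p hp => H p (List.mem_cons_of_mem _ hp)
    have h2 := H a List.mem_cons_self
    simp only [List.map_cons, List.sum_cons]
    linear_combination h1 + h2

lemma mu_M2_half {τ u v α : ℂ} (hτ : 0 < τ.im) (hu : theta u τ ≠ 0) (hv : theta v τ ≠ 0)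
    (h : u - v = α * τ + 1 / 2) :
    mu u v τ - ((2 * τ + 1) ^ (1 / 2 : ℂ))⁻¹ * e (α ^ 2 * τ ^ 2 / (2 * τ + 1)) *
      mu ((u + τ) / (2 * τ + 1)) (v / (2 * τ + 1)) (τ / (2 * τ + 1)) =
    e (-3 / 16) * ((√2 / 4 : ℝ) : ℂ) *
      (mordell (α * τ + 1 / 4) (τ + 1 / 2) - mordell (α * τ - 1 / 4) (τ + 1 / 2)) := by
  have h0 : 2 * τ + 1 ≠ 0 := ne_zero_of_im_pos (two_mul_add_one_im hτ)
  have h1 := mu_M2 hτ (theta_add_tau_ne_zero.2 hu) hv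
  rw [mu_add_tau_left hτ hu hv, show u + τ - v = α * τ + 1 / 2 + τ by rw [← h]; ring,
    mordellTwo_add_tau_aux hτ, h] at h1
  have hP : e ((α * τ + 1 / 2 + τ) ^ 2 / (2 * τ + 1)) =
      -I * e (α * τ + 1 / 2 + τ / 2) * e (α ^ 2 * τ ^ 2 / (2 * τ + 1)) := by
    rw [show -I = e (-1 / 4) by rw [I_eq_e]; exact (e_congr_neg (-1) (by push_cast; ring)).symm]
    simp only [← e_add]
    congr 1
    generalize hd : 2 * τ + 1 = d at h0
    obtain rfl : τ = (d - 1) / 2 := by rw [← hd]; ring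
    field_simp
    ring
  rw [hP, show α * τ + 1 / 2 - 3 / 4 = α * τ - 1 / 4 by ring,
    show α * τ + 1 / 2 - 1 / 4 = α * τ + 1 / 4 by ring] at h1
  have hE := e_ne_zero (α * τ + 1 / 2 + τ / 2)
  refine mul_left_cancel₀ hE ?_
  generalize e (α * τ + 1 / 2 + τ / 2) = E at *
  generalize e (α ^ 2 * τ ^ 2 / (2 * τ + 1)) = F at *
  linear_combination -h1 - ((2 * τ + 1) ^ (1 / 2 : ℂ))⁻¹ * E * F *
    mu ((u + τ) / (2 * τ + 1)) (v / (2 * τ + 1)) (τ / (2 * τ + 1)) * I_sq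

/-- The error of the `M_2`-law of a piece. -/
noncomputable def errorTwo (m : ℕ) (p : Piece) (τ : ℂ) : ℂ :=
  p.w * (e (-3 / 16) * ((√2 / 4 : ℝ) : ℂ)) * (e (p.t * τ) *
    (mordell (p.α * τ + 1 / 4) (τ + 1 / 2) -
      (-1) ^ ellConst m * mordell (p.α * τ - 1 / 4) (τ + 1 / 2)))

/-- The error of the `M_1`-law of a piece. -/
noncomputable def errorOne (p : Piece) (τ : ℂ) : ℂ :=
  p.w * (e (p.t * τ) * (e (1 / 8) * (mordell (p.α * τ) (τ + 1) / (2 * I))))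

lemma e_t_mul_of_linear (p : Piece) {τ d : ℂ} {r : ℂ} (hd : d = r * τ + 1) (h0 : d ≠ 0)
    (hr : r ≠ 0) :
    e (p.t * (τ / d)) = e (p.t * τ) * e (r / 2 * p.α ^ 2 * τ ^ 2 / d) := by
  rw [← e_add, Piece.t]
  congr 1
  obtain rfl : τ = (d - 1) / r := by rw [hd]; field_simp; ring
  field_simp
  ring

theorem VUpper_M2 {m n : ℕ} (hmn : Admissible m n) {τ : ℂ} (hτ : 0 < τ.im) :
    VUpper m n τ + zeta 4 ^ ellConst m * (2 * τ + 1) ^ (-1 / 2 : ℂ) *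
      VUpper m n (τ / (2 * τ + 1)) = ((pieces m).map fun p => errorTwo m p τ).sum := by
  have h0 : 2 * τ + 1 ≠ 0 := ne_zero_of_im_pos (two_mul_add_one_im hτ)
  refine sum_map_add_mul fun p hp => ?_
  have hE := e_t_mul_of_linear p (τ := τ) (d := 2 * τ + 1) rfl h0 two_ne_zero
  rw [hE, show (2 : ℂ) / 2 * p.α ^ 2 * τ ^ 2 = p.α ^ 2 * τ ^ 2 by ring, errorTwo, cpow_neg_half]
  obtain ⟨-, hβ⟩ := pieces_cases hp
  have hz4 : zeta 4 = I := by rw [zeta, I_eq_e]; norm_num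
  have huv : p.uArg n τ - vArg n τ = p.α * τ + p.β := by rw [Piece.uArg]; ring
  have hb : ∃ u v, theta u τ ≠ 0 ∧ theta v τ ≠ 0 ∧ mu u v τ = mu (p.uArg n τ) (vArg n τ) τ ∧
      u - v = p.α * τ + p.β ∧ vArg n (τ / (2 * τ + 1)) = v / (2 * τ + 1) := by
    have hu := theta_uArg_ne_zero hmn hp hτ
    have hv := theta_vArg_ne_zero hmn hτ
    rcases (vCoeff_cases hmn.2.2.1 hmn.2.2.2.1).1 with h | h
    · refine ⟨_, _, hu, hv, rfl, huv, ?_⟩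
      rw [vArg_eq, vArg_eq, h]
      field_simp
      simp
    · refine ⟨p.uArg n τ - τ, vArg n τ - τ, theta_sub_tau_ne_zero.2 hu, theta_sub_tau_ne_zero.2 hv,
        ?_, by rw [← huv]; ring, ?_⟩
      · conv_rhs => rw [← sub_add_cancel (p.uArg n τ) τ, ← sub_add_cancel (vArg n τ) τ,
          mu_add_tau_both]
      · rw [vArg_eq, vArg_eq, h]
        push_cast
        generalize hd : 2 * τ + 1 = d at h0
        obtain rfl : τ = (d - 1) / 2 := by rw [← hd]; ring
        field_simp
        ring
  obtain ⟨u, v, hu, hv, hmu, huv', hv'⟩ := hb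
  rw [← hmu]
  have hu' : p.uArg n (τ / (2 * τ + 1)) = v / (2 * τ + 1) + p.α * τ / (2 * τ + 1) + p.β := by
    rw [Piece.uArg, hv']; ring
  rw [hu', hv']
  rcases hβ with ⟨hβ, hw, hl⟩ | ⟨hβ, hw, hl⟩
  · rw [hβ] at huv' ⊢
    have h := mu_M2_half hτ hu hv (huv'.trans (by push_cast; ring))
    have h5 : v / (2 * τ + 1) + p.α * τ / (2 * τ + 1) + ((1 / 2 : ℚ) : ℂ) =
        (u + τ) / (2 * τ + 1) := by
      obtain rfl : u = p.α * τ + ((1 / 2 : ℚ) : ℂ) + v := by rw [← huv']; ring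
      field_simp
      push_cast
      ring
    rw [h5, hl, hz4, I_sq]
    linear_combination p.w * e (p.t * τ) * h
  · rw [hβ] at huv' ⊢
    have h := mu_M2 hτ hu hv
    rw [huv', mordellTwo] at h
    have h5 : v / (2 * τ + 1) + p.α * τ / (2 * τ + 1) + ((0 : ℚ) : ℂ) = u / (2 * τ + 1) := by
      obtain rfl : u = p.α * τ + ((0 : ℚ) : ℂ) + v := by rw [← huv']; ring
      field_simp
      ring
    rw [h5, hl, hz4]
    simp only [Rat.cast_zero, add_zero, mul_pow] at h
    linear_combination p.w * e (p.t * τ) * h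

theorem VUpper_M1 {m : ℕ} (hmn : Admissible m 1) (hm : m = 2 ∨ m = 4 ∨ m = 6) {τ : ℂ}
    (hτ : 0 < τ.im) :
    VUpper m 1 τ - (zeta 8)⁻¹ * (τ + 1) ^ (-1 / 2 : ℂ) * VUpper m 1 (τ / (τ + 1)) =
      ((pieces m).map fun p => errorOne p τ).sum := by
  have h0 : τ + 1 ≠ 0 := ne_zero_of_im_pos (by simpa using hτ)
  rw [sub_eq_add_neg, ← neg_mul]
  refine sum_map_add_mul fun p hp => ?_
  have hE := e_t_mul_of_linear p (τ := τ) (d := τ + 1) (r := 1) (by ring) h0 one_ne_zero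
  rw [hE, errorOne, cpow_neg_half]
  have hβ : p.β = 0 := by
    rcases (pieces_cases hp).2 with h | h
    · rcases hm with rfl | rfl | rfl <;> simp [ellConst] at h
    · exact h.1
  have hu := theta_uArg_ne_zero hmn hp hτ
  have hv := theta_vArg_ne_zero hmn hτ
  have h := mu_M1 hτ hu hv
  have huv : p.uArg 1 τ - vArg 1 τ = p.α * τ := by rw [Piece.uArg, hβ]; push_cast; ring
  have h1 : vArg 1 (τ / (τ + 1)) = vArg 1 τ / (τ + 1) := by simp only [vArg]; field_simp
  have h2 : p.uArg 1 (τ / (τ + 1)) = p.uArg 1 τ / (τ + 1) := by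
    simp only [Piece.uArg, hβ, vArg]; field_simp; simp
  rw [huv] at h
  rw [h1, h2, show (1 : ℂ) / 2 * p.α ^ 2 * τ ^ 2 / (τ + 1) = (p.α * τ) ^ 2 / (2 * (τ + 1)) by
    field_simp]
  linear_combination p.w * e (p.t * τ) * h

/-- The behaviour of `μ` under integral translations of its arguments. -/
lemma mu_add_nat (u v : ℂ) (N : ℕ) (K L : ℤ) (τ : ℂ) :
    mu (u + K) (v + L) (τ + N) = e (-N / 8 + (K + L) / 2) * mu u v τ := by
  have hK : ∀ (K : ℤ) (u : ℂ), mu (u + K) v τ = e (K / 2) * mu u v τ := by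
    intro K
    induction K with
    | zero => intro u; simp [e_zero]
    | succ k ih =>
      intro u
      rw [show u + ((k + 1 : ℤ) : ℂ) = u + 1 + (k : ℤ) by push_cast; ring, ih, mu_add_one_left,
        mul_neg, ← neg_mul]
      congr 1
      exact (e_congr_neg 0 (by push_cast; ring)).symm
    | pred k ih =>
      intro u
      have := ih (u - 1)
      rw [show u + ((-k - 1 : ℤ) : ℂ) = u - 1 + ((-k : ℤ) : ℂ) by push_cast; ring, this,
        ← sub_add_cancel u 1, mu_add_one_left, mul_neg, ← neg_mul, add_sub_cancel_right]
      congr 1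
      exact e_congr_neg 0 (by push_cast; ring)
  have hL : ∀ (L : ℤ) (u v : ℂ), mu u (v + L) τ = e (L / 2) * mu u v τ := by
    intro L
    induction L with
    | zero => intro u v; simp [e_zero]
    | succ k ih =>
      intro u v
      rw [show v + ((k + 1 : ℤ) : ℂ) = v + 1 + (k : ℤ) by push_cast; ring, ih, mu_add_one_right,
        mul_neg, ← neg_mul]
      congr 1
      exact (e_congr_neg 0 (by push_cast; ring)).symm
    | pred k ih =>
      intro u v
      have := ih u (v - 1)
      rw [show v + ((-k - 1 : ℤ) : ℂ) = v - 1 + ((-k : ℤ) : ℂ) by push_cast; ring, this,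
        ← sub_add_cancel v 1, mu_add_one_right, mul_neg, ← neg_mul, add_sub_cancel_right]
      congr 1
      exact e_congr_neg 0 (by push_cast; ring)
  have hN : ∀ N : ℕ, ∀ u v, mu u v (τ + N) = e (-N / 8) * mu u v τ := by
    intro N
    induction N with
    | zero => intro u v; simp [e_zero]
    | succ k ih =>
      intro u v
      rw [show τ + ((k + 1 : ℕ) : ℂ) = τ + k + 1 by push_cast; ring, mu_tau_add_one, ih, ← mul_assoc,
        ← e_add]
      congr 2
      push_cast
      ring
  rw [hN, hL, hK, ← mul_assoc, ← mul_assoc, ← e_add, ← e_add]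
  congr 2
  ring

lemma translation_arith {m n : ℕ} (hmn : Admissible m n) {p : Piece} (hp : p ∈ pieces m) :
    ∃ K L M : ℤ, (vCoeff n).1 * (kappa m n * bConst m : ℕ) = K ∧
      p.α * (kappa m n * bConst m : ℕ) = L ∧
      (kappa m n : ℚ) / aConst m - p.α ^ 2 / 2 * (kappa m n * bConst m : ℕ) -
        (kappa m n * bConst m : ℕ) / 8 + p.α * (kappa m n * bConst m : ℕ) / 2 = M := by
  have key : ∀ A B C : ℚ, A.den = 1 ∧ B.den = 1 ∧ C.den = 1 →
      ∃ K L M : ℤ, A = K ∧ B = L ∧ C = M := fun A B C ⟨hA, hB, hC⟩ =>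
    ⟨A.num, B.num, C.num, (Rat.coe_int_num_of_den_eq_one hA).symm,
      (Rat.coe_int_num_of_den_eq_one hB).symm, (Rat.coe_int_num_of_den_eq_one hC).symm⟩
  apply key
  obtain ⟨h1, h2, h3, h4, h5⟩ := hmn
  interval_cases m <;> simp only [pieces, List.mem_cons, List.not_mem_nil, or_false] at hp <;>
    interval_cases n <;> first
      | (exfalso; revert h5; simp; done)
      | (subst hp; decide +kernel)
      | (rcases hp with rfl | rfl <;> decide +kernel)

theorem VUpper_translate {m n : ℕ} (hmn : Admissible m n) (τ : ℂ) :
    VUpper m n τ - zeta (aConst m) ^ kappa m n * VUpper m n (τ + kappa m n * bConst m) = 0 := by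
  rw [sub_eq_add_neg, ← neg_mul]
  have : ∀ L : List Piece, (L.map fun _ => (0 : ℂ)).sum = 0 := by simp
  refine (sum_map_add_mul fun p hp => ?_).trans (this (pieces m))
  obtain ⟨K, L, M, hK, hL, hM⟩ := translation_arith hmn hp
  have hK' := congrArg (Rat.cast : ℚ → ℂ) hK
  have hL' := congrArg (Rat.cast : ℚ → ℂ) hL
  have hM' := congrArg (Rat.cast : ℚ → ℂ) hM
  generalize hN : kappa m n * bConst m = N at *
  have hNc : (kappa m n : ℂ) * bConst m = N := by rw [← hN]; push_cast; ring
  push_cast at hK' hL' hM'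
  rw [hNc]
  have h1 : vArg n (τ + N) = vArg n τ + K := by rw [vArg_eq, vArg_eq, ← hK']; ring
  have h2 : p.uArg n (τ + N) = p.uArg n τ + (K + L : ℤ) := by
    rw [Piece.uArg, Piece.uArg, h1]; push_cast; rw [← hL']; ring
  rw [h1, h2, mu_add_nat, zeta, e_pow]
  have h3 : e (kappa m n * (1 / (aConst m : ℂ))) * e (p.t * (τ + N)) *
      e (-(N : ℂ) / 8 + ((K + L : ℤ) + K) / 2) = e (p.t * τ) := by
    simp only [← e_add]
    refine e_congr (M + K) ?_
    push_cast
    rw [Piece.t, ← hM', ← hL']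
    ring
  linear_combination -p.w * mu (p.uArg n τ) (vArg n τ) τ * h3

end EtaTheta

open Complex Filter Topology
namespace EtaTheta

/-! ### The coefficients of the eta-theta functions -/

lemma jacobiSym_even {a : ℤ} {k : ℕ} (ha : Even a) (hk : Even k) (h0 : k ≠ 0) : jacobiSym a k = 0 := by
  have : NeZero k := ⟨h0⟩
  rw [jacobiSym.eq_zero_iff_not_coprime]
  intro h
  have : (2 : ℕ) ∣ a.gcd k := Int.dvd_gcd (by exact_mod_cast ha.two_dvd) (by exact_mod_cast hk.two_dvd)
  omega

lemma jacobiSym_odd {a : ℤ} {k : ℕ} (hk : Odd k) (r : ℕ) (h : k % (4 * a.natAbs) = r) :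
    jacobiSym a k = jacobiSym a r := by
  rw [jacobiSym.mod_right a hk, h]

lemma oddChar_one {k : ℕ} (hk : k ≠ 0) :
    oddChar 1 k = if k % 4 = 1 then 1 else if k % 4 = 3 then -1 else 0 := by
  rcases Nat.even_or_odd k with h | h
  · rw [oddChar, jacobiSym_even (by decide) h hk, if_neg (by grind), if_neg (by grind)]
  · rw [oddChar, jacobiSym_odd h (k % 16) rfl]
    have h1 : k % 16 < 16 := Nat.mod_lt _ (by norm_num)
    have h2 : k % 4 = k % 16 % 4 := by omega
    have h3 : k % 16 % 2 = 1 := by grind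
    rw [h2]
    generalize k % 16 = r at *
    interval_cases r <;> first | omega | norm_num

lemma oddChar_two {k : ℕ} (hk : k ≠ 0) : oddChar 2 k =
    if k % 8 = 1 ∨ k % 8 = 3 then 1 else if k % 8 = 5 ∨ k % 8 = 7 then -1 else 0 := by
  rcases Nat.even_or_odd k with h | h
  · rw [oddChar, jacobiSym_even (by decide) h hk, if_neg (by grind), if_neg (by grind)]
  · rw [oddChar, jacobiSym_odd h (k % 8) rfl]
    have h1 : k % 8 < 8 := Nat.mod_lt _ (by norm_num)
    have h3 : k % 8 % 2 = 1 := by grind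
    generalize k % 8 = r at *
    interval_cases r <;> first | omega | norm_num

lemma oddChar_four {k : ℕ} (hk : k ≠ 0) : oddChar 4 k =
    if k % 24 = 1 ∨ k % 24 = 5 ∨ k % 24 = 7 ∨ k % 24 = 11 then 1 else
      if k % 24 = 13 ∨ k % 24 = 17 ∨ k % 24 = 19 ∨ k % 24 = 23 then -1 else 0 := by
  rcases Nat.even_or_odd k with h | h
  · rw [oddChar, jacobiSym_even (by decide) h hk, if_neg (by grind), if_neg (by grind)]
  · rw [oddChar, jacobiSym_odd h (k % 24) rfl]
    have h1 : k % 24 < 24 := Nat.mod_lt _ (by norm_num)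
    have h3 : k % 24 % 2 = 1 := by grind
    generalize k % 24 = r at *
    interval_cases r <;> first | omega | norm_num

lemma jacobiSym_three (k : ℕ) :
    jacobiSym k 3 = if k % 3 = 1 then 1 else if k % 3 = 2 then -1 else 0 := by
  rw [jacobiSym.mod_left, show ((k : ℤ) % (3 : ℕ)) = ((k % 3 : ℕ) : ℤ) by push_cast; rfl]
  have h1 : k % 3 < 3 := Nat.mod_lt _ (by norm_num)
  generalize k % 3 = r at *
  interval_cases r <;> norm_num

lemma jacobiSym_twelve (k : ℕ) : jacobiSym k 12 =
    if k % 6 = 1 then 1 else if k % 6 = 5 then -1 else 0 := by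
  have h2 : jacobiSym k 2 = if k % 2 = 0 then 0 else 1 := by
    rw [jacobiSym.mod_left, show ((k : ℤ) % (2 : ℕ)) = ((k % 2 : ℕ) : ℤ) by push_cast; rfl]
    rcases Nat.mod_two_eq_zero_or_one k with h | h <;> rw [h]
    · exact jacobiSym.zero_left (by norm_num)
    · exact jacobiSym.one_left 2
  rw [show 12 = 2 * (2 * 3) from rfl, jacobiSym.mul_right, jacobiSym.mul_right, h2, jacobiSym_three]
  split_ifs <;> omega

lemma hasSum_nat_of_int {χ : ℕ → ℤ} {M r : ℤ} {ε : ℤ → ℤ} {x S : ℂ}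
    (h1 : ∀ n, χ (M * n + r).natAbs * (M * n + r).natAbs = ε n * (M * n + r))
    (h0 : ∀ k, k ≠ 0 → χ k ≠ 0 → ∃ n, (M * n + r).natAbs = k)
    (hinj : Function.Injective fun n : ℤ => (M * n + r).natAbs)
    (hS : HasSum (fun n : ℤ => (ε n : ℂ) * (M * n + r) * e ((M * n + r) ^ 2 * x)) S) :
    HasSum (fun k : ℕ => (χ k : ℂ) * k * e ((k : ℂ) ^ 2 * x)) S := by
  rw [← hinj.hasSum_iff]
  · refine hS.congr_fun fun n => ?_
    have h2 := congrArg (Int.cast : ℤ → ℂ) (h1 n)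
    push_cast at h2
    have h3 : (((M * n + r).natAbs : ℕ) : ℂ) ^ 2 = ((M : ℂ) * n + r) ^ 2 := by
      have := congrArg (Int.cast : ℤ → ℂ) (Int.natAbs_sq (M * n + r))
      push_cast at this
      rw [← this, Nat.cast_natAbs]
    simp only [Function.comp_apply]
    rw [h3, ← h2]
    simp
  · intro k hk
    by_cases hk0 : k = 0
    · simp [hk0]
    by_cases hχ : χ k = 0
    · simp [hχ]
    obtain ⟨n, hn⟩ := h0 k hk0 hχ
    exact absurd ⟨n, hn⟩ hk

lemma neg_one_zpow_ite (n : ℤ) : (-1 : ℂ) ^ n = ((if n % 2 = 0 then 1 else -1 : ℤ) : ℂ) := by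
  split_ifs with h
  · rw [(Int.even_iff.2 h).neg_one_zpow]; simp
  · rw [(Int.odd_iff.2 (by omega)).neg_one_zpow]; simp

/-- The general term of the two-sided series of the eta-theta function of a piece. -/
noncomputable def etaThetaTerm (m : ℕ) (p : Piece) (u : ℂ) (n : ℤ) : ℂ :=
  1 / 2 * ((-1) ^ ellConst m) ^ n * (n + p.α + 1 / 2) * e ((n + p.α + 1 / 2) ^ 2 * u / 2)

lemma oddE_single {χ : ℕ → ℤ} {m : ℕ} {p : Piece} {u S : ℂ} (M : ℕ) (r : ℤ) (hM : M ≠ 0)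
    (hr : ∀ n : ℤ, (M : ℂ) * (n + p.α + 1 / 2) = M * n + r) (hc : cConst m = 2 * M)
    (h1 : ∀ n : ℤ, χ (M * n + r).natAbs * (M * n + r).natAbs =
      (if ellConst m = 2 ∨ n % 2 = 0 then 1 else -1) * (M * n + r))
    (h0 : ∀ k, k ≠ 0 → χ k ≠ 0 → ∃ n : ℤ, (M * n + r).natAbs = k)
    (hinj : Function.Injective fun n : ℤ => (M * n + r).natAbs)
    (hS : HasSum (etaThetaTerm m p u) S) :
    HasSum (fun k : ℕ => (χ k : ℂ) * k * e ((k : ℂ) ^ 2 * (2 * u / (cConst m : ℂ) ^ 2)))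
      (cConst m * S) := by
  have hM' : (M : ℂ) ≠ 0 := Nat.cast_ne_zero.2 hM
  refine hasSum_nat_of_int h1 h0 hinj ((hS.mul_left (cConst m : ℂ)).congr_fun fun n => ?_)
  have hε : (((if ellConst m = 2 ∨ n % 2 = 0 then 1 else -1 : ℤ)) : ℂ) =
      ((-1) ^ ellConst m) ^ n := by
    have : ellConst m = 1 ∨ ellConst m = 2 := by unfold ellConst; split_ifs <;> simp
    rcases this with h | h
    · rw [h, pow_one, neg_one_zpow_ite]; norm_num
    · simp [h]
  rw [hε, etaThetaTerm, Int.cast_natCast, ← hr, hc]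
  rw [show ((M : ℂ) * (n + p.α + 1 / 2)) ^ 2 * (2 * u / ((2 * M : ℕ) : ℂ) ^ 2) =
    (n + p.α + 1 / 2) ^ 2 * u / 2 by push_cast; field_simp]
  push_cast
  ring

lemma oddE_eq {m : ℕ} (h1 : 1 ≤ m) (h6 : m ≤ 6) {u : ℂ} {T : Piece → ℂ}
    (hT : ∀ p ∈ pieces m, HasSum (etaThetaTerm m p u) (T p)) :
    oddE m (2 * u / (cConst m : ℂ) ^ 2) = cConst m * ((pieces m).map T).sum := by
  refine HasSum.tsum_eq ?_
  interval_cases m <;> simp only [pieces, List.map_cons, List.map_nil, List.sum_cons, List.sum_nil,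
    add_zero, mul_add, List.mem_cons, List.not_mem_nil, or_false, forall_eq, forall_eq_or_imp] at hT ⊢
  · refine oddE_single 4 1 (by norm_num) (by intro n; push_cast; ring) rfl ?_ ?_ ?_ hT
    · intro n
      rw [oddChar_one (by omega)]
      rw [if_pos (Or.inl (show ellConst 1 = 2 from rfl))]
      simp only [Nat.cast_ofNat]
      split_ifs <;> omega
    · intro k hk h
      rw [oddChar_one hk] at h
      split_ifs at h with h2 h3
      · exact ⟨k / 4, by push_cast; omega⟩
      · exact ⟨-(k / 4) - 1, by push_cast; omega⟩
      · simp at h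
    · intro a b h
      push_cast at h
      omega
  · refine oddE_single 4 1 (by norm_num) (by intro n; push_cast; ring) rfl ?_ ?_ ?_ hT
    · intro n
      rw [oddChar_two (by omega)]
      rw [show ellConst 2 = 1 from rfl]
      simp only [Nat.cast_ofNat]
      split_ifs <;> omega
    · intro k hk h
      rw [oddChar_two hk] at h
      have : k % 4 = 1 ∨ k % 4 = 3 := by
        split_ifs at h <;> omega
      rcases this with h2 | h3
      · exact ⟨k / 4, by push_cast; omega⟩
      · exact ⟨-(k / 4) - 1, by push_cast; omega⟩
    · intro a b h
      push_cast at h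
      omega
  · refine oddE_single 3 1 (by norm_num) (by intro n; push_cast; ring) rfl ?_ ?_ ?_ hT
    · intro n
      rw [oddChar, jacobiSym_three]
      rw [if_pos (Or.inl (show ellConst 3 = 2 from rfl))]
      simp only [Nat.cast_ofNat]
      split_ifs <;> omega
    · intro k hk h
      rw [oddChar, jacobiSym_three] at h
      have : k % 3 = 1 ∨ k % 3 = 2 := by
        split_ifs at h <;> omega
      rcases this with h2 | h3
      · exact ⟨k / 3, by push_cast; omega⟩
      · exact ⟨-(k / 3) - 1, by push_cast; omega⟩
    · intro a b h
      push_cast at h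
      omega
  · obtain ⟨hT1, hT2⟩ := hT
    have hA := oddE_single (χ := fun k => if k % 12 = 1 ∨ k % 12 = 11 then oddChar 4 k else 0)
      12 1 (by norm_num) (by intro n; push_cast; ring) rfl ?_ ?_ ?_ hT1
    have hB := oddE_single (χ := fun k => if k % 12 = 5 ∨ k % 12 = 7 then oddChar 4 k else 0)
      12 5 (by norm_num) (by intro n; push_cast; ring) rfl ?_ ?_ ?_ hT2
    · refine (hA.add hB).congr_fun fun k => ?_
      rcases eq_or_ne k 0 with rfl | hk
      · simp
      rw [← add_mul, ← add_mul]
      congr 2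
      rw [oddChar_four hk, ← Int.cast_add]
      congr 1
      split_ifs <;> omega
    · intro n
      rw [oddChar_four (by omega)]
      rw [show ellConst 4 = 1 from rfl]
      simp only [Nat.cast_ofNat]
      split_ifs <;> omega
    · intro k hk h
      have : k % 12 = 5 ∨ k % 12 = 7 := by
        by_contra h'
        simp [h'] at h
      rcases this with h2 | h3
      · exact ⟨k / 12, by push_cast; omega⟩
      · exact ⟨-(k / 12) - 1, by push_cast; omega⟩
    · intro a b h
      push_cast at h
      omega
    · intro n
      rw [oddChar_four (by omega)]
      rw [show ellConst 4 = 1 from rfl]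
      simp only [Nat.cast_ofNat]
      split_ifs <;> omega
    · intro k hk h
      have : k % 12 = 1 ∨ k % 12 = 11 := by
        by_contra h'
        simp [h'] at h
      rcases this with h2 | h3
      · exact ⟨k / 12, by push_cast; omega⟩
      · exact ⟨-(k / 12) - 1, by push_cast; omega⟩
    · intro a b h
      push_cast at h
      omega
  · refine oddE_single 6 1 (by norm_num) (by intro n; push_cast; ring) rfl ?_ ?_ ?_ hT
    · intro n
      rw [oddChar, jacobiSym_twelve]
      rw [if_pos (Or.inl (show ellConst 5 = 2 from rfl))]
      simp only [Nat.cast_ofNat]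
      split_ifs <;> omega
    · intro k hk h
      rw [oddChar, jacobiSym_twelve] at h
      have : k % 6 = 1 ∨ k % 6 = 5 := by
        split_ifs at h <;> omega
      rcases this with h2 | h3
      · exact ⟨k / 6, by push_cast; omega⟩
      · exact ⟨-(k / 6) - 1, by push_cast; omega⟩
    · intro a b h
      push_cast at h
      omega
  · refine oddE_single 3 1 (by norm_num) (by intro n; push_cast; ring) rfl ?_ ?_ ?_ hT
    · intro n
      rw [oddChar, jacobiSym_twelve, jacobiSym_three]
      rw [show ellConst 6 = 1 from rfl]
      simp only [Nat.cast_ofNat]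
      split_ifs <;> omega
    · intro k hk h
      rw [oddChar, jacobiSym_twelve, jacobiSym_three] at h
      have : k % 3 = 1 ∨ k % 3 = 2 := by
        split_ifs at h <;> omega
      rcases this with h2 | h3
      · exact ⟨k / 3, by push_cast; omega⟩
      · exact ⟨-(k / 3) - 1, by push_cast; omega⟩
    · intro a b h
      push_cast at h
      omega

end EtaTheta

open Complex Filter Topology
namespace EtaTheta

/-! ### Eichler integrals of the eta-theta functions -/

/-- The eta-theta function of a piece on the line with real part `1/2`. -/
noncomputable def lineHalf (m : ℕ) (p : Piece) (t : ℝ) : ℂ :=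
  p.w * (e (-3 / 16) * ((√2 / 4 : ℝ) : ℂ)) * -I *
    (e (-p.α / 4 - p.α ^ 2 / 4) * oddTheta ((p.α : ℝ) + 1 / 2) ((p.α : ℝ) / 2 - 1 / 4 + 1 / 2) t -
      (-1) ^ ellConst m * (e (-3 * p.α / 4 - p.α ^ 2 / 4) *
        oddTheta ((p.α : ℝ) + 1 / 2) ((p.α : ℝ) / 2 + 1 / 4 + 1 / 2) t))

/-- The eta-theta function of a piece on the line with real part `1`. -/
noncomputable def lineOne (p : Piece) (t : ℝ) : ℂ :=
  p.w * e (1 / 8) * (-1 / 2) * (e (-p.α / 2 - p.α ^ 2 / 2) *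
    oddTheta ((p.α : ℝ) + 1 / 2) ((p.α : ℝ) + 1 / 2) t)

lemma e_neg_eighth : e (-1 / 8) = (1 - I) * ((√2 / 2 : ℝ) : ℂ) := by
  have h := e_add (-1 / 8) (1 / 8)
  rw [show (-1 / 8 : ℂ) + 1 / 8 = 0 by ring, e_zero] at h
  refine mul_right_cancel₀ (e_ne_zero (1 / 8)) ?_
  rw [← h, e_eighth]
  linear_combination (I ^ 2 - 1) * sqrt_two_cast_sq + 1 / 2 * I_sq

lemma half_phase {m : ℕ} {p : Piece} (hp : p ∈ pieces m) (n : ℤ) :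
    p.w * (e (-3 / 16) * ((√2 / 4 : ℝ) : ℂ)) * -I * (e (-n ^ 2 / 4 + 1 / 16) -
      (-1) ^ ellConst m * e (-n ^ 2 / 4 + n / 2 + 5 / 16)) = 1 / 2 * ((-1) ^ ellConst m) ^ n := by
  have h1 : e (-3 / 16) * e (-n ^ 2 / 4 + 1 / 16) = e (-n ^ 2 / 4) * e (-1 / 8) := by
    simp only [← e_add]; congr 1; ring
  have h2 : e (-3 / 16) * e (-n ^ 2 / 4 + n / 2 + 5 / 16) =
      e (-n ^ 2 / 4) * e (n / 2) * e (1 / 8) := by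
    simp only [← e_add]; congr 1; ring
  have h3 : ((√2 / 4 : ℝ) : ℂ) = ((√2 / 2 : ℝ) : ℂ) / 2 := by push_cast; ring
  have hs := sqrt_two_cast_sq
  rw [e_eighth] at h2
  rw [e_neg_eighth] at h1
  rw [h3]
  generalize ((√2 / 2 : ℝ) : ℂ) = s at *
  have hI : (-I : ℂ) = e (-1 / 4) := by rw [I_eq_e]; exact (e_congr_neg (-1) (by push_cast; ring)).symm
  rcases Int.even_or_odd' n with ⟨k, rfl | rfl⟩
  · have h4 : e (-((2 * k : ℤ) : ℂ) ^ 2 / 4) = 1 := by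
      rw [← e_zero]; exact e_congr (-k ^ 2) (by push_cast; ring)
    have h5 : e (((2 * k : ℤ) : ℂ) / 2) = 1 := by
      rw [← e_zero]; exact e_congr k (by push_cast; ring)
    rw [h4, one_mul] at h1
    rw [h4, h5, one_mul, one_mul] at h2
    rcases (pieces_cases hp).2 with ⟨-, hw, hl⟩ | ⟨-, hw, hl⟩
    · rw [hw, hl, neg_one_sq, one_zpow, one_mul]
      linear_combination I * s / 2 * (h1 - h2) - I ^ 2 * hs - 1 / 2 * I_sq
    · rw [hw, hl, pow_one, ((even_two_mul k).neg_one_zpow)]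
      linear_combination -I ^ 2 * s / 2 * (h1 + h2) - I ^ 2 * hs - 1 / 2 * I_sq
  · have h4 : e (-((2 * k + 1 : ℤ) : ℂ) ^ 2 / 4) = -I := by
      rw [hI]; exact e_congr (-k ^ 2 - k) (by push_cast; ring)
    have h5 : e (((2 * k + 1 : ℤ) : ℂ) / 2) = -1 := by
      rw [← e_zero]; exact e_congr_neg k (by push_cast; ring)
    rw [h4] at h1
    rw [h4, h5] at h2
    rcases (pieces_cases hp).2 with ⟨-, hw, hl⟩ | ⟨-, hw, hl⟩
    · rw [hw, hl, neg_one_sq, one_zpow, one_mul]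
      linear_combination I * s / 2 * (h1 - h2) - I ^ 2 * hs - 1 / 2 * I_sq
    · rw [hw, hl, pow_one, ((odd_two_mul_add_one k).neg_one_zpow)]
      linear_combination -I ^ 2 * s / 2 * (h1 + h2) - I ^ 4 * hs - (I ^ 2 - 1) / 2 * I_sq

lemma etaThetaTerm_line (m : ℕ) (p : Piece) (r t : ℝ) (n : ℤ) :
    etaThetaTerm m p (r + t * I) n = 1 / 2 * ((-1) ^ ellConst m) ^ n *
      e ((n + p.α + 1 / 2) ^ 2 * r / 2) * ((n + ((p.α : ℝ) + 1 / 2 : ℝ)) *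
      cexp (-Real.pi * (n + ((p.α : ℝ) + 1 / 2 : ℝ)) ^ 2 * t)) := by
  have h : e ((n + p.α + 1 / 2) ^ 2 * (r + t * I) / 2) = e ((n + p.α + 1 / 2) ^ 2 * r / 2) *
      cexp (-Real.pi * (n + ((p.α : ℝ) + 1 / 2 : ℝ)) ^ 2 * t) := by
    rw [e, e, ← Complex.exp_add]
    congr 1
    push_cast
    linear_combination Real.pi * (n + p.α + 1 / 2) ^ 2 * t * I_sq
  rw [etaThetaTerm, h]
  push_cast
  ring

lemma hasSum_lineHalf {m : ℕ} {p : Piece} (hp : p ∈ pieces m) {t : ℝ} (ht : 0 < t) :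
    HasSum (etaThetaTerm m p ((1 / 2 : ℝ) + t * I)) (lineHalf m p t) := by
  have h1 := (summable_oddTheta ((p.α : ℝ) + 1 / 2) ((p.α : ℝ) / 2 - 1 / 4 + 1 / 2) ht).hasSum
  have h2 := (summable_oddTheta ((p.α : ℝ) + 1 / 2) ((p.α : ℝ) / 2 + 1 / 4 + 1 / 2) ht).hasSum
  refine (((h1.mul_left (e (-p.α / 4 - p.α ^ 2 / 4))).sub ((h2.mul_left
    (e (-3 * p.α / 4 - p.α ^ 2 / 4))).mul_left ((-1) ^ ellConst m))).mul_left
      (p.w * (e (-3 / 16) * ((√2 / 4 : ℝ) : ℂ)) * -I)).congr_fun fun n => ?_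
  rw [etaThetaTerm_line, ← half_phase hp]
  have h3 : e (-p.α / 4 - p.α ^ 2 / 4) * e ((n + ((p.α : ℝ) + 1 / 2 : ℝ)) *
      ((p.α : ℝ) / 2 - 1 / 4 + 1 / 2 : ℝ)) =
      e (-n ^ 2 / 4 + 1 / 16) * e ((n + p.α + 1 / 2) ^ 2 * (1 / 2 : ℝ) / 2) := by
    simp only [← e_add]; congr 1; push_cast; ring
  have h4 : e (-3 * p.α / 4 - p.α ^ 2 / 4) * e ((n + ((p.α : ℝ) + 1 / 2 : ℝ)) *
      ((p.α : ℝ) / 2 + 1 / 4 + 1 / 2 : ℝ)) =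
      e (-n ^ 2 / 4 + n / 2 + 5 / 16) * e ((n + p.α + 1 / 2) ^ 2 * (1 / 2 : ℝ) / 2) := by
    simp only [← e_add]; congr 1; push_cast; ring
  linear_combination p.w * (e (-3 / 16) * ((√2 / 4 : ℝ) : ℂ)) * -I *
    (n + ((p.α : ℝ) + 1 / 2 : ℝ)) * cexp (-Real.pi * (n + ((p.α : ℝ) + 1 / 2 : ℝ)) ^ 2 * t) *
    ((-1) ^ ellConst m * h4 - h3)

lemma hasSum_lineOne {m : ℕ} {p : Piece} (hp : p ∈ pieces m) (hm : ellConst m = 1) {t : ℝ}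
    (ht : 0 < t) : HasSum (etaThetaTerm m p ((1 : ℝ) + t * I)) (lineOne p t) := by
  have h1 := (summable_oddTheta ((p.α : ℝ) + 1 / 2) ((p.α : ℝ) + 1 / 2) ht).hasSum
  refine ((h1.mul_left (e (-p.α / 2 - p.α ^ 2 / 2))).mul_left
    (p.w * e (1 / 8) * (-1 / 2))).congr_fun fun n => ?_
  have hw : p.w = I := by
    rcases (pieces_cases hp).2 with h | h
    · omega
    · exact h.2.1
  have h3 : p.w * e (1 / 8) * (e (-p.α / 2 - p.α ^ 2 / 2) * e ((n + ((p.α : ℝ) + 1 / 2 : ℝ)) *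
      ((p.α : ℝ) + 1 / 2 : ℝ))) = -((-1) ^ n * e ((n + p.α + 1 / 2) ^ 2 * (1 : ℝ) / 2)) := by
    rw [hw, neg_one_zpow_eq, I_eq_e]
    simp only [← e_add]
    refine e_congr_neg (-(n * (n + 1) / 2)) ?_
    have : ((n * (n + 1) / 2 : ℤ) : ℂ) = n * (n + 1) / 2 := by
      rw [Int.cast_div (Int.even_mul_succ_self n).two_dvd (by norm_num)]; push_cast; ring
    rw [Int.cast_neg, this]
    push_cast
    ring
  rw [etaThetaTerm_line, hm, pow_one]
  linear_combination 1 / 2 * ((n : ℂ) + ((p.α : ℝ) + 1 / 2 : ℝ)) *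
    cexp (-Real.pi * (n + ((p.α : ℝ) + 1 / 2 : ℝ)) ^ 2 * t) * h3

open MeasureTheory

lemma neg_I_mul_mem_slitPlane {r t : ℝ} (ht : 0 < t) {x : ℂ} (hx : 0 ≤ x.im) :
    -I * ((r : ℂ) + t * I + x) ∈ slitPlane := by
  refine Or.inl ?_
  simp
  linarith

lemma norm_cpow_half (w : ℂ) : ‖w ^ (1 / 2 : ℂ)‖ = √‖w‖ := by
  rw [Eq.comm, Real.sqrt_eq_iff_mul_self_eq (norm_nonneg _) (norm_nonneg _), ← norm_mul, ← sq,
    cpow_half_sq]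

lemma norm_inv_cpow_half_le {r t δ : ℝ} {x : ℂ} (hδ : 0 < δ) (h : δ ≤ ‖(r : ℂ) + t * I + x‖) :
    ‖((-I * ((r : ℂ) + t * I + x)) ^ (1 / 2 : ℂ))⁻¹‖ ≤ (√δ)⁻¹ := by
  rw [norm_inv, norm_cpow_half, norm_mul, norm_neg, norm_I, one_mul]
  have := Real.sqrt_pos.2 hδ
  gcongr

lemma continuousOn_inv_cpow_half {r : ℝ} {x : ℂ} (hx : 0 ≤ x.im) :
    ContinuousOn (fun t : ℝ => ((-I * ((r : ℂ) + t * I + x)) ^ (1 / 2 : ℂ))⁻¹) (Set.Ioi 0) := by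
  refine ContinuousOn.inv₀ (fun t ht => ?_) fun t ht => ?_
  · have hc : Continuous fun t : ℝ => -I * ((r : ℂ) + t * I + x) := by fun_prop
    exact (ContinuousAt.cpow hc.continuousAt continuousAt_const
      (neg_I_mul_mem_slitPlane ht hx)).continuousWithinAt
  · exact cpow_half_ne_zero (slitPlane_ne_zero (neg_I_mul_mem_slitPlane ht hx))

lemma integrableOn_mul_inv_cpow_half {f : ℝ → ℂ} (hf : IntegrableOn f (Set.Ioi 0)) {r δ : ℝ} {x : ℂ}
    (hx : 0 ≤ x.im) (hδ : 0 < δ) (h : ∀ t : ℝ, 0 < t → δ ≤ ‖(r : ℂ) + t * I + x‖) :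
    IntegrableOn (fun t : ℝ => f t * ((-I * ((r : ℂ) + t * I + x)) ^ (1 / 2 : ℂ))⁻¹)
      (Set.Ioi 0) := by
  refine Integrable.mul_bdd (c := (√δ)⁻¹) hf ((continuousOn_inv_cpow_half hx).aestronglyMeasurable
    measurableSet_Ioi) ?_
  filter_upwards [ae_restrict_mem measurableSet_Ioi] with t ht
  exact norm_inv_cpow_half_le hδ (h t ht)

lemma exists_le_norm_of_ne {r : ℝ} {x : ℂ} (hx : 0 < x.im ∨ (x.im = 0 ∧ x ≠ -r)) :
    ∃ δ, 0 < δ ∧ ∀ᶠ y in 𝓝[{z : ℂ | 0 < z.im}] x, ∀ t : ℝ, 0 < t → δ ≤ ‖(r : ℂ) + t * I + y‖ := by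
  have hne : 0 < x.im ∨ 0 < |r + x.re| := by
    refine hx.imp_right fun ⟨h1, h2⟩ => abs_pos.2 fun h => h2 (Complex.ext ?_ (by simpa using h1))
    simp; linarith
  rcases hne with h | h
  · refine ⟨x.im / 2, by positivity, ?_⟩
    have := (continuous_im.tendsto x).eventually (lt_mem_nhds (half_lt_self h))
    filter_upwards [this.filter_mono nhdsWithin_le_nhds] with y hy t ht
    refine le_trans ?_ (Complex.abs_im_le_norm _)
    refine le_trans ?_ (le_abs_self _)
    simp; linarith
  · refine ⟨|r + x.re| / 2, by positivity, ?_⟩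
    have hc : Continuous fun y : ℂ => |r + y.re| := by fun_prop
    have := (hc.tendsto x).eventually (lt_mem_nhds (half_lt_self h))
    filter_upwards [this.filter_mono nhdsWithin_le_nhds] with y hy t ht
    refine le_trans hy.le (le_trans (le_of_eq ?_) (Complex.abs_re_le_norm _))
    simp

lemma le_norm_of_ne {r : ℝ} {x : ℂ} (hx : 0 < x.im ∨ (x.im = 0 ∧ x ≠ -r)) :
    ∃ δ, 0 < δ ∧ ∀ t : ℝ, 0 < t → δ ≤ ‖(r : ℂ) + t * I + x‖ := by
  rcases hx with h | ⟨h1, h2⟩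
  · refine ⟨x.im, h, fun t ht => le_trans ?_ (Complex.abs_im_le_norm _)⟩
    refine le_trans ?_ (le_abs_self _)
    simp; linarith
  · refine ⟨|r + x.re|, abs_pos.2 fun h => h2 (Complex.ext ?_ (by simpa using h1)), fun t ht =>
      le_trans (le_of_eq ?_) (Complex.abs_re_le_norm _)⟩
    · simp; linarith
    · simp

/-- `f` is the eta-theta function `E_m` on the line with real part `r`. -/
structure IsLine (m : ℕ) (r : ℝ) (L : Piece → ℝ → ℂ) : Prop where
  hasSum : ∀ p ∈ pieces m, ∀ t : ℝ, 0 < t → HasSum (etaThetaTerm m p (r + t * I)) (L p t)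
  integrableOn : ∀ p ∈ pieces m, IntegrableOn (L p) (Set.Ioi 0)

lemma IsLine.eichlerIntegrand_eq {m : ℕ} {r : ℝ} {L : Piece → ℝ → ℂ} (hL : IsLine m r L)
    (h1 : 1 ≤ m) (h6 : m ≤ 6) (x : ℂ) {t : ℝ} (ht : 0 < t) :
    eichlerIntegrand m r x t = I * cConst m * (((pieces m).map fun p => L p t).sum *
      ((-I * ((r : ℂ) + t * I + x)) ^ (1 / 2 : ℂ))⁻¹) := by
  rw [eichlerIntegrand, oddE_eq h1 h6 fun p hp => hL.hasSum p hp t ht, div_eq_mul_inv]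
  ring

lemma list_sum_mul {ι : Type*} (L : List ι) (f : ι → ℂ) (c : ℂ) :
    (L.map f).sum * c = (L.map fun p => f p * c).sum := by
  rw [List.sum_map_mul_right]

lemma integrableOn_list_sum {L : List Piece} {f : Piece → ℝ → ℂ} {s : Set ℝ}
    (h : ∀ p ∈ L, IntegrableOn (f p) s) : IntegrableOn (fun t => (L.map fun p => f p t).sum) s ∧
      ∫ t in s, (L.map fun p => f p t).sum = (L.map fun p => ∫ t in s, f p t).sum := by
  induction L with
  | nil => simp
  | cons a L ih =>
    obtain ⟨h1, h2⟩ := ih fun p hp => h p (List.mem_cons_of_mem _ hp)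
    have h3 := h a List.mem_cons_self
    simp only [List.map_cons, List.sum_cons]
    exact ⟨h3.add h1, by rw [integral_add h3 h1, h2]⟩

lemma IsLine.integrableOn_eichlerIntegrand {m : ℕ} {r : ℝ} {L : Piece → ℝ → ℂ} (hL : IsLine m r L)
    (h1 : 1 ≤ m) (h6 : m ≤ 6) {x : ℂ} (hx : 0 < x.im ∨ (x.im = 0 ∧ x ≠ -r)) :
    IntegrableOn (eichlerIntegrand m r x) (Set.Ioi 0) := by
  obtain ⟨δ, hδ, h⟩ := le_norm_of_ne hx
  have hx0 : 0 ≤ x.im := by rcases hx with h | h <;> linarith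
  refine IntegrableOn.congr_fun ?_ (fun t ht => (hL.eichlerIntegrand_eq h1 h6 x ht).symm)
    measurableSet_Ioi
  exact (integrableOn_mul_inv_cpow_half (integrableOn_list_sum hL.integrableOn).1 hx0 hδ
    h).const_mul _

lemma IsLine.eichlerIntegral_eq {m : ℕ} {r : ℝ} {L : Piece → ℝ → ℂ} (hL : IsLine m r L)
    (h1 : 1 ≤ m) (h6 : m ≤ 6) (hc : cConst m ≠ 0) {x : ℂ} (hx : 0 < x.im) :
    -I / (cConst m : ℂ) * eichlerIntegral m r x = ((pieces m).map fun p =>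
      ∫ t in Set.Ioi (0 : ℝ), L p t * ((-I * ((r : ℂ) + t * I + x)) ^ (1 / 2 : ℂ))⁻¹).sum := by
  obtain ⟨δ, hδ, h⟩ := le_norm_of_ne (r := r) (Or.inl hx)
  have hc' : (cConst m : ℂ) ≠ 0 := Nat.cast_ne_zero.2 hc
  rw [eichlerIntegral, setIntegral_congr_fun measurableSet_Ioi
    (fun t ht => hL.eichlerIntegrand_eq h1 h6 x ht), integral_const_mul, ← mul_assoc]
  rw [show -I / (cConst m : ℂ) * (I * cConst m) = 1 by field_simp; simp, one_mul]
  simp only [list_sum_mul]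
  exact (integrableOn_list_sum fun p hp =>
    integrableOn_mul_inv_cpow_half (hL.integrableOn p hp) hx.le hδ h).2

lemma IsLine.tendsto_eichlerIntegral {m : ℕ} {r : ℝ} {L : Piece → ℝ → ℂ} (hL : IsLine m r L)
    (h1 : 1 ≤ m) (h6 : m ≤ 6) {x : ℂ} (hx : 0 < x.im ∨ (x.im = 0 ∧ x ≠ -r)) :
    Tendsto (eichlerIntegral m r) (𝓝[{z : ℂ | 0 < z.im}] x) (𝓝 (eichlerIntegral m r x)) := by
  obtain ⟨δ, hδ, h⟩ := exists_le_norm_of_ne hx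
  have hx0 : 0 ≤ x.im := by rcases hx with h | h <;> linarith
  set F : ℝ → ℂ := fun t => ((pieces m).map fun p => L p t).sum with hF
  have hFi : IntegrableOn F (Set.Ioi 0) := (integrableOn_list_sum hL.integrableOn).1
  have hev : ∀ y, eichlerIntegral m r y = ∫ t in Set.Ioi (0 : ℝ), I * cConst m * (F t *
      ((-I * ((r : ℂ) + t * I + y)) ^ (1 / 2 : ℂ))⁻¹) := fun y =>
    setIntegral_congr_fun measurableSet_Ioi fun t ht => hL.eichlerIntegrand_eq h1 h6 y ht
  simp only [funext hev]
  refine tendsto_integral_filter_of_dominated_convergence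
    (fun t => ‖I * cConst m‖ * (‖F t‖ * (√δ)⁻¹)) ?_ ?_ ((hFi.norm.mul_const _).const_mul _) ?_
  · filter_upwards [self_mem_nhdsWithin, h] with y hy hy'
    exact ((integrableOn_mul_inv_cpow_half hFi (le_of_lt hy) hδ hy').const_mul
      (I * cConst m)).aestronglyMeasurable
  · filter_upwards [h] with y hy
    filter_upwards [ae_restrict_mem measurableSet_Ioi] with t ht
    rw [norm_mul, norm_mul (F t)]
    gcongr
    exact norm_inv_cpow_half_le hδ (hy t ht)
  · filter_upwards [ae_restrict_mem measurableSet_Ioi] with t ht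
    refine Tendsto.const_mul _ (Tendsto.const_mul _ ?_)
    have hmem := neg_I_mul_mem_slitPlane (r := r) ht hx0
    have : ContinuousAt (fun y : ℂ => ((-I * ((r : ℂ) + t * I + y)) ^ (1 / 2 : ℂ))⁻¹) x :=
      ContinuousAt.inv₀ (ContinuousAt.cpow (by fun_prop) (by fun_prop) hmem)
        (cpow_half_ne_zero (slitPlane_ne_zero hmem))
    exact this.tendsto.mono_left nhdsWithin_le_nhds

lemma isLine_half (m : ℕ) : IsLine m (1 / 2) (lineHalf m) where
  hasSum _ hp _ ht := hasSum_lineHalf hp ht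
  integrableOn _ _ := (((integrableOn_oddTheta _ _).const_mul _).sub
    (((integrableOn_oddTheta _ _).const_mul _).const_mul _)).const_mul _

lemma isLine_one {m : ℕ} (hm : ellConst m = 1) : IsLine m 1 lineOne where
  hasSum _ hp _ ht := hasSum_lineOne hp hm ht
  integrableOn _ _ := ((integrableOn_oddTheta _ _).const_mul _).const_mul _

lemma integral_lineHalf {m : ℕ} {p : Piece} (hp : p ∈ pieces m) {τ : ℂ} (hτ : 0 < τ.im) :
    ∫ t in Set.Ioi (0 : ℝ), lineHalf m p t *
      ((-I * (((1 / 2 : ℝ) : ℂ) + t * I + τ)) ^ (1 / 2 : ℂ))⁻¹ = errorTwo m p τ := by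
  obtain ⟨⟨hα1, hα2⟩, -⟩ := pieces_cases hp
  have hα1' : (-1 / 2 : ℝ) < p.α := by exact_mod_cast hα1
  have hα2' : (p.α : ℝ) < 0 := by exact_mod_cast hα2
  have hσ : 0 < (τ + 1 / 2).im := by simpa using hτ
  obtain ⟨δ, hδ, h⟩ := le_norm_of_ne (r := 1 / 2) (Or.inl hτ)
  have hA := eichler_mordell (a := p.α) (b := (p.α : ℝ) / 2 - 1 / 4) (abs_lt.2 ⟨by linarith, by linarith⟩)
    (abs_lt.2 ⟨by linarith, by linarith⟩) hσ
  have hB := eichler_mordell (a := p.α) (b := (p.α : ℝ) / 2 + 1 / 4) (abs_lt.2 ⟨by linarith, by linarith⟩)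
    (abs_lt.2 ⟨by linarith, by linarith⟩) hσ
  have hs : ∀ t : ℝ, τ + 1 / 2 + t * I = ((1 / 2 : ℝ) : ℂ) + t * I + τ := fun t => by
    push_cast; ring
  simp only [hs] at hA hB
  have hiA := integrableOn_mul_inv_cpow_half
    (integrableOn_oddTheta ((p.α : ℝ) + 1 / 2) ((p.α : ℝ) / 2 - 1 / 4 + 1 / 2)) hτ.le hδ h
  have hiB := integrableOn_mul_inv_cpow_half
    (integrableOn_oddTheta ((p.α : ℝ) + 1 / 2) ((p.α : ℝ) / 2 + 1 / 4 + 1 / 2)) hτ.le hδ h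
  have hsplit : ∀ t : ℝ, lineHalf m p t * ((-I * (((1 / 2 : ℝ) : ℂ) + t * I + τ)) ^ (1 / 2 : ℂ))⁻¹ =
      p.w * (e (-3 / 16) * ((√2 / 4 : ℝ) : ℂ)) * -I * (e (-p.α / 4 - p.α ^ 2 / 4) *
        (oddTheta ((p.α : ℝ) + 1 / 2) ((p.α : ℝ) / 2 - 1 / 4 + 1 / 2) t *
          ((-I * (((1 / 2 : ℝ) : ℂ) + t * I + τ)) ^ (1 / 2 : ℂ))⁻¹) -
      (-1) ^ ellConst m * e (-3 * p.α / 4 - p.α ^ 2 / 4) *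
        (oddTheta ((p.α : ℝ) + 1 / 2) ((p.α : ℝ) / 2 + 1 / 4 + 1 / 2) t *
          ((-I * (((1 / 2 : ℝ) : ℂ) + t * I + τ)) ^ (1 / 2 : ℂ))⁻¹)) := fun t => by
    rw [lineHalf]; ring
  simp only [hsplit]
  rw [integral_const_mul, integral_sub (hiA.const_mul _) (hiB.const_mul _), integral_const_mul,
    integral_const_mul, hA, hB, errorTwo]
  have hA1 : ((p.α : ℝ) : ℂ) * (τ + 1 / 2) - (((p.α : ℝ) / 2 - 1 / 4 : ℝ) : ℂ) =
      p.α * τ + 1 / 4 := by push_cast; ring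
  have hB1 : ((p.α : ℝ) : ℂ) * (τ + 1 / 2) - (((p.α : ℝ) / 2 + 1 / 4 : ℝ) : ℂ) =
      p.α * τ - 1 / 4 := by push_cast; ring
  rw [hA1, hB1]
  have hA2 : e (-p.α / 4 - p.α ^ 2 / 4) * e (((p.α : ℝ) : ℂ) / 2 - ((p.α : ℝ) : ℂ) ^ 2 *
      (τ + 1 / 2) / 2 + ((p.α : ℝ) : ℂ) * (((p.α : ℝ) / 2 - 1 / 4 : ℝ) : ℂ)) = e (p.t * τ) := by
    rw [← e_add, Piece.t]; congr 1; push_cast; ring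
  have hB2 : e (-3 * p.α / 4 - p.α ^ 2 / 4) * e (((p.α : ℝ) : ℂ) / 2 - ((p.α : ℝ) : ℂ) ^ 2 *
      (τ + 1 / 2) / 2 + ((p.α : ℝ) : ℂ) * (((p.α : ℝ) / 2 + 1 / 4 : ℝ) : ℂ)) = e (p.t * τ) := by
    rw [← e_add, Piece.t]; congr 1; push_cast; ring
  linear_combination (exp := 1) -p.w * (e (-3 / 16) * ((√2 / 4 : ℝ) : ℂ)) * I ^ 2 *
    (mordell (p.α * τ + 1 / 4) (τ + 1 / 2) * hA2 -
      (-1) ^ ellConst m * mordell (p.α * τ - 1 / 4) (τ + 1 / 2) * hB2) -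
    p.w * (e (-3 / 16) * ((√2 / 4 : ℝ) : ℂ)) * e (p.t * τ) *
    (mordell (p.α * τ + 1 / 4) (τ + 1 / 2) -
      (-1) ^ ellConst m * mordell (p.α * τ - 1 / 4) (τ + 1 / 2)) * I_sq

lemma integral_lineOne {m : ℕ} {p : Piece} (hp : p ∈ pieces m) {τ : ℂ} (hτ : 0 < τ.im) :
    ∫ t in Set.Ioi (0 : ℝ), lineOne p t *
      ((-I * (((1 : ℝ) : ℂ) + t * I + τ)) ^ (1 / 2 : ℂ))⁻¹ = errorOne p τ := by
  obtain ⟨⟨hα1, hα2⟩, -⟩ := pieces_cases hp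
  have hα1' : (-1 / 2 : ℝ) < p.α := by exact_mod_cast hα1
  have hα2' : (p.α : ℝ) < 0 := by exact_mod_cast hα2
  have hσ : 0 < (τ + 1).im := by simpa using hτ
  have hA := eichler_mordell (a := p.α) (b := p.α) (abs_lt.2 ⟨by linarith, by linarith⟩)
    (abs_lt.2 ⟨by linarith, by linarith⟩) hσ
  have hs : ∀ t : ℝ, τ + 1 + t * I = ((1 : ℝ) : ℂ) + t * I + τ := fun t => by
    push_cast; ring
  simp only [hs] at hA
  have hsplit : ∀ t : ℝ, lineOne p t * ((-I * (((1 : ℝ) : ℂ) + t * I + τ)) ^ (1 / 2 : ℂ))⁻¹ =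
      p.w * e (1 / 8) * (-1 / 2) * e (-p.α / 2 - p.α ^ 2 / 2) *
        (oddTheta ((p.α : ℝ) + 1 / 2) ((p.α : ℝ) + 1 / 2) t *
          ((-I * (((1 : ℝ) : ℂ) + t * I + τ)) ^ (1 / 2 : ℂ))⁻¹) := fun t => by
    rw [lineOne]; ring
  simp only [hsplit]
  rw [integral_const_mul, hA, errorOne, div_two_mul_I]
  have hA1 : ((p.α : ℝ) : ℂ) * (τ + 1) - ((p.α : ℝ) : ℂ) = p.α * τ := by push_cast; ring
  rw [hA1]
  have hA2 : e (-p.α / 2 - p.α ^ 2 / 2) * e (((p.α : ℝ) : ℂ) / 2 - ((p.α : ℝ) : ℂ) ^ 2 *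
      (τ + 1) / 2 + ((p.α : ℝ) : ℂ) * ((p.α : ℝ) : ℂ)) = e (p.t * τ) := by
    rw [← e_add, Piece.t]; congr 1; push_cast; ring
  linear_combination p.w * e (1 / 8) * (-1 / 2) * I * mordell (p.α * τ) (τ + 1) * hA2

lemma cConst_ne_zero {m : ℕ} (h1 : 1 ≤ m) (h6 : m ≤ 6) : cConst m ≠ 0 := by
  interval_cases m <;> decide

theorem VUpper_eichler_half {m n : ℕ} (hmn : Admissible m n) {τ : ℂ} (hτ : 0 < τ.im) :
    VUpper m n τ + zeta 4 ^ ellConst m * (2 * τ + 1) ^ (-1 / 2 : ℂ) *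
      VUpper m n (τ / (2 * τ + 1)) = -I / (cConst m : ℂ) * eichlerIntegral m (1 / 2) τ := by
  rw [VUpper_M2 hmn hτ, (isLine_half m).eichlerIntegral_eq hmn.1 hmn.2.1
    (cConst_ne_zero hmn.1 hmn.2.1) hτ]
  congr 1
  exact List.map_congr_left fun p hp => (integral_lineHalf hp hτ).symm

theorem VUpper_eichler_one {m : ℕ} (hmn : Admissible m 1) (hm : m = 2 ∨ m = 4 ∨ m = 6) {τ : ℂ}
    (hτ : 0 < τ.im) :
    VUpper m 1 τ - (zeta 8)⁻¹ * (τ + 1) ^ (-1 / 2 : ℂ) * VUpper m 1 (τ / (τ + 1)) =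
      -I / (cConst m : ℂ) * eichlerIntegral m 1 τ := by
  have hl : ellConst m = 1 := by rcases hm with rfl | rfl | rfl <;> rfl
  rw [VUpper_M1 hmn hm hτ, (isLine_one hl).eichlerIntegral_eq hmn.1 hmn.2.1
    (cConst_ne_zero hmn.1 hmn.2.1) hτ]
  congr 1
  exact List.map_congr_left fun p hp => (integral_lineOne hp hτ).symm

end EtaTheta

open Complex Filter Topology
namespace EtaTheta

/-! ### Radial comparison of products at roots of unity -/

/-- A thin neighbourhood of the vertical half-line above `x`. -/
def Horn (x C t₀ : ℝ) (τ : ℂ) : Prop := 0 < τ.im ∧ τ.im ≤ t₀ ∧ |τ.re - x| ≤ C * τ.im ^ 2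

lemma Horn.mono {x C t₀ t₁ : ℝ} {τ : ℂ} (h : Horn x C t₀ τ) (ht : t₀ ≤ t₁) : Horn x C t₁ τ :=
  ⟨h.1, h.2.1.trans ht, h.2.2⟩

lemma norm_e_horn {x s : ℝ} {τ : ℂ} :
    ‖e (s * ((τ - x) / 2))‖ = Real.exp (-(Real.pi * s * τ.im)) := by
  rw [norm_e]
  congr 1
  have : ((s : ℂ) * ((τ - x) / 2)).im = s * (τ.im / 2) := by
    rw [im_ofReal_mul, show ((τ - x) / 2) = ((1 / 2 : ℝ) : ℂ) * (τ - x) by push_cast; ring,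
      im_ofReal_mul, sub_im, ofReal_im]
    ring
  rw [this]
  ring

lemma norm_e_horn_le {x s : ℝ} {τ : ℂ} {b : ℝ} (hτ : 0 < τ.im) (hb : 0 ≤ b) (hs : b ≤ s) :
    ‖e (s * ((τ - x) / 2))‖ ≤ Real.exp (-(τ.im * b)) := by
  rw [norm_e_horn, Real.exp_le_exp]
  have h1 : 1 * b ≤ Real.pi * s := mul_le_mul (by linarith [Real.pi_gt_three]) hs hb Real.pi_pos.le
  have := mul_le_mul_of_nonneg_right h1 hτ.le
  linarith

lemma norm_e_sub_e_le {x C D : ℝ} (hC : 0 ≤ C) (hD : 0 < D) : ∃ t₀, 0 < t₀ ∧ ∀ τ, Horn x C t₀ τ →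
    ∀ b y y' : ℝ, 0 ≤ b → b ≤ y → b ≤ y' → |y - y'| ≤ D →
    ‖e (y * ((τ - x) / 2)) - e (y' * ((τ - x) / 2))‖ ≤
      4 * Real.pi * D * τ.im * Real.exp (-(τ.im * b)) := by
  have hpi := Real.pi_pos
  refine ⟨min (1 / (C + 1)) (1 / (2 * Real.pi * D)), by positivity, fun τ hτ => ?_⟩
  obtain ⟨h1, h2, h3⟩ := hτ
  have h4 : τ.im ≤ 1 / (C + 1) := h2.trans (min_le_left _ _)
  have h5 : τ.im ≤ 1 / (2 * Real.pi * D) := h2.trans (min_le_right _ _)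
  rw [le_div_iff₀ (by positivity)] at h4 h5
  have hw : ‖(τ - x) / 2‖ ≤ τ.im := by
    rw [norm_div, RCLike.norm_ofNat, div_le_iff₀ two_pos]
    refine (Complex.norm_le_abs_re_add_abs_im _).trans ?_
    simp only [sub_re, ofReal_re, sub_im, ofReal_im, sub_zero, abs_of_pos h1]
    nlinarith
  have key : ∀ b y y' : ℝ, 0 ≤ b → b ≤ y' → y' ≤ y → |y - y'| ≤ D →
      ‖e (y * ((τ - x) / 2)) - e (y' * ((τ - x) / 2))‖ ≤
      4 * Real.pi * D * τ.im * Real.exp (-(τ.im * b)) := by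
    intro b y y' hb hy' hyy hD'
    rw [abs_of_nonneg (by linarith)] at hD'
    have hz : ‖2 * (Real.pi : ℂ) * I * (((y - y' : ℝ) : ℂ) * ((τ - x) / 2))‖ ≤
        2 * Real.pi * D * τ.im := by
      rw [norm_mul, norm_mul, norm_mul, norm_mul, norm_I, norm_real, norm_real, Real.norm_of_nonneg
        hpi.le, Real.norm_of_nonneg (by linarith : 0 ≤ y - y'), RCLike.norm_ofNat, mul_one, mul_assoc
        (2 * Real.pi)]
      gcongr
    have h6 : e (y * ((τ - x) / 2)) - e (y' * ((τ - x) / 2)) =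
        e (y' * ((τ - x) / 2)) * (e (((y - y' : ℝ) : ℂ) * ((τ - x) / 2)) - 1) := by
      rw [mul_sub, ← e_add, mul_one]; congr 2; push_cast; ring
    rw [h6, norm_mul, mul_comm]
    have h7 := norm_exp_sub_one_le (hz.trans (by linarith))
    exact mul_le_mul (h7.trans (by linarith)) (norm_e_horn_le h1 hb hy') (norm_nonneg _)
      (by positivity)
  intro b y y' hb hy hy' hD'
  rcases le_total y' y with h | h
  · exact key b y y' hb hy' h hD'
  · rw [norm_sub_rev]; exact key b y' y hb hy h (by rwa [abs_sub_comm])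

lemma norm_e_sub_norm_le {x C t₀ : ℝ} {τ : ℂ} (hτ : Horn x C t₀ τ) {b s : ℝ} (hb : 0 ≤ b)
    (hs : b ≤ s) : ‖e (s * ((τ - x) / 2)) - ‖e (s * ((τ - x) / 2))‖‖ ≤
      Real.pi * C * τ.im * Real.exp (-(τ.im * b)) := by
  obtain ⟨h1, -, h3⟩ := hτ
  have hpi := Real.pi_gt_three
  have h4 : e (s * ((τ - x) / 2)) = ‖e (s * ((τ - x) / 2))‖ *
      cexp (I * ((Real.pi * s * (τ.re - x) : ℝ) : ℂ)) := by
    rw [norm_e_horn, e, ofReal_exp, ← Complex.exp_add]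
    congr 1
    conv_lhs => rw [← re_add_im τ]
    push_cast
    linear_combination Real.pi * s * τ.im * I_sq
  have h5 : e (s * ((τ - x) / 2)) - ‖e (s * ((τ - x) / 2))‖ = ‖e (s * ((τ - x) / 2))‖ *
      (cexp (I * ((Real.pi * s * (τ.re - x) : ℝ) : ℂ)) - 1) := by
    rw [mul_sub, ← h4, mul_one]
  rw [h5, norm_mul, norm_real, norm_norm]
  have hs0 : 0 ≤ s := hb.trans hs
  have h6 : ‖cexp (I * ((Real.pi * s * (τ.re - x) : ℝ) : ℂ)) - 1‖ ≤
      Real.pi * s * (C * τ.im ^ 2) := by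
    refine Real.norm_exp_I_mul_ofReal_sub_one_le.trans ?_
    rw [Real.norm_eq_abs, abs_mul, abs_of_nonneg (by positivity : 0 ≤ Real.pi * s)]
    gcongr
  have hC : 0 ≤ C * τ.im ^ 2 := (abs_nonneg _).trans h3
  have hC' : 0 ≤ C := by
    by_contra h
    have : C * τ.im ^ 2 < 0 := mul_neg_of_neg_of_pos (not_le.1 h) (by positivity)
    linarith
  have h7 : s * τ.im * ‖e (s * ((τ - x) / 2))‖ ≤ Real.exp (-(τ.im * b)) := by
    rw [norm_e_horn]
    have h8 : s * τ.im ≤ Real.exp (s * τ.im) := by linarith [Real.add_one_le_exp (s * τ.im)]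
    have h9 : 0 ≤ s * τ.im := by positivity
    calc s * τ.im * Real.exp (-(Real.pi * s * τ.im))
        ≤ Real.exp (s * τ.im) * Real.exp (-(Real.pi * s * τ.im)) := by gcongr
      _ = Real.exp (s * τ.im - Real.pi * s * τ.im) := by rw [← Real.exp_add]; congr 1
      _ ≤ _ := by
        rw [Real.exp_le_exp]
        have := mul_le_mul_of_nonneg_right hs h1.le
        nlinarith
  calc _ ≤ ‖e (s * ((τ - x) / 2))‖ * (Real.pi * s * (C * τ.im ^ 2)) := by gcongr
    _ = Real.pi * C * τ.im * (s * τ.im * ‖e (s * ((τ - x) / 2))‖) := by ring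
    _ ≤ _ := by gcongr

lemma norm_one_sub_mul_ge {ζ : ℂ} (hζ : ‖ζ‖ = 1) {r : ℝ} (h0 : 0 ≤ r) (h1 : r ≤ 1) :
    ‖1 - ζ‖ ≤ 2 * ‖1 - ζ * r‖ := by
  have h2 : ‖1 - ζ‖ ≤ ‖1 - ζ * r‖ + (1 - r) := by
    calc ‖1 - ζ‖ = ‖(1 - ζ * r) - ζ * ((1 - r : ℝ) : ℂ)‖ := by congr 1; push_cast; ring
      _ ≤ _ := by
        refine (norm_sub_le _ _).trans (le_of_eq ?_)
        rw [norm_mul ζ, hζ, one_mul, norm_real, Real.norm_of_nonneg (by linarith)]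
  have h3 : 1 - r ≤ ‖1 - ζ * r‖ := by
    have := norm_sub_norm_le 1 (ζ * r)
    rwa [norm_one, norm_mul, hζ, one_mul, norm_real, Real.norm_of_nonneg h0] at this
  linarith

lemma norm_e_horn_le_one {x s : ℝ} {τ : ℂ} (hτ : 0 < τ.im) (hs : 0 ≤ s) :
    ‖e (s * ((τ - x) / 2))‖ ≤ 1 := by
  simpa using norm_e_horn_le (x := x) hτ le_rfl hs

lemma exists_gap (ζ : ℕ → ℂ) (N : ℕ) : ∃ c, 0 < c ∧ ∀ i < N, ζ i ≠ 1 → c ≤ ‖1 - ζ i‖ := by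
  induction N with
  | zero => exact ⟨1, one_pos, by simp⟩
  | succ N ih =>
    obtain ⟨c, hc, h⟩ := ih
    by_cases h1 : ζ N = 1
    · refine ⟨c, hc, fun i hi hne => h i (lt_of_le_of_ne (Nat.lt_succ_iff.1 hi) ?_) hne⟩
      rintro rfl; exact hne h1
    · have h2 : 0 < ‖1 - ζ N‖ := norm_pos_iff.2 (sub_ne_zero.2 (Ne.symm h1))
      refine ⟨min c ‖1 - ζ N‖, lt_min hc h2, fun i hi hne => ?_⟩
      rcases Nat.lt_succ_iff_lt_or_eq.1 hi with h3 | rfl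
      · exact (min_le_left _ _).trans (h i h3 hne)
      · exact min_le_right _ _

/-- Factors at nearby radii are comparable, unless the factor vanishes at radius one. -/
lemma prod_compare {x C : ℝ} (hC : 0 ≤ C) {N : ℕ} (hN : 0 < N) (ζ : ℕ → ℂ) (hζ : ∀ i, ‖ζ i‖ = 1) :
    ∃ K t₀, 0 < K ∧ 0 < t₀ ∧ ∀ τ, Horn x C t₀ τ → ∀ b : ℕ, ∀ y y' : ℕ → ℝ,
      (∀ i < N, (b * N : ℕ) ≤ y i ∧ y i ≤ (b * N : ℕ) + (N + 1) ∧ (b * N : ℕ) ≤ y' i ∧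
        y' i ≤ (b * N : ℕ) + (N + 1) ∧ (ζ i = 1 → y i = y' i)) →
      ∏ i ∈ Finset.range N, ‖1 - ζ i * e (y i * ((τ - x) / 2))‖ ≤
        (∏ i ∈ Finset.range N, ‖1 - ζ i * e (y' i * ((τ - x) / 2))‖) *
          Real.exp (K * (τ.im * Real.exp (-(τ.im * b)))) := by
  obtain ⟨c, hc, hgap⟩ := exists_gap ζ N
  obtain ⟨t₀, ht₀, hE⟩ := norm_e_sub_e_le (x := x) (D := N + 1) hC (by positivity)
  have hpi := Real.pi_pos
  set K₀ := 4 * Real.pi * (N + 1 : ℝ) with hK₀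
  refine ⟨N * (K₀ * (4 / c)), min t₀ (c / (4 * (Real.pi * C + 1))), by positivity, by positivity, ?_⟩
  intro τ hτ b y y' hy
  have h0 := hτ.1
  have hE' := hE τ (hτ.mono (min_le_left _ _))
  have hsmall : Real.pi * C * τ.im ≤ c / 4 := by
    have h1 : τ.im ≤ c / (4 * (Real.pi * C + 1)) := hτ.2.1.trans (min_le_right _ _)
    rw [le_div_iff₀ (by positivity)] at h1
    have : 0 ≤ Real.pi * C := by positivity
    nlinarith
  set δ := K₀ * (τ.im * Real.exp (-(τ.im * b))) with hδ
  have hb : (b : ℝ) ≤ ((b * N : ℕ) : ℝ) := by exact_mod_cast Nat.le_mul_of_pos_right b hN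
  have hbN : (0 : ℝ) ≤ ((b * N : ℕ) : ℝ) := Nat.cast_nonneg _
  have hfac : ∀ i ∈ Finset.range N, ‖1 - ζ i * e (y i * ((τ - x) / 2))‖ ≤
      ‖1 - ζ i * e (y' i * ((τ - x) / 2))‖ * (1 + δ * (4 / c)) := by
    intro i hi
    have hi' := Finset.mem_range.1 hi
    obtain ⟨h1, h2, h3, h4, h5⟩ := hy i hi'
    have hδ0 : 0 ≤ δ * (4 / c) := by positivity
    by_cases h1ζ : ζ i = 1
    · rw [h5 h1ζ]
      exact le_mul_of_one_le_right (norm_nonneg _) (by linarith)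
    · have h6 : ‖e (y i * ((τ - x) / 2)) - e (y' i * ((τ - x) / 2))‖ ≤ δ := by
        refine (hE' b (y i) (y' i) (Nat.cast_nonneg b) (by linarith) (by linarith)
          (abs_le.2 ⟨by linarith, by linarith⟩)).trans (le_of_eq ?_)
        rw [hδ]; ring
      have h7 : c / 4 ≤ ‖1 - ζ i * e (y' i * ((τ - x) / 2))‖ := by
        have h8 := norm_e_sub_norm_le hτ (le_refl 0) (by linarith : (0 : ℝ) ≤ y' i)
        rw [mul_zero, neg_zero, Real.exp_zero, mul_one] at h8
        have h9 := norm_one_sub_mul_ge (hζ i) (norm_nonneg (e (y' i * ((τ - x) / 2))))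
          (norm_e_horn_le_one h0 (by linarith))
        have h10 := hgap i hi' h1ζ
        have h11 : ‖1 - ζ i * ‖e (y' i * ((τ - x) / 2))‖‖ ≤
            ‖1 - ζ i * e (y' i * ((τ - x) / 2))‖ +
              ‖e (y' i * ((τ - x) / 2)) - ‖e (y' i * ((τ - x) / 2))‖‖ := by
          rw [← one_mul ‖e (y' i * ((τ - x) / 2)) - _‖, ← hζ i, ← norm_mul]
          refine le_trans (le_of_eq ?_) (norm_add_le _ _)
          congr 1; ring
        linarith
      have h12 : ‖1 - ζ i * e (y i * ((τ - x) / 2))‖ ≤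
          ‖1 - ζ i * e (y' i * ((τ - x) / 2))‖ +
            ‖e (y i * ((τ - x) / 2)) - e (y' i * ((τ - x) / 2))‖ := by
        rw [← one_mul ‖e (y i * ((τ - x) / 2)) - _‖, ← hζ i, ← norm_mul]
        refine le_trans (le_of_eq ?_) (norm_sub_le _ _)
        congr 1; ring
      have h13 : δ ≤ ‖1 - ζ i * e (y' i * ((τ - x) / 2))‖ * (δ * (4 / c)) := by
        calc δ = (c / 4) * (δ * (4 / c)) := by field_simp
          _ ≤ _ := by gcongr
      linarith
  refine (Finset.prod_le_prod (fun _ _ => norm_nonneg _) hfac).trans ?_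
  rw [Finset.prod_mul_distrib, Finset.prod_const, Finset.card_range]
  refine mul_le_mul_of_nonneg_left ?_ (Finset.prod_nonneg fun _ _ => norm_nonneg _)
  calc (1 + δ * (4 / c)) ^ N ≤ (Real.exp (δ * (4 / c))) ^ N := by
        gcongr
        linarith [Real.add_one_le_exp (δ * (4 / c))]
    _ = _ := by rw [← Real.exp_nat_mul]; congr 1; rw [hδ]; ring

lemma prod_one_sub_pow {ρ : ℂ} {N : ℕ} (hN : 0 < N) (h : IsPrimitiveRoot ρ N) (y : ℂ) :
    ∏ i ∈ Finset.range N, (1 - y * ρ ^ i) = 1 - y ^ N := by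
  have h1 := h.pow_sub_pow_eq_prod_sub_mul 1 y hN
  rw [one_pow] at h1
  rw [h1]
  refine Finset.prod_bij (fun i _ => ρ ^ i) ?_ ?_ ?_ ?_
  · intro i _
    rw [Polynomial.mem_nthRootsFinset hN, ← pow_mul, mul_comm, pow_mul, h.pow_eq_one, one_pow]
  · intro i hi j hj hij
    exact h.pow_inj (Finset.mem_range.1 hi) (Finset.mem_range.1 hj) hij
  · intro ζ hζ
    have : NeZero N := ⟨hN.ne'⟩
    obtain ⟨i, hi, h2⟩ := h.eq_pow_of_pow_eq_one ((Polynomial.mem_nthRootsFinset hN _).1 hζ)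
    exact ⟨i, Finset.mem_range.2 hi, h2⟩
  · intro i _
    ring

lemma sum_exp_le {t : ℝ} (h0 : 0 < t) (h1 : t ≤ 1) (B : ℕ) :
    ∑ b ∈ Finset.range B, t * Real.exp (-(t * b)) ≤ 2 := by
  have h2 : Real.exp (-t) < 1 := by rw [Real.exp_lt_one_iff]; linarith
  have h3 : ∀ b : ℕ, Real.exp (-(t * b)) = Real.exp (-t) ^ b := fun b => by
    rw [← Real.exp_nat_mul]; congr 1; ring
  simp only [h3, ← Finset.mul_sum]
  have h4 : ∑ b ∈ Finset.range B, Real.exp (-t) ^ b ≤ (1 - Real.exp (-t))⁻¹ := by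
    rw [← tsum_geometric_of_lt_one (Real.exp_pos _).le h2]
    exact (summable_geometric_of_lt_one (Real.exp_pos _).le h2).sum_le_tsum _
      fun _ _ => by positivity
  have h5 : t / 2 ≤ 1 - Real.exp (-t) := by
    have h6 := Real.add_one_le_exp t
    have h7 : Real.exp (-t) * Real.exp t = 1 := by rw [← Real.exp_add]; simp
    have h8 := Real.exp_pos (-t)
    nlinarith
  calc t * ∑ b ∈ Finset.range B, Real.exp (-t) ^ b ≤ t * (1 - Real.exp (-t))⁻¹ := by gcongr
    _ ≤ t * (t / 2)⁻¹ := by gcongr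
    _ = 2 := by field_simp

/-- Products that are bounded block by block. -/
lemma prod_blocks_le {N : ℕ} {F : ℕ → ℝ} (hF : ∀ i, 0 ≤ F i) {lam K t : ℝ} (hlam : 0 ≤ lam)
    (hK : 0 ≤ K) (h0 : 0 < t) (h1 : t ≤ 1)
    (h : ∀ b : ℕ, ∏ i ∈ Finset.range N, F (b * N + i) ≤ lam * Real.exp (K * (t * Real.exp (-(t * b)))))
    (B : ℕ) : ∏ i ∈ Finset.range (B * N), F i ≤ lam ^ B * Real.exp (2 * K) := by
  have h2 : ∏ i ∈ Finset.range (B * N), F i ≤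
      lam ^ B * Real.exp (K * ∑ b ∈ Finset.range B, t * Real.exp (-(t * b))) := by
    induction B with
    | zero => simp
    | succ B ih =>
      rw [Nat.succ_mul, Finset.prod_range_add, Finset.sum_range_succ, mul_add, Real.exp_add]
      calc _ ≤ (lam ^ B * Real.exp (K * ∑ b ∈ Finset.range B, t * Real.exp (-(t * b)))) *
            (lam * Real.exp (K * (t * Real.exp (-(t * B))))) :=
          mul_le_mul ih (h B) (Finset.prod_nonneg fun _ _ => hF _) (by positivity)
        _ = _ := by ring
  refine h2.trans ?_
  refine mul_le_mul_of_nonneg_left (Real.exp_le_exp.2 ?_) (by positivity)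
  have := mul_le_mul_of_nonneg_left (sum_exp_le h0 h1 B) hK
  linarith

end EtaTheta

open Complex Filter Topology
namespace EtaTheta

/-! ### Limits of the `q`-expressions at rational numbers -/

/-- The general factor of the products in the `q`-expressions. -/
noncomputable def fac (a B : ℝ) (τ : ℂ) (J : ℕ) : ℂ := 1 - e (B + (J + a) * (τ / 2))

/-- The product over a period of the roots of unity that occur in `fac`. -/
noncomputable def fullPhase (x : ℚ) (a B : ℝ) : ℂ := e (2 * x.den * B + x.num * a)

lemma den_mul_self (x : ℚ) : (x.den : ℂ) * x = x.num := by
  exact_mod_cast congrArg (Rat.cast : ℚ → ℂ) (Rat.den_mul_eq_num x)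

lemma fac_block (x : ℚ) (a B : ℝ) (τ : ℂ) (b i : ℕ) :
    fac a B τ (b * (2 * x.den) + i + 1) = 1 - e (B + (i + 1 + a) * (x / 2)) *
      e (((((b * (2 * x.den) : ℕ) : ℝ) + (i + 1) + a : ℝ) : ℂ) * ((τ - ((x : ℝ) : ℂ)) / 2)) := by
  rw [fac, ← e_add]
  congr 1
  refine e_congr (b * x.num) ?_
  have := den_mul_self x
  push_cast
  linear_combination (b : ℂ) * this

lemma isPrimitiveRoot_half {x : ℚ} (hx : Odd x.num) : IsPrimitiveRoot (e (x / 2)) (2 * x.den) := by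
  have := isPrimitiveRoot_exp_rat_of_odd_num x hx
  rwa [show cexp (Real.pi * I * x) = e (x / 2) by rw [e]; congr 1; ring] at this

lemma phase_pow (x : ℚ) (a B : ℝ) (i : ℕ) :
    e (B + (i + 1 + a) * (x / 2)) ^ (2 * x.den) = fullPhase x a B := by
  rw [e_pow, fullPhase]
  refine e_congr ((i + 1) * x.num) ?_
  have := den_mul_self x
  push_cast
  linear_combination (i + 1 + a : ℂ) * this

lemma prod_phase {x : ℚ} (hx : Odd x.num) (a B : ℝ) (Y : ℂ) :
    ∏ i ∈ Finset.range (2 * x.den), (1 - e (B + (i + 1 + a) * (x / 2)) * Y) =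
      1 - fullPhase x a B * Y ^ (2 * x.den) := by
  have hN : 0 < 2 * x.den := by have := x.den_pos; omega
  have h := prod_one_sub_pow hN (isPrimitiveRoot_half hx) (e (B + (1 + a) * (x / 2)) * Y)
  have h2 := phase_pow x a B 0
  rw [Nat.cast_zero, zero_add] at h2
  rw [mul_pow, h2] at h
  rw [← h]
  refine Finset.prod_congr rfl fun i _ => ?_
  rw [mul_right_comm, e_pow, ← e_add]
  congr 3
  ring

lemma prod_phase_horn {x : ℚ} (hx : Odd x.num) (a B y : ℝ) (τ : ℂ) :
    ∏ i ∈ Finset.range (2 * x.den), ‖1 - e (B + (i + 1 + a) * (x / 2)) *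
      e (y * ((τ - ((x : ℝ) : ℂ)) / 2))‖ =
      ‖1 - fullPhase x a B * e (((2 * x.den * y : ℝ) : ℂ) * ((τ - ((x : ℝ) : ℂ)) / 2))‖ := by
  rw [← norm_prod, prod_phase hx, e_pow]
  congr 4
  push_cast
  ring

lemma norm_phase (x : ℚ) (B s : ℝ) : ‖e (B + s * (x / 2))‖ = 1 := by
  rw [show (B : ℂ) + s * (x / 2) = ((B + s * (x / 2) : ℝ) : ℂ) by push_cast; ring, norm_e_ofReal]

lemma phase_ne_one {x : ℚ} {a B : ℝ} (h : fullPhase x a B ≠ 1) (i : ℕ) :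
    e (B + (i + 1 + a) * (x / 2)) ≠ 1 := by
  intro h1
  apply h
  rw [← phase_pow x a B i, h1, one_pow]

section Blocks

variable {x : ℚ} {C : ℝ}

lemma block_lower (hx : Odd x.num) (hC : 0 ≤ C) {a B : ℝ} (ha : |a| ≤ 1)
    (hΩ : fullPhase x a B ≠ 1) : ∃ K t₀, 0 < K ∧ 0 < t₀ ∧ ∀ τ, Horn x C t₀ τ → ∀ b : ℕ, ∀ y : ℝ,
      (b * (2 * x.den) : ℕ) ≤ y → y ≤ (b * (2 * x.den) : ℕ) + (2 * x.den : ℕ) →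
      ‖1 - fullPhase x a B * e (((2 * x.den * y : ℝ) : ℂ) * ((τ - ((x : ℝ) : ℂ)) / 2))‖ ≤
        (∏ i ∈ Finset.range (2 * x.den), ‖fac a B τ (b * (2 * x.den) + i + 1)‖) *
          Real.exp (K * (τ.im * Real.exp (-(τ.im * b)))) := by
  have hN : 0 < 2 * x.den := by have := x.den_pos; omega
  obtain ⟨K, t₀, hK, ht₀, h⟩ := prod_compare (x := x) hC hN (fun i => e (B + (i + 1 + a) * (x / 2)))
    (fun i => by
      have := norm_phase x B (i + 1 + a)
      push_cast at this
      exact this)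
  refine ⟨K, t₀, hK, ht₀, fun τ hτ b y h1 h2 => ?_⟩
  rw [← prod_phase_horn hx]
  simp only [fac_block]
  obtain ⟨ha1, ha2⟩ := abs_le.1 ha
  refine h τ hτ b (fun _ => y) (fun i => ((b * (2 * x.den) : ℕ) : ℝ) + (i + 1) + a)
    fun i hi => ⟨h1, by linarith, ?_, ?_, fun h3 => absurd h3 (phase_ne_one hΩ i)⟩
  · have : (0 : ℝ) ≤ i := Nat.cast_nonneg i
    linarith
  · have : ((i + 1 : ℕ) : ℝ) ≤ (2 * x.den : ℕ) := by exact_mod_cast hi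
    push_cast at this ⊢
    linarith

lemma block_upper (hx : Odd x.num) (hC : 0 ≤ C) {B : ℝ} {s : ℕ} (hs : s ≤ 2 * x.den)
    (hspec : ∀ i < 2 * x.den, e (B + (i + 1 + (0 : ℝ)) * (x / 2)) = 1 → i + 1 = s) :
    ∃ K t₀, 0 < K ∧ 0 < t₀ ∧ ∀ τ, Horn x C t₀ τ → ∀ b : ℕ,
      ∏ i ∈ Finset.range (2 * x.den), ‖fac 0 B τ (b * (2 * x.den) + i + 1)‖ ≤
      ‖1 - fullPhase x 0 B * e (((2 * x.den * ((b * (2 * x.den) : ℕ) + s) : ℝ) : ℂ) *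
        ((τ - ((x : ℝ) : ℂ)) / 2))‖ * Real.exp (K * (τ.im * Real.exp (-(τ.im * b)))) := by
  have hN : 0 < 2 * x.den := by have := x.den_pos; omega
  obtain ⟨K, t₀, hK, ht₀, h⟩ := prod_compare (x := x) hC hN
    (fun i => e (B + (i + 1 + (0 : ℝ)) * (x / 2))) (fun i => by
      have := norm_phase x B (i + 1 + 0)
      push_cast at this ⊢
      exact this)
  refine ⟨K, t₀, hK, ht₀, fun τ hτ b => ?_⟩
  rw [← prod_phase_horn hx]
  simp only [fac_block]
  have hs' : (s : ℝ) ≤ (2 * x.den : ℕ) := by exact_mod_cast hs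
  have hs0 : (0 : ℝ) ≤ s := Nat.cast_nonneg s
  refine h τ hτ b (fun i => ((b * (2 * x.den) : ℕ) : ℝ) + (i + 1) + 0)
    (fun _ => ((b * (2 * x.den) : ℕ) : ℝ) + s) fun i hi => ⟨?_, ?_, by linarith, by linarith, ?_⟩
  · have : (0 : ℝ) ≤ i := Nat.cast_nonneg i
    linarith
  · have : ((i + 1 : ℕ) : ℝ) ≤ (2 * x.den : ℕ) := by exact_mod_cast hi
    push_cast at this ⊢
    linarith
  · intro h3
    rw [← hspec i hi h3]
    push_cast
    ring

lemma special_half (hx : Odd x.num) (i : ℕ) (hi : i < 2 * x.den)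
    (h : e ((1 / 2 : ℝ) + (i + 1 + (0 : ℝ)) * (x / 2)) = 1) : i + 1 = x.den := by
  have hp := isPrimitiveRoot_half hx
  have hk := x.den_pos
  have h1 : e (x / 2) ^ (i + 1 + x.den) = 1 := by
    rw [e_pow, ← h]
    have hd := den_mul_self x
    obtain ⟨j, hj⟩ := hx
    refine e_congr j ?_
    rw [hj] at hd
    push_cast at hd ⊢
    linear_combination 1 / 2 * hd
  obtain ⟨q, hq⟩ := (hp.pow_eq_one_iff_dvd _).1 h1
  have : q = 1 := by nlinarith
  rw [this] at hq
  omega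

lemma special_zero (hx : Odd x.num) (i : ℕ) (hi : i < 2 * x.den)
    (h : e ((0 : ℝ) + (i + 1 + (0 : ℝ)) * (x / 2)) = 1) : i + 1 = 2 * x.den := by
  have hp := isPrimitiveRoot_half hx
  have h1 : e (x / 2) ^ (i + 1) = 1 := by
    rw [e_pow, ← h]; congr 1; push_cast; ring
  exact Nat.le_antisymm hi (Nat.le_of_dvd (by omega) ((hp.pow_eq_one_iff_dvd _).1 h1))

lemma fullPhase_zero_half : fullPhase x 0 (1 / 2) = 1 := by
  rw [fullPhase, ← e_nat x.den]; congr 1; push_cast; ring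

lemma fullPhase_zero_zero : fullPhase x 0 0 = 1 := by
  rw [fullPhase, ← e_zero]; congr 1; push_cast; ring

lemma norm_fullPhase (a B : ℝ) : ‖fullPhase x a B‖ = 1 := by
  rw [fullPhase, show (2 * (x.den : ℂ) * B + x.num * a) = ((2 * x.den * B + x.num * a : ℝ) : ℂ) by
    push_cast; ring, norm_e_ofReal]

lemma norm_one_sub_le_mul_exp (hC : 0 ≤ C) {Ω : ℂ} (hΩ : ‖Ω‖ = 1) (hΩ1 : Ω ≠ 1) :
    ∃ K t₀, 0 < K ∧ 0 < t₀ ∧ ∀ τ, Horn x C t₀ τ → ∀ b s : ℝ, 0 ≤ b → b ≤ s →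
      ‖1 - e (s * ((τ - ((x : ℝ) : ℂ)) / 2))‖ ≤ ‖1 - Ω * e (s * ((τ - ((x : ℝ) : ℂ)) / 2))‖ *
        Real.exp (K * (τ.im * Real.exp (-(τ.im * b)))) := by
  have hpi := Real.pi_pos
  have hg : 0 < ‖1 - Ω‖ := norm_pos_iff.2 (sub_ne_zero.2 (Ne.symm hΩ1))
  set g := ‖1 - Ω‖
  refine ⟨2 * (Real.pi * C + 1) * (4 / g), g / (4 * (Real.pi * C + 1)), by positivity, by positivity,
    fun τ hτ b s hb hs => ?_⟩
  have h0 := hτ.1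
  have h1 := norm_e_sub_norm_le hτ hb hs
  have h2 := norm_e_sub_norm_le hτ le_rfl (hb.trans hs)
  rw [mul_zero, neg_zero, Real.exp_zero, mul_one] at h2
  have h3 := norm_e_horn_le_one (x := x) h0 (hb.trans hs)
  set S := e (s * ((τ - ((x : ℝ) : ℂ)) / 2)) with hS
  have h4 := norm_one_sub_mul_ge hΩ (norm_nonneg S) h3
  have hPC : 0 ≤ Real.pi * C := by positivity
  have h5 : Real.pi * C * τ.im ≤ g / 4 := by
    have := hτ.2.1
    rw [le_div_iff₀ (by positivity)] at this
    nlinarith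
  have h6 : ‖1 - Ω * ‖S‖‖ ≤ ‖1 - Ω * S‖ + ‖S - ‖S‖‖ := by
    rw [← one_mul ‖S - ‖S‖‖, ← hΩ, ← norm_mul]
    refine le_trans (le_of_eq ?_) (norm_add_le _ _)
    congr 1; ring
  have h7 : ‖1 - S‖ ≤ (1 - ‖S‖) + ‖S - ‖S‖‖ := by
    calc ‖1 - S‖ = ‖((1 - ‖S‖ : ℝ) : ℂ) - (S - ‖S‖)‖ := by congr 1; push_cast; ring
      _ ≤ _ := by
        refine (norm_sub_le _ _).trans (le_of_eq ?_)
        rw [norm_real, Real.norm_of_nonneg (by linarith)]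
  have h8 : 1 - ‖S‖ ≤ ‖1 - Ω * ‖S‖‖ := by
    have := norm_sub_norm_le 1 (Ω * ‖S‖)
    rwa [norm_one, norm_mul, hΩ, one_mul, norm_real, norm_norm] at this
  have h9 : g / 4 ≤ ‖1 - Ω * S‖ := by linarith
  set δ := τ.im * Real.exp (-(τ.im * b)) with hδ
  have hδ0 : 0 ≤ δ := by positivity
  have h10 : ‖1 - S‖ ≤ ‖1 - Ω * S‖ + 2 * (Real.pi * C + 1) * δ := by
    have : Real.pi * C * τ.im * Real.exp (-(τ.im * b)) ≤ (Real.pi * C + 1) * δ := by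
      rw [hδ, mul_assoc]; gcongr; linarith
    linarith
  have h11 : 2 * (Real.pi * C + 1) * δ ≤ ‖1 - Ω * S‖ * (2 * (Real.pi * C + 1) * (4 / g) * δ) := by
    calc 2 * (Real.pi * C + 1) * δ = (g / 4) * (2 * (Real.pi * C + 1) * (4 / g) * δ) := by field_simp
      _ ≤ _ := by gcongr
  calc ‖1 - S‖ ≤ ‖1 - Ω * S‖ * (2 * (Real.pi * C + 1) * (4 / g) * δ + 1) := by linarith
    _ ≤ _ := by gcongr; exact Real.add_one_le_exp _

/-- The product of the quotients of two factors over a period is asymptotically at most one. -/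
lemma block_pair (hx : Odd x.num) (hC : 0 ≤ C) {a B B₀ : ℝ} {s : ℕ} (ha : |a| ≤ 1)
    (hΩ : fullPhase x a B ≠ 1) (hΩ₀ : fullPhase x 0 B₀ = 1) (hs : s ≤ 2 * x.den)
    (hspec : ∀ i < 2 * x.den, e (B₀ + (i + 1 + (0 : ℝ)) * (x / 2)) = 1 → i + 1 = s) :
    ∃ K t₀, 0 < K ∧ 0 < t₀ ∧ ∀ τ, Horn x C t₀ τ → ∀ b : ℕ,
      ∏ i ∈ Finset.range (2 * x.den), (‖fac 0 B₀ τ (b * (2 * x.den) + i + 1)‖ /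
        ‖fac a B τ (b * (2 * x.den) + i + 1)‖) ≤
      1 * Real.exp (K * (τ.im * Real.exp (-(τ.im * b)))) := by
  obtain ⟨K₁, t₁, hK₁, ht₁, h₁⟩ := block_upper hx hC hs hspec
  obtain ⟨K₂, t₂, hK₂, ht₂, h₂⟩ := block_lower hx hC ha hΩ
  obtain ⟨K₃, t₃, hK₃, ht₃, h₃⟩ := norm_one_sub_le_mul_exp (x := x) hC (norm_fullPhase a B) hΩ
  refine ⟨K₁ + K₂ + K₃, min t₁ (min t₂ t₃), by positivity, by positivity, fun τ hτ b => ?_⟩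
  have e1 := h₁ τ (hτ.mono (min_le_left _ _)) b
  have hbN : (b : ℝ) ≤ ((b * (2 * x.den) : ℕ) : ℝ) := by
    exact_mod_cast Nat.le_mul_of_pos_right b (by have := x.den_pos; omega)
  have hs' : (s : ℝ) ≤ (2 * x.den : ℕ) := by exact_mod_cast hs
  have hs0 : (0 : ℝ) ≤ s := Nat.cast_nonneg s
  have e2 := h₂ τ (hτ.mono ((min_le_right _ _).trans (min_le_left _ _))) b
    (((b * (2 * x.den) : ℕ) : ℝ) + s) (by linarith) (by linarith)
  have hb0 : (0 : ℝ) ≤ b := Nat.cast_nonneg b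
  have hd : (1 : ℝ) ≤ 2 * x.den := by
    have : (1 : ℝ) ≤ x.den := by exact_mod_cast x.den_pos
    linarith
  have e3 := h₃ τ (hτ.mono ((min_le_right _ _).trans (min_le_right _ _))) b
    (2 * x.den * (((b * (2 * x.den) : ℕ) : ℝ) + s)) hb0 (by nlinarith)
  rw [hΩ₀, one_mul] at e1
  rw [Finset.prod_div_distrib]
  refine div_le_of_le_mul₀ (Finset.prod_nonneg fun _ _ => norm_nonneg _) (by positivity) ?_
  refine e1.trans ?_
  set δ := τ.im * Real.exp (-(τ.im * b)) with hδ
  rw [add_mul, add_mul, Real.exp_add, Real.exp_add]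
  calc _ ≤ ((∏ i ∈ Finset.range (2 * x.den), ‖fac a B τ (b * (2 * x.den) + i + 1)‖) *
          Real.exp (K₂ * δ) * Real.exp (K₃ * δ)) * Real.exp (K₁ * δ) :=
        mul_le_mul_of_nonneg_right (e3.trans (mul_le_mul_of_nonneg_right e2 (Real.exp_pos _).le))
          (Real.exp_pos _).le
    _ = _ := by ring

lemma fac_lower (hC : 0 ≤ C) {a B : ℝ} (hΩ : fullPhase x a B ≠ 1) :
    ∃ c t₀, 0 < c ∧ 0 < t₀ ∧ ∀ τ, Horn x C t₀ τ → ∀ J : ℕ, 0 ≤ J + a → c ≤ ‖fac a B τ J‖ := by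
  have hpi := Real.pi_pos
  have hN : 0 < 2 * x.den := by have := x.den_pos; omega
  obtain ⟨c, hc, h⟩ := exists_gap (fun i => e (B + (i + 1 + (a - 1 : ℝ)) * (x / 2))) (2 * x.den)
  refine ⟨c / 4, c / (4 * (Real.pi * C + 1)), by positivity, by positivity, fun τ hτ J hJ => ?_⟩
  have h0 := hτ.1
  have hPC : 0 ≤ Real.pi * C := by positivity
  have hsmall : Real.pi * C * τ.im ≤ c / 4 := by
    have := hτ.2.1
    rw [le_div_iff₀ (by positivity)] at this
    nlinarith
  have h8 := norm_e_sub_norm_le hτ (le_refl 0) hJ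
  rw [mul_zero, neg_zero, Real.exp_zero, mul_one] at h8
  set ζ := e (B + (J + a : ℝ) * (x / 2)) with hζ
  have hζ1 : ‖ζ‖ = 1 := norm_phase x B (J + a)
  have hgap : c ≤ ‖1 - ζ‖ := by
    have h1 := h (J % (2 * x.den)) (Nat.mod_lt _ hN)
    have h2 : e (B + (((J % (2 * x.den) : ℕ) : ℂ) + 1 + (a - 1 : ℝ)) * (x / 2)) = ζ := by
      rw [hζ]
      refine e_congr (-((J / (2 * x.den) : ℕ) : ℤ) * x.num) ?_
      have h3 : ((J : ℕ) : ℂ) = (2 * x.den) * ((J / (2 * x.den) : ℕ) : ℂ) +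
          ((J % (2 * x.den) : ℕ) : ℂ) := by
        exact_mod_cast (Nat.div_add_mod J (2 * x.den)).symm
      have hd := den_mul_self x
      generalize J % (2 * x.den) = m at *
      generalize J / (2 * x.den) = q at *
      push_cast
      rw [h3]
      linear_combination -(q : ℂ) * hd
    rw [h2] at h1
    apply h1
    intro h4
    apply hΩ
    have := phase_pow x (a - 1) B (J)
    rw [show (J : ℂ) + 1 + (a - 1 : ℝ) = ((J + a : ℝ) : ℂ) by push_cast; ring, ← hζ, h4, one_pow]
      at this
    rw [fullPhase, ← e_add_int _ (-x.num)]
    rw [fullPhase] at this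
    rw [this]
    congr 1
    push_cast
    ring
  have hf : fac a B τ J = 1 - ζ * e (((J + a : ℝ) : ℂ) * ((τ - ((x : ℝ) : ℂ)) / 2)) := by
    rw [fac, hζ, ← e_add]
    congr 2
    push_cast
    ring
  have h9 := norm_one_sub_mul_ge hζ1 (norm_nonneg (e (((J + a : ℝ) : ℂ) *
    ((τ - ((x : ℝ) : ℂ)) / 2)))) (norm_e_horn_le_one h0 hJ)
  rw [hf]
  set S := e (((J + a : ℝ) : ℂ) * ((τ - ((x : ℝ) : ℂ)) / 2))
  have h6 : ‖1 - ζ * ‖S‖‖ ≤ ‖1 - ζ * S‖ + ‖S - ‖S‖‖ := by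
    rw [← one_mul ‖S - ‖S‖‖, ← hζ1, ← norm_mul]
    refine le_trans (le_of_eq ?_) (norm_add_le _ _)
    congr 1; ring
  linarith

end Blocks

end EtaTheta

open Complex Filter Topology
namespace EtaTheta

lemma root_twelve_gap {Ω : ℂ} (h12 : Ω ^ 12 = 1) (hne : Ω ≠ 1) {r : ℝ} (h0 : 0 ≤ r) :
    r * (1 - r) + 1 / 16 ≤ ‖1 - Ω * r‖ ^ 2 := by
  have hn : ‖Ω‖ = 1 := norm_eq_one_of_pow_eq_one h12 (by norm_num)
  have hre : Ω.re ≤ √3 / 2 := by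
    obtain ⟨i, hi, rfl⟩ := (Complex.isPrimitiveRoot_exp 12 (by norm_num)).eq_pow_of_pow_eq_one h12
    have hi0 : i ≠ 0 := by rintro rfl; exact hne (pow_zero _)
    rw [← Complex.exp_nat_mul, show (i : ℂ) * (2 * Real.pi * I / (12 : ℕ)) =
      ((i * (Real.pi / 6) : ℝ) : ℂ) * I by push_cast; ring, Complex.exp_ofReal_mul_I_re,
      ← Real.cos_pi_div_six]
    have hpi := Real.pi_pos
    have hi1 : (1 : ℝ) ≤ i := by exact_mod_cast Nat.one_le_iff_ne_zero.2 hi0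
    rcases le_or_gt i 6 with h | h
    · have : (i : ℝ) ≤ 6 := by exact_mod_cast h
      exact Real.cos_le_cos_of_nonneg_of_le_pi (by positivity) (by nlinarith) (by nlinarith)
    · have h7 : (7 : ℝ) ≤ i := by exact_mod_cast h
      have h11 : (i : ℝ) ≤ 11 := by exact_mod_cast Nat.lt_succ_iff.1 hi
      rw [← Real.cos_two_pi_sub]
      exact Real.cos_le_cos_of_nonneg_of_le_pi (by positivity) (by nlinarith) (by nlinarith)
  have hsq : ‖1 - Ω * r‖ ^ 2 = 1 - 2 * r * Ω.re + r ^ 2 := by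
    have h2 : Ω.re ^ 2 + Ω.im ^ 2 = 1 := by
      have := Complex.sq_norm Ω
      rw [hn, normSq_apply] at this
      linarith
    rw [Complex.sq_norm, normSq_apply]
    simp
    linear_combination r ^ 2 * h2
  rw [hsq]
  have h3 : √3 ≤ 1.7321 := by rw [Real.sqrt_le_left (by norm_num)]; norm_num
  nlinarith [sq_nonneg (r - 0.683), mul_le_mul_of_nonneg_left hre h0]

lemma block_ratio {Ω Ω' S : ℂ} (h12 : Ω ^ 12 = 1) (hne : Ω ≠ 1) (h12' : Ω' ^ 12 = 1) (hne' : Ω' ≠ 1)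
    (hS : ‖S‖ ≤ 1) (hS' : ‖S - ‖S‖‖ ≤ 1 / 400) :
    ‖S‖ * ‖1 - S‖ ≤ 9 / 10 * (‖1 - Ω * S‖ * ‖1 - Ω' * S‖) := by
  have h0 := norm_nonneg S
  have key : ∀ Ω : ℂ, Ω ^ 12 = 1 → Ω ≠ 1 → ∃ d : ℝ, 0 ≤ d ∧ d ≤ ‖1 - Ω * S‖ ∧
      ‖S‖ * (1 - ‖S‖) + 21 / 400 ≤ d ^ 2 := by
    intro Ω h12 hne
    have hn : ‖Ω‖ = 1 := norm_eq_one_of_pow_eq_one h12 (by norm_num)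
    have hg := root_twelve_gap h12 hne h0
    have h1 : ‖1 - Ω * ‖S‖‖ ≤ ‖1 - Ω * S‖ + ‖S - ‖S‖‖ := by
      rw [← one_mul ‖S - ‖S‖‖, ← hn, ← norm_mul]
      refine le_trans (le_of_eq ?_) (norm_add_le _ _)
      congr 1; ring
    have h2 : ‖1 - Ω * ‖S‖‖ ≤ 2 := by
      refine (norm_sub_le _ _).trans ?_
      rw [norm_one, norm_mul, hn, norm_real, norm_norm]; linarith
    refine ⟨‖1 - Ω * ‖S‖‖ - 1 / 400, ?_, by linarith, by nlinarith⟩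
    nlinarith [norm_nonneg (1 - Ω * ‖S‖)]
  obtain ⟨d, hd0, hd1, hd2⟩ := key Ω h12 hne
  obtain ⟨d', hd0', hd1', hd2'⟩ := key Ω' h12' hne'
  have h3 : ‖1 - S‖ ≤ 1 - ‖S‖ + 1 / 400 := by
    calc ‖1 - S‖ = ‖((1 - ‖S‖ : ℝ) : ℂ) - (S - ‖S‖)‖ := by congr 1; push_cast; ring
      _ ≤ _ := by
        refine (norm_sub_le _ _).trans ?_
        rw [norm_real, Real.norm_of_nonneg (by linarith)]
        linarith
  have h4 : ‖S‖ * (1 - ‖S‖) + 21 / 400 ≤ d * d' := by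
    set X := ‖S‖ * (1 - ‖S‖) + 21 / 400
    have hX : 0 ≤ X := by have := mul_nonneg h0 (by linarith : 0 ≤ 1 - ‖S‖); positivity
    refine le_of_sq_le_sq ?_ (by positivity)
    rw [mul_pow, sq X]
    exact mul_le_mul hd2 hd2' hX (by positivity)
  have h5 : d * d' ≤ ‖1 - Ω * S‖ * ‖1 - Ω' * S‖ := mul_le_mul hd1 hd1' hd0' (norm_nonneg _)
  nlinarith [sq_nonneg (‖S‖ - 1 / 2)]

lemma eventually_horn {x C t₀ : ℝ} (ht₀ : 0 < t₀) :
    ∀ᶠ τ in 𝓝[{τ | Horn x C 1 τ}] (x : ℂ), Horn x C t₀ τ := by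
  have h : ∀ᶠ τ : ℂ in 𝓝 (x : ℂ), τ.im < t₀ :=
    continuous_im.continuousAt.eventually_lt continuousAt_const (by simpa using ht₀)
  filter_upwards [self_mem_nhdsWithin, h.filter_mono nhdsWithin_le_nhds] with τ h1 h2
  exact ⟨h1.1, h2.le, h1.2.2⟩

lemma fullPhase_reflect (x : ℚ) (n : ℤ) (a B : ℝ) :
    fullPhase x (n - a) (-B) = (fullPhase x a B)⁻¹ := by
  rw [fullPhase, fullPhase, ← e_neg]
  exact e_congr (x.num * n) (by push_cast; ring)

lemma fullPhase_add_half (x : ℚ) (a B : ℝ) : fullPhase x a (B + 1 / 2) = fullPhase x a B :=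
  e_congr x.den (by push_cast; ring)

lemma fullPhase_sub_one (x : ℚ) (a B : ℝ) : fullPhase x (a - 1) B = fullPhase x a B :=
  e_congr (-x.num) (by push_cast; ring)

lemma pow_triangle (Q : ℂ) (n : ℕ) : Q ^ (n * (n + 1) / 2) = ∏ j ∈ Finset.range n, Q ^ (j + 1) := by
  rw [Finset.prod_pow_eq_pow_sum]
  congr 1
  have := Finset.sum_range_succ' (fun i => i) n
  rw [add_zero] at this
  rw [← this, Finset.sum_range_id, Nat.add_sub_cancel, mul_comm]

lemma fac_numerator (τ : ℂ) (j : ℕ) : 1 - -e (τ / 2) * e (τ / 2) ^ j = fac 0 (1 / 2) τ (j + 1) := by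
  rw [fac, e_pow, neg_mul, ← e_add]
  congr 1
  exact (e_congr_neg 0 (by push_cast; ring)).symm

lemma fac_first (A β : ℝ) (τ : ℂ) (j : ℕ) :
    1 - e ((A * τ + β) / 2) * e (τ / 2) ^ j = fac A (β / 2) τ j := by
  rw [fac, e_pow, ← e_add]; congr 2; push_cast; ring

lemma fac_second (A β : ℝ) (τ : ℂ) (j : ℕ) :
    1 - (e ((A * τ + β) / 2))⁻¹ * e (τ / 2) * e (τ / 2) ^ j = fac (1 - A) (-(β / 2)) τ j := by
  rw [fac, e_pow, ← e_neg, ← e_add, ← e_add]; congr 2; push_cast; ring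

/-- The quotient of two consecutive terms of `g₂`. -/
noncomputable def g2Ratio (A β : ℝ) (τ : ℂ) (j : ℕ) : ℝ :=
  ‖fac 0 (1 / 2) τ (j + 1)‖ * ‖e ((j + 1) * (τ / 2))‖ /
    (‖fac A (β / 2) τ (j + 1)‖ * ‖fac (1 - A) (-(β / 2)) τ (j + 1)‖)

lemma norm_g2Term (A β : ℝ) (τ : ℂ) (n : ℕ) :
    ‖g2Term (e ((A * τ + β) / 2)) (e (τ / 2)) n‖ =
      (‖fac A (β / 2) τ 0‖ * ‖fac (1 - A) (-(β / 2)) τ 0‖)⁻¹ *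
        ∏ j ∈ Finset.range n, g2Ratio A β τ j := by
  simp only [g2Term, g2Ratio, qPoch, fac_numerator, fac_first, fac_second, pow_triangle]
  rw [Finset.prod_range_succ', Finset.prod_range_succ', Finset.prod_div_distrib,
    Finset.prod_mul_distrib, Finset.prod_mul_distrib]
  simp only [norm_div, norm_mul, norm_prod, e_pow]
  push_cast
  simp only [div_eq_mul_inv, mul_inv]
  ring

end EtaTheta

open Complex Filter Topology
namespace EtaTheta

lemma prod_norm_e_le (x : ℚ) {τ : ℂ} (hτ : 0 < τ.im) (b : ℕ) :
    ∏ i ∈ Finset.range (2 * x.den), ‖e ((((b * (2 * x.den) + i : ℕ) : ℂ) + 1) * (τ / 2))‖ ≤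
      ‖e (((2 * x.den * (((b * (2 * x.den) : ℕ) : ℝ) + x.den) : ℝ) : ℂ) *
        ((τ - ((x : ℝ) : ℂ)) / 2))‖ := by
  have h : ∀ j : ℕ, ‖e (((j : ℂ) + 1) * (τ / 2))‖ = Real.exp (-(Real.pi * τ.im) * (j + 1)) := by
    intro j
    rw [norm_e, show ((j : ℂ) + 1) * (τ / 2) = (((j + 1) / 2 : ℝ) : ℂ) * τ by push_cast; ring,
      im_ofReal_mul]
    congr 1; ring
  simp only [h]
  rw [norm_e_horn, ← Real.exp_sum, Real.exp_le_exp, ← Finset.mul_sum]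
  have hs : ∑ i ∈ Finset.range (2 * x.den), (((b * (2 * x.den) + i : ℕ) : ℝ) + 1) =
      2 * x.den * ((b * (2 * x.den) : ℕ) : ℝ) + x.den * (2 * x.den + 1) := by
    generalize x.den = k
    have hg : ∀ n : ℕ, ∑ i ∈ Finset.range n, (((b * (2 * k) + i : ℕ) : ℝ) + 1) =
        n * ((b * (2 * k) : ℕ) : ℝ) + n * (n + 1) / 2 := by
      intro n
      induction n with
      | zero => simp
      | succ n ih => rw [Finset.sum_range_succ, ih]; push_cast; ring
    rw [hg]; push_cast; ring
  rw [hs]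
  have hpt : 0 < Real.pi * τ.im := mul_pos Real.pi_pos hτ
  have hk : (0 : ℝ) ≤ x.den := Nat.cast_nonneg _
  nlinarith [mul_nonneg hpt.le hk]

variable {x : ℚ} {C : ℝ}

lemma g2Ratio_block (hx : Odd x.num) (hC : 0 ≤ C) {A β : ℝ} (hA0 : 0 ≤ A) (hA1 : A ≤ 1)
    (h12 : fullPhase x A (β / 2) ^ 12 = 1) (hne : fullPhase x A (β / 2) ≠ 1) :
    ∃ K t₀, 0 < K ∧ 0 < t₀ ∧ ∀ τ, Horn x C t₀ τ → ∀ b : ℕ,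
      ∏ i ∈ Finset.range (2 * x.den), g2Ratio A β τ (b * (2 * x.den) + i) ≤
        9 / 10 * Real.exp (K * (τ.im * Real.exp (-(τ.im * b)))) := by
  have hr := fullPhase_reflect x 1 A (β / 2)
  rw [Int.cast_one] at hr
  have h12' : fullPhase x (1 - A) (-(β / 2)) ^ 12 = 1 := by rw [hr, inv_pow, h12, inv_one]
  have hne' : fullPhase x (1 - A) (-(β / 2)) ≠ 1 := by rw [hr]; simpa using hne
  obtain ⟨K₁, t₁, hK₁, ht₁, h₁⟩ := block_upper (x := x) (B := 1 / 2) (s := x.den) hx hC (by omega)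
    (special_half hx)
  obtain ⟨K₂, t₂, hK₂, ht₂, h₂⟩ := block_lower (a := A) hx hC (abs_le.2 ⟨by linarith, hA1⟩) hne
  obtain ⟨K₃, t₃, hK₃, ht₃, h₃⟩ := block_lower (a := 1 - A) hx hC
    (abs_le.2 ⟨by linarith, by linarith⟩) hne'
  have hpi := Real.pi_pos
  refine ⟨K₁ + K₂ + K₃, min (min t₁ (min t₂ t₃)) (1 / (400 * (Real.pi * C + 1))), by positivity,
    by positivity, fun τ hτ b => ?_⟩
  have hτ' := hτ.mono (min_le_left _ _)
  have e1 := h₁ τ (hτ'.mono (min_le_left _ _)) b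
  have hk : (x.den : ℝ) ≤ (2 * x.den : ℕ) := by exact_mod_cast (by omega : x.den ≤ 2 * x.den)
  have hk0 : (0 : ℝ) ≤ x.den := Nat.cast_nonneg _
  have e2 := h₂ τ (hτ'.mono ((min_le_right _ _).trans (min_le_left _ _))) b
    (((b * (2 * x.den) : ℕ) : ℝ) + x.den) (by linarith) (by linarith)
  have e3 := h₃ τ (hτ'.mono ((min_le_right _ _).trans (min_le_right _ _))) b
    (((b * (2 * x.den) : ℕ) : ℝ) + x.den) (by linarith) (by linarith)
  rw [fullPhase_zero_half, one_mul] at e1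
  have e4 := prod_norm_e_le x hτ.1 b
  have hs0 : (0 : ℝ) ≤ 2 * x.den * (((b * (2 * x.den) : ℕ) : ℝ) + x.den) := by positivity
  have e5 := norm_e_horn_le_one (x := x) hτ.1 hs0
  have e6 := norm_e_sub_norm_le hτ le_rfl hs0
  rw [mul_zero, neg_zero, Real.exp_zero, mul_one] at e6
  have hsmall : Real.pi * C * τ.im ≤ 1 / 400 := by
    have h1 : τ.im ≤ 1 / (400 * (Real.pi * C + 1)) := hτ.2.1.trans (min_le_right _ _)
    rw [le_div_iff₀ (by positivity)] at h1
    have : 0 ≤ Real.pi * C := by positivity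
    nlinarith [hτ.1]
  have e7 := block_ratio h12 hne h12' hne' e5 (e6.trans hsmall)
  set S := e (((2 * x.den * (((b * (2 * x.den) : ℕ) : ℝ) + x.den) : ℝ) : ℂ) *
        ((τ - ((x : ℝ) : ℂ)) / 2))
  set δ := τ.im * Real.exp (-(τ.im * b)) with hδ
  simp only [g2Ratio]
  rw [Finset.prod_div_distrib, Finset.prod_mul_distrib, Finset.prod_mul_distrib]
  set P₁ := ∏ i ∈ Finset.range (2 * x.den), ‖fac 0 (1 / 2) τ (b * (2 * x.den) + i + 1)‖
  set P₂ := ∏ i ∈ Finset.range (2 * x.den), ‖fac A (β / 2) τ (b * (2 * x.den) + i + 1)‖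
  set P₃ := ∏ i ∈ Finset.range (2 * x.den), ‖fac (1 - A) (-(β / 2)) τ (b * (2 * x.den) + i + 1)‖
  have hP₁ : 0 ≤ P₁ := Finset.prod_nonneg fun _ _ => norm_nonneg _
  have hP₂ : 0 ≤ P₂ := Finset.prod_nonneg fun _ _ => norm_nonneg _
  have hP₃ : 0 ≤ P₃ := Finset.prod_nonneg fun _ _ => norm_nonneg _
  refine div_le_of_le_mul₀ (by positivity) (by positivity) ?_
  rw [add_mul, add_mul, Real.exp_add, Real.exp_add]
  calc _ ≤ (‖1 - S‖ * Real.exp (K₁ * δ)) * ‖S‖ :=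
        mul_le_mul e1 e4 (Finset.prod_nonneg fun _ _ => norm_nonneg _) (by positivity)
    _ = ‖S‖ * ‖1 - S‖ * Real.exp (K₁ * δ) := by ring
    _ ≤ 9 / 10 * ((P₂ * Real.exp (K₂ * δ)) * (P₃ * Real.exp (K₃ * δ))) * Real.exp (K₁ * δ) := by
        refine mul_le_mul_of_nonneg_right (e7.trans ?_) (Real.exp_pos _).le
        refine mul_le_mul_of_nonneg_left ?_ (by norm_num)
        exact mul_le_mul e2 e3 (norm_nonneg _) (by positivity)
    _ = _ := by ring

lemma summable_pow_div {lam : ℝ} (h0 : 0 < lam) (h1 : lam < 1) {N : ℕ} (hN : N ≠ 0) :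
    Summable fun n : ℕ => lam ^ (n / N) := by
  set μ := lam ^ ((N : ℝ)⁻¹) with hμ
  have hμ0 : 0 < μ := Real.rpow_pos_of_pos h0 _
  have hμN : μ ^ N = lam := Real.rpow_inv_natCast_pow h0.le hN
  have hμ1 : μ < 1 := Real.rpow_lt_one h0.le h1 (by positivity)
  refine Summable.of_nonneg_of_le (fun n => by positivity) (fun n => ?_)
    ((summable_geometric_of_lt_one hμ0.le hμ1).mul_left lam⁻¹)
  rw [← div_eq_inv_mul, le_div_iff₀ h0]
  conv_rhs => rw [← Nat.div_add_mod n N, pow_add, pow_mul, hμN]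
  refine mul_le_mul_of_nonneg_left ?_ (by positivity)
  rw [← hμN]
  exact pow_le_pow_of_le_one hμ0.le hμ1.le (Nat.mod_lt n (Nat.pos_of_ne_zero hN)).le

lemma fac_rat_ne_zero {a B : ℝ} (h : fullPhase x a B ≠ 1) (J : ℕ) : fac a B x J ≠ 0 := by
  intro h0
  apply h
  have h1 : e (B + (J + a) * (x / 2)) = 1 := (sub_eq_zero.1 h0).symm
  have h2 := congrArg (· ^ (2 * x.den)) h1
  simp only [one_pow] at h2
  rw [← h2, e_pow, fullPhase]
  refine e_congr (-(J * x.num)) ?_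
  have := den_mul_self x
  push_cast
  linear_combination -(J + a : ℂ) * this

lemma continuous_fac (a B : ℝ) (J : ℕ) : Continuous fun τ => fac a B τ J := by
  unfold fac; fun_prop

lemma continuousAt_g2Term {A β : ℝ} (hne : fullPhase x A (β / 2) ≠ 1)
    (hne' : fullPhase x (1 - A) (-(β / 2)) ≠ 1) (n : ℕ) :
    ContinuousAt (fun τ : ℂ => g2Term (e ((A * τ + β) / 2)) (e (τ / 2)) n) (x : ℂ) := by
  simp only [g2Term, qPoch, fac_numerator, fac_first, fac_second]
  have hc := continuous_fac
  refine ContinuousAt.div (Continuous.continuousAt (by fun_prop))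
    (Continuous.continuousAt (by fun_prop)) (mul_ne_zero ?_ ?_)
  · exact Finset.prod_ne_zero_iff.2 fun j _ => fac_rat_ne_zero hne j
  · exact Finset.prod_ne_zero_iff.2 fun j _ => fac_rat_ne_zero hne' j

theorem tendsto_g2 (hx : Odd x.num) (hC : 0 ≤ C) {A β : ℝ} (hA0 : 0 ≤ A) (hA1 : A ≤ 1)
    (h12 : fullPhase x A (β / 2) ^ 12 = 1) (hne : fullPhase x A (β / 2) ≠ 1) :
    Tendsto (fun τ : ℂ => g2 (e ((A * τ + β) / 2)) (e (τ / 2)))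
      (𝓝[{τ | Horn x C 1 τ}] (x : ℂ)) (𝓝 (g2 (e ((A * x + β) / 2)) (e (x / 2)))) := by
  have hN : 0 < 2 * x.den := by have := x.den_pos; omega
  have hr := fullPhase_reflect x 1 A (β / 2)
  rw [Int.cast_one] at hr
  have hne' : fullPhase x (1 - A) (-(β / 2)) ≠ 1 := by rw [hr]; simpa using hne
  obtain ⟨K, t₀, hK, ht₀, h⟩ := g2Ratio_block hx hC hA0 hA1 h12 hne
  obtain ⟨c₁, t₁, hc₁, ht₁, h₁⟩ := fac_lower hC hne
  obtain ⟨c₂, t₂, hc₂, ht₂, h₂⟩ := fac_lower hC hne'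
  set M := max 1 (2 / (c₁ * c₂)) with hM
  have hM1 : 1 ≤ M := le_max_left _ _
  refine tendsto_tsum_of_dominated_convergence
    (bound := fun n => (c₁ * c₂)⁻¹ * ((9 / 10) ^ (n / (2 * x.den)) * Real.exp (2 * K) *
      M ^ (2 * x.den))) ?_ ?_ ?_
  · exact (((summable_pow_div (by norm_num) (by norm_num) hN.ne').mul_right _).mul_right _).mul_left _
  · intro n
    exact (continuousAt_g2Term hne hne' n).tendsto.mono_left nhdsWithin_le_nhds
  · have ev : ∀ {t : ℝ}, 0 < t → ∀ᶠ τ in 𝓝[{τ | Horn x C 1 τ}] (x : ℂ), Horn x C t τ :=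
      fun ht => by simpa using eventually_horn (x := x) (C := C) ht
    filter_upwards [ev ht₀, ev ht₁, ev ht₂, ev one_pos] with τ i0 i1 i2 i3 n
    rw [norm_g2Term]
    have hlow : ∀ J : ℕ, c₁ * c₂ ≤ ‖fac A (β / 2) τ J‖ * ‖fac (1 - A) (-(β / 2)) τ J‖ := by
      intro J
      have hJ : (0 : ℝ) ≤ J := Nat.cast_nonneg J
      exact mul_le_mul (h₁ τ i1 J (by linarith)) (h₂ τ i2 J (by linarith)) hc₂.le (norm_nonneg _)
    have hnn : ∀ j, 0 ≤ g2Ratio A β τ j := fun j => by unfold g2Ratio; positivity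
    have hle : ∀ j, g2Ratio A β τ j ≤ M := by
      intro j
      refine le_trans ?_ (le_max_right _ _)
      have hn : ‖e ((j + 1) * (τ / 2))‖ ≤ 1 := by
        rw [show ((j : ℂ) + 1) * (τ / 2) = (((j + 1) / 2 : ℝ) : ℂ) * τ by push_cast; ring, norm_e,
          im_ofReal_mul, Real.exp_le_one_iff]
        have : 0 ≤ (((j : ℝ) + 1) / 2 * τ.im) := mul_nonneg (by positivity) i3.1.le
        nlinarith [Real.pi_pos]
      have hn2 : ‖fac 0 (1 / 2) τ (j + 1)‖ ≤ 2 := by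
        rw [← fac_numerator, sub_eq_add_neg, neg_mul, neg_neg]
        refine (norm_add_le _ _).trans ?_
        rw [norm_one, e_pow, ← e_add, show τ / 2 + j * (τ / 2) = (j + 1) * (τ / 2) by ring]
        linarith
      unfold g2Ratio
      have := hlow (j + 1)
      calc _ ≤ 2 * 1 / (c₁ * c₂) := by gcongr
        _ = _ := by ring
    have hB := prod_blocks_le (F := g2Ratio A β τ) hnn (by norm_num : (0 : ℝ) ≤ 9 / 10) hK.le i3.1
      i3.2.1 (h τ i0) (n / (2 * x.den))
    have hsplit : ∏ j ∈ Finset.range n, g2Ratio A β τ j ≤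
        (9 / 10) ^ (n / (2 * x.den)) * Real.exp (2 * K) * M ^ (2 * x.den) := by
      conv_lhs => rw [← Nat.div_add_mod n (2 * x.den), mul_comm, Finset.prod_range_add]
      refine mul_le_mul hB ?_ (Finset.prod_nonneg fun _ _ => hnn _) (by positivity)
      calc _ ≤ ∏ _j ∈ Finset.range (n % (2 * x.den)), M :=
            Finset.prod_le_prod (fun _ _ => hnn _) fun _ _ => hle _
        _ = M ^ (n % (2 * x.den)) := by rw [Finset.prod_const, Finset.card_range]
        _ ≤ _ := pow_le_pow_right₀ hM1 (Nat.mod_lt n hN).le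
    have := hlow 0
    exact mul_le_mul (by gcongr) hsplit (Finset.prod_nonneg fun _ _ => hnn _) (by positivity)

/-- The factors of the eta quotient in the formula for `V_{m1}`. -/
noncomputable def etaRatio (A β : ℝ) (τ : ℂ) (j : ℕ) : ℂ :=
  (1 - e τ ^ (j + 1)) * (1 + e (τ / 2) ^ (j + 1)) ^ 2 / jacobiFactor (A * τ + β) τ j

lemma jacobiFactor_eq (A β : ℝ) (τ : ℂ) (j : ℕ) : jacobiFactor (A * τ + β) τ j =
    (fac (A - 1) (β / 2) τ (j + 1) * fac (A - 1) (β / 2 + 1 / 2) τ (j + 1)) *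
      (fac (-A) (-(β / 2)) τ (j + 1) * fac (-A) (-(β / 2) + 1 / 2) τ (j + 1)) := by
  have h1 : e ((β / 2 + 1 / 2 : ℝ) + ((j + 1 : ℕ) + (A - 1 : ℝ)) * (τ / 2)) =
      -e ((β / 2 : ℝ) + ((j + 1 : ℕ) + (A - 1 : ℝ)) * (τ / 2)) :=
    e_congr_neg 0 (by push_cast; ring)
  have h2 : e ((-(β / 2) + 1 / 2 : ℝ) + ((j + 1 : ℕ) + (-A : ℝ)) * (τ / 2)) =
      -e ((-(β / 2) : ℝ) + ((j + 1 : ℕ) + (-A : ℝ)) * (τ / 2)) :=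
    e_congr_neg 0 (by push_cast; ring)
  have h3 : e (A * τ + β) * e τ ^ j =
      e ((β / 2 : ℝ) + ((j + 1 : ℕ) + (A - 1 : ℝ)) * (τ / 2)) ^ 2 := by
    rw [e_pow, e_pow, ← e_add]; congr 1; push_cast; ring
  have h4 : e (-(A * τ + β)) * e τ ^ (j + 1) =
      e ((-(β / 2) : ℝ) + ((j + 1 : ℕ) + (-A : ℝ)) * (τ / 2)) ^ 2 := by
    rw [e_pow, e_pow, ← e_add]; congr 1; push_cast; ring
  rw [jacobiFactor, h3, h4]
  simp only [fac]
  rw [h1, h2]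
  ring

lemma etaRatio_eq (A β : ℝ) (τ : ℂ) (j : ℕ) : etaRatio A β τ j =
    fac 0 0 τ (j + 1) / fac (A - 1) (β / 2) τ (j + 1) *
    (fac 0 (1 / 2) τ (j + 1) / fac (A - 1) (β / 2 + 1 / 2) τ (j + 1)) *
    (fac 0 (1 / 2) τ (j + 1) / fac (-A) (-(β / 2)) τ (j + 1)) *
    (fac 0 (1 / 2) τ (j + 1) / fac (-A) (-(β / 2) + 1 / 2) τ (j + 1)) := by
  rw [etaRatio, jacobiFactor_eq]
  have h1 : fac 0 (1 / 2) τ (j + 1) = 1 + e (τ / 2) ^ (j + 1) := by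
    rw [← fac_numerator, pow_succ]; ring
  have h2 : fac 0 0 τ (j + 1) = 1 - e (τ / 2) ^ (j + 1) := by
    rw [fac, e_pow]; congr 2; push_cast; ring
  have h3 : e τ ^ (j + 1) = (e (τ / 2) ^ (j + 1)) ^ 2 := by
    rw [e_pow, e_pow, e_pow]; congr 1; push_cast; ring
  rw [h1, h2, h3]
  simp only [div_eq_mul_inv, mul_inv]
  ring

theorem tendsto_etaProduct (hx : Odd x.num) (hC : 0 ≤ C) {A β : ℝ} (hA0 : 0 ≤ A) (hA1 : A ≤ 1)
    (hne : fullPhase x A (β / 2) ≠ 1)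
    (hu : ∀ τ : ℂ, 0 < τ.im → ∀ n : ℤ, 1 - e (A * τ + β + n * τ) ≠ 0) :
    Tendsto (fun τ : ℂ => ∏' j, etaRatio A β τ j) (𝓝[{τ | Horn x C 1 τ}] (x : ℂ)) (𝓝 0) := by
  have hN : 0 < 2 * x.den := by have := x.den_pos; omega
  have hr := fullPhase_reflect x 0 A (β / 2)
  rw [Int.cast_zero, zero_sub] at hr
  have hne1 : fullPhase x (A - 1) (β / 2) ≠ 1 := by rwa [fullPhase_sub_one]
  have hne2 : fullPhase x (A - 1) (β / 2 + 1 / 2) ≠ 1 := by rwa [fullPhase_add_half]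
  have hne3 : fullPhase x (-A) (-(β / 2)) ≠ 1 := by rw [hr]; simpa using hne
  have hne4 : fullPhase x (-A) (-(β / 2) + 1 / 2) ≠ 1 := by rwa [fullPhase_add_half]
  have ha1 : |A - 1| ≤ 1 := abs_le.2 ⟨by linarith, by linarith⟩
  have ha2 : |-A| ≤ 1 := abs_le.2 ⟨by linarith, by linarith⟩
  obtain ⟨K₁, t₁, hK₁, ht₁, h₁⟩ := block_pair hx hC ha1 hne1 fullPhase_zero_zero le_rfl
    (special_zero hx)
  obtain ⟨K₂, t₂, hK₂, ht₂, h₂⟩ := block_pair (s := x.den) hx hC ha1 hne2 fullPhase_zero_half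
    (by omega) (special_half hx)
  obtain ⟨K₃, t₃, hK₃, ht₃, h₃⟩ := block_pair (s := x.den) hx hC ha2 hne3 fullPhase_zero_half
    (by omega) (special_half hx)
  obtain ⟨K₄, t₄, hK₄, ht₄, h₄⟩ := block_pair (s := x.den) hx hC ha2 hne4 fullPhase_zero_half
    (by omega) (special_half hx)
  have ev : ∀ {t : ℝ}, 0 < t → ∀ᶠ τ in 𝓝[{τ | Horn x C 1 τ}] (x : ℂ), Horn x C t τ :=
    fun ht => by simpa using eventually_horn (x := x) (C := C) ht
  have hfirst : Tendsto (fun τ : ℂ => (∏ i ∈ Finset.range (2 * x.den), ‖etaRatio A β τ i‖) *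
      Real.exp (2 * (K₁ + K₂ + K₃ + K₄))) (𝓝[{τ | Horn x C 1 τ}] (x : ℂ)) (𝓝 0) := by
    have hc : ContinuousAt (fun τ : ℂ => (∏ i ∈ Finset.range (2 * x.den), ‖etaRatio A β τ i‖) *
        Real.exp (2 * (K₁ + K₂ + K₃ + K₄))) (x : ℂ) := by
      refine ContinuousAt.mul (tendsto_finsetProd _ fun i _ => ContinuousAt.norm ?_)
        continuousAt_const
      simp only [etaRatio_eq]
      have hq : ∀ {B₀ a B : ℝ}, fullPhase x a B ≠ 1 →
          ContinuousAt (fun τ : ℂ => fac 0 B₀ τ (i + 1) / fac a B τ (i + 1)) (x : ℂ) := fun h =>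
        (continuous_fac _ _ _).continuousAt.div (continuous_fac _ _ _).continuousAt
          (fac_rat_ne_zero h _)
      exact (((hq hne1).mul (hq hne2)).mul (hq hne3)).mul (hq hne4)
    have h0 : (∏ i ∈ Finset.range (2 * x.den), ‖etaRatio A β x i‖) = 0 := by
      refine Finset.prod_eq_zero (i := 2 * x.den - 1) (Finset.mem_range.2 (by omega)) ?_
      rw [norm_eq_zero, etaRatio, Nat.sub_add_cancel (by omega), e_pow]
      have : e ((2 * x.den : ℕ) * x) = 1 := by
        rw [← e_zero]
        refine e_congr (2 * x.num) ?_
        have := den_mul_self x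
        push_cast
        linear_combination 2 * this
      rw [this, sub_self, zero_mul, zero_div]
    have := hc.tendsto
    rw [h0, zero_mul] at this
    exact this.mono_left nhdsWithin_le_nhds
  refine squeeze_zero_norm' ?_ hfirst
  filter_upwards [ev ht₁, ev ht₂, ev ht₃, ev ht₄, ev one_pos] with τ i1 i2 i3 i4 i5
  have hblock : ∀ b : ℕ, ∏ i ∈ Finset.range (2 * x.den), ‖etaRatio A β τ (b * (2 * x.den) + i)‖ ≤
      Real.exp ((K₁ + K₂ + K₃ + K₄) * (τ.im * Real.exp (-(τ.im * b)))) := by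
    intro b
    simp only [etaRatio_eq, norm_mul, norm_div, Finset.prod_mul_distrib]
    simp only [← norm_div, ← Finset.prod_mul_distrib]
    simp only [Finset.prod_mul_distrib, norm_div]
    have j1 := h₁ τ i1 b
    have j2 := h₂ τ i2 b
    have j3 := h₃ τ i3 b
    have j4 := h₄ τ i4 b
    rw [one_mul] at j1 j2 j3 j4
    rw [add_mul, add_mul, add_mul, Real.exp_add, Real.exp_add, Real.exp_add]
    have nn : ∀ (f : ℕ → ℝ), (∀ i, 0 ≤ f i) → 0 ≤ ∏ i ∈ Finset.range (2 * x.den), f i :=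
      fun f hf => Finset.prod_nonneg fun i _ => hf i
    have n2 := nn _ fun i => div_nonneg (norm_nonneg (fac 0 (1 / 2) τ (b * (2 * x.den) + i + 1)))
      (norm_nonneg (fac (A - 1) (β / 2 + 1 / 2) τ (b * (2 * x.den) + i + 1)))
    have n3 := nn _ fun i => div_nonneg (norm_nonneg (fac 0 (1 / 2) τ (b * (2 * x.den) + i + 1)))
      (norm_nonneg (fac (-A) (-(β / 2)) τ (b * (2 * x.den) + i + 1)))
    have n4 := nn _ fun i => div_nonneg (norm_nonneg (fac 0 (1 / 2) τ (b * (2 * x.den) + i + 1)))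
      (norm_nonneg (fac (-A) (-(β / 2) + 1 / 2) τ (b * (2 * x.den) + i + 1)))
    exact mul_le_mul (mul_le_mul (mul_le_mul j1 j2 n2 (by positivity)) j3 n3 (by positivity)) j4 n4
      (by positivity)
  have hpart : ∀ B : ℕ, ‖∏ i ∈ Finset.range (2 * x.den + B * (2 * x.den)), etaRatio A β τ i‖ ≤
      (∏ i ∈ Finset.range (2 * x.den), ‖etaRatio A β τ i‖) *
        Real.exp (2 * (K₁ + K₂ + K₃ + K₄)) := by
    intro B
    rw [norm_prod, Finset.prod_range_add]
    refine mul_le_mul_of_nonneg_left ?_ (Finset.prod_nonneg fun _ _ => norm_nonneg _)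
    have := prod_blocks_le (F := fun i => ‖etaRatio A β τ (2 * x.den + i)‖) (N := 2 * x.den)
      (lam := 1) (K := K₁ + K₂ + K₃ + K₄) (fun _ => norm_nonneg _) zero_le_one (by positivity) i5.1
      i5.2.1 (fun b => ?_) B
    · simpa using this
    · have h5 := hblock (b + 1)
      rw [one_mul]
      refine (le_of_eq ?_).trans (h5.trans ?_)
      · refine Finset.prod_congr rfl fun i _ => ?_
        congr 2
        ring
      · have h6 := i5.1
        gcongr
        linarith
  have hτ := i5.1
  have hp := (hasProd_etaQuotient hτ (hu τ hτ)).congr_fun (g := etaRatio A β τ) fun j => rfl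
  rw [hp.tprod_eq]
  have ht : Tendsto (fun B : ℕ => 2 * x.den + B * (2 * x.den)) atTop atTop := by
    refine tendsto_atTop_mono (fun B => ?_) tendsto_id
    calc id B ≤ B * (2 * x.den) := Nat.le_mul_of_pos_right B hN
      _ ≤ _ := Nat.le_add_left _ _
  exact le_of_tendsto ((hp.tendsto_prod_nat.comp ht).norm) (Eventually.of_forall hpart)

end EtaTheta

open Complex Filter Topology
namespace EtaTheta

/-! ### Values at rational numbers -/

lemma quantumSet_odd {m n : ℕ} {x : ℚ} (hx : x ∈ quantumSet m n) : x.num % 2 = 1 := by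
  unfold quantumSet at hx
  split at hx <;> simp only [SAll, SPrime, SEv, SOd, Set.mem_union, Set.mem_inter_iff,
    Set.mem_ofPred_eq, Set.mem_empty_iff_false, Int.odd_iff] at hx <;> omega

lemma quantumSet_subset {m n : ℕ} (hmn : Admissible m n) : quantumSet m n ⊆ quantumSet m 1 := by
  intro x hx
  obtain ⟨h1, h2, h3, h4, h5⟩ := hmn
  interval_cases m <;> interval_cases n <;> simp only [quantumSet, SAll, SPrime, SEv, SOd,
    Set.mem_union, Set.mem_inter_iff, Set.mem_ofPred_eq, Set.mem_empty_iff_false, Int.odd_iff] at hx ⊢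
    <;> first | omega | exact Or.inr hx

/-- `A h + B k` is not an integer, where `x = h/k`. -/
def Generic (A B x : ℚ) : Prop := ∀ N : ℤ, A * x.num + B * x.den ≠ N

lemma generic_of_twelve {A B x : ℚ} (a b : ℤ) (hA : A = a / 12) (hB : B = b / 12)
    (h : ¬ (12 : ℤ) ∣ a * x.num + b * x.den) : Generic A B x := by
  rintro N hN
  apply h
  refine ⟨N, ?_⟩
  rw [hA, hB] at hN
  have : ((a * x.num + b * x.den : ℤ) : ℚ) = ((12 * N : ℤ) : ℚ) := by
    push_cast
    linear_combination 12 * hN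
  exact_mod_cast this

lemma Generic.e_ne_one {A B x : ℚ} (h : Generic A B x) (j : ℤ) :
    e ((A + j) * x + B) ≠ 1 := by
  rw [Ne, e_eq_one_iff]
  rintro ⟨N, hN⟩
  refine h (N * x.den - j * x.num) ?_
  have hd := Rat.den_mul_eq_num x
  have hN' : (A + j) * x + B = N := by exact_mod_cast hN
  push_cast
  linear_combination (x.den : ℚ) * hN' - (A + j) * hd

lemma Generic.jacobiFactor_ne_zero {A B x : ℚ} (h : Generic A B x) (j : ℕ) :
    jacobiFactor (A * x + B) x j ≠ 0 := by
  rw [jacobiFactor, e_pow, e_pow, ← e_add, ← e_add]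
  refine mul_ne_zero (sub_ne_zero.2 (Ne.symm ?_)) (sub_ne_zero.2 (Ne.symm ?_))
  · have := h.e_ne_one j
    rwa [show ((A : ℂ) + (j : ℤ)) * x + B = A * x + B + j * x by push_cast; ring] at this
  · have := h.e_ne_one (-(j + 1 : ℕ))
    intro h1
    apply this
    rw [← inv_inj, ← e_neg, inv_one, ← h1]
    congr 1
    push_cast
    ring

lemma generic_half {m n : ℕ} {x : ℚ} (hx : x ∈ quantumSet m n) : Generic (1 / 2) 0 x := by
  have := quantumSet_odd hx
  exact generic_of_twelve 6 0 (by norm_num) (by norm_num) (by omega)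

/-- Twelve times the coefficients of `vArg`. -/
def vInt (n : ℕ) : ℤ × ℤ :=
  match n with
  | 1 => (6, 0)
  | 2 => (6, -6)
  | 3 => (4, 0)
  | 4 => (4, -6)
  | 5 => (3, 0)
  | 6 => (3, -6)
  | 7 => (2, 0)
  | 8 => (2, -6)
  | _ => (0, 0)

lemma vCoeff_eq (n : ℕ) : (vCoeff n).1 = (vInt n).1 / 12 ∧ (vCoeff n).2 = (vInt n).2 / 12 := by
  by_cases h : n ≤ 8
  · interval_cases n <;> norm_num [vCoeff, vInt]
  · have h1 : vCoeff n = (0, 0) := by unfold vCoeff; split <;> first | omega | rfl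
    have h2 : vInt n = (0, 0) := by unfold vInt; split <;> first | omega | rfl
    simp [h1, h2]

lemma piece_int {m : ℕ} {p : Piece} (hp : p ∈ pieces m) : ∃ a b : ℤ, p.α = a / 12 ∧ p.β = b / 12 ∧
    (m, a, b) ∈ ({(1, -3, 6), (2, -3, 0), (3, -2, 6), (4, -5, 0), (4, -1, 0), (5, -4, 6),
      (6, -2, 0)} : Set (ℕ × ℤ × ℤ)) := by
  unfold pieces at hp
  split at hp <;> simp only [List.mem_cons, List.not_mem_nil, or_false] at hp
  · subst hp; exact ⟨-3, 6, by norm_num, by norm_num, by simp⟩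
  · subst hp; exact ⟨-3, 0, by norm_num, by norm_num, by simp⟩
  · subst hp; exact ⟨-2, 6, by norm_num, by norm_num, by simp⟩
  · rcases hp with rfl | rfl
    · exact ⟨-5, 0, by norm_num, by norm_num, by simp⟩
    · exact ⟨-1, 0, by norm_num, by norm_num, by simp⟩
  · subst hp; exact ⟨-4, 6, by norm_num, by norm_num, by simp⟩
  · subst hp; exact ⟨-2, 0, by norm_num, by norm_num, by simp⟩

lemma generic_vu {m n : ℕ} (hmn : Admissible m n) {x : ℚ} (hx : x ∈ quantumSet m n) {p : Piece}
    (hp : p ∈ pieces m) : Generic (vCoeff n).1 (vCoeff n).2 x ∧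
      Generic ((vCoeff n).1 + p.α) ((vCoeff n).2 + p.β) x := by
  obtain ⟨a, b, hα, hβ, hm⟩ := piece_int hp
  obtain ⟨hv1, hv2⟩ := vCoeff_eq n
  suffices h : ¬ (12 : ℤ) ∣ (vInt n).1 * x.num + (vInt n).2 * x.den ∧
      ¬ (12 : ℤ) ∣ ((vInt n).1 + a) * x.num + ((vInt n).2 + b) * x.den from
    ⟨generic_of_twelve _ _ hv1 hv2 h.1, generic_of_twelve _ _
      (by rw [hv1, hα]; push_cast; ring) (by rw [hv2, hβ]; push_cast; ring) h.2⟩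
  obtain ⟨h1, h2, h3, h4, h5⟩ := hmn
  have hcop : ¬ (x.num % 3 = 0 ∧ x.den % 3 = 0) := by
    rintro ⟨h6, h7⟩
    have h8 : (3 : ℕ) ∣ Nat.gcd x.num.natAbs x.den := Nat.dvd_gcd (by omega) (by omega)
    rw [x.reduced] at h8
    norm_num at h8
  simp only [Set.mem_insert_iff, Set.mem_singleton_iff, Prod.mk.injEq] at hm
  rcases hm with ⟨rfl, rfl, rfl⟩ | ⟨rfl, rfl, rfl⟩ | ⟨rfl, rfl, rfl⟩ | ⟨rfl, rfl, rfl⟩ |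
    ⟨rfl, rfl, rfl⟩ | ⟨rfl, rfl, rfl⟩ | ⟨rfl, rfl, rfl⟩ <;>
  interval_cases n <;> simp only [quantumSet, SAll, SPrime, SEv, SOd,
    Set.mem_union, Set.mem_inter_iff, Set.mem_ofPred_eq, Set.mem_empty_iff_false, Int.odd_iff,
    Nat.even_iff, Nat.odd_iff] at hx <;>
  simp only [vInt] <;> omega

lemma admissible_one {m n : ℕ} (hmn : Admissible m n) : Admissible m 1 :=
  ⟨hmn.1, hmn.2.1, le_rfl, by norm_num, by simp⟩

lemma phase_one {m : ℕ} (hm : Admissible m 1) {x : ℚ} (hx : x ∈ quantumSet m 1) {p : Piece}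
    (hp : p ∈ pieces m) : fullPhase x ((p.α : ℝ) + 1 / 2) ((p.β : ℝ) / 2) ^ 12 = 1 ∧
      fullPhase x ((p.α : ℝ) + 1 / 2) ((p.β : ℝ) / 2) ≠ 1 := by
  have hg := (generic_vu hm hx hp).2
  obtain ⟨a, b, hα, hβ, -⟩ := piece_int hp
  have hα' : (p.α : ℂ) = a / 12 := by rw [hα]; push_cast; ring
  have hβ' : (p.β : ℂ) = b / 12 := by rw [hβ]; push_cast; ring
  constructor
  · rw [fullPhase, e_pow, ← e_zero]
    refine e_congr (b * x.den + x.num * (a + 6)) ?_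
    push_cast
    rw [hα', hβ']
    ring
  · rw [fullPhase, Ne, e_eq_one_iff]
    rintro ⟨N, hN⟩
    refine hg N ?_
    have : ((vCoeff 1).1 + p.α) * x.num + ((vCoeff 1).2 + p.β) * x.den =
        ((2 * (x.den : ℚ)) * (p.β / 2) + x.num * (p.α + 1 / 2) : ℚ) := by
      simp only [vCoeff]; ring
    rw [this, ← Rat.cast_inj (α := ℂ), Rat.cast_intCast, ← hN]
    push_cast
    ring

lemma one_sub_e_pow_den (x : ℚ) : 1 - e x ^ (x.den - 1 + 1) = 0 := by
  rw [Nat.sub_add_cancel x.den_pos, e_pow, sub_eq_zero, ← e_int x.num, den_mul_self]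

lemma etaFactor_zero (p : Piece) (x : ℚ) : ∃ j, etaFactor p x j = 0 :=
  ⟨x.den - 1, by rw [etaFactor, one_sub_e_pow_den, zero_mul, zero_div]⟩

lemma diffFactor_zero (p : Piece) (n : ℕ) (x : ℚ) : ∃ j, diffFactor p n x j = 0 :=
  ⟨x.den - 1, by rw [diffFactor, one_sub_e_pow_den, zero_mul, zero_mul, zero_div]⟩

lemma VRat_eq (m n : ℕ) (x : ℚ) : VRat m n x = ((pieces m).map fun p =>
    I * p.w * e ((p.t + 1 / 8) * x) * g2 (e (p.uArg 1 x / 2)) (e (x / 2))).sum := by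
  rw [VRat]
  congr 1
  refine List.map_congr_left fun p _ => ?_
  rw [tprod_of_exists_eq_zero (etaFactor_zero p x), tprod_of_exists_eq_zero (diffFactor_zero p n x)]
  ring

lemma VRat_eq_one (m n : ℕ) (x : ℚ) : VRat m n x = VRat m 1 x := by rw [VRat_eq, VRat_eq]

lemma uArg_one (p : Piece) (τ : ℂ) :
    p.uArg 1 τ = (((p.α : ℝ) + 1 / 2 : ℝ) : ℂ) * τ + ((p.β : ℝ) : ℂ) := by
  rw [Piece.uArg, vArg]; push_cast; ring

lemma e_half_eq_neg_one {x : ℚ} (hx : Odd x.num) : e (x / 2) ^ x.den = -1 := by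
  obtain ⟨j, hj⟩ := hx
  have hd := den_mul_self x
  rw [hj] at hd
  rw [e_pow, ← e_zero]
  refine e_congr_neg j ?_
  push_cast at hd ⊢
  linear_combination 1 / 2 * hd

theorem nonsingularAt {m n : ℕ} (hmn : Admissible m n) {x : ℚ} (hx : x ∈ quantumSet m n) :
    NonsingularAt m n x := by
  intro p hp
  have hm := admissible_one hmn
  have hx1 := quantumSet_subset hmn hx
  obtain ⟨h12, hne⟩ := phase_one hm hx1 hp
  have hr := fullPhase_reflect x 1 ((p.α : ℝ) + 1 / 2) ((p.β : ℝ) / 2)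
  rw [Int.cast_one] at hr
  have hne' : fullPhase x (1 - ((p.α : ℝ) + 1 / 2)) (-((p.β : ℝ) / 2)) ≠ 1 := by
    rw [hr]; simpa using hne
  have hu1 : ∀ j, jacobiFactor (p.uArg 1 x) x j ≠ 0 := by
    rw [uArg_eq]; exact (generic_vu hm hx1 hp).2.jacobiFactor_ne_zero
  have hodd : Odd x.num := Int.odd_iff.2 (quantumSet_odd hx)
  refine ⟨fun j => ⟨?_, ?_⟩, ?_, hu1, multipliable_of_exists_eq_zero (etaFactor_zero p x), fun j => ?_,
    multipliable_of_exists_eq_zero (diffFactor_zero p n x)⟩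
  · rw [uArg_one, qPoch]
    refine Finset.prod_ne_zero_iff.2 fun i _ => ?_
    rw [fac_first]
    exact fac_rat_ne_zero hne i
  · rw [uArg_one, qPoch]
    refine Finset.prod_ne_zero_iff.2 fun i _ => ?_
    rw [fac_second]
    exact fac_rat_ne_zero hne' i
  · refine summable_of_ne_finset_zero (s := Finset.range x.den) fun i hi => ?_
    have h0 : qPoch (-e ((x : ℂ) / 2)) (e ((x : ℂ) / 2)) i = 0 := by
      have hd := x.den_pos
      rw [Finset.mem_range, not_lt] at hi
      refine Finset.prod_eq_zero (i := x.den - 1) (Finset.mem_range.2 (by omega)) ?_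
      rw [neg_mul, ← pow_succ', Nat.sub_add_cancel hd, e_half_eq_neg_one hodd]
      ring
    rw [g2Term, h0, zero_mul, zero_div]
  · obtain ⟨hv, hu⟩ := generic_vu hmn hx hp
    have h2 := (generic_half hx).jacobiFactor_ne_zero j
    rw [show ((1 / 2 : ℚ) : ℂ) * x + ((0 : ℚ) : ℂ) = x / 2 by push_cast; ring] at h2
    have h3 := hu.jacobiFactor_ne_zero j
    have h4 := hv.jacobiFactor_ne_zero j
    rw [← uArg_eq] at h3
    rw [← vArg_eq] at h4
    exact mul_ne_zero (mul_ne_zero (mul_ne_zero (hu1 j) h2) h3) h4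

lemma mu_one_eq {m : ℕ} (hm : Admissible m 1) {p : Piece} (hp : p ∈ pieces m) {τ : ℂ}
    (hτ : 0 < τ.im) : mu (p.uArg 1 τ) (vArg 1 τ) τ = I * e (τ / 8) *
      (g2 (e ((((((p.α : ℝ) + 1 / 2 : ℝ) : ℂ) * τ + ((p.β : ℝ) : ℂ))) / 2)) (e (τ / 2)) -
        ∏' j, etaRatio ((p.α : ℝ) + 1 / 2) (p.β : ℝ) τ j) := by
  have h := one_sub_ne_zero_of_theta hτ (theta_uArg_ne_zero hm hp hτ)
  rw [vArg, mu_half hτ h, uArg_one]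
  rfl

theorem tendsto_VUpper {m : ℕ} (hm : Admissible m 1) {x : ℚ} (hx : x ∈ quantumSet m 1) {C : ℝ}
    (hC : 0 ≤ C) : Tendsto (VUpper m 1) (𝓝[{τ | Horn x C 1 τ}] (x : ℂ)) (𝓝 (VRat m 1 x)) := by
  have hodd : Odd x.num := Int.odd_iff.2 (quantumSet_odd hx)
  have key : ∀ L : List Piece, (∀ p ∈ L, p ∈ pieces m) →
      Tendsto (fun τ => (L.map fun p => p.w * e (p.t * τ) * mu (p.uArg 1 τ) (vArg 1 τ) τ).sum)
        (𝓝[{τ | Horn x C 1 τ}] (x : ℂ)) (𝓝 (L.map fun p =>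
          I * p.w * e ((p.t + 1 / 8) * x) * g2 (e (p.uArg 1 x / 2)) (e (x / 2))).sum) := by
    intro L
    induction L with
    | nil => intro _; simpa using tendsto_const_nhds
    | cons p L ih =>
      intro hL
      simp only [List.map_cons, List.sum_cons]
      refine Tendsto.add ?_ (ih fun q hq => hL q (List.mem_cons_of_mem _ hq))
      have hp := hL p List.mem_cons_self
      obtain ⟨h12, hne⟩ := phase_one hm hx hp
      obtain ⟨⟨hα1, hα2⟩, -⟩ := pieces_cases hp
      have hA0 : (0 : ℝ) ≤ (p.α : ℝ) + 1 / 2 := by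
        have : (-1 / 2 : ℝ) < p.α := by exact_mod_cast hα1
        linarith
      have hA1 : (p.α : ℝ) + 1 / 2 ≤ 1 := by
        have : (p.α : ℝ) < 0 := by exact_mod_cast hα2
        linarith
      have t1 := tendsto_g2 hodd hC hA0 hA1 h12 hne
      have t2 := tendsto_etaProduct hodd hC hA0 hA1 hne fun τ hτ n => by
        have := one_sub_ne_zero_of_theta hτ (theta_uArg_ne_zero hm hp hτ) n
        rwa [uArg_one] at this
      have t3 : Tendsto (fun τ : ℂ => I * p.w * e ((p.t + 1 / 8) * τ))
          (𝓝[{τ | Horn x C 1 τ}] (x : ℂ)) (𝓝 (I * p.w * e ((p.t + 1 / 8) * x))) := by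
        have : Continuous fun τ : ℂ => I * p.w * e ((p.t + 1 / 8) * τ) := by fun_prop
        exact (this.tendsto _).mono_left nhdsWithin_le_nhds
      have t4 := t3.mul (t1.sub t2)
      rw [sub_zero, ← uArg_one] at t4
      refine t4.congr' ?_
      filter_upwards [self_mem_nhdsWithin] with τ hτ
      rw [mu_one_eq hm hp hτ.1, show (p.t + 1 / 8) * τ = p.t * τ + τ / 8 by ring, e_add]
      ring
  rw [VRat_eq]
  exact key _ fun _ h => h

end EtaTheta

open Complex Filter Topology
namespace EtaTheta

/-! ### The action on rational numbers -/

/-- The congruence conditions satisfied by the elements of `⟨M_ℓ, T_B⟩`. -/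
def InCongruence (B ℓ : ℤ) (γ : Matrix.SpecialLinearGroup (Fin 2) ℤ) : Prop :=
  B ∣ γ.1 0 1 ∧ B ∣ γ.1 0 0 - 1 ∧ B ∣ γ.1 1 1 - 1 ∧ ℓ ∣ γ.1 1 0

lemma det_eq_one (γ : Matrix.SpecialLinearGroup (Fin 2) ℤ) :
    γ.1 0 0 * γ.1 1 1 - γ.1 0 1 * γ.1 1 0 = 1 := by
  have := γ.2
  rwa [Matrix.det_fin_two] at this

lemma inCongruence_lower {B ℓ r : ℤ} (h : ℓ ∣ r) : InCongruence B ℓ (lowerMat r) := by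
  simpa [InCongruence, lowerMat] using h

lemma inCongruence_upper {B ℓ b : ℤ} (h : B ∣ b) : InCongruence B ℓ (upperMat b) := by
  simpa [InCongruence, upperMat] using h

lemma inCongruence_of_mem {B ℓ : ℤ} {γ : Matrix.SpecialLinearGroup (Fin 2) ℤ}
    (h : γ ∈ Subgroup.closure {lowerMat ℓ, upperMat B}) : InCongruence B ℓ γ := by
  induction h using Subgroup.closure_induction with
  | mem γ h =>
    rcases h with rfl | rfl
    · exact inCongruence_lower dvd_rfl
    · exact inCongruence_upper dvd_rfl
  | one => simp [InCongruence]
  | mul γ δ _ _ h1 h2 =>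
    obtain ⟨⟨a1, ha⟩, ⟨b1, hb⟩, ⟨c1, hc⟩, ⟨d1, hd⟩⟩ := h1
    obtain ⟨⟨a2, ha2⟩, ⟨b2, hb2⟩, ⟨c2, hc2⟩, ⟨d2, hd2⟩⟩ := h2
    simp only [InCongruence, Matrix.SpecialLinearGroup.coe_mul, Matrix.mul_apply, Fin.sum_univ_two]
    rw [sub_eq_iff_eq_add] at hb hc hb2 hc2
    rw [ha, hb, hc, hd, ha2, hb2, hc2, hd2]
    exact ⟨⟨a2 * (B * b1 + 1) + a1 * (B * c2 + 1), by ring⟩,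
      ⟨b1 * (B * b2 + 1) + b2 + a1 * (ℓ * d2), by ring⟩,
      ⟨d1 * ℓ * a2 + c1 * (B * c2 + 1) + c2, by ring⟩,
      ⟨d1 * (B * b2 + 1) + (B * c1 + 1) * d2, by ring⟩⟩
  | inv γ _ h =>
    obtain ⟨h1, h2, h3, h4⟩ := h
    simp only [InCongruence, Matrix.SpecialLinearGroup.coe_inv, Matrix.adjugate_fin_two]
    simpa using ⟨h1, h3, h2, h4⟩

lemma moebiusDen_eq (γ : Matrix.SpecialLinearGroup (Fin 2) ℤ) (x : ℚ) :
    moebiusDen γ x * x.den = (γ.1 1 0 * x.num + γ.1 1 1 * x.den : ℤ) := by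
  have := Rat.den_mul_eq_num x
  rw [moebiusDen]
  push_cast
  linear_combination (γ.1 1 0 : ℚ) * this

lemma moebius_num_den {γ : Matrix.SpecialLinearGroup (Fin 2) ℤ} {x : ℚ} (h : moebiusDen γ x ≠ 0) :
    ∃ s : ℤ, (s = 1 ∨ s = -1) ∧ (moebius γ x).num = s * (γ.1 0 0 * x.num + γ.1 0 1 * x.den) ∧
      ((moebius γ x).den : ℤ) = s * (γ.1 1 0 * x.num + γ.1 1 1 * x.den) := by
  have hdet := det_eq_one γ
  have hden := moebiusDen_eq γ x
  have hd0 : (x.den : ℚ) ≠ 0 := Nat.cast_ne_zero.2 x.den_pos.ne'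
  set P := γ.1 0 0 * x.num + γ.1 0 1 * x.den with hP
  set Q := γ.1 1 0 * x.num + γ.1 1 1 * x.den with hQ
  have hQ0 : Q ≠ 0 := by
    intro h0
    rw [h0, Int.cast_zero] at hden
    exact (mul_ne_zero h hd0) hden
  have hval : moebius γ x = (P : ℚ) / Q := by
    have := Rat.den_mul_eq_num x
    rw [moebius, div_eq_div_iff h (by exact_mod_cast hQ0), ← hden, hP]
    push_cast
    linear_combination (γ.1 0 0 : ℚ) * moebiusDen γ x * this
  have hcop : IsCoprime P Q := by
    have hx : IsCoprime x.num (x.den : ℤ) := Int.isCoprime_iff_nat_coprime.mpr x.reduced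
    obtain ⟨u, v, huv⟩ := hx
    refine ⟨u * γ.1 1 1 - v * γ.1 1 0, v * γ.1 0 0 - u * γ.1 0 1, ?_⟩
    rw [hP, hQ]
    linear_combination (u * x.num + v * x.den) * hdet + huv
  rcases lt_or_gt_of_ne hQ0 with hneg | hpos
  · have hval' : moebius γ x = ((-P : ℤ) : ℚ) / ((-Q : ℤ) : ℚ) := by
      rw [hval]; push_cast; rw [neg_div_neg_eq]
    have hc : (-P).natAbs.Coprime (-Q).natAbs := by
      rw [Int.natAbs_neg, Int.natAbs_neg]; exact Int.isCoprime_iff_nat_coprime.mp hcop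
    have h1 := Rat.num_div_eq_of_coprime (by omega : 0 < -Q) hc
    have h2 := Rat.den_div_eq_of_coprime (by omega : 0 < -Q) hc
    exact ⟨-1, Or.inr rfl, by rw [hval', h1]; ring, by rw [hval', h2]; ring⟩
  · have hc : P.natAbs.Coprime Q.natAbs := Int.isCoprime_iff_nat_coprime.mp hcop
    have h1 := Rat.num_div_eq_of_coprime hpos hc
    have h2 := Rat.den_div_eq_of_coprime hpos hc
    exact ⟨1, Or.inl rfl, by rw [hval, h1]; ring, by rw [hval, h2]; ring⟩

lemma num_mod {γ : Matrix.SpecialLinearGroup (Fin 2) ℤ} {B ℓ : ℤ} (hγ : InCongruence B ℓ γ) {x : ℚ}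
    (h : moebiusDen γ x ≠ 0) : ∃ s : ℤ, (s = 1 ∨ s = -1) ∧ (∃ q, (moebius γ x).num =
      s * x.num + B * q) ∧ ((∃ r, B = 2 * r) → (∃ r, ℓ = 2 * r) →
        (moebius γ x).den % 2 = x.den % 2) := by
  obtain ⟨s, hs, h1, h2⟩ := moebius_num_den h
  obtain ⟨⟨u, hu⟩, ⟨v, hv⟩, ⟨w, hw⟩, ⟨z, hz⟩⟩ := hγ
  rw [sub_eq_iff_eq_add] at hv hw
  rw [hu, hv] at h1
  rw [hw, hz] at h2
  refine ⟨s, hs, ⟨s * (v * x.num + u * x.den), by rw [h1]; ring⟩, ?_⟩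
  rintro ⟨r, rfl⟩ ⟨r', rfl⟩
  have h3 : ((moebius γ x).den : ℤ) = s * x.den + 2 * (s * (r' * z * x.num + r * w * x.den)) := by
    rw [h2]; ring
  rcases hs with rfl | rfl <;> omega

lemma moebius_mem {m n : ℕ} (hmn : Admissible m n) {γ : Matrix.SpecialLinearGroup (Fin 2) ℤ}
    (hγ : InCongruence (groupShift m n) (ellPair m n) γ) {x : ℚ} (hx : x ∈ quantumSet m n)
    (h : moebiusDen γ x ≠ 0) : moebius γ x ∈ quantumSet m n := by
  obtain ⟨s, hs, ⟨q, hq⟩, hd⟩ := num_mod hγ h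
  have hB : ∃ r, groupShift m n = 2 * r := by
    unfold groupShift
    split <;> first | exact ⟨2, rfl⟩ | exact ⟨3, rfl⟩ | exact ⟨6, rfl⟩
  have h_odd : (moebius γ x).num % 2 = 1 := by
    have h1 := quantumSet_odd hx
    obtain ⟨r, hr⟩ := hB
    rw [hr, mul_assoc] at hq
    rcases hs with rfl | rfl <;> omega
  have h_six : groupShift m n % 6 = 0 → x.num % 6 = 1 ∨ x.num % 6 = 5 →
      (moebius γ x).num % 6 = 1 ∨ (moebius γ x).num % 6 = 5 := by
    intro h1 h2
    obtain ⟨r, hr⟩ := Int.dvd_of_emod_eq_zero h1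
    rw [hr, mul_assoc] at hq
    rcases hs with rfl | rfl <;> omega
  have h_den : ellPair m n = 2 → (moebius γ x).den % 2 = x.den % 2 := fun h1 =>
    hd hB ⟨1, by rw [h1]; rfl⟩
  clear hd hq hs hB hγ
  generalize moebius γ x = y at *
  obtain ⟨h1, h2, h3, h4, h5⟩ := hmn
  interval_cases m <;> interval_cases n <;>
    simp only [quantumSet, SAll, SPrime, SEv, SOd,
      Set.mem_union, Set.mem_inter_iff, Set.mem_ofPred_eq, Set.mem_empty_iff_false, Int.odd_iff,
      Nat.even_iff, Nat.odd_iff] at hx ⊢ <;>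
    first
    | exact h_odd
    | exact h_six rfl hx
    | (have h6 := h_den rfl; omega)
    | (have h6 := h_den rfl; have h7 := h_six rfl; omega)

end EtaTheta

open Complex Filter Topology
namespace EtaTheta

lemma moebius_radial {a b c d x t : ℝ} (hdet : a * d - b * c = 1) (hj : c * x + d ≠ 0) (ht : 0 < t) :
    ((a : ℂ) * (x + t * I) + b) / (c * (x + t * I) + d) =
      (((a * x + b) / (c * x + d) + c * t ^ 2 / ((c * x + d) * ((c * x + d) ^ 2 + c ^ 2 * t ^ 2)) : ℝ) : ℂ)
        + ((t / ((c * x + d) ^ 2 + c ^ 2 * t ^ 2) : ℝ) : ℂ) * I := by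
  have h1 : (0 : ℝ) < (c * x + d) ^ 2 + c ^ 2 * t ^ 2 := by positivity
  have h2 : ((c : ℂ) * x + d) ≠ 0 := by exact_mod_cast hj
  have h3 : (((c : ℂ) * x + d) ^ 2 + c ^ 2 * t ^ 2) ≠ 0 := by exact_mod_cast h1.ne'
  have h4 : ((c : ℂ) * (x + t * I) + d) ≠ 0 := by
    intro h
    apply h3
    linear_combination (c * x + d - c * t * I) * h + (c : ℂ) ^ 2 * t ^ 2 * I_sq
  have h5 : (a : ℂ) * d - b * c = 1 := by exact_mod_cast hdet
  rw [div_eq_iff h4]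
  push_cast
  have hd : (d : ℂ) = (c * x + d) - c * x := by ring
  generalize (c : ℂ) * x + d = j at *
  rw [hd] at h5 ⊢
  have hI := I_sq
  have h6 : (a : ℂ) * j = 1 + c * (a * x + b) := by linear_combination h5
  generalize hD : j ^ 2 + (c : ℂ) ^ 2 * t ^ 2 = D at *
  field_simp
  linear_combination t * I * D * h6 - c * t ^ 2 * j * hI - t * I * hD

lemma tendsto_radial (x : ℝ) : Tendsto (fun t : ℝ => (x : ℂ) + t * I) (𝓝[>] 0) (𝓝 (x : ℂ)) := by
  have : Continuous fun t : ℝ => (x : ℂ) + t * I := by fun_prop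
  have := (this.tendsto 0).mono_left (nhdsWithin_le_nhds (s := Set.Ioi 0))
  simpa using this

lemma tendsto_moebius_horn {a b c d x : ℝ} (hdet : a * d - b * c = 1) (hj : c * x + d ≠ 0) :
    ∃ C, 0 ≤ C ∧ Tendsto (fun t : ℝ => ((a : ℂ) * (x + t * I) + b) / (c * (x + t * I) + d))
      (𝓝[>] 0) (𝓝[{τ | Horn ((a * x + b) / (c * x + d)) C 1 τ}]
        (((a * x + b) / (c * x + d) : ℝ) : ℂ)) := by
  have hj' : 0 < |c * x + d| := abs_pos.2 hj
  have hj2 : 0 < (c * x + d) ^ 2 := by positivity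
  have hjc : (c : ℂ) * x + d ≠ 0 := by exact_mod_cast hj
  refine ⟨|c| * ((c * x + d) ^ 2 + c ^ 2) / |c * x + d|, by positivity, tendsto_nhdsWithin_iff.2 ⟨?_, ?_⟩⟩
  · have h1 := tendsto_radial x
    have h2 := ((h1.const_mul (a : ℂ)).add_const (b : ℂ)).div
      ((h1.const_mul (c : ℂ)).add_const (d : ℂ)) hjc
    simpa [Pi.div_def] using h2
  · have h1 : ∀ᶠ t : ℝ in 𝓝[>] 0, t < min 1 ((c * x + d) ^ 2) :=
      (gt_mem_nhds (by positivity)).filter_mono nhdsWithin_le_nhds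
    filter_upwards [self_mem_nhdsWithin, h1] with t ht ht1
    have ht : 0 < t := ht
    have h3 : t < 1 := ht1.trans_le (min_le_left _ _)
    have h4 : t < (c * x + d) ^ 2 := ht1.trans_le (min_le_right _ _)
    have h5 : 0 ≤ c ^ 2 * t ^ 2 := by positivity
    set D := (c * x + d) ^ 2 + c ^ 2 * t ^ 2 with hD
    have hD0 : 0 < D := by positivity
    show Horn _ _ _ _
    rw [moebius_radial hdet hj ht]
    set g := (a * x + b) / (c * x + d)
    have hre : ((((g + c * t ^ 2 / ((c * x + d) * D) : ℝ) : ℂ)) + ((t / D : ℝ) : ℂ) * I).re =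
        g + c * t ^ 2 / ((c * x + d) * D) := by
      rw [add_re, ofReal_re, re_ofReal_mul, I_re, mul_zero, add_zero]
    have him : ((((g + c * t ^ 2 / ((c * x + d) * D) : ℝ) : ℂ)) + ((t / D : ℝ) : ℂ) * I).im =
        t / D := by
      rw [add_im, ofReal_im, im_ofReal_mul, I_im, mul_one, zero_add]
    refine ⟨?_, ?_, ?_⟩
    · rw [him]; positivity
    · rw [him, div_le_one hD0]; linarith
    · rw [hre, him, add_sub_cancel_left, abs_div, abs_mul, abs_mul, abs_of_pos hD0,
        abs_of_pos (by positivity : 0 < t ^ 2), div_pow, div_mul_div_comm, div_le_div_iff₀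
        (by positivity) (by positivity)]
      have h6 : D ≤ (c * x + d) ^ 2 + c ^ 2 := by
        rw [hD]
        have : t ^ 2 ≤ 1 := by nlinarith
        nlinarith [sq_nonneg c]
      calc |c| * t ^ 2 * (|c * x + d| * D ^ 2) = |c| * D * t ^ 2 * (|c * x + d| * D) := by ring
        _ ≤ |c| * ((c * x + d) ^ 2 + c ^ 2) * t ^ 2 * (|c * x + d| * D) := by gcongr

lemma tendsto_VUpper_moebius {m : ℕ} (hm : Admissible m 1) {γ : Matrix.SpecialLinearGroup (Fin 2) ℤ}
    (hγ : InCongruence (groupShift m 1) (ellPair m 1) γ) {x : ℚ} (hx : x ∈ quantumSet m 1)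
    (h : moebiusDen γ x ≠ 0) :
    Tendsto (fun t : ℝ => VUpper m 1 ((γ.1 0 0 * ((x : ℂ) + t * I) + γ.1 0 1) /
      (γ.1 1 0 * ((x : ℂ) + t * I) + γ.1 1 1))) (𝓝[>] 0) (𝓝 (VRat m 1 (moebius γ x : ℚ))) := by
  have hdet : ((γ.1 0 0 : ℤ) : ℝ) * (γ.1 1 1 : ℤ) - (γ.1 0 1 : ℤ) * (γ.1 1 0 : ℤ) = 1 := by
    exact_mod_cast det_eq_one γ
  have hj : ((γ.1 1 0 : ℤ) : ℝ) * (x : ℝ) + (γ.1 1 1 : ℤ) ≠ 0 := by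
    have : ((moebiusDen γ x : ℚ) : ℝ) ≠ 0 := by exact_mod_cast h
    rw [moebiusDen] at this
    exact_mod_cast this
  obtain ⟨C, hC, ht⟩ := tendsto_moebius_horn hdet hj
  have h1 := tendsto_VUpper hm (moebius_mem hm hγ hx h) hC
  have h2 : ((γ.1 0 0 : ℤ) * (x : ℝ) + (γ.1 0 1 : ℤ)) / ((γ.1 1 0 : ℤ) * (x : ℝ) + (γ.1 1 1 : ℤ)) =
      ((moebius γ x : ℚ) : ℝ) := by
    rw [moebius, moebiusDen]; push_cast; ring
  rw [h2] at ht
  rw [ofReal_ratCast] at ht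
  refine (h1.comp ht).congr fun t => ?_
  simp

lemma tendsto_VUpper_radial {m : ℕ} (hm : Admissible m 1) {x : ℚ} (hx : x ∈ quantumSet m 1) :
    Tendsto (fun t : ℝ => VUpper m 1 ((x : ℂ) + t * I)) (𝓝[>] 0) (𝓝 (VRat m 1 x)) := by
  have h := tendsto_VUpper_moebius (γ := 1) hm (by simp [InCongruence]) hx (by simp [moebiusDen])
  have h1 : moebius 1 x = x := by simp [moebius, moebiusDen]
  rw [h1] at h
  simpa using h

lemma continuousWithinAt_cpow {w : ℂ} (hw : w ≠ 0) (s : ℂ) :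
    ContinuousWithinAt (fun z => z ^ s) {z | 0 ≤ z.im} w ∨ w.im < 0 := by
  rcases lt_or_ge w.im 0 with h | h
  · exact Or.inr h
  left
  by_cases hs : w ∈ slitPlane
  · exact (ContinuousAt.cpow continuousAt_id continuousAt_const hs).continuousWithinAt
  · have h1 : w.re < 0 ∧ w.im = 0 := by
      rw [mem_slitPlane_iff, not_or, not_lt, not_not] at hs
      refine ⟨lt_of_le_of_ne hs.1 fun h0 => hw (Complex.ext h0 hs.2), hs.2⟩
    have h2 : ContinuousWithinAt (fun z => cexp (Complex.log z * s)) {z | 0 ≤ z.im} w :=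
      ((continuousWithinAt_log_of_re_neg_of_im_zero h1.1 h1.2).mul
        continuousWithinAt_const).cexp
    refine h2.congr_of_eventuallyEq ?_ (cpow_def_of_ne_zero hw s)
    filter_upwards [nhdsWithin_le_nhds (isOpen_ne.mem_nhds hw)] with z hz
    exact cpow_def_of_ne_zero hz s

lemma tendsto_cpow_radial {c d x : ℝ} (hc : 0 ≤ c) (h : c * x + d ≠ 0) (s : ℂ) :
    Tendsto (fun t : ℝ => ((c : ℂ) * (x + t * I) + d) ^ s) (𝓝[>] 0)
      (𝓝 (((c * x + d : ℝ) : ℂ) ^ s)) := by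
  have hw : ((c * x + d : ℝ) : ℂ) ≠ 0 := by exact_mod_cast h
  rcases continuousWithinAt_cpow hw s with h1 | h1
  · refine h1.tendsto.comp (tendsto_nhdsWithin_iff.2 ⟨?_, ?_⟩)
    · have := ((tendsto_radial x).const_mul (c : ℂ)).add_const (d : ℂ)
      simpa using this
    · filter_upwards [self_mem_nhdsWithin] with t ht
      have ht : 0 < t := ht
      have : 0 ≤ c * t := by positivity
      simpa using this
  · simp at h1

lemma V_upper {m n : ℕ} {τ : ℂ} (h : 0 < τ.im) : V m n τ = VUpper m n τ := by rw [V, if_pos h]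

lemma V_rat (m n : ℕ) (x : ℚ) : V m n (x : ℂ) = VRat m 1 x := by
  rw [V, if_neg (by simp), VRat_eq_one]

lemma tendsto_V_radial {m : ℕ} (hm : Admissible m 1) {x : ℚ} (hx : x ∈ quantumSet m 1) :
    Tendsto (fun t : ℝ => V m 1 ((x : ℂ) + t * I)) (𝓝[>] 0) (𝓝 (V m 1 x)) := by
  rw [V_rat]
  refine (tendsto_VUpper_radial hm hx).congr' ?_
  filter_upwards [self_mem_nhdsWithin] with t ht
  have ht : 0 < t := ht
  rw [V_upper (by simpa using ht)]

lemma tendsto_radial_upper (x : ℝ) :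
    Tendsto (fun t : ℝ => (x : ℂ) + t * I) (𝓝[>] 0) (𝓝[{z : ℂ | 0 < z.im}] (x : ℂ)) := by
  refine tendsto_nhdsWithin_iff.2 ⟨tendsto_radial x, ?_⟩
  filter_upwards [self_mem_nhdsWithin] with t ht
  have ht : 0 < t := ht
  simpa using ht

/-- A period relation on the upper half-plane persists at the rational numbers. -/
lemma rational_law {m : ℕ} (hm : Admissible m 1) {r : ℕ} (hr : (ellPair m 1 : ℤ) ∣ r)
    {L : Piece → ℝ → ℂ} {ρ : ℝ} (hL : IsLine m ρ L) (k : ℂ) {x : ℚ} (hx : x ∈ quantumSet m 1)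
    (h : (r : ℚ) * x + 1 ≠ 0) (hρ : (x : ℂ) ≠ -ρ)
    (hlaw : ∀ τ : ℂ, 0 < τ.im → VUpper m 1 τ + k * (r * τ + 1) ^ (-1 / 2 : ℂ) *
      VUpper m 1 (τ / (r * τ + 1)) = -I / (cConst m : ℂ) * eichlerIntegral m ρ τ) :
    VRat m 1 x + k * (r * x + 1) ^ (-1 / 2 : ℂ) * VRat m 1 ((x / (r * x + 1) : ℚ) : ℂ) =
      -I / (cConst m : ℂ) * eichlerIntegral m ρ x := by
  have hden : moebiusDen (lowerMat r) x ≠ 0 := by simpa [moebiusDen, lowerMat] using h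
  have h1 := tendsto_VUpper_radial hm hx
  have h2 := tendsto_VUpper_moebius hm (inCongruence_lower (B := groupShift m 1) hr) hx hden
  have h3 := tendsto_cpow_radial (c := r) (d := 1) (x := x) (Nat.cast_nonneg r)
    (by exact_mod_cast h) (-1 / 2)
  have h4 := ((hL.tendsto_eichlerIntegral hm.1 hm.2.1 (x := (x : ℂ)) (Or.inr ⟨by simp, hρ⟩)).comp
    (by simpa using tendsto_radial_upper x)).const_mul (-I / (cConst m : ℂ))
  have h5 : moebius (lowerMat r) x = x / (r * x + 1) := by simp [moebius, moebiusDen, lowerMat]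
  rw [h5] at h2
  have h6 := h1.add ((h3.const_mul k).mul h2)
  have h7 : ((((r : ℕ) : ℝ) * (x : ℝ) + 1 : ℝ) : ℂ) = r * x + 1 := by push_cast; ring
  rw [h7] at h6
  refine tendsto_nhds_unique (h6.congr' ?_) h4
  filter_upwards [self_mem_nhdsWithin] with t ht
  have ht : 0 < t := ht
  have h8 := hlaw ((x : ℂ) + t * I) (by simpa using ht)
  simp only [Function.comp_apply]
  rw [← h8]
  simp [lowerMat]

theorem law_half {m n : ℕ} (hmn : Admissible m n) {x : ℂ} (hx : x ∈ upperOrQuantum m n)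
    (hne : x ≠ -1 / 2) :
    MeasureTheory.IntegrableOn (eichlerIntegrand m (1 / 2) x) (Set.Ioi 0) ∧
      V m n x + zeta 4 ^ ellConst m * (2 * x + 1) ^ (-1 / 2 : ℂ) * V m n (x / (2 * x + 1)) =
        -I / (cConst m : ℂ) * eichlerIntegral m (1 / 2) x := by
  have hne' : x ≠ -((1 / 2 : ℝ) : ℂ) := by
    intro h; apply hne; rw [h]; push_cast; ring
  rcases hx with hx | ⟨y, hy, rfl⟩
  · have hx : 0 < x.im := hx
    refine ⟨(isLine_half m).integrableOn_eichlerIntegrand hmn.1 hmn.2.1 (Or.inl hx), ?_⟩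
    have h2 := div_linear_im_pos hx 2
    rw [ofReal_ofNat] at h2
    rw [V_upper hx, V_upper h2, VUpper_eichler_half hmn hx]
  · simp only at hne hne' ⊢
    refine ⟨(isLine_half m).integrableOn_eichlerIntegrand hmn.1 hmn.2.1 (Or.inr ⟨by simp, hne'⟩), ?_⟩
    have h1 : (y : ℂ) / (2 * y + 1) = ((y / ((2 : ℕ) * y + 1) : ℚ) : ℂ) := by push_cast; ring
    have hm := admissible_one hmn
    have hr : ((ellPair m 1 : ℕ) : ℤ) ∣ (2 : ℕ) := by
      simp only [ellPair, ellConst]; split_ifs <;> norm_num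
    have := rational_law hm hr (isLine_half m) (zeta 4 ^ ellConst m)
      (quantumSet_subset hmn hy) (fun h0 => hne (by
        have : (y : ℚ) = -1 / 2 := by push_cast at h0; linarith
        rw [this]; push_cast; ring)) hne'
      (fun τ hτ => by simpa using VUpper_eichler_half hm hτ)
    rw [V_rat, h1, V_rat]
    simpa using this

theorem law_one {m : ℕ} (hmn : Admissible m 1) (hm : m = 2 ∨ m = 4 ∨ m = 6) {x : ℂ}
    (hx : x ∈ upperOrQuantum m 1) (hne : x ≠ -1) :
    MeasureTheory.IntegrableOn (eichlerIntegrand m 1 x) (Set.Ioi 0) ∧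
      V m 1 x - (zeta 8)⁻¹ * (x + 1) ^ (-1 / 2 : ℂ) * V m 1 (x / (x + 1)) =
        -I / (cConst m : ℂ) * eichlerIntegral m 1 x := by
  have hne' : x ≠ -((1 : ℝ) : ℂ) := by simpa using hne
  have hl : ellConst m = 1 := by rcases hm with rfl | rfl | rfl <;> rfl
  rcases hx with hx | ⟨y, hy, rfl⟩
  · have hx : 0 < x.im := hx
    refine ⟨(isLine_one hl).integrableOn_eichlerIntegrand hmn.1 hmn.2.1 (Or.inl hx), ?_⟩
    have h2 := div_linear_im_pos hx 1
    rw [ofReal_one, one_mul] at h2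
    rw [V_upper hx, V_upper h2, VUpper_eichler_one hmn hm hx]
  · simp only at hne hne' ⊢
    refine ⟨(isLine_one hl).integrableOn_eichlerIntegrand hmn.1 hmn.2.1 (Or.inr ⟨by simp, hne'⟩), ?_⟩
    have h1 : (y : ℂ) / (y + 1) = ((y / ((1 : ℕ) * y + 1) : ℚ) : ℂ) := by push_cast; ring
    have hr : ((ellPair m 1 : ℕ) : ℤ) ∣ (1 : ℕ) := by simp [ellPair, hl]
    have := rational_law hmn hr (isLine_one hl) (-(zeta 8)⁻¹) hy (fun h0 => hne (by
        have : (y : ℚ) = -1 := by push_cast at h0; linarith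
        rw [this]; push_cast; ring)) hne'
      (fun τ hτ => by simpa [sub_eq_add_neg] using VUpper_eichler_one hmn hm hτ)
    rw [V_rat, h1, V_rat]
    simpa [sub_eq_add_neg] using this

theorem law_translate {m n : ℕ} (hmn : Admissible m n) {x : ℂ} (hx : x ∈ upperOrQuantum m n) :
    V m n x - zeta (aConst m) ^ kappa m n * V m n (x + kappa m n * bConst m) = 0 := by
  rcases hx with hx | ⟨y, hy, rfl⟩
  · have hx : 0 < x.im := hx
    rw [V_upper hx, V_upper (by
      rw [add_im, ← Nat.cast_mul]; simpa using hx), VUpper_translate hmn]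
  · have hm := admissible_one hmn
    have hy1 := quantumSet_subset hmn hy
    have hB : groupShift m 1 ∣ (bConst m : ℤ) := by
      obtain ⟨h1, h2, -⟩ := hmn
      interval_cases m <;> simp [groupShift, bConst, aConst]
    have hstep : ∀ z : ℚ, z ∈ quantumSet m 1 → z + bConst m ∈ quantumSet m 1 ∧
        VRat m 1 z = zeta (aConst m) * VRat m 1 ((z + bConst m : ℚ) : ℂ) := by
      intro z hz
      have hγ := inCongruence_upper (ℓ := ellPair m 1) hB
      have hden : moebiusDen (upperMat (bConst m)) z ≠ 0 := by simp [moebiusDen, upperMat]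
      have h5 : moebius (upperMat (bConst m)) z = z + bConst m := by
        simp [moebius, moebiusDen, upperMat]
      have h6 := moebius_mem hm hγ hz hden
      have h2 := tendsto_VUpper_moebius hm hγ hz hden
      rw [h5] at h6 h2
      refine ⟨h6, tendsto_nhds_unique (tendsto_VUpper_radial hm hz) ((h2.const_mul _).congr fun t => ?_)⟩
      have h7 := VUpper_translate hm ((z : ℂ) + t * I)
      have h8 : kappa m 1 = 1 := by
        obtain ⟨h1, h2, -⟩ := hmn
        interval_cases m <;> rfl
      rw [h8, pow_one, Nat.cast_one, one_mul, sub_eq_zero] at h7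
      rw [h7]
      simp [upperMat]
    have hall : ∀ κ : ℕ, ∀ z : ℚ, z ∈ quantumSet m 1 →
        VRat m 1 z = zeta (aConst m) ^ κ * VRat m 1 ((z + κ * bConst m : ℚ) : ℂ) := by
      intro κ
      induction κ with
      | zero => intro z _; simp
      | succ κ ih =>
        intro z hz
        obtain ⟨h1, h2⟩ := hstep z hz
        rw [h2, ih _ h1, pow_succ, show z + bConst m + κ * bConst m = z + ((κ + 1 : ℕ) : ℚ) * bConst m by
          push_cast; ring]
        ring
    simp only
    rw [V_rat, show (y : ℂ) + kappa m n * bConst m = ((y + kappa m n * bConst m : ℚ) : ℂ) by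
      push_cast; ring, V_rat, ← hall _ y hy1, sub_self]

theorem exists_values {m n : ℕ} (hmn : Admissible m n) {x : ℚ} (hx : x ∈ quantumSet m n) :
    NonsingularAt m n x ∧ ∀ γ ∈ quantumGroup m n, moebiusDen γ x ≠ 0 →
      NonsingularAt m n (moebius γ x) :=
  ⟨nonsingularAt hmn hx, fun _ hγ h =>
    nonsingularAt hmn (moebius_mem hmn (inCongruence_of_mem hγ) hx h)⟩

end EtaTheta

open Complex Filter Topology
open scoped MatrixGroups
namespace EtaTheta

/-! ### The action of the modular group -/

/-- The denominator `cτ + d`. -/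
noncomputable def den (γ : SL(2, ℤ)) (τ : ℂ) : ℂ := γ.1 1 0 * τ + γ.1 1 1

/-- The action `τ ↦ (aτ + b)/(cτ + d)`. -/
noncomputable def act (γ : SL(2, ℤ)) (τ : ℂ) : ℂ := (γ.1 0 0 * τ + γ.1 0 1) / den γ τ

/-- The matrix of `τ ↦ -1/τ`. -/
def invMat : SL(2, ℤ) := ⟨!![0, -1; 1, 0], by simp [Matrix.det_fin_two]⟩

lemma den_ne_zero {γ : SL(2, ℤ)} {τ : ℂ} (hτ : 0 < τ.im) : den γ τ ≠ 0 := by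
  intro h
  have him := congrArg im h
  have hre := congrArg re h
  have hdet := det_eq_one γ
  rw [den, ← ofReal_intCast, ← ofReal_intCast] at him hre
  simp only [add_im, add_re, im_ofReal_mul, re_ofReal_mul, ofReal_im, ofReal_re, zero_im, zero_re,
    add_zero, mul_eq_zero, hτ.ne', or_false, Int.cast_eq_zero] at him hre
  rw [him, Int.cast_zero, zero_mul, zero_add, Int.cast_eq_zero] at hre
  rw [him, hre] at hdet
  simp at hdet

lemma act_im {γ : SL(2, ℤ)} (τ : ℂ) : (act γ τ).im = τ.im / normSq (den γ τ) := by
  have hdet : ((γ.1 0 0 : ℤ) : ℝ) * (γ.1 1 1 : ℤ) - (γ.1 0 1 : ℤ) * (γ.1 1 0 : ℤ) = 1 := by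
    exact_mod_cast det_eq_one γ
  rw [act, div_im, ← sub_div]
  congr 1
  simp only [den, ← ofReal_intCast, add_im, add_re, im_ofReal_mul, re_ofReal_mul, ofReal_im,
    ofReal_re]
  linear_combination τ.im * hdet

lemma act_im_pos {γ : SL(2, ℤ)} {τ : ℂ} (hτ : 0 < τ.im) : 0 < (act γ τ).im := by
  rw [act_im]
  exact div_pos hτ (normSq_pos.2 (den_ne_zero hτ))

lemma act_ofReal (γ : SL(2, ℤ)) (y : ℝ) : act γ y = ((act γ y).re : ℂ) := by
  refine Complex.ext rfl ?_
  rw [act_im]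
  simp

lemma sl_ext {γ δ : SL(2, ℤ)} (h₁ : γ.1 0 0 = δ.1 0 0) (h₂ : γ.1 0 1 = δ.1 0 1)
    (h₃ : γ.1 1 0 = δ.1 1 0) (h₄ : γ.1 1 1 = δ.1 1 1) : γ = δ := by
  ext i j
  fin_cases i <;> fin_cases j <;> assumption

lemma mul_entry (γ δ : SL(2, ℤ)) (i j : Fin 2) :
    (γ * δ).1 i j = γ.1 i 0 * δ.1 0 j + γ.1 i 1 * δ.1 1 j := by
  rw [Matrix.SpecialLinearGroup.coe_mul, Matrix.mul_apply, Fin.sum_univ_two]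

lemma linear_act (a b : ℤ) {δ : SL(2, ℤ)} {τ : ℂ} (h : den δ τ ≠ 0) :
    (a * act δ τ + b) * den δ τ =
      ((a * δ.1 0 0 + b * δ.1 1 0 : ℤ) : ℂ) * τ + (a * δ.1 0 1 + b * δ.1 1 1 : ℤ) := by
  rw [act, add_mul, mul_assoc, div_mul_cancel₀ _ h, den]
  push_cast
  ring

lemma den_mul {γ δ : SL(2, ℤ)} {τ : ℂ} (h : den δ τ ≠ 0) :
    den (γ * δ) τ = den γ (act δ τ) * den δ τ := by
  rw [den, den.eq_1 γ, linear_act _ _ h, mul_entry, mul_entry]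

lemma act_mul {γ δ : SL(2, ℤ)} {τ : ℂ} (h : den δ τ ≠ 0) :
    act (γ * δ) τ = act γ (act δ τ) := by
  rw [act, den_mul h, act.eq_1 γ, mul_entry, mul_entry, ← linear_act _ _ h, mul_div_mul_right _ _ h]

lemma den_upperMat (k : ℤ) (τ : ℂ) : den (upperMat k) τ = 1 := by simp [den, upperMat]

lemma act_upperMat (k : ℤ) (τ : ℂ) : act (upperMat k) τ = τ + k := by
  rw [act, den_upperMat]; simp [upperMat]

lemma den_invMat (τ : ℂ) : den invMat τ = τ := by simp [den, invMat]

lemma act_invMat (τ : ℂ) : act invMat τ = -1 / τ := by rw [act, den_invMat]; simp [invMat]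

lemma continuousAt_act {γ : SL(2, ℤ)} {τ : ℂ} (h : den γ τ ≠ 0) : ContinuousAt (act γ) τ := by
  unfold act den at *
  exact ContinuousAt.div (by fun_prop) (by fun_prop) h

lemma analyticAt_act {γ : SL(2, ℤ)} {τ : ℂ} (h : den γ τ ≠ 0) : AnalyticAt ℂ (act γ) τ := by
  unfold act den at *
  exact AnalyticAt.div (by fun_prop) (by fun_prop) h

/-- Every element of the modular group decomposes into translations and inversions, in such a way
that a given point does not pass through `∞`. -/
lemma modular_induction {motive : SL(2, ℤ) → ℂ → Prop} (hT : ∀ k τ, motive (upperMat k) τ)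
    (hS : ∀ τ, τ ≠ 0 → motive invMat τ)
    (hmul : ∀ γ δ τ, den δ τ ≠ 0 → motive γ (act δ τ) → motive δ τ → motive (γ * δ) τ)
    (γ : SL(2, ℤ)) (τ : ℂ) (h : den γ τ ≠ 0) : motive γ τ := by
  have hTS : ∀ k τ, τ ≠ 0 → motive (upperMat k * invMat) τ := fun k τ h0 =>
    hmul _ _ _ (by rwa [den_invMat]) (hT _ _) (hS _ h0)
  induction hc : (γ.1 1 0).natAbs using Nat.strong_induction_on generalizing γ with
  | _ N ih =>
    have hdet := det_eq_one γ
    by_cases h0 : γ.1 1 0 = 0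
    · rw [h0, mul_zero, sub_zero] at hdet
      rcases Int.eq_one_or_neg_one_of_mul_eq_one hdet with h1 | h1
      · have h2 : γ.1 1 1 = 1 := by rw [h1] at hdet; omega
        have : γ = upperMat (γ.1 0 1) := by
          apply sl_ext <;> simp [upperMat, h0, h1, h2]
        rw [this]; exact hT _ _
      · have h2 : γ.1 1 1 = -1 := by rw [h1] at hdet; omega
        have hk : ∀ k : ℤ, τ - γ.1 0 1 - k ≠ 0 → motive γ τ := by
          intro k hk
          have : γ = upperMat k * invMat * (invMat * upperMat (-γ.1 0 1 - k)) := by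
            apply sl_ext <;> simp only [mul_entry] <;> simp [upperMat, invMat, h0, h1, h2]
          have h3 : act (upperMat (-γ.1 0 1 - k)) τ ≠ 0 := by
            rw [act_upperMat]; push_cast; convert hk using 1; ring
          have h4 : den (upperMat (-γ.1 0 1 - k)) τ ≠ 0 := by rw [den_upperMat]; exact one_ne_zero
          rw [this]
          refine hmul _ _ _ ?_ (hTS _ _ ?_) (hmul _ _ _ h4 (hS _ h3) (hT _ _))
          · rw [den_mul h4, den_invMat]
            exact mul_ne_zero h3 h4
          · rw [act_mul h4, act_invMat]
            exact div_ne_zero (by simp) h3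
        by_cases h3 : τ - γ.1 0 1 = 0
        · refine hk 1 ?_
          rw [h3]; simp
        · exact hk 0 (by simpa using h3)
    · have key : ∀ k : ℤ, (γ.1 0 0 + k * γ.1 1 0).natAbs < N →
          (γ.1 0 0 + k * γ.1 1 0 : ℤ) * τ + (γ.1 0 1 + k * γ.1 1 1 : ℤ) ≠ 0 → motive γ τ := by
        intro k h1 h2
        set δ : SL(2, ℤ) := ⟨!![γ.1 1 0, γ.1 1 1; -(γ.1 0 0 + k * γ.1 1 0),
          -(γ.1 0 1 + k * γ.1 1 1)], by rw [Matrix.det_fin_two_of]; linear_combination hdet⟩ with hδ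
        have h5 : den δ τ ≠ 0 := by
          intro h6; apply h2; rw [← neg_eq_zero, ← h6, den]; simp [hδ]; ring
        have h7 : γ = upperMat (-k) * invMat * δ := by
          apply sl_ext <;>
            simp only [mul_entry] <;> simp [upperMat, invMat, hδ]
        have h8 := ih (δ.1 1 0).natAbs (by
          rw [show δ.1 1 0 = -(γ.1 0 0 + k * γ.1 1 0) from rfl, Int.natAbs_neg]; exact h1) δ h5 rfl
        rw [h7]
        exact hmul _ _ _ h5 (hTS _ _ (div_ne_zero (by rw [den] at h; simpa [hδ] using h) h5)) h8
      have hmod := Int.emod_add_mul_ediv (γ.1 0 0) (γ.1 1 0)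
      have hpos := Int.emod_nonneg (γ.1 0 0) h0
      have hlt := Int.emod_lt_abs (γ.1 0 0) h0
      have habs : |γ.1 1 0| = N := by rw [← hc, Int.natCast_natAbs]
      set k := -(γ.1 0 0 / γ.1 1 0) with hk
      have hr : γ.1 0 0 + k * γ.1 1 0 = γ.1 0 0 % γ.1 1 0 := by rw [hk]; linarith
      by_cases h1 : (γ.1 0 0 + k * γ.1 1 0 : ℤ) * τ + (γ.1 0 1 + k * γ.1 1 1 : ℤ) = 0
      · have h2 : γ.1 0 0 + k * γ.1 1 0 ≠ 0 := by
          intro h2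
          rw [h2, Int.cast_zero, zero_mul, zero_add, Int.cast_eq_zero] at h1
          have : (γ.1 0 0 + k * γ.1 1 0) * γ.1 1 1 - (γ.1 0 1 + k * γ.1 1 1) * γ.1 1 0 = 1 := by
            linear_combination hdet
          rw [h1, h2] at this
          simp at this
        obtain ⟨s, hs, hs'⟩ : ∃ s : ℤ, s ≠ 0 ∧ s * γ.1 1 0 = -|γ.1 1 0| := by
          rcases abs_cases (γ.1 1 0) with h | h
          · exact ⟨-1, by simp, by omega⟩
          · exact ⟨1, by simp, by omega⟩
        refine key (k + s) ?_ ?_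
        · rw [add_mul, ← add_assoc, hs', hr, habs]; omega
        · have h3 : (s : ℂ) * den γ τ ≠ 0 := mul_ne_zero (by exact_mod_cast hs) h
          convert h3 using 1
          rw [den]
          push_cast at h1 ⊢
          linear_combination h1
      · exact key k (by rw [hr]; omega) h1

end EtaTheta

open Complex Filter Topology
open scoped MatrixGroups
namespace EtaTheta

/-! ### The multiplier -/

/-- The product of the three even theta constants, a multiple of `η³`. -/
noncomputable def thetaNull (τ : ℂ) : ℂ :=
  theta (1 / 2) τ * (e (τ / 8) * theta (τ / 2) τ) * (e (τ / 8) * theta ((τ + 1) / 2) τ)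

lemma thetaNull_ne_zero {τ : ℂ} (hτ : 0 < τ.im) : thetaNull τ ≠ 0 := by
  have h1 := theta_ne_zero_of_not_int (A := 0) (B := 1 / 2) hτ (Or.inr (by decide +kernel))
  have h2 := theta_ne_zero_of_not_int (A := 1 / 2) (B := 0) hτ (Or.inl (by decide +kernel))
  have h3 := theta_ne_zero_of_not_int (A := 1 / 2) (B := 1 / 2) hτ (Or.inl (by decide +kernel))
  have E := e_ne_zero (τ / 8)
  push_cast at h1 h2 h3
  rw [zero_mul, zero_add] at h1
  rw [show 1 / 2 * τ + 0 = τ / 2 by ring] at h2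
  rw [show 1 / 2 * τ + 1 / 2 = (τ + 1) / 2 by ring] at h3
  exact mul_ne_zero (mul_ne_zero h1 (mul_ne_zero E h2)) (mul_ne_zero E h3)

lemma thetaNull_add_one (τ : ℂ) : thetaNull (τ + 1) = e (1 / 8) * thetaNull τ := by
  simp only [thetaNull, theta_tau_add_one]
  rw [show (τ + 1 + 1) / 2 = τ / 2 + 1 by ring, theta_add_one,
    show (τ + 1) / 8 = τ / 8 + 1 / 8 by ring, e_add]
  have h : e (1 / 8) ^ 4 = -1 := by rw [e_pow, ← e_half]; congr 1; push_cast; ring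
  linear_combination -(e (1 / 8) * theta (1 / 2) τ * e (τ / 8) * theta (τ / 2) τ * e (τ / 8) *
    theta ((τ + 1) / 2) τ) * h

lemma thetaNull_inv {τ : ℂ} (hτ : 0 < τ.im) :
    thetaNull (-1 / τ) = ((-I * τ) ^ (1 / 2 : ℂ)) ^ 3 * thetaNull τ := by
  have h0 := ne_zero_of_im_pos hτ
  have h1 := theta_S hτ (τ / 2)
  have h2 := theta_S hτ (-(1 / 2))
  have h3 := theta_S hτ ((τ + 1) / 2 - 1)
  rw [show τ / 2 / τ = 1 / 2 by field_simp] at h1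
  rw [show -(1 / 2) / τ = -1 / τ / 2 by field_simp, theta_neg] at h2
  rw [show ((τ + 1) / 2 - 1) / τ = (-1 / τ + 1) / 2 by field_simp; ring,
    show theta ((τ + 1) / 2 - 1) τ = -theta ((τ + 1) / 2) τ by
      rw [← neg_eq_iff_eq_neg, ← theta_add_one, sub_add_cancel]] at h3
  rw [thetaNull, thetaNull, h1, h2, h3]
  have E1 : e ((τ / 2) ^ 2 / (2 * τ)) = e (τ / 8) := by congr 1; field_simp; ring
  have E2 : e (-1 / τ / 8) * e ((-(1 / 2)) ^ 2 / (2 * τ)) = 1 := by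
    rw [← e_add]; convert e_zero using 2; field_simp; ring
  have E3 : e (-1 / τ / 8) * e (((τ + 1) / 2 - 1) ^ 2 / (2 * τ)) = -I * e (τ / 8) := by
    rw [← e_add, show -I = e (-1 / 4) by
      rw [I_eq_e]; exact (e_congr_neg (-1) (by push_cast; ring)).symm, ← e_add]
    congr 1; field_simp; ring
  rw [E1]
  generalize e (τ / 8) = a at *
  generalize e (-1 / τ / 8) = b at *
  generalize e ((-(1 / 2)) ^ 2 / (2 * τ)) = c at *
  generalize e (((τ + 1) / 2 - 1) ^ 2 / (2 * τ)) = d at *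
  generalize (-I * τ) ^ (1 / 2 : ℂ) = s at *
  generalize theta (τ / 2) τ = t1 at *
  generalize theta (1 / 2) τ = t2 at *
  generalize theta ((τ + 1) / 2) τ = t3 at *
  have hI := I_sq
  linear_combination -(I ^ 3 * s ^ 3 * t1 * t2 * t3 * a * b * d) * E2 -
    I ^ 3 * s ^ 3 * t1 * t2 * t3 * a * E3 + s ^ 3 * t1 * t2 * t3 * a ^ 2 * (I ^ 2 - 1) * hI

lemma continuousAt_theta {v : ℂ → ℂ} {τ : ℂ} (hτ : 0 < τ.im) (hv : ContinuousAt v τ) :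
    ContinuousAt (fun τ => theta (v τ) τ) τ := by
  simp only [theta_eq]
  refine ContinuousAt.mul (by fun_prop) ?_
  exact (continuousAt_jacobiTheta₂ (v τ + 1 / 2 + τ / 2) hτ).comp_of_eq
    (f := fun τ => (v τ + 1 / 2 + τ / 2, τ)) (by fun_prop) rfl

lemma continuousAt_thetaNull {τ : ℂ} (hτ : 0 < τ.im) : ContinuousAt thetaNull τ := by
  unfold thetaNull
  have h1 := continuousAt_theta (v := fun _ => 1 / 2) hτ (by fun_prop)
  have h2 := continuousAt_theta (v := fun τ => τ / 2) hτ (by fun_prop)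
  have h3 := continuousAt_theta (v := fun τ => (τ + 1) / 2) hτ (by fun_prop)
  exact (h1.mul (ContinuousAt.mul (by fun_prop) h2)).mul (ContinuousAt.mul (by fun_prop) h3)

/-- The automorphy factor of weight `-1/2` defined by `thetaNull`. -/
noncomputable def multiplier (γ : SL(2, ℤ)) (τ : ℂ) : ℂ :=
  thetaNull (act γ τ) / (thetaNull τ * den γ τ ^ 2)

lemma multiplier_mul (γ δ : SL(2, ℤ)) {τ : ℂ} (hτ : 0 < τ.im) :
    multiplier (γ * δ) τ = multiplier γ (act δ τ) * multiplier δ τ := by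
  have h := den_ne_zero (γ := δ) hτ
  have h1 := thetaNull_ne_zero (act_im_pos (γ := δ) hτ)
  rw [multiplier, multiplier, multiplier, act_mul h, den_mul h, div_mul_div_comm,
    mul_assoc (thetaNull (act δ τ)), mul_comm (thetaNull (act γ _)) (thetaNull (act δ τ)),
    mul_div_mul_left _ _ h1]
  congr 1
  ring

lemma add_int_of_add_one {f : ℂ → ℂ} {c : ℂ} (hc : c ≠ 0) (h : ∀ τ, f (τ + 1) = c * f τ) (k : ℤ)
    (τ : ℂ) : f (τ + k) = c ^ k * f τ := by
  induction k generalizing τ with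
  | zero => simp
  | succ k ih => rw [zpow_add_one₀ hc, Int.cast_add, ← add_assoc, Int.cast_one, h, ih]; ring
  | pred k ih =>
    have := h (τ + ((-k - 1 : ℤ) : ℂ))
    rw [show τ + ((-k - 1 : ℤ) : ℂ) + 1 = τ + ((-k : ℤ) : ℂ) by push_cast; ring, ih] at this
    rw [zpow_sub_one₀ hc]
    field_simp
    rw [mul_comm _ c, ← this]

lemma multiplier_upperMat (k : ℤ) {τ : ℂ} (hτ : 0 < τ.im) :
    multiplier (upperMat k) τ = e (1 / 8) ^ k := by
  have := thetaNull_ne_zero hτ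
  rw [multiplier, act_upperMat, den_upperMat, add_int_of_add_one (e_ne_zero _) thetaNull_add_one]
  field_simp

lemma multiplier_invMat {τ : ℂ} (hτ : 0 < τ.im) :
    multiplier invMat τ = -((-I * τ) ^ (1 / 2 : ℂ))⁻¹ := by
  have h1 := thetaNull_ne_zero hτ
  have h2 := sqrt_ne_zero hτ
  have h3 := cpow_half_sq (-I * τ)
  have h4 := ne_zero_of_im_pos hτ
  rw [multiplier, act_invMat, den_invMat, thetaNull_inv hτ]
  generalize (-I * τ) ^ (1 / 2 : ℂ) = s at *
  field_simp
  have hI := I_sq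
  linear_combination (s ^ 2 - I * τ) * h3 + τ ^ 2 * hI

lemma multiplier_pow (γ : SL(2, ℤ)) {τ : ℂ} (hτ : 0 < τ.im) :
    multiplier γ τ ^ 8 * den γ τ ^ 4 = 1 := by
  refine modular_induction (motive := fun γ τ => 0 < τ.im → multiplier γ τ ^ 8 * den γ τ ^ 4 = 1)
    (fun k τ hτ => ?_) (fun τ _ hτ => ?_) (fun γ δ τ hden h1 h2 hτ => ?_) γ τ (den_ne_zero hτ) hτ
  · rw [multiplier_upperMat k hτ, den_upperMat, e_zpow, e_pow, one_pow, mul_one]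
    convert e_int k using 2
    push_cast; ring
  · have h1 := sqrt_ne_zero hτ
    have h3 := cpow_half_sq (-I * τ)
    rw [multiplier_invMat hτ, den_invMat]
    generalize (-I * τ) ^ (1 / 2 : ℂ) = s at *
    have h4 : τ ^ 4 = s ^ 8 := by
      rw [show s ^ 8 = (s ^ 2) ^ 4 by ring, h3, mul_pow, neg_pow, I_pow_four]; ring
    rw [h4]
    field_simp
  · rw [multiplier_mul _ _ hτ, den_mul hden]
    linear_combination multiplier δ τ ^ 8 * den δ τ ^ 4 * h1 (act_im_pos hτ) + h2 hτ

lemma den_im (γ : SL(2, ℤ)) (τ : ℂ) : (den γ τ).im = γ.1 1 0 * τ.im := by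
  rw [den, ← ofReal_intCast, ← ofReal_intCast]; simp

lemma continuousOn_den_cpow (γ : SL(2, ℤ)) :
    ContinuousOn (fun τ => den γ τ ^ (1 / 2 : ℂ)) {τ | 0 < τ.im} := by
  by_cases h : γ.1 1 0 = 0
  · simp only [den, h, Int.cast_zero, zero_mul]
    exact continuousOn_const
  · intro τ hτ
    have hτ : 0 < τ.im := hτ
    have hc : ContinuousAt (den γ) τ := by unfold den; fun_prop
    refine (hc.cpow continuousAt_const (Or.inr ?_)).continuousWithinAt
    rw [den_im]
    exact mul_ne_zero (by exact_mod_cast h) hτ.ne'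

lemma exists_multiplier_eq (γ : SL(2, ℤ)) : ∃ κ : ℂ, ‖κ‖ = 1 ∧
    ∀ τ : ℂ, 0 < τ.im → multiplier γ τ = κ * den γ τ ^ (-1 / 2 : ℂ) := by
  have hmaps : ∀ τ : ℂ, 0 < τ.im → (multiplier γ τ * den γ τ ^ (1 / 2 : ℂ)) ^ 8 = 1 := by
    intro τ hτ
    rw [mul_pow, show (den γ τ ^ (1 / 2 : ℂ)) ^ 8 = ((den γ τ ^ (1 / 2 : ℂ)) ^ 2) ^ 4 by ring,
      cpow_half_sq, multiplier_pow γ hτ]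
  have hfin : {z : ℂ | z ^ 8 = 1}.Finite := by
    have : {z : ℂ | z ^ 8 = 1} = ((Polynomial.nthRoots 8 (1 : ℂ)).toFinset : Set ℂ) := by
      ext z; simp [Polynomial.mem_nthRoots]
    rw [this]; exact Finset.finite_toSet _
  have hcont : ContinuousOn (fun τ => multiplier γ τ * den γ τ ^ (1 / 2 : ℂ)) {τ | 0 < τ.im} := by
    refine ContinuousOn.mul (fun τ hτ => ContinuousAt.continuousWithinAt ?_)
      (continuousOn_den_cpow γ)
    have hτ : 0 < τ.im := hτ
    have hd := den_ne_zero (γ := γ) hτ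
    have hc : ContinuousAt (den γ) τ := by unfold den; fun_prop
    exact ((continuousAt_thetaNull (act_im_pos hτ)).comp (continuousAt_act hd)).div
      ((continuousAt_thetaNull hτ).mul (hc.pow 2))
      (mul_ne_zero (thetaNull_ne_zero hτ) (pow_ne_zero 2 hd))
  have hI : 0 < I.im := by simp
  refine ⟨multiplier γ I * den γ I ^ (1 / 2 : ℂ), ?_, fun τ hτ => ?_⟩
  · have := congrArg norm (hmaps I hI)
    rw [norm_pow, norm_one] at this
    exact (pow_eq_one_iff_of_nonneg (norm_nonneg _) (by norm_num)).1 this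
  · have h := (convex_halfSpace_im_gt 0).isPreconnected.constant_of_mapsTo hfin.isDiscrete hcont
      (fun τ hτ => hmaps τ hτ) hτ hI
    have h1 := cpow_half_ne_zero (den_ne_zero (γ := γ) hτ)
    rw [cpow_neg_half, ← div_eq_mul_inv, eq_div_iff h1]
    exact h

/-! ### Functions on the upper half-plane that extend across the real line -/

/-- Near `y`, the function `f` agrees on the upper half-plane with a function analytic at `y`. -/
def Extends (f : ℂ → ℂ) (y : ℂ) : Prop :=
  ∃ A : ℂ → ℂ, AnalyticAt ℂ A y ∧ ∀ᶠ τ in 𝓝 y, 0 < τ.im → f τ = A τ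

lemma extends_of_analyticAt {A : ℂ → ℂ} {y : ℂ} (h : AnalyticAt ℂ A y) : Extends A y :=
  ⟨A, h, Eventually.of_forall fun _ _ => rfl⟩

variable {f g : ℂ → ℂ} {y : ℂ}

lemma Extends.congr (hf : Extends f y) (h : ∀ τ : ℂ, 0 < τ.im → g τ = f τ) : Extends g y := by
  obtain ⟨A, hA, hfA⟩ := hf
  exact ⟨A, hA, hfA.mono fun τ h1 hτ => (h τ hτ).trans (h1 hτ)⟩

lemma Extends.add (hf : Extends f y) (hg : Extends g y) : Extends (fun τ => f τ + g τ) y := by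
  obtain ⟨A, hA, hfA⟩ := hf
  obtain ⟨B, hB, hgB⟩ := hg
  refine ⟨_, hA.fun_add hB, ?_⟩
  filter_upwards [hfA, hgB] with τ h1 h2 hτ
  rw [h1 hτ, h2 hτ]

lemma Extends.mul (hf : Extends f y) (hg : Extends g y) : Extends (fun τ => f τ * g τ) y := by
  obtain ⟨A, hA, hfA⟩ := hf
  obtain ⟨B, hB, hgB⟩ := hg
  refine ⟨_, hA.fun_mul hB, ?_⟩
  filter_upwards [hfA, hgB] with τ h1 h2 hτ
  rw [h1 hτ, h2 hτ]

lemma Extends.comp_act {γ : SL(2, ℤ)} (hf : Extends f (act γ y)) (hy : den γ y ≠ 0) :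
    Extends (fun τ => f (act γ τ)) y := by
  obtain ⟨A, hA, hfA⟩ := hf
  refine ⟨_, hA.fun_comp (analyticAt_act hy), ?_⟩
  filter_upwards [(continuousAt_act hy).eventually hfA] with τ h1 hτ
  exact h1 (act_im_pos hτ)

lemma extends_den_cpow {γ : SL(2, ℤ)} {y : ℝ} (hy : den γ y ≠ 0) :
    Extends (fun τ => den γ τ ^ (-1 / 2 : ℂ)) y := by
  by_cases h0 : γ.1 1 0 = 0
  · simp only [den, h0, Int.cast_zero, zero_mul]
    exact extends_of_analyticAt analyticAt_const
  obtain ⟨s, hs, hs0, h⟩ : ∃ s : ℂ, s.re = 0 ∧ s.im ≠ 0 ∧ ∀ τ : ℂ, 0 < τ.im →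
      (s * den γ τ) ^ (1 / 2 : ℂ) = s ^ (1 / 2 : ℂ) * den γ τ ^ (1 / 2 : ℂ) := by
    rcases lt_or_gt_of_ne h0 with h0 | h0
    · refine ⟨I, by simp, by simp, fun τ hτ => mul_cpow_of_arg _ I_ne_zero (den_ne_zero hτ) ?_⟩
      have h1 : (den γ τ).im < 0 := by
        rw [den_im]; exact mul_neg_of_neg_of_pos (by exact_mod_cast h0) hτ
      have h2 := arg_neg_iff.2 h1
      have h3 := neg_pi_lt_arg (den γ τ)
      rw [arg_I]
      constructor <;> linarith [Real.pi_pos]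
    · refine ⟨-I, by simp, by simp, fun τ hτ => ?_⟩
      have h1 : 0 < (den γ τ).im := by
        rw [den_im]; exact mul_pos (by exact_mod_cast h0) hτ
      rw [neg_I_mul_cpow_half h1, neg_I_cpow_half]
  have hs1 : s ≠ 0 := by rintro rfl; simp at hs0
  have hden : den γ y = ((γ.1 1 0 * y + γ.1 1 1 : ℝ) : ℂ) := by rw [den]; push_cast; rfl
  refine Extends.congr (f := fun τ => s ^ (1 / 2 : ℂ) * ((s * den γ τ) ^ (1 / 2 : ℂ))⁻¹) ?_ ?_
  · refine extends_of_analyticAt (analyticAt_const.mul ((AnalyticAt.cpow ?_ analyticAt_const ?_).inv ?_))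
    · unfold den; fun_prop
    · rw [mem_slitPlane_iff]
      right
      rw [hden] at hy ⊢
      rw [mul_comm, im_ofReal_mul]
      exact mul_ne_zero (by exact_mod_cast hy) hs0
    · exact cpow_half_ne_zero (mul_ne_zero hs1 hy)
  · intro τ hτ
    rw [h τ hτ, cpow_neg_half]
    have h1 := cpow_half_ne_zero hs1
    have h2 := cpow_half_ne_zero (den_ne_zero (γ := γ) hτ)
    field_simp

lemma extends_multiplier {γ : SL(2, ℤ)} {y : ℝ} (hy : den γ y ≠ 0) :
    Extends (multiplier γ) y := by
  obtain ⟨κ, -, h⟩ := exists_multiplier_eq γ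
  exact ((extends_of_analyticAt analyticAt_const).mul (extends_den_cpow hy)).congr h

end EtaTheta

open Complex Filter Topology
open scoped MatrixGroups
namespace EtaTheta

/-! ### `μ` at torsion points under the modular group -/

/-- The action of the modular group on row vectors. -/
def rowAct (z : ℚ × ℚ) (γ : SL(2, ℤ)) : ℚ × ℚ :=
  (z.1 * γ.1 0 0 + z.2 * γ.1 1 0, z.1 * γ.1 0 1 + z.2 * γ.1 1 1)

/-- The point of `ℂ` with characteristic `z`. -/
noncomputable def lin (z : ℚ × ℚ) (τ : ℂ) : ℂ := z.1 * τ + z.2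

def NonLattice (z : ℚ × ℚ) : Prop := z.1.den ≠ 1 ∨ z.2.den ≠ 1

lemma NonLattice.rowAct {z : ℚ × ℚ} (hz : NonLattice z) (γ : SL(2, ℤ)) :
    NonLattice (rowAct z γ) := by
  by_contra h
  rw [NonLattice, not_or, not_not, not_not] at h
  have h1 := Rat.coe_int_num_of_den_eq_one h.1
  have h2 := Rat.coe_int_num_of_den_eq_one h.2
  have hdet : (γ.1 0 0 : ℚ) * γ.1 1 1 - γ.1 0 1 * γ.1 1 0 = 1 := by exact_mod_cast det_eq_one γ
  generalize (EtaTheta.rowAct z γ).1.num = k at h1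
  generalize (EtaTheta.rowAct z γ).2.num = l at h2
  simp only [EtaTheta.rowAct] at h1 h2
  have h3 : z.1 = ((k * γ.1 1 1 - l * γ.1 1 0 : ℤ) : ℚ) := by
    push_cast; linear_combination -z.1 * hdet - γ.1 1 1 * h1 + γ.1 1 0 * h2
  have h4 : z.2 = ((l * γ.1 0 0 - k * γ.1 0 1 : ℤ) : ℚ) := by
    push_cast; linear_combination -z.2 * hdet + γ.1 0 1 * h1 - γ.1 0 0 * h2
  rcases hz with hz | hz
  · exact hz (by rw [h3]; exact Rat.den_intCast _)
  · exact hz (by rw [h4]; exact Rat.den_intCast _)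

lemma rowAct_mul (z : ℚ × ℚ) (γ δ : SL(2, ℤ)) : rowAct z (γ * δ) = rowAct (rowAct z γ) δ := by
  simp only [rowAct, mul_entry]
  ext <;> push_cast <;> ring

lemma theta_lin_ne_zero {z : ℚ × ℚ} (hz : NonLattice z) {τ : ℂ} (hτ : 0 < τ.im) :
    theta (lin z τ) τ ≠ 0 := theta_ne_zero_of_not_int hτ hz

/-- The function `μ` with characteristics, normalized to be modular up to analytic errors. -/
noncomputable def normMu (w z : ℚ × ℚ) (τ : ℂ) : ℂ :=
  e (-((w.1 - z.1) * (lin w τ - lin z τ)) / 2) * mu (lin w τ) (lin z τ) τ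

lemma normMu_upperMat (w z : ℚ × ℚ) (k : ℤ) (τ : ℂ) :
    normMu (rowAct w (upperMat k)) (rowAct z (upperMat k)) τ = e (1 / 8) ^ k * normMu w z (τ + k) := by
  have h : ∀ z : ℚ × ℚ, lin z (τ + k) = lin (rowAct z (upperMat k)) τ := by
    intro z; simp [lin, rowAct, upperMat]; ring
  have h1 : ∀ z : ℚ × ℚ, (rowAct z (upperMat k)).1 = z.1 := by
    intro z; simp [rowAct, upperMat]
  rw [normMu, normMu, h, h, h1, h1]
  have h2 := add_int_of_add_one (e_ne_zero _) (mu_tau_add_one (lin (rowAct w (upperMat k)) τ)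
    (lin (rowAct z (upperMat k)) τ)) k τ
  rw [h2, show (-1 / 8 : ℂ) = -(1 / 8) by ring, e_neg, inv_zpow]
  have h3 := zpow_ne_zero k (e_ne_zero (1 / 8))
  generalize e (1 / 8) ^ k = a at *
  field_simp

lemma normMu_invMat {w z : ℚ × ℚ} (hw : NonLattice w) (hz : NonLattice z) {τ : ℂ}
    (hτ : 0 < τ.im) :
    normMu (rowAct w invMat) (rowAct z invMat) τ - multiplier invMat τ * normMu w z (act invMat τ) =
      e (-((w.2 - z.2) * ((w.2 - z.2) * τ - (w.1 - z.1))) / 2) *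
        (mordell ((w.2 - z.2) * τ + (-(w.1 - z.1))) τ / (2 * I)) := by
  have h0 := ne_zero_of_im_pos hτ
  have h : ∀ z : ℚ × ℚ, lin z (-1 / τ) = lin (rowAct z invMat) τ / τ := by
    intro z; simp [lin, rowAct, invMat]; field_simp; ring
  have h1 : ∀ z : ℚ × ℚ, (rowAct z invMat).1 = z.2 := by
    intro z; simp [rowAct, invMat]
  have h2 := mu_S hτ (theta_lin_ne_zero (hw.rowAct invMat) hτ)
    (theta_lin_ne_zero (hz.rowAct invMat) hτ)
  have h3 : lin (rowAct w invMat) τ - lin (rowAct z invMat) τ =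
      (w.2 - z.2) * τ + (-(w.1 - z.1)) := by
    simp [lin, rowAct, invMat]; ring
  rw [h3] at h2
  rw [act_invMat, multiplier_invMat hτ, normMu, normMu, h, h, h1, h1, ← sub_div, h3, ← h2]
  have h4 : e (-((w.1 - z.1) * (((w.2 - z.2) * τ + (-(w.1 - z.1))) / τ)) / 2) =
      e (-((w.2 - z.2) * ((w.2 - z.2) * τ - (w.1 - z.1))) / 2) *
        e (((w.2 - z.2) * τ + (-(w.1 - z.1))) ^ 2 / (2 * τ)) := by
    rw [← e_add]; congr 1; field_simp; ring
  rw [h4, ← sub_eq_add_neg]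
  ring

/-- The functions `μ` at torsion points transform under the modular group with errors that are
analytic at all real points that are not mapped to `∞`. -/
theorem extends_normMu (γ : SL(2, ℤ)) {y : ℝ} (hy : den γ y ≠ 0) {w z : ℚ × ℚ}
    (hw : NonLattice w) (hz : NonLattice z) :
    Extends (fun τ => normMu (rowAct w γ) (rowAct z γ) τ +
      -1 * (multiplier γ τ * normMu w z (act γ τ))) y := by
  refine modular_induction (motive := fun γ τ => den γ τ ≠ 0 → ∀ y : ℝ, τ = y →
    ∀ w z, NonLattice w → NonLattice z →
    Extends (fun τ => normMu (rowAct w γ) (rowAct z γ) τ +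
      -1 * (multiplier γ τ * normMu w z (act γ τ))) y)
    ?_ ?_ ?_ γ y hy hy y rfl w z hw hz
  · intro k _ _ y _ w z hw hz
    refine (extends_of_analyticAt (A := fun _ => 0) analyticAt_const).congr fun τ hτ => ?_
    rw [normMu_upperMat, multiplier_upperMat k hτ, act_upperMat]
    ring
  · rintro _ h0 _ y rfl w z hw hz
    obtain ⟨A, hA, hA'⟩ := exists_analyticAt_mordell (w.2 - z.2) (-(w.1 - z.1)) (y := y)
      (by exact_mod_cast h0)
    have h1 : Extends (fun τ => e (-((w.2 - z.2) * ((w.2 - z.2) * τ - (w.1 - z.1))) / 2)) y :=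
      extends_of_analyticAt (Differentiable.analyticAt (by fun_prop) _)
    refine (h1.mul (Extends.mul (g := fun _ => (2 * I)⁻¹) ⟨A, hA, hA'⟩
      (extends_of_analyticAt analyticAt_const))).congr fun τ hτ => ?_
    rw [neg_one_mul, ← sub_eq_add_neg, normMu_invMat hw hz hτ, div_eq_mul_inv (mordell _ _)]
  · rintro γ δ _ hδ h1 h2 hγδ y rfl w z hw hz
    have hγ : den γ (act δ y) ≠ 0 := fun h => hγδ (by rw [den_mul hδ, h, zero_mul])
    have h3 := h2 hδ y rfl _ _ (hw.rowAct γ) (hz.rowAct γ)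
    have h4 := h1 hγ _ (act_ofReal δ y) w z hw hz
    rw [← act_ofReal] at h4
    refine (h3.add ((extends_multiplier hδ).mul (h4.comp_act hδ))).congr fun τ hτ => ?_
    rw [rowAct_mul, rowAct_mul, multiplier_mul _ _ hτ, act_mul (den_ne_zero hτ)]
    ring

end EtaTheta

open Complex Filter Topology
open scoped MatrixGroups
namespace EtaTheta

/-! ### Shifts of the characteristics -/

/-- The vector with integral entries `k`, `l`. -/
def intVec (k l : ℤ) : ℚ × ℚ := (k, l)

lemma lin_add_intVec (z : ℚ × ℚ) (k l : ℤ) (τ : ℂ) : lin (z + intVec k l) τ = lin z τ + k * τ + l := by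
  simp [lin, intVec]; ring

lemma normMu_add_both (w z : ℚ × ℚ) (k l : ℤ) (τ : ℂ) :
    normMu (w + intVec k l) (z + intVec k l) τ = normMu w z τ := by
  have h1 := mu_add_nat (lin w τ + k * τ) (lin z τ + k * τ) 0 l l τ
  have h2 := add_int_of_add_one (f := fun t => mu (lin w τ + t * τ) (lin z τ + t * τ) τ) one_ne_zero
    (fun t => by
      rw [one_mul, ← mu_add_tau_both (lin w τ + t * τ)]
      congr 1 <;> ring) k 0
  simp only [zero_add, one_zpow, zero_mul, add_zero, one_mul] at h2
  rw [normMu, normMu, lin_add_intVec, lin_add_intVec]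
  rw [Nat.cast_zero, add_zero, h2, show -(0 : ℂ) / 8 + (l + l) / 2 = l by ring, e_int, one_mul] at h1
  rw [h1, show lin w τ + k * τ + l - (lin z τ + k * τ + l) = lin w τ - lin z τ by ring]
  simp [intVec]

lemma normMu_add_one (w z : ℚ × ℚ) (l : ℤ) (τ : ℂ) :
    normMu (w + intVec 0 l) z τ = e (l / 2 - l * (w.1 - z.1) / 2) * normMu w z τ := by
  have h1 := mu_add_nat (lin w τ) (lin z τ) 0 l 0 τ
  rw [Int.cast_zero, Nat.cast_zero, add_zero, add_zero] at h1
  rw [normMu, normMu, lin_add_intVec, Int.cast_zero, zero_mul, add_zero, h1, ← mul_assoc, ← mul_assoc,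
    ← e_add, ← e_add]
  congr 2
  simp [intVec]
  ring

lemma normMu_add_tau {w z : ℚ × ℚ} (hw : NonLattice w) (hz : NonLattice z) :
    ∃ E : ℂ → ℂ, Differentiable ℂ E ∧ ∀ τ : ℂ, 0 < τ.im → normMu (w + intVec 1 0) z τ =
      e (1 / 2 + (w.2 - z.2) / 2) * normMu w z τ + E τ := by
  refine ⟨fun τ => e (-((w.1 + 1 - z.1) * (lin w τ + τ - lin z τ)) / 2) *
    (-(I * e ((lin w τ - lin z τ) / 2 + 3 * τ / 8))), ?_, fun τ hτ => ?_⟩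
  · unfold lin; fun_prop
  · have h := mu_add_tau_left hτ (theta_lin_ne_zero hw hτ) (theta_lin_ne_zero hz hτ)
    have h1 : e (1 / 2 + (w.2 - z.2) / 2) * e (-((w.1 - z.1) * (lin w τ - lin z τ)) / 2) =
        -(e (-((w.1 + 1 - z.1) * (lin w τ + τ - lin z τ)) / 2) * e (lin w τ - lin z τ + τ / 2)) := by
      rw [← e_add, ← e_add]
      exact e_congr_neg 0 (by unfold lin; push_cast; ring)
    rw [normMu, normMu, lin_add_intVec, show (w + intVec 1 0).1 = w.1 + 1 by simp [intVec],
      show lin w τ + ((1 : ℤ) : ℂ) * τ + ((0 : ℤ) : ℂ) = lin w τ + τ by push_cast; ring, h]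
    push_cast
    linear_combination -mu (lin w τ) (lin z τ) τ * h1

lemma NonLattice.add_intVec {z : ℚ × ℚ} (hz : NonLattice z) (k l : ℤ) :
    NonLattice (z + intVec k l) := by
  have key : ∀ (q : ℚ) (k : ℤ), q.den ≠ 1 → (q + k).den ≠ 1 := by
    intro q k hq h
    have := Rat.coe_int_num_of_den_eq_one h
    exact hq (by rw [show q = (((q + k).num - k : ℤ) : ℚ) by push_cast; linarith, Rat.den_intCast])
  exact hz.imp (key _ _) (key _ _)

lemma normMu_add_tau_int {w z : ℚ × ℚ} (hw : NonLattice w) (hz : NonLattice z) (k : ℤ) :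
    ∃ E : ℂ → ℂ, Differentiable ℂ E ∧ ∀ τ : ℂ, 0 < τ.im → normMu (w + intVec k 0) z τ =
      e (k * (1 / 2 + (w.2 - z.2) / 2)) * normMu w z τ + E τ := by
  have hadd : ∀ k l : ℤ, intVec k 0 + intVec l 0 = intVec (k + l) 0 := by
    intro k l; simp [intVec]
  have h2 : ∀ k : ℤ, (w + intVec k 0).2 = w.2 := by intro k; simp [intVec]
  induction k with
  | zero => exact ⟨fun _ => 0, by fun_prop, fun τ _ => by simp [intVec, ← Prod.zero_eq_mk]⟩
  | succ k ih =>
    obtain ⟨E, hE, h⟩ := ih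
    obtain ⟨E', hE', h'⟩ := normMu_add_tau (hw.add_intVec k 0) hz
    refine ⟨fun τ => e (1 / 2 + (w.2 - z.2) / 2) * E τ + E' τ, by fun_prop, fun τ hτ => ?_⟩
    rw [← hadd, ← add_assoc, h' τ hτ, h2, h τ hτ]
    generalize (1 / 2 + ((w.2 : ℂ) - z.2) / 2) = x
    rw [Int.cast_add, add_mul, e_add, Int.cast_one, one_mul]
    ring
  | pred k ih =>
    obtain ⟨E, hE, h⟩ := ih
    obtain ⟨E', hE', h'⟩ := normMu_add_tau (hw.add_intVec (-k - 1) 0) hz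
    refine ⟨fun τ => e (-(1 / 2 + (w.2 - z.2) / 2)) * (E τ - E' τ), by fun_prop, fun τ hτ => ?_⟩
    have h3 := h' τ hτ
    rw [add_assoc, hadd, sub_add_cancel, h2, h τ hτ] at h3
    rw [Int.cast_sub, sub_mul, e_sub, Int.cast_one, one_mul, e_neg]
    have h4 := e_ne_zero (1 / 2 + (w.2 - z.2) / 2)
    generalize e (((-k : ℤ) : ℂ) * (1 / 2 + (w.2 - z.2) / 2)) = u at *
    generalize e (1 / 2 + (w.2 - z.2) / 2) = c at *
    field_simp
    linear_combination -h3

lemma normMu_shift {w z : ℚ × ℚ} (hw : NonLattice w) (hz : NonLattice z) (k l k' l' : ℤ) :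
    ∃ E : ℂ → ℂ, Differentiable ℂ E ∧ ∀ τ : ℂ, 0 < τ.im →
      normMu (w + intVec k l + intVec k' l') (z + intVec k' l') τ =
      e (((k + l + k * l + k * (w.2 - z.2) - l * (w.1 - z.1)) / 2 : ℚ) : ℂ) * normMu w z τ + E τ := by
  obtain ⟨E, hE, h⟩ := normMu_add_tau_int (hw.add_intVec 0 l) hz k
  refine ⟨E, hE, fun τ hτ => ?_⟩
  rw [normMu_add_both, show w + intVec k l = w + intVec 0 l + intVec k 0 by
    rw [add_assoc]; simp [intVec], h τ hτ, normMu_add_one, ← mul_assoc, ← e_add]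
  congr 3
  simp [intVec]
  ring

/-! ### The quantum modularity of `V_{m1}` -/

lemma vCoeff_one : NonLattice (vCoeff 1) := Or.inl (by decide +kernel)

lemma piece_nonLattice {m : ℕ} (hm : Admissible m 1) {p : Piece} (hp : p ∈ pieces m) :
    NonLattice (vCoeff 1 + (p.α, p.β)) := uArg_den hm hp

lemma exists_shift {m : ℕ} (hm : Admissible m 1) {γ : SL(2, ℤ)}
    (hγ : InCongruence (groupShift m 1) (ellPair m 1) γ) : ∃ c : ℂ, ‖c‖ = 1 ∧
    ∀ p ∈ pieces m, ∃ E : ℂ → ℂ, Differentiable ℂ E ∧ ∀ τ : ℂ, 0 < τ.im →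
      normMu (rowAct (vCoeff 1 + (p.α, p.β)) γ) (rowAct (vCoeff 1) γ) τ =
        c * normMu (vCoeff 1 + (p.α, p.β)) (vCoeff 1) τ + E τ := by
  obtain ⟨⟨b, hb⟩, ⟨a, ha⟩, ⟨d, hd⟩, ⟨c, hc⟩⟩ := hγ
  rw [sub_eq_iff_eq_add] at ha hd
  have key : ∀ (h N M N' : ℤ), groupShift m 1 = 2 * h → ∀ p ∈ pieces m,
      (groupShift m 1 : ℚ) * p.α = N → (ellPair m 1 : ℚ) * p.β = M →
      (groupShift m 1 : ℚ) * p.β = N' → ∃ E : ℂ → ℂ, Differentiable ℂ E ∧ ∀ τ : ℂ, 0 < τ.im →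
      normMu (rowAct (vCoeff 1 + (p.α, p.β)) γ) (rowAct (vCoeff 1) γ) τ =
        e ((((N * a + M * c : ℤ) + (N * b + N' * d : ℤ) + (N * a + M * c : ℤ) * (N * b + N' * d : ℤ) +
          (N * a + M * c : ℤ) * p.β - (N * b + N' * d : ℤ) * p.α) / 2 : ℚ) : ℂ) *
          normMu (vCoeff 1 + (p.α, p.β)) (vCoeff 1) τ + E τ := by
    intro h N M N' hh p hp h1 h2 h3
    obtain ⟨E, hE, hs⟩ := normMu_shift (piece_nonLattice hm hp) vCoeff_one (N * a + M * c)
      (N * b + N' * d) (h * a) (h * b)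
    refine ⟨E, hE, fun τ hτ => ?_⟩
    have h4 : (groupShift m 1 : ℚ) = 2 * h := by exact_mod_cast hh
    have h5 : rowAct (vCoeff 1) γ = vCoeff 1 + intVec (h * a) (h * b) := by
      simp only [rowAct, vCoeff, intVec, ha, hb]
      ext <;> push_cast <;> rw [h4] <;> simp <;> ring
    have h6 : rowAct (vCoeff 1 + (p.α, p.β)) γ = vCoeff 1 + (p.α, p.β) +
        intVec (N * a + M * c) (N * b + N' * d) + intVec (h * a) (h * b) := by
      simp only [rowAct, vCoeff, intVec, ha, hb, hc, hd]
      ext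
      · simp
        linear_combination (1 / 2 * a : ℚ) * h4 + a * h1 + c * h2
      · simp
        linear_combination (1 / 2 * b : ℚ) * h4 + b * h1 + d * h3
    rw [h5, h6, hs τ hτ]
    simp
  by_cases h4 : m = 4
  · subst h4
    refine ⟨_, norm_e_ratCast (((-1 * a + 0 * c : ℤ) + (-1 * b + 0 * d : ℤ) +
      (-1 * a + 0 * c : ℤ) * (-1 * b + 0 * d : ℤ) +
      (-1 * a + 0 * c : ℤ) * 0 - (-1 * b + 0 * d : ℤ) * (-1 / 12)) / 2), fun p hp => ?_⟩
    have hp' := hp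
    simp only [pieces, List.mem_cons, List.not_mem_nil, or_false] at hp'
    rcases hp' with rfl | rfl
    · obtain ⟨E, hE, h⟩ := key 6 (-5) 0 0 rfl _ hp (by norm_num [groupShift])
        (by norm_num) (by norm_num)
      refine ⟨E, hE, fun τ hτ => ?_⟩
      rw [h τ hτ]
      congr 2
      exact e_congr (-2 * a + 12 * a * b - 3 * b) (by push_cast; ring)
    · exact key 6 (-1) 0 0 rfl _ hp (by norm_num [groupShift]) (by norm_num) (by norm_num)
  · obtain ⟨p, hp, h, N, M, N', h1, h2, h3, h5⟩ : ∃ p : Piece, pieces m = [p] ∧ ∃ h N M N' : ℤ,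
        groupShift m 1 = 2 * h ∧ (groupShift m 1 : ℚ) * p.α = N ∧ (ellPair m 1 : ℚ) * p.β = M ∧
        (groupShift m 1 : ℚ) * p.β = N' := by
      obtain ⟨h1, h2, -⟩ := hm
      interval_cases m
      · exact ⟨_, rfl, 2, -1, 1, 2, rfl, by norm_num [groupShift], by norm_num [ellPair, ellConst],
          by norm_num [groupShift]⟩
      · exact ⟨_, rfl, 2, -1, 0, 0, rfl, by norm_num [groupShift], by norm_num, by norm_num⟩
      · exact ⟨_, rfl, 3, -1, 1, 3, rfl, by norm_num [groupShift], by norm_num [ellPair, ellConst],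
          by norm_num [groupShift]⟩
      · exact absurd rfl h4
      · exact ⟨_, rfl, 3, -2, 1, 3, rfl, by norm_num [groupShift], by norm_num [ellPair, ellConst],
          by norm_num [groupShift]⟩
      · exact ⟨_, rfl, 3, -1, 0, 0, rfl, by norm_num [groupShift], by norm_num, by norm_num⟩
    have := key h N M N' h1 p (by simp [hp]) h2 h3 h5
    rw [hp]
    exact ⟨_, norm_e_ratCast _, List.forall_mem_singleton.2 this⟩

lemma VUpper_eq (m : ℕ) (τ : ℂ) : VUpper m 1 τ = ((pieces m).map fun p =>
    p.w * e (p.α * p.β / 2) * normMu (vCoeff 1 + (p.α, p.β)) (vCoeff 1) τ).sum := by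
  rw [VUpper]
  congr 1
  refine List.map_congr_left fun p _ => ?_
  have h1 : lin (vCoeff 1) τ = vArg 1 τ := (vArg_eq 1 τ).symm
  have h2 : lin (vCoeff 1 + (p.α, p.β)) τ = p.uArg 1 τ := (uArg_eq p 1 τ).symm
  have h3 : e (p.t * τ) = e (p.α * p.β / 2) *
      e (-(((vCoeff 1 + (p.α, p.β)).1 - (vCoeff 1).1) * (p.uArg 1 τ - vArg 1 τ)) / 2) := by
    rw [← e_add]
    congr 1
    rw [Piece.t, Piece.uArg, show (vCoeff 1 + (p.α, p.β)).1 = (vCoeff 1).1 + p.α from rfl]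
    push_cast
    ring
  rw [normMu, h1, h2, h3]
  ring

theorem extends_VUpper {m : ℕ} (hm : Admissible m 1) {γ : SL(2, ℤ)}
    (hγ : InCongruence (groupShift m 1) (ellPair m 1) γ) : ∃ ε : ℂ, ‖ε‖ = 1 ∧ ∀ y : ℝ, den γ y ≠ 0 →
    Extends (fun τ => VUpper m 1 τ - ε * den γ τ ^ (-1 / 2 : ℂ) * VUpper m 1 (act γ τ)) y := by
  obtain ⟨c, hc, hE⟩ := exists_shift hm hγ
  obtain ⟨κ, hκ, hmul⟩ := exists_multiplier_eq γ
  have hc0 : c ≠ 0 := by rintro rfl; simp at hc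
  refine ⟨c⁻¹ * κ, by rw [norm_mul, norm_inv, hc, hκ]; simp, fun y hy => ?_⟩
  have key : ∀ L : List Piece, (∀ p ∈ L, p ∈ pieces m) → Extends (fun τ =>
      (L.map fun p => p.w * e (p.α * p.β / 2) *
        normMu (vCoeff 1 + (p.α, p.β)) (vCoeff 1) τ).sum - c⁻¹ * κ * den γ τ ^ (-1 / 2 : ℂ) *
      (L.map fun p => p.w * e (p.α * p.β / 2) *
        normMu (vCoeff 1 + (p.α, p.β)) (vCoeff 1) (act γ τ)).sum) y := by
    intro L
    induction L with
    | nil => exact fun _ => (extends_of_analyticAt (A := fun _ => 0) analyticAt_const).congr (by simp)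
    | cons p L ih =>
      intro hL
      have hp := hL p List.mem_cons_self
      obtain ⟨E, hE, hs⟩ := hE p hp
      have h1 := (extends_normMu γ hy (piece_nonLattice hm hp) vCoeff_one).add
        ((extends_of_analyticAt (analyticAt_const (v := (-1 : ℂ)))).mul
          (extends_of_analyticAt (hE.analyticAt y)))
      refine ((ih fun p hp => hL p (List.mem_cons_of_mem _ hp)).add ((extends_of_analyticAt
        (analyticAt_const (v := p.w * e (p.α * p.β / 2) * c⁻¹))).mul h1)).congr fun τ hτ => ?_
      rw [hs τ hτ, hmul τ hτ, List.map_cons, List.map_cons, List.sum_cons, List.sum_cons]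
      field_simp
      ring
  simp only [VUpper_eq]
  exact key _ fun _ h => h

end EtaTheta

open Complex Filter Topology
open scoped MatrixGroups
namespace EtaTheta

/-! ### Boundary values -/

lemma tendsto_of_extends {f A : ℂ → ℂ} {y : ℝ} (hA : ContinuousAt A y)
    (h : ∀ᶠ τ in 𝓝 (y : ℂ), 0 < τ.im → f τ = A τ) :
    Tendsto (fun t : ℝ => f (y + t * I)) (𝓝[>] 0) (𝓝 (A y)) := by
  have h1 := tendsto_radial_upper y
  refine (hA.tendsto.comp (tendsto_radial y)).congr' ?_
  filter_upwards [h1.eventually (eventually_nhdsWithin_iff.2 h)] with t ht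
  exact ht.symm

/-- The boundary values of a function that extends across an open set of real numbers are real
analytic there. -/
lemma analyticOnNhd_limUnder {f : ℂ → ℂ} {U : Set ℝ} (h : ∀ y ∈ U, Extends f (y : ℂ)) :
    AnalyticOnNhd ℝ (fun y : ℝ => limUnder (𝓝[>] (0 : ℝ)) fun t : ℝ => f (y + t * I)) U := by
  intro y hy
  obtain ⟨A, hA, hfA⟩ := h y hy
  have h1 : AnalyticAt ℝ (fun y : ℝ => A y) y :=
    (hA.restrictScalars (𝕜 := ℝ)).comp_of_eq (ofRealCLM.analyticAt y) rfl
  refine h1.congr ?_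
  have h2 := hA.eventually_analyticAt.and (eventually_eventually_nhds.2 hfA)
  filter_upwards [continuous_ofReal.continuousAt.eventually h2] with z hz
  exact (tendsto_of_extends hz.1.continuousAt hz.2).limUnder_eq.symm

lemma tendsto_limUnder_of_extends {f : ℂ → ℂ} {y : ℝ} (h : Extends f (y : ℂ)) :
    Tendsto (fun t : ℝ => f (y + t * I)) (𝓝[>] 0)
      (𝓝 (limUnder (𝓝[>] (0 : ℝ)) fun t : ℝ => f (y + t * I))) := by
  obtain ⟨A, hA, hfA⟩ := h
  have := tendsto_of_extends hA.continuousAt hfA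
  rwa [this.limUnder_eq]

lemma den_ratCast (γ : SL(2, ℤ)) (x : ℚ) : den γ x = (moebiusDen γ x : ℂ) := by
  rw [den, moebiusDen]; push_cast; rfl

lemma tendsto_den_cpow {γ : SL(2, ℤ)} {x : ℚ} (hx : moebiusDen γ x ≠ 0) :
    Tendsto (fun t : ℝ => den γ ((x : ℂ) + t * I) ^ (-1 / 2 : ℂ)) (𝓝[>] 0)
      (𝓝 (autFactor (1 / 2) γ x)) := by
  have hs : -(((1 / 2 : ℝ) : ℝ) : ℂ) = -1 / 2 := by push_cast; ring
  have hx' : ((γ.1 1 0 : ℤ) : ℝ) * (x : ℝ) + (γ.1 1 1 : ℤ) ≠ 0 := by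
    have : ((moebiusDen γ x : ℚ) : ℝ) ≠ 0 := by exact_mod_cast hx
    rw [moebiusDen] at this
    exact_mod_cast this
  have hval : ((((γ.1 1 0 : ℤ) : ℝ) * (x : ℝ) + (γ.1 1 1 : ℤ) : ℝ) : ℂ) = moebiusDen γ x := by
    rw [moebiusDen]; push_cast; ring
  rw [autFactor, hs]
  split_ifs with hc
  · have h := tendsto_cpow_radial (by exact_mod_cast hc) hx' (-1 / 2)
    rw [hval] at h
    refine h.congr fun t => ?_
    simp [den]
  · have h := tendsto_cpow_radial (c := -(γ.1 1 0 : ℤ)) (x := -(x : ℝ)) (d := (γ.1 1 1 : ℤ))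
      (by rw [neg_nonneg]; exact_mod_cast (not_le.1 hc).le) (by rwa [neg_mul_neg]) (-1 / 2)
    rw [neg_mul_neg, hval] at h
    refine ((continuous_conj.tendsto _).comp h).congr' ?_
    filter_upwards [self_mem_nhdsWithin] with t ht
    have ht : 0 < t := ht
    have h1 : (starRingEnd ℂ) (den γ ((x : ℂ) + t * I)) =
        ((-(γ.1 1 0 : ℤ) : ℝ) : ℂ) * (((-(x : ℝ) : ℝ) : ℂ) + t * I) + ((γ.1 1 1 : ℤ) : ℝ) := by
      have h2 : (starRingEnd ℂ) (x : ℂ) = x := by rw [← ofReal_ratCast, conj_ofReal]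
      simp only [den, map_add, map_mul, conj_ofReal, conj_I, h2, map_intCast]
      push_cast
      ring
    have h3 : (den γ ((x : ℂ) + t * I)).arg ≠ Real.pi := by
      intro h4
      have := (arg_eq_pi_iff.1 h4).2
      rw [den_im] at this
      simp only [mul_eq_zero, Int.cast_eq_zero] at this
      rcases this with h5 | h5
      · exact hc h5.ge
      · simp [ht.ne'] at h5
    have h4 := cpow_conj (den γ ((x : ℂ) + t * I)) (-1 / 2) h3
    rw [show (starRingEnd ℂ) (-1 / 2 : ℂ) = -1 / 2 by
      rw [← hs, ← ofReal_neg, conj_ofReal], h1] at h4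
    exact h4.symm

lemma inCongruence_one {m n : ℕ} (hmn : Admissible m n) {γ : SL(2, ℤ)}
    (hγ : γ ∈ quantumGroup m n) : InCongruence (groupShift m 1) (ellPair m 1) γ := by
  obtain ⟨h1, h2, h3, h4⟩ := inCongruence_of_mem hγ
  have hB : groupShift m 1 ∣ groupShift m n := by
    obtain ⟨h1, h2, h3, h4, h5⟩ := hmn
    interval_cases m <;> interval_cases n <;> first
      | (simp only [groupShift]; norm_num; done)
      | (exfalso; revert h5; simp)
  have hl : (ellPair m 1 : ℤ) ∣ ellPair m n := by
    simp only [ellPair, ellConst]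
    split_ifs <;> norm_num
  exact ⟨hB.trans h1, hB.trans h2, hB.trans h3, hl.trans h4⟩

theorem isQuantumModularForm {m n : ℕ} (hmn : Admissible m n) :
    IsQuantumModularForm (1 / 2) (V m n) {x : ℚ | NonsingularAt m n x}
      (quantumSet m n \ {-1 / (ellPair m n : ℚ)}) (quantumGroup m n) := by
  have hm := admissible_one hmn
  refine ⟨fun x hx => exists_values hmn hx.1, fun γ hγ => ?_⟩
  have hγ1 := inCongruence_one hmn hγ
  obtain ⟨ε, hε, hext⟩ := extends_VUpper hm hγ1
  have hden : ∀ y : ℝ, den γ y = (((γ.1 1 0 : ℝ) * y + γ.1 1 1 : ℝ) : ℂ) := by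
    intro y; rw [den]; push_cast; rfl
  refine ⟨ε, hε, _, analyticOnNhd_limUnder fun y hy => hext y (by rw [hden]; exact_mod_cast hy),
    fun x hx hx0 => ?_⟩
  have hx1 := quantumSet_subset hmn hx.1
  have h1 := tendsto_limUnder_of_extends (hext x (by
    rw [ofReal_ratCast, den_ratCast]; exact_mod_cast hx0))
  simp only [ofReal_ratCast] at h1 ⊢
  rw [V_rat, V_rat]
  exact tendsto_nhds_unique ((tendsto_VUpper_radial hm hx1).sub
    ((tendsto_const_nhds.mul (tendsto_den_cpow hx0)).mul (tendsto_VUpper_moebius hm hγ1 hx1 hx0))) h1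

end EtaTheta

open EtaTheta in
theorem theorem1p2 (m n : ℕ) (hmn : Admissible m n) :
    IsQuantumModularForm (1 / 2) (V m n) {x : ℚ | NonsingularAt m n x}
      (quantumSet m n \ {-1 / (ellPair m n : ℚ)}) (quantumGroup m n) ∧
    (∀ x ∈ upperOrQuantum m n, x ≠ -1 / 2 →
      MeasureTheory.IntegrableOn (eichlerIntegrand m (1 / 2) x) (Set.Ioi 0) ∧
      V m n x + zeta 4 ^ ellConst m * (2 * x + 1) ^ (-1 / 2 : ℂ) * V m n (x / (2 * x + 1)) =
        -Complex.I / (cConst m : ℂ) * eichlerIntegral m (1 / 2) x) ∧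
    (n = 1 → m = 2 ∨ m = 4 ∨ m = 6 → ∀ x ∈ upperOrQuantum m n, x ≠ -1 →
      MeasureTheory.IntegrableOn (eichlerIntegrand m 1 x) (Set.Ioi 0) ∧
      V m n x - (zeta 8)⁻¹ * (x + 1) ^ (-1 / 2 : ℂ) * V m n (x / (x + 1)) =
        -Complex.I / (cConst m : ℂ) * eichlerIntegral m 1 x) ∧
    (∀ x ∈ upperOrQuantum m n,
      V m n x - zeta (aConst m) ^ kappa m n * V m n (x + kappa m n * bConst m) = 0) ∧
    (n = 1 → ∀ x ∈ quantumSet m n,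
      Filter.Tendsto (fun t : ℝ => V m n ((x : ℂ) + t * Complex.I)) (nhdsWithin 0 (Set.Ioi 0))
        (nhds (V m n (x : ℂ)))) := by
  refine ⟨isQuantumModularForm hmn, fun x hx hne => law_half hmn hx hne, ?_,
    fun x hx => law_translate hmn hx, ?_⟩
  · rintro rfl hm x hx hne
    exact law_one hmn hm hx hne
  · rintro rfl x hx
    exact tendsto_V_radial hmn hx
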